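/- Theorem (testing small decision trees by larger ones). A decision tree over $x_1,\dots,x_n$ is a rooted binary tree whose internal nodes are labeled by variables and whose leaves are labeled by bits; its size is its number of leaves. Let $\mathbb{DT}^s$ be the class of Boolean functions $f:\{0,1\}^n\to\{0,1\}$ computed by a decision tree of size at most $s$. For a distribution $D$ on $\{0,1\}^n$, say that $f$ is $\epsilon$-far from a class $H$ with respect to $D$ if $\Pr_{x\sim D}[g(x)\neq f(x)]>\epsilon$ for every $g\in H$. The model is a randomized random-access machine with memory cells holding natural numbers. At unit cost it sets a cell to a constant, adds, subtracts (truncated at $0$), reads or writes a cell indirectly, tests a cell for zero, and tosses a fair coin. It has two oracles: a black-box query, which returns $f(x)$ for a point $x$ written in memory, and a random example query, which returns $(x,f(x))$ for a fresh $x\sim D$. Either query costs $n+1$ time units, and both kinds count as queries. The machine receives $n$, $s$ and $\lceil 1/\epsilon\rceil$. There are constants $c>0$ and $L\in\mathbb N$ such that for every $\delta>0$ there are a single program $P$ and a constant $K$ (depending only on $\delta$) with the following property. For all integers $n,s\ge 1$, all real $\epsilon\in(0,1]$, every $f:\{0,1\}^n\to\{0,1\}$ and every distribution $D$ on $\{0,1\}^n$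 ($f$ and $D$ being unknown to $P$ and accessible only through the two oracles), $P$ always halts, and on every outcome of its coin tosses and random examples it runs in time at most $$K\,\frac{s^{c\log s}\,n}{\epsilon}$$ and makes at most $$K\,\frac{s^{c\log s}}{\epsilon}\left(1+\log\frac{s^{c\log s}}{\epsilon}\right)^{L}=\tilde O\!\left(\frac{s^{O(\log s)}}{\epsilon}\right)$$ queries; moreover 1. if $f\in\mathbb{DT}^s$, then $P$ accepts with probability at least $1-\delta$; 2. if $f$ is $\epsilon$-far, with respect to $D$, from $\mathbb{DT}^{S}$ with $S=\lfloor s^{c\log s}\rfloor$, then $P$ rejects with probability at least $1-\delta$. -/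

import Mathlib

noncomputable section

namespace DTTest

/-! ### Decision trees -/

/-- Boolean functions on `{0,1}^n`. -/
abbrev BoolFun (n : ℕ) : Type := (Fin n → Bool) → Bool

/-- Decision trees over the variables `x_0, …, x_{n-1}`: an internal node carries a variable and its
left and right subtrees (followed when the variable is `0`, respectively `1`); a leaf carries an
output. -/
inductive DTree (n : ℕ) : Type where
  | leaf (b : Bool) : DTree n
  | node (i : Fin n) (left right : DTree n) : DTree n

/-- The size of a decision tree is its number of leaves. -/
def DTree.size {n : ℕ} : DTree n → ℕ
  | .leaf _ => 1
  | .node _ l r => l.size + r.size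

/-- The Boolean function computed by a decision tree. -/
def DTree.eval {n : ℕ} : DTree n → BoolFun n
  | .leaf b => fun _ => b
  | .node i l r => fun x => if x i then r.eval x else l.eval x

/-- The class of size-`s` decision trees: functions computed by a tree with at most `s` leaves. -/
def DT (n s : ℕ) : Set (BoolFun n) := {f | ∃ T : DTree n, T.size ≤ s ∧ T.eval = f}

/-! ### Probability and distance -/

/-- The probability of the event `S` under the discrete distribution `μ`, as a real number. -/
def prob {α : Type} (μ : PMF α) (S : Set α) : ℝ := (μ.toOuterMeasure S).toReal

/-- `f` is `ε`-far from the class `H` with respect to `D`: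
no `g ∈ H` satisfies `Pr_D[g(x) ≠ f(x)] ≤ ε`. -/
def IsFar {n : ℕ} (D : PMF (Fin n → Bool)) (ε : ℝ) (f : BoolFun n) (H : Set (BoolFun n)) : Prop :=
  ∀ g ∈ H, ε < prob D {x | g x ≠ f x}

/-! ### Randomized random-access machines with black-box and random-example queries -/

/-- The elementary instructions. `M` denotes the memory. -/
inductive Instr : Type where
  /-- `M[i] := k` -/
  | const (i k : ℕ) : Instr
  /-- `M[i] := M[j] + M[k]` -/
  | add (i j k : ℕ) : Instr
  /-- `M[i] := max (M[j] - M[k]) 0` -/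
  | sub (i j k : ℕ) : Instr
  /-- `M[i] := M[M[j]]` -/
  | load (i j : ℕ) : Instr
  /-- `M[M[i]] := M[j]` -/
  | store (i j : ℕ) : Instr
  /-- `M[i] :=` a fresh fair random bit -/
  | flip (i : ℕ) : Instr
  /-- black-box query: `M[i] := f(x)`, where `x` is stored in the `n` cells from address `M[j]` on
  (a non-zero cell is read as `1`) -/
  | query (i j : ℕ) : Instr
  /-- random example query: a fresh `x`, drawn from the unknown distribution, is written to the `n`
  cells from address `M[j]` on, and then `M[i] := f(x)` -/
  | sample (i j : ℕ) : Instr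

/-- Programs: one fixed finite program serves all inputs. -/
inductive Prog : Type where
  | op (i : Instr) : Prog
  | seq (a b : Prog) : Prog
  /-- if `M[r] ≠ 0` then `a` else `b` -/
  | cond (r : ℕ) (a b : Prog) : Prog
  /-- while `M[r] ≠ 0` do `a` -/
  | loop (r : ℕ) (a : Prog) : Prog

/-- A machine state: the memory, together with the running time and the number of queries (of both
kinds) spent so far. -/
structure State : Type where
  mem : ℕ → ℕ
  time : ℕ
  queries : ℕ

/-- Replace the memory and charge `t` time units and `q` queries. -/
def State.upd (σ : State) (m : ℕ → ℕ) (t q : ℕ) : State := ⟨m, σ.time + t, σ.queries + q⟩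

/-- One time unit, for a test of a branch or of a loop. -/
def State.tick (σ : State) : State := σ.upd σ.mem 1 0

/-- The point of `{0,1}^n` stored from address `a` on. -/
def readPoint (n : ℕ) (m : ℕ → ℕ) (a : ℕ) : Fin n → Bool := fun l => decide (m (a + l) ≠ 0)

/-- Write the point `x` to the `n` cells from address `a` on. -/
def writePoint {n : ℕ} (m : ℕ → ℕ) (a : ℕ) (x : Fin n → Bool) : ℕ → ℕ :=
  fun b => if h : b - a < n then (if a ≤ b then (x ⟨b - a, h⟩).toNat else m b) else m b

/-- The effect of an instruction, for the unknown function `f` and the unknown distribution `D`.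
A query costs `n + 1` time units (its argument or answer is an `n`-bit string), every other
instruction costs `1`. -/
def Instr.exec {n : ℕ} (f : BoolFun n) (D : PMF (Fin n → Bool)) (σ : State) : Instr → PMF State
  | .const i k => PMF.pure (σ.upd (Function.update σ.mem i k) 1 0)
  | .add i j k => PMF.pure (σ.upd (Function.update σ.mem i (σ.mem j + σ.mem k)) 1 0)
  | .sub i j k => PMF.pure (σ.upd (Function.update σ.mem i (σ.mem j - σ.mem k)) 1 0)
  | .load i j => PMF.pure (σ.upd (Function.update σ.mem i (σ.mem (σ.mem j))) 1 0)
  | .store i j => PMF.pure (σ.upd (Function.update σ.mem (σ.mem i) (σ.mem j)) 1 0)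
  | .flip i => (PMF.uniformOfFintype Bool).map
      fun b => σ.upd (Function.update σ.mem i b.toNat) 1 0
  | .query i j => PMF.pure
      (σ.upd (Function.update σ.mem i (f (readPoint n σ.mem (σ.mem j))).toNat) (n + 1) 1)
  | .sample i j => D.map
      fun x => σ.upd (Function.update (writePoint σ.mem (σ.mem j) x) i (f x).toNat) (n + 1) 1

/-- `Runs f D P σ μ`: started in state `σ`, the program `P` halts on every possible outcome of its
coin flips and random examples, and `μ` is the distribution of its final state. -/
inductive Runs {n : ℕ} (f : BoolFun n) (D : PMF (Fin n → Bool)) : Prog → State → PMF State → Prop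
  | op (i : Instr) (σ : State) : Runs f D (.op i) σ (i.exec f D σ)
  | seq (a b : Prog) (σ : State) (μ : PMF State) (ν : State → PMF State)
      (ha : Runs f D a σ μ) (hb : ∀ τ ∈ μ.support, Runs f D b τ (ν τ)) :
      Runs f D (.seq a b) σ (μ.bind ν)
  | condTrue (r : ℕ) (a b : Prog) (σ : State) (μ : PMF State) (hr : σ.mem r ≠ 0)
      (h : Runs f D a σ.tick μ) : Runs f D (.cond r a b) σ μ
  | condFalse (r : ℕ) (a b : Prog) (σ : State) (μ : PMF State) (hr : σ.mem r = 0)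
      (h : Runs f D b σ.tick μ) : Runs f D (.cond r a b) σ μ
  | loopStop (r : ℕ) (a : Prog) (σ : State) (hr : σ.mem r = 0) :
      Runs f D (.loop r a) σ (PMF.pure σ.tick)
  | loopStep (r : ℕ) (a : Prog) (σ : State) (μ : PMF State) (ν : State → PMF State)
      (hr : σ.mem r ≠ 0) (ha : Runs f D a σ.tick μ)
      (hl : ∀ τ ∈ μ.support, Runs f D (.loop r a) τ (ν τ)) :
      Runs f D (.loop r a) σ (μ.bind ν)

theorem bind_congr_support {μ : PMF State} {ν ν' : State → PMF State}
    (h : ∀ τ ∈ μ.support, ν τ = ν' τ) : μ.bind ν = μ.bind ν' := by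
  ext x
  simp only [PMF.bind_apply]
  refine tsum_congr fun τ => ?_
  by_cases hτ : μ τ = 0
  · simp [hτ]
  · rw [h τ ((PMF.mem_support_iff μ τ).2 hτ)]

/-- The final distribution is determined by the program, the oracles and the initial state. -/
theorem Runs.unique {n : ℕ} {f : BoolFun n} {D : PMF (Fin n → Bool)} {P : Prog} {σ : State}
    {μ μ' : PMF State} (h : Runs f D P σ μ) (h' : Runs f D P σ μ') : μ = μ' := by
  induction h generalizing μ' with
  | op i σ => cases h'; rfl
  | seq a b σ μ ν ha hb iha ihb =>
    cases h' with
    | seq _ _ _ μ₂ ν₂ ha₂ hb₂ =>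
      obtain rfl := iha ha₂
      exact bind_congr_support fun τ hτ => ihb τ hτ (hb₂ τ hτ)
  | condTrue r a b σ μ hr h ih =>
    cases h' with
    | condTrue _ _ _ _ _ _ h₂ => exact ih h₂
    | condFalse _ _ _ _ _ hr₂ _ => exact absurd hr₂ hr
  | condFalse r a b σ μ hr h ih =>
    cases h' with
    | condTrue _ _ _ _ _ hr₂ _ => exact absurd hr hr₂
    | condFalse _ _ _ _ _ _ h₂ => exact ih h₂
  | loopStop r a σ hr =>
    cases h' with
    | loopStop _ _ _ _ => rfl
    | loopStep _ _ _ _ _ hr₂ _ _ => exact absurd hr hr₂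
  | loopStep r a σ μ ν hr ha hl iha ihl =>
    cases h' with
    | loopStop _ _ _ hr₂ => exact absurd hr₂ hr
    | loopStep _ _ _ μ₂ ν₂ _ ha₂ hl₂ =>
      obtain rfl := iha ha₂
      exact bind_congr_support fun τ hτ => ihl τ hτ (hl₂ τ hτ)

/-- The initial state: `n`, `s` and the integer `N` encoding the distance parameter are stored in
cells `0`, `1`, `2`; all other cells are `0`, and nothing has been spent. -/
def initState (n s N : ℕ) : State :=
  ⟨fun a => if a = 0 then n else if a = 1 then s else if a = 2 then N else 0, 0, 0⟩

/-- Final states in which the machine accepts. -/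
def accepting : Set State := {σ | σ.mem 0 ≠ 0}

/-- Final states in which the machine rejects. -/
def rejecting : Set State := {σ | σ.mem 0 = 0}

/-- `s ^ (c · log s)`. -/
def quasi (c : ℝ) (s : ℕ) : ℝ := (s : ℝ) ^ (c * Real.log s)

end DTTest

end

open DTTest

set_option linter.all false
set_option autoImplicit false

/-! The tester never identifies variables. It hashes the `n` variables into blocks, with constantly
many times `s²` blocks, so that the fewer than `s` variables of a tree of size `s` most likely lie
in different blocks. Relevant blocks are discovered one at a time. If a random example `x` and its
projection to the known blocks (zero elsewhere) have different values, the first hybrid between the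
two whose value is `f x` shows a new relevant block, and this hybrid is kept as a witness. Varying
only block `j` around its witness gives a function `g_j`. For a small tree and a hash that separates
its variables, `g_j` is one variable or its negation.

A round draws `q` rows, each an example `x` and uniform points `y, u, v`. If no row shows a
discrepancy, two checks are made. First, the differences `p ↦ g_j(y) + g_j(y + p)` must be additive
and multiplicative on the directions `u, v`. Second, the bits `g_j(y) + g_j(y + x)`, a
self-corrected reading of a coordinate of `x`, form a table labelled by `f x`, and a search of rank
`r = ⌊log₂ s⌋` must explain the table. The tester accepts if one of `s + 1` rounds passes.

Completeness: a tree of size at most `s` has fewer than `s` variables, so some round makes no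
discovery (`rounds_complete`). In it the labels are those of the projected points, hence given by
the tree with each variable replaced by the bit of a slot or by zero, and the search succeeds
(`Fd.Good.pass`, `Tab.R_of_cons`). Among the two subtrees of a root one has less than half of the
size bound, so the literal leading to it is eliminated by a search of smaller rank, and each pass
over the literals shrinks the tree.

Soundness: a slot that is not nearly a coordinate (or zero) fails the first check noticeably often
(`exists_coord_of_test`: the majority of the differences is an additive and multiplicative map on
`F₂ⁿ`, that is, a coordinate or zero). If all slots are good, a successful search yields a
hypothesis from a class of at most `2 ^ ((2W+1)^r)` elements fixed before the rows are drawn. Each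
hypothesis is, up to reading errors, a tree of size at most `(W+1)^r`. A far function disagrees with
it on mass more than `ε`, and the readings are right at least half of the time, so each row refutes
it with probability at least `ε/2`; a union bound finishes (`prob_pass_le`). These bounds hold for
every collection of blocks and witnesses, so the adaptive discoveries do no harm.

With `W = 2s²` and `q` of order `s (2W+1)^r / ε` the time is `s^{O(log s)} n / ε`. A query costs `n
+ 1` units of time, so the query bound follows by division, without logarithms.

The program is written in a structured language whose compiler is correct in distribution
(`Cmd.simulates`). Its random semantics is coupled with the idealized process `tester` by relations
between states (`Sim`), and its time is bounded from the registers that bound loops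
(`Cmd.den_time`). -/

namespace DTTester

noncomputable section

/-! ### A structured language over registers, infinite arrays and a point buffer -/

/-- Registers. -/
inductive Var : Type where
  | n | s | N | one | zero | two | r | p | W | W2 | L | q | tau | m2 | qs | sn | rq | s1 | cst
  | k1 | k2 | kt | kd | ki | kj
  | t | d | d2 | h | b | c | g | o | o2 | l | dir | res | flag | bad | acc
  | lx | lp | e | hh | fnd | k | kn | wp | tp | bj | xx | yy | uu
  | w0 | w1 | w2 | w3 | w4 | w5 | wi
  deriving DecidableEq

/-- Arrays. -/
inductive Arr : Type where
  | H | X | Y | U | V | P1 | P2 | P3 | P4 | P5 | PD | BLK | WT | MK | TB | LB | S | DG | LV | LP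
  deriving DecidableEq

/-- The memory cell of a register. -/
def Var.addr (x : Var) : ℕ := x.ctorIdx

/-- The residue of the cells of an array. -/
def Arr.addr (a : Arr) : ℕ := a.ctorIdx

/-- Cells 60 to 62 stay free as scratch space of the compiled code, and cell 63 for the address `64
+ n`. -/
theorem Var.addr_lt (x : Var) : x.addr < 60 := by cases x <;> decide

/-- The arrays are interleaved after the buffer with stride 32, so residues below 32 keep them
disjoint. -/
theorem Arr.addr_lt (a : Arr) : a.addr < 32 := by cases a <;> decide

theorem Var.addr_inj {x y : Var} : x.addr = y.addr ↔ x = y := by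
  refine ⟨fun h => ?_, fun h => h ▸ rfl⟩
  have key : ∀ z : Var, Var.ofNat z.addr = z := by intro z; cases z <;> rfl
  rw [← key x, ← key y, h]

theorem Arr.addr_inj {x y : Arr} : x.addr = y.addr ↔ x = y := by
  refine ⟨fun h => ?_, fun h => h ▸ rfl⟩
  have key : ∀ z : Arr, Arr.ofNat z.addr = z := by intro z; cases z <;> rfl
  rw [← key x, ← key y, h]

/-- Structured states: registers, arrays, the point buffer and the running time. -/
structure HS : Type where
  v : Var → ℕ
  A : Arr → ℕ → ℕ
  B : ℕ → ℕ
  T : ℕ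

namespace HS

/-- Assign a register and charge `c` time units. -/
def setV (σ : HS) (x : Var) (k c : ℕ) : HS := ⟨Function.update σ.v x k, σ.A, σ.B, σ.T + c⟩

/-- Assign an array cell and charge `c` time units. -/
def setA (σ : HS) (a : Arr) (i k c : ℕ) : HS :=
  ⟨σ.v, Function.update σ.A a (Function.update (σ.A a) i k), σ.B, σ.T + c⟩

/-- Assign the buffer and charge `c` time units. -/
def setB (σ : HS) (B : ℕ → ℕ) (c : ℕ) : HS := ⟨σ.v, σ.A, B, σ.T + c⟩

/-- Charge `c` time units. -/
def tick (σ : HS) (c : ℕ) : HS := ⟨σ.v, σ.A, σ.B, σ.T + c⟩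

end HS

/-- Structured commands. `rep k r c` repeats `c` with `k` counting down from `r - 1` to `0`. -/
inductive Cmd : Type where
  | set (x : Var) (k : ℕ)
  | add (x y z : Var)
  | sub (x y z : Var)
  | ld (x : Var) (a : Arr) (i : Var)
  | st (a : Arr) (i x : Var)
  | ldB (x i : Var)
  | stB (i x : Var)
  | qry (x : Var)
  | flip (x : Var)
  | smp (x : Var)
  | seq (a b : Cmd)
  | ite (x : Var) (a b : Cmd)
  | rep (k r : Var) (c : Cmd)

infixr:60 " ;; " => Cmd.seq

/-- The point stored in the buffer. -/
def bufPoint (n : ℕ) (B : ℕ → ℕ) : Fin n → Bool := fun i => decide (B i ≠ 0)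

/-- The buffer holding a point. -/
def pointBuf {n : ℕ} (x : Fin n → Bool) : ℕ → ℕ := fun i => if h : i < n then (x ⟨i, h⟩).toNat else 0

/-! ### Deterministic and randomized semantics of commands -/

section semantics

variable {n : ℕ} (f : BoolFun n) (D : PMF (Fin n → Bool))

/-- Iterate a deterministic loop body. -/
def iterRun (F : HS → HS) (k : Var) : ℕ → HS → HS
  | 0, σ => σ.tick 1
  -- The 3 units are the loop test, the constant 1 and the decrement of the counter.
  | j + 1, σ => iterRun F k j (F (σ.setV k j 3))

/-- Iterate a randomized loop body. -/
def iterDen (F : HS → PMF HS) (k : Var) : ℕ → HS → PMF HS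
  | 0, σ => PMF.pure (σ.tick 1)
  | j + 1, σ => (F (σ.setV k j 3)).bind (iterDen F k j)

/-- Deterministic semantics (random instructions are skipped). -/
def Cmd.run : Cmd → HS → HS
  | .set x k, σ => σ.setV x k 1
  | .add x y z, σ => σ.setV x (σ.v y + σ.v z) 1
  | .sub x y z, σ => σ.setV x (σ.v y - σ.v z) 1
  -- The charges are the exact costs of the compiled code: eight address instructions and one access
  -- here, three guard instructions, a test and an access for the buffer, one address constant
  -- before a query.
  | .ld x a i, σ => σ.setV x (σ.A a (σ.v i)) 9
  | .st a i x, σ => σ.setA a (σ.v i) (σ.v x) 9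
  | .ldB x i, σ => σ.setV x (if σ.v i < n then σ.B (σ.v i) else 0) 5
  | .stB i x, σ => σ.setB (if σ.v i < n then Function.update σ.B (σ.v i) (σ.v x) else σ.B) 5
  | .qry x, σ => σ.setV x (f (bufPoint n σ.B)).toNat (n + 2)
  | .flip _, σ => σ
  | .smp _, σ => σ
  | .seq a b, σ => b.run (a.run σ)
  | .ite x a b, σ => if σ.v x ≠ 0 then a.run (σ.tick 1) else b.run (σ.tick 1)
  | .rep k r c, σ => iterRun c.run k (σ.v r) (σ.setV k (σ.v r) 2)

/-- Randomized semantics. -/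
def Cmd.den : Cmd → HS → PMF HS
  | .flip x, σ => (PMF.uniformOfFintype Bool).map fun b => σ.setV x b.toNat 1
  | .smp x, σ => D.map fun p => (σ.setB (pointBuf p) 0).setV x (f p).toNat (n + 2)
  | .seq a b, σ => (a.den σ).bind b.den
  | .ite x a b, σ => if σ.v x ≠ 0 then a.den (σ.tick 1) else b.den (σ.tick 1)
  | .rep k r c, σ => iterDen c.den k (σ.v r) (σ.setV k (σ.v r) 2)
  | c, σ => PMF.pure (c.run f σ)

end semantics

/-- The command contains no random instruction. -/
def Cmd.det : Cmd → Bool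
  | .flip _ => false
  | .smp _ => false
  | .seq a b => a.det && b.det
  | .ite _ a b => a.det && b.det
  | .rep _ _ c => c.det
  | _ => true

/-- The register may be written by the command. -/
def Cmd.writes : Cmd → Var → Bool
  | .set x _, y => x = y
  | .add x _ _, y => x = y
  | .sub x _ _, y => x = y
  | .ld x _ _, y => x = y
  | .st _ _ _, _ => false
  | .ldB x _, y => x = y
  | .stB _ _, _ => false
  | .qry x, y => x = y
  | .flip x, y => x = y
  | .smp x, y => x = y
  | .seq a b, y => a.writes y || b.writes y
  | .ite _ a b, y => a.writes y || b.writes y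
  | .rep k _ c, y => k = y || c.writes y

/-- The array may be written by the command. -/
def Cmd.writesA : Cmd → Arr → Bool
  | .st a _ _, y => a = y
  | .seq a b, y => a.writesA y || b.writesA y
  | .ite _ a b, y => a.writesA y || b.writesA y
  | .rep _ _ c, y => c.writesA y
  | _, _ => false

/-- Loop counters are not written by loop bodies. -/
def Cmd.wf : Cmd → Bool
  | .seq a b => a.wf && b.wf
  | .ite _ a b => a.wf && b.wf
  | .rep k _ c => c.wf && !c.writes k
  | _ => true

/-- A test on all registers that bound loops. -/
def Cmd.boundsAll (P : Var → Bool) : Cmd → Bool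
  | .seq a b => a.boundsAll P && b.boundsAll P
  | .ite _ a b => a.boundsAll P && b.boundsAll P
  | .rep _ r c => P r && c.boundsAll P
  | _ => true

/-- An upper bound on the running time in terms of the registers that bound loops. -/
def Cmd.cost (n : ℕ) (v : Var → ℕ) : Cmd → ℕ
  | .set _ _ => 1
  | .add _ _ _ => 1
  | .sub _ _ _ => 1
  | .ld _ _ _ => 9
  | .st _ _ _ => 9
  | .ldB _ _ => 5
  | .stB _ _ => 5
  | .qry _ => n + 2
  | .flip _ => 1
  | .smp _ => n + 2
  | .seq a b => a.cost n v + b.cost n v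
  | .ite _ a b => 1 + (a.cost n v + b.cost n v)
  | .rep _ r c => 3 + v r * (3 + c.cost n v)

/-! ### Compilation -/

/-- Compute in cell `60` the address of a cell of an array. -/
def addrProg (a : Arr) (i : Var) : Prog :=
  -- Five doublings multiply the index by 32; cell 63 adds the base `64 + n`.
  .seq (.op (.add 60 i.addr i.addr)) <| .seq (.op (.add 60 60 60)) <| .seq (.op (.add 60 60 60)) <|
  .seq (.op (.add 60 60 60)) <| .seq (.op (.add 60 60 60)) <| .seq (.op (.add 60 60 63)) <|
  .seq (.op (.const 61 a.addr)) (.op (.add 60 60 61))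

/-- Compute in cell `60` a buffer address and in cell `61` a test that it lies in the buffer. -/
def guardProg (i : Var) : Prog :=
  -- Cell 61 becomes `(64 + n) - (64 + i)`, truncated at zero: it is nonzero exactly when `i < n`.
  .seq (.op (.const 61 64)) <| .seq (.op (.add 60 i.addr 61)) (.op (.sub 61 63 60))

/-- The compiler. Cell `63` holds the first address after the buffer. -/
def Cmd.compile : Cmd → Prog
  | .set x k => .op (.const x.addr k)
  | .add x y z => .op (.add x.addr y.addr z.addr)
  | .sub x y z => .op (.sub x.addr y.addr z.addr)
  | .ld x a i => .seq (addrProg a i) (.op (.load x.addr 60))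
  | .st a i x => .seq (addrProg a i) (.op (.store 60 x.addr))
  | .ldB x i => .seq (guardProg i) (.cond 61 (.op (.load x.addr 60)) (.op (.const x.addr 0)))
  | .stB i x => .seq (guardProg i) (.cond 61 (.op (.store 60 x.addr)) (.op (.const 61 0)))
  | .qry x => .seq (.op (.const 60 64)) (.op (.query x.addr 60))
  | .flip x => .op (.flip x.addr)
  | .smp x => .seq (.op (.const 60 64)) (.op (.sample x.addr 60))
  | .seq a b => .seq a.compile b.compile
  | .ite x a b => .cond x.addr a.compile b.compile
  | .rep k r c => .seq (.op (.const 62 0)) <| .seq (.op (.add k.addr r.addr 62)) <|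
      .loop k.addr <| .seq (.op (.const 62 1)) <| .seq (.op (.sub k.addr k.addr 62)) c.compile

/-- Registers of a memory. -/
def vOf (m : ℕ → ℕ) : Var → ℕ := fun x => m x.addr

/-- Arrays of a memory. -/
def aOf (n : ℕ) (m : ℕ → ℕ) : Arr → ℕ → ℕ := fun a i => m (64 + n + 32 * i + a.addr)

/-- Buffer of a memory. -/
def bOf (n : ℕ) (m : ℕ → ℕ) : ℕ → ℕ := fun i => if i < n then m (64 + i) else 0

/-- The structured state represented by a machine state. -/
def absS (n : ℕ) (σ : State) : HS := ⟨vOf σ.mem, aOf n σ.mem, bOf n σ.mem, σ.time⟩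

theorem vOf_update_var (m : ℕ → ℕ) (x : Var) (k : ℕ) :
    vOf (Function.update m x.addr k) = Function.update (vOf m) x k := by
  funext y
  simp [vOf, Function.update_apply, Var.addr_inj]

theorem vOf_update_ge (m : ℕ → ℕ) {a : ℕ} (ha : 60 ≤ a) (k : ℕ) :
    vOf (Function.update m a k) = vOf m := by
  funext y
  have := y.addr_lt
  simp [vOf, Function.update_apply, show y.addr ≠ a by omega]

theorem aOf_update_lt (n : ℕ) (m : ℕ → ℕ) {a : ℕ} (ha : a < 64 + n) (k : ℕ) :
    aOf n (Function.update m a k) = aOf n m := by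
  funext y i
  simp [aOf, Function.update_apply, show 64 + n + 32 * i + y.addr ≠ a by omega]

/-- Cells of different arrays differ modulo 32, and cells of one array with different indices differ
by a nonzero multiple of 32, so exactly one entry changes. -/
theorem aOf_update_arr (n : ℕ) (m : ℕ → ℕ) (a : Arr) (i k : ℕ) :
    aOf n (Function.update m (64 + n + 32 * i + a.addr) k) =
      Function.update (aOf n m) a (Function.update (aOf n m a) i k) := by
  funext y j
  have h1 := a.addr_lt
  have h2 := y.addr_lt
  by_cases hy : y = a
  · subst hy
    by_cases hj : j = i
    · subst hj; simp [aOf]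
    · simp [aOf, hj, show 64 + n + 32 * j + y.addr ≠ 64 + n + 32 * i + y.addr by omega]
  · have : y.addr ≠ a.addr := fun h => hy (Arr.addr_inj.1 h)
    simp [aOf, hy, show 64 + n + 32 * j + y.addr ≠ 64 + n + 32 * i + a.addr by omega]

theorem bOf_update_lt (n : ℕ) (m : ℕ → ℕ) {a : ℕ} (ha : a < 64) (k : ℕ) :
    bOf n (Function.update m a k) = bOf n m := by
  funext i
  simp [bOf, Function.update_apply, show 64 + i ≠ a by omega]

theorem bOf_update_ge (n : ℕ) (m : ℕ → ℕ) {a : ℕ} (ha : 64 + n ≤ a) (k : ℕ) :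
    bOf n (Function.update m a k) = bOf n m := by
  funext i
  by_cases h : i < n
  · simp [bOf, Function.update_apply, show 64 + i ≠ a by omega]
  · simp [bOf, h]

theorem bOf_update_buf {n : ℕ} (m : ℕ → ℕ) {i : ℕ} (hi : i < n) (k : ℕ) :
    bOf n (Function.update m (64 + i) k) = Function.update (bOf n m) i k := by
  funext j
  by_cases hj : j = i
  · subst hj; simp [bOf, hi]
  · simp [bOf, Function.update_apply, hj]

/-! ### Correctness of the compiler -/

section correctness

variable {n : ℕ} {f : BoolFun n} {D : PMF (Fin n → Bool)}

theorem Runs.seqPure {a b : Prog} {σ τ : State} {μ : PMF State}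
    (ha : Runs f D a σ (PMF.pure τ)) (hb : Runs f D b τ μ) : Runs f D (.seq a b) σ μ := by
  have := Runs.seq a b σ (PMF.pure τ) (fun _ => μ) ha (fun τ' hτ' => by
    rw [PMF.support_pure, Set.mem_singleton_iff] at hτ'
    exact hτ' ▸ hb)
  rwa [PMF.pure_bind] at this

theorem runs_addrProg (a : Arr) (i : Var) (σ : State) (h63 : σ.mem 63 = 64 + n) :
    ∃ τ, Runs f D (addrProg a i) σ (PMF.pure τ) ∧ τ.mem 60 = 64 + n + 32 * σ.mem i.addr + a.addr ∧
      τ.time = σ.time + 8 ∧ ∀ j, j ≠ 60 → j ≠ 61 → τ.mem j = σ.mem j := by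
  refine ⟨_, Runs.seqPure (.op _ _) <| Runs.seqPure (.op _ _) <| Runs.seqPure (.op _ _) <|
    Runs.seqPure (.op _ _) <| Runs.seqPure (.op _ _) <| Runs.seqPure (.op _ _) <|
    Runs.seqPure (.op _ _) (.op _ _), ?_, ?_, ?_⟩
  · simp [State.upd, h63]; ring
  · simp [State.upd]
  · intro j h1 h2
    simp [State.upd, h1, h2]

theorem runs_guardProg (i : Var) (σ : State) (h63 : σ.mem 63 = 64 + n) :
    ∃ τ, Runs f D (guardProg i) σ (PMF.pure τ) ∧ τ.mem 60 = 64 + σ.mem i.addr ∧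
      τ.mem 61 = n - σ.mem i.addr ∧
      τ.time = σ.time + 3 ∧ ∀ j, j ≠ 60 → j ≠ 61 → τ.mem j = σ.mem j := by
  have := i.addr_lt
  refine ⟨_, Runs.seqPure (.op _ _) <| Runs.seqPure (.op _ _) (.op _ _), ?_, ?_, ?_, ?_⟩
  · simp [State.upd, show i.addr ≠ 61 by omega]; ring
  · simp [State.upd, h63, show i.addr ≠ 61 by omega]; omega
  · simp [State.upd]
  · intro j h1 h2
    simp [State.upd, h1, h2]

theorem vOf_eq {m m' : ℕ → ℕ} (h : ∀ j, j ≠ 60 → j ≠ 61 → m' j = m j) : vOf m' = vOf m := by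
  funext x
  have := x.addr_lt
  exact h _ (by omega) (by omega)

theorem aOf_eq {m m' : ℕ → ℕ} (h : ∀ j, j ≠ 60 → j ≠ 61 → m' j = m j) : aOf n m' = aOf n m := by
  funext a i
  exact h _ (by omega) (by omega)

theorem bOf_eq {m m' : ℕ → ℕ} (h : ∀ j, j ≠ 60 → j ≠ 61 → m' j = m j) : bOf n m' = bOf n m := by
  funext i
  simp only [bOf]
  split
  · exact h _ (by omega) (by omega)
  · rfl

theorem readPoint_buf (m : ℕ → ℕ) : readPoint n m 64 = bufPoint n (bOf n m) := by
  funext i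
  simp [readPoint, bufPoint, bOf]

theorem vOf_writePoint (m : ℕ → ℕ) (x : Fin n → Bool) : vOf (writePoint m 64 x) = vOf m := by
  funext y
  have := y.addr_lt
  simp [vOf, writePoint, show ¬ 64 ≤ y.addr by omega]

theorem aOf_writePoint (m : ℕ → ℕ) (x : Fin n → Bool) : aOf n (writePoint m 64 x) = aOf n m := by
  funext y i
  simp [aOf, writePoint, show ¬ (64 + n + 32 * i + y.addr - 64 < n) by omega]

theorem bOf_writePoint (m : ℕ → ℕ) (x : Fin n → Bool) :
    bOf n (writePoint m 64 x) = pointBuf x := by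
  funext i
  by_cases h : i < n
  · simp [bOf, pointBuf, writePoint, h]
  · simp [bOf, pointBuf, h]

/-- A command is simulated by a program from every state with a correct address cell. -/
def Simulates (P : Prog) (f : BoolFun n) (D : PMF (Fin n → Bool)) (F : HS → PMF HS) : Prop :=
  ∀ σ : State, σ.mem 63 = 64 + n → ∃ μ, Runs f D P σ μ ∧
    (∀ τ ∈ μ.support, τ.mem 63 = 64 + n) ∧ μ.map (absS n) = F (absS n σ)

theorem Simulates.of_pure {P : Prog} {F : HS → PMF HS} {G : HS → HS}
    (hF : ∀ h, F h = PMF.pure (G h))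
    (h : ∀ σ : State, σ.mem 63 = 64 + n → ∃ τ, Runs f D P σ (PMF.pure τ) ∧ τ.mem 63 = 64 + n ∧
      absS n τ = G (absS n σ)) : Simulates P f D F := by
  intro σ hσ
  obtain ⟨τ, h1, h2, h3⟩ := h σ hσ
  refine ⟨_, h1, ?_, ?_⟩
  · intro τ' hτ'
    rw [PMF.support_pure, Set.mem_singleton_iff] at hτ'
    rw [hτ', h2]
  · rw [PMF.pure_map, h3, hF]

theorem Simulates.seq {P Q : Prog} {F G : HS → PMF HS} (hP : Simulates P f D F)
    (hQ : Simulates Q f D G) : Simulates (.seq P Q) f D (fun h => (F h).bind G) := by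
  intro σ hσ
  obtain ⟨μ, h1, h2, h3⟩ := hP σ hσ
  -- `Runs.seq` wants a family of distributions on all states; off the support of `μ` an arbitrary
  -- point mass is used, which has weight zero.
  have key : ∀ τ : State, ∃ ν, τ ∈ μ.support → Runs f D Q τ ν ∧
      (∀ τ' ∈ ν.support, τ'.mem 63 = 64 + n) ∧ ν.map (absS n) = G (absS n τ) := by
    intro τ
    by_cases hτ : τ ∈ μ.support
    · obtain ⟨ν, hν⟩ := hQ τ (h2 τ hτ)
      exact ⟨ν, fun _ => hν⟩
    · exact ⟨PMF.pure τ, fun h => absurd h hτ⟩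
  choose ν hν using key
  refine ⟨μ.bind ν, .seq _ _ _ _ _ h1 fun τ hτ => (hν τ hτ).1, ?_, ?_⟩
  · intro τ' hτ'
    obtain ⟨τ, hτ, hτ'⟩ := (PMF.mem_support_bind_iff _ _ _).1 hτ'
    exact (hν τ hτ).2.1 τ' hτ'
  · simp only [PMF.map_bind, ← h3, PMF.bind_map]
    ext x
    simp only [PMF.bind_apply]
    refine tsum_congr fun τ => ?_
    by_cases hτ : μ τ = 0
    · simp [hτ]
    · rw [(hν τ ((PMF.mem_support_iff μ τ).2 hτ)).2.2]; rfl

theorem Simulates.cond {P Q : Prog} {F G : HS → PMF HS} (x : Var) (hP : Simulates P f D F)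
    (hQ : Simulates Q f D G) : Simulates (.cond x.addr P Q) f D
      (fun h => if h.v x ≠ 0 then F (h.tick 1) else G (h.tick 1)) := by
  intro σ hσ
  by_cases hx : σ.mem x.addr = 0
  · obtain ⟨μ, h1, h2, h3⟩ := hQ σ.tick hσ
    refine ⟨μ, .condFalse _ _ _ _ _ hx h1, h2, ?_⟩
    rw [h3]
    simp [absS, vOf, hx, State.tick, State.upd, HS.tick]
  · obtain ⟨μ, h1, h2, h3⟩ := hP σ.tick hσ
    refine ⟨μ, .condTrue _ _ _ _ _ hx h1, h2, ?_⟩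
    rw [h3]
    simp [absS, vOf, hx, State.tick, State.upd, HS.tick]

/-- A deterministic update in one instruction. -/
theorem Simulates.op_pure {i : Instr} {F : HS → PMF HS} {G : HS → HS}
    (hF : ∀ h, F h = PMF.pure (G h)) (S : State → State)
    (hi : ∀ σ, i.exec f D σ = PMF.pure (S σ)) (h63 : ∀ σ, (S σ).mem 63 = σ.mem 63)
    (hS : ∀ σ, absS n (S σ) = G (absS n σ)) : Simulates (.op i) f D F := by
  refine Simulates.of_pure hF fun σ hσ => ⟨S σ, hi σ ▸ Runs.op i σ, by rw [h63, hσ], hS σ⟩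

theorem absS_setV (σ : State) (x : Var) (k c q : ℕ) :
    absS n (σ.upd (Function.update σ.mem x.addr k) c q) = (absS n σ).setV x k c := by
  have := x.addr_lt
  simp only [absS, State.upd, HS.setV, vOf_update_var, aOf_update_lt n σ.mem (show x.addr < 64 + n by omega),
    bOf_update_lt n σ.mem (show x.addr < 64 by omega)]

theorem update_addr_63 (m : ℕ → ℕ) (x : Var) (k : ℕ) : Function.update m x.addr k 63 = m 63 := by
  have := x.addr_lt
  simp [Function.update_apply, show 63 ≠ x.addr by omega]

theorem simulates_ld (x : Var) (a : Arr) (i : Var) :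
    Simulates (Cmd.ld x a i).compile f D ((Cmd.ld x a i).den f D) := by
  refine Simulates.of_pure (G := fun σ => σ.setV x (σ.A a (σ.v i)) 9) (fun _ => rfl) fun σ hσ => ?_
  obtain ⟨τ, h1, h2, h3, h4⟩ := runs_addrProg (f := f) (D := D) a i σ hσ
  refine ⟨_, Runs.seqPure h1 (.op _ _), ?_, ?_⟩
  · simp only [State.upd]
    rw [update_addr_63, h4 _ (by norm_num) (by norm_num), hσ]
  · rw [absS_setV]
    simp only [absS, HS.setV, vOf_eq h4, aOf_eq h4, bOf_eq h4, h3]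
    have : τ.mem (τ.mem 60) = aOf n σ.mem a (vOf σ.mem i) := by
      rw [h2, h4 _ (by omega) (by omega)]; rfl
    rw [this]

theorem simulates_st (a : Arr) (i x : Var) :
    Simulates (Cmd.st a i x).compile f D ((Cmd.st a i x).den f D) := by
  refine Simulates.of_pure (G := fun σ => σ.setA a (σ.v i) (σ.v x) 9) (fun _ => rfl) fun σ hσ => ?_
  obtain ⟨τ, h1, h2, h3, h4⟩ := runs_addrProg (f := f) (D := D) a i σ hσ
  refine ⟨_, Runs.seqPure h1 (.op _ _), ?_, ?_⟩
  · simp only [State.upd, h2]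
    rw [Function.update_of_ne (by omega), h4 _ (by norm_num) (by norm_num), hσ]
  · have hx := x.addr_lt
    simp only [absS, HS.setA, State.upd, h2]
    rw [vOf_update_ge _ (by omega), aOf_update_arr, bOf_update_ge _ _ (by omega),
      vOf_eq h4, aOf_eq h4, bOf_eq h4, h3, h4 x.addr (by omega) (by omega)]
    rfl

theorem simulates_ldB (x i : Var) :
    Simulates (Cmd.ldB x i).compile f D ((Cmd.ldB x i).den f D) := by
  refine Simulates.of_pure (fun _ => rfl) fun σ hσ => ?_
  obtain ⟨τ, h1, h2, h61, h3, h4⟩ := runs_guardProg (f := f) (D := D) i σ hσ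
  by_cases hi : σ.mem i.addr < n
  · refine ⟨_, Runs.seqPure h1 (.condTrue _ _ _ _ _ (by omega) (.op _ _)), ?_, ?_⟩
    · simp only [State.upd, State.tick]
      rw [update_addr_63, h4 _ (by norm_num) (by norm_num), hσ]
    · rw [absS_setV]
      simp only [absS, HS.setV, State.tick, State.upd, vOf_eq h4, aOf_eq h4, bOf_eq h4, h3, h2,
        Cmd.run]
      rw [h4 _ (by omega) (by omega)]
      simp [vOf, bOf, hi]
  · refine ⟨_, Runs.seqPure h1 (.condFalse _ _ _ _ _ (by omega) (.op _ _)), ?_, ?_⟩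
    · simp only [State.upd, State.tick]
      rw [update_addr_63, h4 _ (by norm_num) (by norm_num), hσ]
    · rw [absS_setV]
      simp only [absS, HS.setV, State.tick, State.upd, vOf_eq h4, aOf_eq h4, bOf_eq h4, h3, h2,
        Cmd.run]
      simp [vOf, bOf, hi]

theorem simulates_stB (i x : Var) :
    Simulates (Cmd.stB i x).compile f D ((Cmd.stB i x).den f D) := by
  refine Simulates.of_pure (fun _ => rfl) fun σ hσ => ?_
  obtain ⟨τ, h1, h2, h61, h3, h4⟩ := runs_guardProg (f := f) (D := D) i σ hσ
  have hx := x.addr_lt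
  by_cases hi : σ.mem i.addr < n
  · refine ⟨_, Runs.seqPure h1 (.condTrue _ _ _ _ _ (by omega) (.op _ _)), ?_, ?_⟩
    · simp only [State.upd, State.tick, h2]
      rw [Function.update_of_ne (by omega), h4 _ (by norm_num) (by norm_num), hσ]
    · simp only [absS, HS.setB, State.tick, State.upd, h2, Cmd.run]
      rw [vOf_update_ge _ (by omega), aOf_update_lt _ _ (by omega), bOf_update_buf _ hi,
        vOf_eq h4, aOf_eq h4, bOf_eq h4, h3, h4 x.addr (by omega) (by omega)]
      simp [vOf, hi]
  · refine ⟨_, Runs.seqPure h1 (.condFalse _ _ _ _ _ (by omega) (.op _ _)), ?_, ?_⟩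
    · simp only [State.upd, State.tick]
      rw [Function.update_of_ne (by omega), h4 _ (by norm_num) (by norm_num), hσ]
    · simp only [absS, HS.setB, State.tick, State.upd, Cmd.run]
      rw [vOf_update_ge _ (by omega), aOf_update_lt _ _ (by omega), bOf_update_lt _ _ (by omega),
        vOf_eq h4, aOf_eq h4, bOf_eq h4, h3]
      simp [vOf, hi]

theorem simulates_qry (x : Var) : Simulates (Cmd.qry x).compile f D ((Cmd.qry x).den f D) := by
  refine Simulates.of_pure (fun _ => rfl) fun σ hσ => ?_
  refine ⟨_, Runs.seqPure (.op _ _) (.op _ _), ?_, ?_⟩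
  · simp only [State.upd]
    rw [update_addr_63]
    simpa using hσ
  · rw [absS_setV]
    simp only [State.upd, Function.update_self, readPoint_buf, absS, Cmd.run, HS.setV,
      vOf_update_ge _ (show 60 ≤ 60 by norm_num), aOf_update_lt n _ (show 60 < 64 + n by omega),
      bOf_update_lt n _ (show 60 < 64 by norm_num)]
    congr 1
    ring

theorem simulates_flip (x : Var) : Simulates (Cmd.flip x).compile f D ((Cmd.flip x).den f D) := by
  intro σ hσ
  refine ⟨_, .op _ _, ?_, ?_⟩
  · intro τ hτ
    simp only [Instr.exec, PMF.support_map] at hτ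
    obtain ⟨b, -, rfl⟩ := hτ
    simp only [State.upd]
    rw [update_addr_63, hσ]
  · simp only [Instr.exec, PMF.map_comp, Cmd.den]
    congr 1
    funext b
    exact absS_setV _ _ _ _ _

theorem simulates_smp (x : Var) : Simulates (Cmd.smp x).compile f D ((Cmd.smp x).den f D) := by
  intro σ hσ
  refine ⟨_, Runs.seqPure (.op _ _) (.op _ _), ?_, ?_⟩
  · intro τ hτ
    simp only [Instr.exec, PMF.support_map] at hτ
    obtain ⟨b, -, rfl⟩ := hτ
    simp only [State.upd]
    rw [update_addr_63]
    simp [writePoint, hσ]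
  · simp only [Instr.exec, PMF.map_comp, Cmd.den]
    congr 1
    funext p
    have := x.addr_lt
    simp only [Function.comp_apply, absS, State.upd, HS.setV, HS.setB, vOf_update_var,
      Function.update_self, vOf_writePoint, aOf_writePoint, bOf_writePoint,
      aOf_update_lt n _ (show x.addr < 64 + n by omega), bOf_update_lt n _ (show x.addr < 64 by omega),
      vOf_update_ge _ (show 60 ≤ 60 by norm_num), aOf_update_lt n _ (show 60 < 64 + n by omega)]
    congr 1
    ring

theorem iterDen_writes {F : HS → PMF HS} {k x : Var} (hkx : k ≠ x)
    (hF : ∀ h, ∀ h' ∈ (F h).support, h'.v x = h.v x) (j : ℕ) :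
    ∀ h, ∀ h' ∈ (iterDen F k j h).support, h'.v x = h.v x := by
  induction j with
  | zero =>
    intro h h' hh
    simp only [iterDen, PMF.support_pure, Set.mem_singleton_iff] at hh
    rw [hh]; rfl
  | succ j ih =>
    intro h h' hh
    obtain ⟨g, hg, hh⟩ := (PMF.mem_support_bind_iff _ _ _).1 hh
    rw [ih g h' hh, hF _ g hg]
    simp [HS.setV, hkx.symm]

theorem Cmd.den_v {x : Var} (c : Cmd) (hc : c.writes x = false) :
    ∀ h, ∀ h' ∈ (c.den f D h).support, h'.v x = h.v x := by
  induction c with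
  | seq a b iha ihb =>
    intro h h' hh
    simp only [Cmd.writes, Bool.or_eq_false_iff] at hc
    obtain ⟨g, hg, hh⟩ := (PMF.mem_support_bind_iff _ _ _).1 hh
    rw [ihb hc.2 g h' hh, iha hc.1 h g hg]
  | ite y a b iha ihb =>
    intro h h' hh
    simp only [Cmd.writes, Bool.or_eq_false_iff] at hc
    simp only [Cmd.den] at hh
    split at hh
    · rw [iha hc.1 _ h' hh]; rfl
    · rw [ihb hc.2 _ h' hh]; rfl
  | rep k r c ih =>
    intro h h' hh
    simp only [Cmd.writes, Bool.or_eq_false_iff, decide_eq_false_iff_not] at hc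
    rw [iterDen_writes hc.1 (ih hc.2) _ _ h' hh]
    simp [HS.setV, Ne.symm hc.1]
  | flip y =>
    intro h h' hh
    simp only [Cmd.writes, decide_eq_false_iff_not] at hc
    simp only [Cmd.den, PMF.support_map] at hh
    obtain ⟨b, -, rfl⟩ := hh
    simp [HS.setV, Ne.symm hc]
  | smp y =>
    intro h h' hh
    simp only [Cmd.writes, decide_eq_false_iff_not] at hc
    simp only [Cmd.den, PMF.support_map] at hh
    obtain ⟨b, -, rfl⟩ := hh
    simp [HS.setV, HS.setB, Ne.symm hc]
  | _ =>
    intro h h' hh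
    simp only [Cmd.writes, decide_eq_false_iff_not] at hc
    simp only [Cmd.den, PMF.support_pure, Set.mem_singleton_iff] at hh
    rw [hh]
    first
      | rfl
      | simp [Cmd.run, HS.setV, HS.setB, HS.setA, Ne.symm hc]

/-- Induction on the value of the counter. The machine loops on a memory cell while `iterDen`
recurses on a number; they stay in step because the body leaves the counter alone (`hF`). -/
theorem simulates_loop {P : Prog} {F : HS → PMF HS} (k : Var) (hP : Simulates P f D F)
    (hF : ∀ h, ∀ h' ∈ (F h).support, h'.v k = h.v k) (j : ℕ) :
    ∀ σ : State, σ.mem 63 = 64 + n → σ.mem k.addr = j → ∃ μ,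
      Runs f D (.loop k.addr <| .seq (.op (.const 62 1)) <| .seq (.op (.sub k.addr k.addr 62)) P) σ μ ∧
      (∀ τ ∈ μ.support, τ.mem 63 = 64 + n) ∧ μ.map (absS n) = iterDen F k j (absS n σ) := by
  have hk := k.addr_lt
  induction j with
  | zero =>
    intro σ hσ hj
    refine ⟨_, .loopStop _ _ _ hj, ?_, ?_⟩
    · intro τ hτ
      rw [PMF.support_pure, Set.mem_singleton_iff] at hτ
      rw [hτ]; exact hσ
    · rw [PMF.pure_map]; rfl
  | succ j ih =>
    intro σ hσ hj
    have hdec : ∃ τ : State, (∀ μ, Runs f D P τ μ →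
        Runs f D (.seq (.op (.const 62 1)) <| .seq (.op (.sub k.addr k.addr 62)) P) σ.tick μ) ∧
        τ.mem 63 = 64 + n ∧ absS n τ = (absS n σ).setV k j 3 := by
      refine ⟨_, fun μ hμ => Runs.seqPure (.op _ _) (Runs.seqPure (.op _ _) hμ), ?_, ?_⟩
      · simp only [State.upd, State.tick]
        rw [update_addr_63]
        simpa using hσ
      · rw [absS_setV]
        simp only [State.upd, State.tick, absS, HS.setV,
          vOf_update_ge _ (show 60 ≤ 62 by norm_num), aOf_update_lt n _ (show 62 < 64 + n by omega),
          bOf_update_lt n _ (show 62 < 64 by norm_num), Function.update_self,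
          Function.update_of_ne (show k.addr ≠ 62 by omega), hj, Nat.add_sub_cancel]
    obtain ⟨τ, h1, h2, h3⟩ := hdec
    obtain ⟨μ, m1, m2, m3⟩ := hP τ h2
    have key : ∀ υ : State, ∃ ν, υ ∈ μ.support →
        Runs f D (.loop k.addr <| .seq (.op (.const 62 1)) <|
          .seq (.op (.sub k.addr k.addr 62)) P) υ ν ∧
        (∀ τ' ∈ ν.support, τ'.mem 63 = 64 + n) ∧ ν.map (absS n) = iterDen F k j (absS n υ) := by
      intro υ
      by_cases hυ : υ ∈ μ.support
      · have hj' : υ.mem k.addr = j := by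
          have h5 : absS n υ ∈ (F (absS n τ)).support := by
            rw [← m3, PMF.support_map]; exact ⟨υ, hυ, rfl⟩
          have h6 := hF _ _ h5
          rw [h3] at h6
          have h7 : (((absS n σ).setV k j 3).v k) = j := Function.update_self _ _ _
          exact h6.trans h7
        obtain ⟨ν, hν⟩ := ih υ (m2 υ hυ) hj'
        exact ⟨ν, fun _ => hν⟩
      · exact ⟨PMF.pure υ, fun h => absurd h hυ⟩
    choose ν hν using key
    refine ⟨μ.bind ν, .loopStep _ _ _ _ _ (by omega) (h1 μ m1) (fun υ hυ => (hν υ hυ).1), ?_, ?_⟩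
    · intro τ' hτ'
      obtain ⟨τ, hτ, hτ'⟩ := (PMF.mem_support_bind_iff _ _ _).1 hτ'
      exact (hν τ hτ).2.1 τ' hτ'
    · simp only [iterDen, ← h3, ← m3, PMF.map_bind, PMF.bind_map]
      ext x
      simp only [PMF.bind_apply]
      refine tsum_congr fun τ => ?_
      by_cases hτ : μ τ = 0
      · simp [hτ]
      · rw [(hν τ ((PMF.mem_support_iff μ τ).2 hτ)).2.2]; rfl

/-- Compiled commands realize the randomized semantics. -/
theorem Cmd.simulates (c : Cmd) (hc : c.wf = true) : Simulates c.compile f D (c.den f D) := by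
  induction c with
  | set x k =>
    exact Simulates.op_pure (fun _ => rfl) _ (fun σ => rfl) (fun σ => update_addr_63 _ _ _)
      (fun σ => absS_setV _ _ _ _ _)
  | add x y z =>
    exact Simulates.op_pure (fun _ => rfl) _ (fun σ => rfl) (fun σ => update_addr_63 _ _ _)
      (fun σ => absS_setV _ _ _ _ _)
  | sub x y z =>
    exact Simulates.op_pure (fun _ => rfl) _ (fun σ => rfl) (fun σ => update_addr_63 _ _ _)
      (fun σ => absS_setV _ _ _ _ _)
  | ld x a i => exact simulates_ld x a i
  | st a i x => exact simulates_st a i x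
  | ldB x i => exact simulates_ldB x i
  | stB i x => exact simulates_stB i x
  | qry x => exact simulates_qry x
  | flip x => exact simulates_flip x
  | smp x => exact simulates_smp x
  | seq a b iha ihb =>
    simp only [Cmd.wf, Bool.and_eq_true] at hc
    exact (iha hc.1).seq (ihb hc.2)
  | ite x a b iha ihb =>
    simp only [Cmd.wf, Bool.and_eq_true] at hc
    exact (iha hc.1).cond x (ihb hc.2)
  | rep k r c ih =>
    simp only [Cmd.wf, Bool.and_eq_true, Bool.not_eq_true'] at hc
    have hk := k.addr_lt
    have hr := r.addr_lt
    intro σ hσ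
    have hinit : ∃ τ : State, (∀ μ P, Runs f D P τ μ →
        Runs f D (.seq (.op (.const 62 0)) <| .seq (.op (.add k.addr r.addr 62)) P) σ μ) ∧
        τ.mem 63 = 64 + n ∧ τ.mem k.addr = σ.mem r.addr ∧
        absS n τ = (absS n σ).setV k (σ.mem r.addr) 2 := by
      refine ⟨_, fun μ P hμ => Runs.seqPure (.op _ _) (Runs.seqPure (.op _ _) hμ), ?_, ?_, ?_⟩
      · simp only [State.upd, State.tick]
        rw [update_addr_63]
        simpa using hσ
      · simp [State.upd, show r.addr ≠ 62 by omega]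
      · rw [absS_setV]
        simp only [State.upd, State.tick, absS, HS.setV,
          vOf_update_ge _ (show 60 ≤ 62 by norm_num), aOf_update_lt n _ (show 62 < 64 + n by omega),
          bOf_update_lt n _ (show 62 < 64 by norm_num), Function.update_self,
          Function.update_of_ne (show r.addr ≠ 62 by omega), Nat.add_zero]
    obtain ⟨τ, h1, h2, h3, h4⟩ := hinit
    obtain ⟨μ, m1, m2, m3⟩ := simulates_loop k (ih hc.1) (c.den_v hc.2) _ τ h2 h3
    exact ⟨μ, h1 _ _ m1, m2, by rw [m3, h4]; rfl⟩

theorem iterDen_pure (F : HS → PMF HS) (G : HS → HS) (hF : ∀ h, F h = PMF.pure (G h)) (k : Var)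
    (j : ℕ) : ∀ h, iterDen F k j h = PMF.pure (iterRun G k j h) := by
  induction j with
  | zero => intro h; rfl
  | succ j ih => intro h; rw [iterDen, hF, PMF.pure_bind, ih]; rfl

/-- Deterministic commands have deterministic semantics. -/
theorem Cmd.den_of_det (c : Cmd) (hc : c.det = true) : ∀ h, c.den f D h = PMF.pure (c.run f h) := by
  induction c with
  | flip x => simp [Cmd.det] at hc
  | smp x => simp [Cmd.det] at hc
  | seq a b iha ihb =>
    simp only [Cmd.det, Bool.and_eq_true] at hc
    intro h
    rw [Cmd.den, iha hc.1, PMF.pure_bind, ihb hc.2]; rfl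
  | ite x a b iha ihb =>
    simp only [Cmd.det, Bool.and_eq_true] at hc
    intro h
    simp only [Cmd.den, Cmd.run]
    split
    · exact iha hc.1 _
    · exact ihb hc.2 _
  | rep k r c ih =>
    intro h
    exact iterDen_pure _ _ (ih hc) _ _ _
  | _ => intro h; rfl

theorem Cmd.run_v {x : Var} (c : Cmd) (hd : c.det = true) (hc : c.writes x = false) (h : HS) :
    (c.run f h).v x = h.v x :=
  -- A deterministic command never consults the distribution, so any point mass serves.
  c.den_v (f := f) (D := PMF.pure fun _ => false) hc h _ (by simp [c.den_of_det hd])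

theorem iterDen_A {F : HS → PMF HS} {k : Var} {a : Arr}
    (hF : ∀ h, ∀ h' ∈ (F h).support, h'.A a = h.A a) (j : ℕ) :
    ∀ h, ∀ h' ∈ (iterDen F k j h).support, h'.A a = h.A a := by
  induction j with
  | zero =>
    intro h h' hh
    simp only [iterDen, PMF.support_pure, Set.mem_singleton_iff] at hh
    rw [hh]; rfl
  | succ j ih =>
    intro h h' hh
    obtain ⟨g, hg, hh⟩ := (PMF.mem_support_bind_iff _ _ _).1 hh
    rw [ih g h' hh, hF _ g hg]
    rfl

theorem Cmd.den_A {a : Arr} (c : Cmd) (hc : c.writesA a = false) :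
    ∀ h, ∀ h' ∈ (c.den f D h).support, h'.A a = h.A a := by
  induction c with
  | seq a b iha ihb =>
    intro h h' hh
    simp only [Cmd.writesA, Bool.or_eq_false_iff] at hc
    obtain ⟨g, hg, hh⟩ := (PMF.mem_support_bind_iff _ _ _).1 hh
    rw [ihb hc.2 g h' hh, iha hc.1 h g hg]
  | ite y a b iha ihb =>
    intro h h' hh
    simp only [Cmd.writesA, Bool.or_eq_false_iff] at hc
    simp only [Cmd.den] at hh
    split at hh
    · rw [iha hc.1 _ h' hh]; rfl
    · rw [ihb hc.2 _ h' hh]; rfl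
  | rep k r c ih =>
    intro h h' hh
    rw [iterDen_A (ih hc) _ _ h' hh]
    rfl
  | flip y =>
    intro h h' hh
    simp only [Cmd.den, PMF.support_map] at hh
    obtain ⟨b, -, rfl⟩ := hh
    rfl
  | smp y =>
    intro h h' hh
    simp only [Cmd.den, PMF.support_map] at hh
    obtain ⟨b, -, rfl⟩ := hh
    rfl
  | st b i x =>
    intro h h' hh
    simp only [Cmd.writesA, decide_eq_false_iff_not] at hc
    simp only [Cmd.den, PMF.support_pure, Set.mem_singleton_iff] at hh
    rw [hh]
    simp [Cmd.run, HS.setA, Ne.symm hc]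
  | _ =>
    intro h h' hh
    simp only [Cmd.den, PMF.support_pure, Set.mem_singleton_iff] at hh
    rw [hh]
    rfl

theorem Cmd.run_A {a : Arr} (c : Cmd) (hd : c.det = true) (hc : c.writesA a = false) (h : HS) :
    (c.run f h).A a = h.A a :=
  c.den_A (f := f) (D := PMF.pure fun _ => false) hc h _ (by simp [c.den_of_det hd])

theorem Cmd.cost_congr (c : Cmd) {v v' : Var → ℕ} (P : Var → Bool) (hc : c.boundsAll P = true)
    (hv : ∀ r, P r = true → v r = v' r) : c.cost n v = c.cost n v' := by
  induction c with
  | seq a b iha ihb =>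
    simp only [Cmd.boundsAll, Bool.and_eq_true] at hc
    simp only [Cmd.cost, iha hc.1, ihb hc.2]
  | ite y a b iha ihb =>
    simp only [Cmd.boundsAll, Bool.and_eq_true] at hc
    simp only [Cmd.cost, iha hc.1, ihb hc.2]
  | rep k r c ih =>
    simp only [Cmd.boundsAll, Bool.and_eq_true] at hc
    simp only [Cmd.cost, ih hc.2, hv r hc.1]
  | _ => rfl

/-- If the registers in `P` are not written and bound all loops then the cost bound holds. -/
theorem Cmd.den_time (c : Cmd) (P : Var → Bool) (hc : c.boundsAll P = true)
    (hw : ∀ r, P r = true → c.writes r = false) :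
    ∀ h, ∀ h' ∈ (c.den f D h).support, h'.T ≤ h.T + c.cost n h.v := by
  induction c with
  | seq a b iha ihb =>
    intro h h' hh
    simp only [Cmd.boundsAll, Bool.and_eq_true] at hc
    simp only [Cmd.writes, Bool.or_eq_false_iff] at hw
    obtain ⟨g, hg, hh⟩ := (PMF.mem_support_bind_iff _ _ _).1 hh
    have h1 := iha hc.1 (fun r hr => (hw r hr).1) h g hg
    have h2 := ihb hc.2 (fun r hr => (hw r hr).2) g h' hh
    have h3 : b.cost n g.v = b.cost n h.v :=
      b.cost_congr P hc.2 fun r hr => a.den_v (hw r hr).1 h g hg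
    simp only [Cmd.cost]
    omega
  | ite y a b iha ihb =>
    intro h h' hh
    simp only [Cmd.boundsAll, Bool.and_eq_true] at hc
    simp only [Cmd.writes, Bool.or_eq_false_iff] at hw
    simp only [Cmd.den] at hh
    simp only [Cmd.cost]
    split at hh
    · have := iha hc.1 (fun r hr => (hw r hr).1) _ h' hh
      simp only [HS.tick] at this
      omega
    · have := ihb hc.2 (fun r hr => (hw r hr).2) _ h' hh
      simp only [HS.tick] at this
      omega
  | rep k r c ih =>
    intro h h' hh
    simp only [Cmd.boundsAll, Bool.and_eq_true] at hc
    simp only [Cmd.writes, Bool.or_eq_false_iff, decide_eq_false_iff_not] at hw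
    have key : ∀ j : ℕ, ∀ g, (∀ r, P r = true → g.v r = h.v r) →
        ∀ g' ∈ (iterDen (c.den f D) k j g).support, g'.T ≤ g.T + 1 + j * (3 + c.cost n h.v) := by
      intro j
      induction j with
      | zero =>
        intro g _ g' hg'
        simp only [iterDen, PMF.support_pure, Set.mem_singleton_iff] at hg'
        simp [hg', HS.tick]
      | succ j ihj =>
        intro g hg g' hg'
        obtain ⟨g₁, hg₁, hg'⟩ := (PMF.mem_support_bind_iff _ _ _).1 hg'
        have hgk : ∀ r, P r = true → (g.setV k j 3).v r = h.v r := by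
          intro r hr
          rw [← hg r hr]
          simp [HS.setV, Ne.symm (hw r hr).1]
        have h1 := ih hc.2 (fun r hr => (hw r hr).2) _ g₁ hg₁
        rw [c.cost_congr P hc.2 hgk] at h1
        have h2 := ihj g₁ (fun r hr => by
          rw [c.den_v (hw r hr).2 _ g₁ hg₁, hgk r hr]) g' hg'
        simp only [HS.setV] at h1
        rw [Nat.succ_mul]
        omega
    have := key (h.v r) _ (fun r hr => by simp [HS.setV, Ne.symm (hw r hr).1]) h' hh
    simp only [Cmd.cost]
    simp only [HS.setV] at this
    omega
  | flip y =>
    intro h h' hh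
    simp only [Cmd.den, PMF.support_map] at hh
    obtain ⟨b, -, rfl⟩ := hh
    simp [Cmd.cost, HS.setV]
  | smp y =>
    intro h h' hh
    simp only [Cmd.den, PMF.support_map] at hh
    obtain ⟨b, -, rfl⟩ := hh
    simp [Cmd.cost, HS.setV, HS.setB]
  | _ =>
    intro h h' hh
    simp only [Cmd.den, PMF.support_pure, Set.mem_singleton_iff] at hh
    rw [hh]
    simp [Cmd.run, Cmd.cost, HS.setV, HS.setB, HS.setA]

/-- Every query costs `n + 1` time units. -/
theorem runs_queries {P : Prog} {σ : State} {μ : PMF State} (h : Runs f D P σ μ) :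
    ∀ τ ∈ μ.support, τ.queries * (n + 1) + σ.time ≤ σ.queries * (n + 1) + τ.time := by
  induction h with
  | op i σ =>
    intro τ hτ
    cases i <;> simp only [Instr.exec, PMF.support_pure, PMF.support_map, Set.mem_singleton_iff,
      Set.mem_image] at hτ
    case flip => obtain ⟨b, -, rfl⟩ := hτ; simp [State.upd]
    case sample => obtain ⟨b, -, rfl⟩ := hτ; simp [State.upd, Nat.succ_mul]; omega
    all_goals
      subst hτ
      simp [State.upd, Nat.succ_mul]
    all_goals omega
  | seq a b σ μ ν ha hb iha ihb =>
    intro τ hτ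
    obtain ⟨υ, hυ, hτ⟩ := (PMF.mem_support_bind_iff _ _ _).1 hτ
    have h1 := iha υ hυ
    have h2 := ihb υ hυ τ hτ
    omega
  | condTrue r a b σ μ hr h ih =>
    intro τ hτ
    have := ih τ hτ
    simp only [State.tick, State.upd, Nat.add_zero] at this
    omega
  | condFalse r a b σ μ hr h ih =>
    intro τ hτ
    have := ih τ hτ
    simp only [State.tick, State.upd, Nat.add_zero] at this
    omega
  | loopStop r a σ hr =>
    intro τ hτ
    rw [PMF.support_pure, Set.mem_singleton_iff] at hτ
    subst hτ
    simp [State.tick, State.upd]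
  | loopStep r a σ μ ν hr ha hl iha ihl =>
    intro τ hτ
    obtain ⟨υ, hυ, hτ⟩ := (PMF.mem_support_bind_iff _ _ _).1 hτ
    have h1 := iha υ hυ
    have h2 := ihl υ hυ τ hτ
    simp only [State.tick, State.upd, Nat.add_zero] at h1
    omega

end correctness

/-! ### Couplings -/

/-- `μ` and `ν` have a coupling supported on `R`. -/
def Sim {α β : Type} (μ : PMF α) (ν : PMF β) (R : α → β → Prop) : Prop :=
  ∃ κ : PMF (α × β), κ.map Prod.fst = μ ∧ κ.map Prod.snd = ν ∧ ∀ p ∈ κ.support, R p.1 p.2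

theorem Sim.pure {α β : Type} {R : α → β → Prop} {a : α} {b : β} (h : R a b) :
    Sim (PMF.pure a) (PMF.pure b) R := by
  refine ⟨PMF.pure (a, b), by simp [PMF.pure_map], by simp [PMF.pure_map], ?_⟩
  intro p hp
  rw [PMF.support_pure, Set.mem_singleton_iff] at hp
  rw [hp]; exact h

theorem Sim.map {α β γ : Type} (μ : PMF γ) (F : γ → α) (G : γ → β) {R : α → β → Prop}
    (h : ∀ c, R (F c) (G c)) : Sim (μ.map F) (μ.map G) R := by
  refine ⟨μ.map fun c => (F c, G c), by simp [PMF.map_comp, Function.comp_def],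
    by simp [PMF.map_comp, Function.comp_def], ?_⟩
  intro p hp
  rw [PMF.support_map] at hp
  obtain ⟨c, -, rfl⟩ := hp
  exact h c

theorem PMF_bind_congr {α β : Type} {μ : PMF α} {F G : α → PMF β}
    (h : ∀ a ∈ μ.support, F a = G a) : μ.bind F = μ.bind G := by
  ext x
  simp only [PMF.bind_apply]
  refine tsum_congr fun a => ?_
  by_cases ha : μ a = 0
  · simp [ha]
  · rw [h a ((PMF.mem_support_iff μ a).2 ha)]

theorem Sim.bind {α β γ δ : Type} {μ : PMF α} {ν : PMF β} {R : α → β → Prop}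
    (h : Sim μ ν R) {F : α → PMF γ} {G : β → PMF δ} {R' : γ → δ → Prop}
    (hFG : ∀ a b, R a b → Sim (F a) (G b) R') : Sim (μ.bind F) (ν.bind G) R' := by
  obtain ⟨κ, h1, h2, h3⟩ := h
  have key : ∀ p : α × β, ∃ κ' : PMF (γ × δ), p ∈ κ.support → κ'.map Prod.fst = F p.1 ∧
      κ'.map Prod.snd = G p.2 ∧ ∀ p ∈ κ'.support, R' p.1 p.2 := by
    intro p
    by_cases hp : p ∈ κ.support
    · obtain ⟨κ', hκ⟩ := hFG p.1 p.2 (h3 p hp)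
      exact ⟨κ', fun _ => hκ⟩
    · have : Nonempty (γ × δ) :=
        ⟨(((F p.1).support_nonempty).some, ((G p.2).support_nonempty).some)⟩
      exact ⟨PMF.pure this.some, fun h => absurd h hp⟩
  choose κ' hκ using key
  refine ⟨κ.bind κ', ?_, ?_, ?_⟩
  · rw [PMF.map_bind, ← h1, PMF.bind_map]
    exact PMF_bind_congr fun p hp => (hκ p hp).1
  · rw [PMF.map_bind, ← h2, PMF.bind_map]
    exact PMF_bind_congr fun p hp => (hκ p hp).2.1
  · intro p hp
    obtain ⟨p', hp', hp⟩ := (PMF.mem_support_bind_iff _ _ _).1 hp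
    exact (hκ p' hp').2.2 p hp

theorem Sim.mono {α β : Type} {μ : PMF α} {ν : PMF β} {R R' : α → β → Prop} (h : Sim μ ν R)
    (hR : ∀ a b, R a b → R' a b) : Sim μ ν R' := by
  obtain ⟨κ, h1, h2, h3⟩ := h
  exact ⟨κ, h1, h2, fun p hp => hR _ _ (h3 p hp)⟩

/-- Weaken a coupling using facts about the support of the first distribution. -/
theorem Sim.mono_support {α β : Type} {μ : PMF α} {ν : PMF β} {R R' : α → β → Prop} (h : Sim μ ν R)
    (hR : ∀ a ∈ μ.support, ∀ b, R a b → R' a b) : Sim μ ν R' := by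
  obtain ⟨κ, h1, h2, h3⟩ := h
  refine ⟨κ, h1, h2, fun p hp => hR _ ?_ _ (h3 p hp)⟩
  rw [← h1, PMF.support_map]
  exact ⟨p, hp, rfl⟩

theorem prob_map {α β : Type} (μ : PMF α) (F : α → β) (S : Set β) :
    prob (μ.map F) S = prob μ (F ⁻¹' S) := by
  simp [prob, PMF.toOuterMeasure_map_apply]

/-- This transfers acceptance probabilities from the program to the idealized tester: under the
coupling both probabilities are those of events that agree on its support. -/
theorem Sim.prob_eq {α β : Type} {μ : PMF α} {ν : PMF β} {R : α → β → Prop} (h : Sim μ ν R)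
    {S : Set α} {S' : Set β} (hS : ∀ a b, R a b → (a ∈ S ↔ b ∈ S')) : prob μ S = prob ν S' := by
  obtain ⟨κ, rfl, rfl, h3⟩ := h
  rw [prob_map, prob_map]
  unfold prob
  congr 1
  refine PMF.toOuterMeasure_apply_eq_of_inter_support_eq κ ?_
  ext p
  simp only [Set.mem_inter_iff, Set.mem_preimage]
  exact ⟨fun ⟨h, hp⟩ => ⟨(hS _ _ (h3 p hp)).1 h, hp⟩, fun ⟨h, hp⟩ => ⟨(hS _ _ (h3 p hp)).2 h, hp⟩⟩

/-! ### Probabilities -/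

section prob

variable {α β : Type}

theorem prob_nonneg (μ : PMF α) (S : Set α) : 0 ≤ prob μ S := ENNReal.toReal_nonneg

theorem toOuterMeasure_le_one (μ : PMF α) (S : Set α) : μ.toOuterMeasure S ≤ 1 := by
  rw [PMF.toOuterMeasure_apply, ← μ.tsum_coe]
  exact ENNReal.tsum_le_tsum fun a => Set.indicator_le_self _ _ _

theorem toOuterMeasure_ne_top (μ : PMF α) (S : Set α) : μ.toOuterMeasure S ≠ ⊤ :=
  ne_top_of_le_ne_top ENNReal.one_ne_top (toOuterMeasure_le_one μ S)

theorem prob_le_one (μ : PMF α) (S : Set α) : prob μ S ≤ 1 :=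
  ENNReal.toReal_le_of_le_ofReal zero_le_one (by simpa using toOuterMeasure_le_one μ S)

theorem prob_mono (μ : PMF α) {S T : Set α} (h : S ⊆ T) : prob μ S ≤ prob μ T :=
  ENNReal.toReal_mono (toOuterMeasure_ne_top μ T) (MeasureTheory.measure_mono h)

theorem prob_union_le (μ : PMF α) (S T : Set α) : prob μ (S ∪ T) ≤ prob μ S + prob μ T := by
  unfold prob
  rw [← ENNReal.toReal_add (toOuterMeasure_ne_top μ S) (toOuterMeasure_ne_top μ T)]
  exact ENNReal.toReal_mono (ENNReal.add_ne_top.2 ⟨toOuterMeasure_ne_top μ S,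
    toOuterMeasure_ne_top μ T⟩) (MeasureTheory.measure_union_le S T)

theorem prob_iUnion_le {ι : Type} (I : Finset ι) (μ : PMF α) (S : ι → Set α) :
    prob μ (⋃ i ∈ I, S i) ≤ ∑ i ∈ I, prob μ (S i) := by
  classical
  induction I using Finset.induction_on with
  | empty => simp [prob]
  | insert i I hi ih =>
    rw [Finset.set_biUnion_insert, Finset.sum_insert hi]
    exact (prob_union_le _ _ _).trans (by linarith)

theorem prob_add_compl (μ : PMF α) (S : Set α) : prob μ S + prob μ Sᶜ = 1 := by
  unfold prob
  rw [← ENNReal.toReal_add (toOuterMeasure_ne_top μ S) (toOuterMeasure_ne_top μ _),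
    PMF.toOuterMeasure_apply, PMF.toOuterMeasure_apply, ← ENNReal.tsum_add]
  have : ∀ a, S.indicator μ a + Sᶜ.indicator μ a = μ a := fun a => by
    by_cases h : a ∈ S <;> simp [h]
  simp [this, μ.tsum_coe]

theorem prob_univ (μ : PMF α) : prob μ Set.univ = 1 := by
  have := prob_add_compl μ Set.univ
  simpa [prob] using this

theorem prob_eq_zero (μ : PMF α) {S : Set α} (h : ∀ a ∈ μ.support, a ∉ S) : prob μ S = 0 := by
  unfold prob
  rw [(PMF.toOuterMeasure_apply_eq_zero_iff μ S).2 (Set.disjoint_left.2 h)]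
  rfl

theorem prob_pure (a : α) (S : Set α) [Decidable (a ∈ S)] :
    prob (PMF.pure a) S = if a ∈ S then 1 else 0 := by
  unfold prob
  rw [PMF.toOuterMeasure_pure_apply]
  split <;> simp

theorem toOuterMeasure_bind_ofReal (μ : PMF α) (ν : α → PMF β) (S : Set β) :
    (μ.bind ν).toOuterMeasure S = ∑' a, μ a * ENNReal.ofReal (prob (ν a) S) := by
  rw [PMF.toOuterMeasure_bind_apply]
  refine tsum_congr fun a => ?_
  rw [prob, ENNReal.ofReal_toReal (toOuterMeasure_ne_top _ _)]

/-- A bound on a mixture: probability `≤ c` off the set `B`. -/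
theorem prob_bind_le (μ : PMF α) (ν : α → PMF β) (S : Set β) (B : Set α) {c : ℝ} (hc : 0 ≤ c)
    (h : ∀ a ∉ B, prob (ν a) S ≤ c) : prob (μ.bind ν) S ≤ prob μ B + c := by
  have key : (μ.bind ν).toOuterMeasure S ≤ μ.toOuterMeasure B + ENNReal.ofReal c := by
    rw [toOuterMeasure_bind_ofReal, PMF.toOuterMeasure_apply]
    calc ∑' a, μ a * ENNReal.ofReal (prob (ν a) S)
        ≤ ∑' a, (B.indicator μ a + μ a * ENNReal.ofReal c) := by
          refine ENNReal.tsum_le_tsum fun a => ?_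
          by_cases ha : a ∈ B
          · simp only [Set.indicator_of_mem ha]
            calc μ a * ENNReal.ofReal (prob (ν a) S) ≤ μ a * 1 := by
                  gcongr
                  exact ENNReal.ofReal_le_one.2 (prob_le_one _ _)
              _ = μ a := mul_one _
              _ ≤ _ := le_self_add
          · simp only [Set.indicator_of_notMem ha, zero_add]
            gcongr
            exact h a ha
      _ = _ := by rw [ENNReal.tsum_add, ENNReal.tsum_mul_right, μ.tsum_coe, one_mul]
  have h2 := ENNReal.toReal_mono (ENNReal.add_ne_top.2 ⟨toOuterMeasure_ne_top _ _,
    ENNReal.ofReal_ne_top⟩) key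
  rwa [ENNReal.toReal_add (toOuterMeasure_ne_top _ _) ENNReal.ofReal_ne_top,
    ENNReal.toReal_ofReal hc] at h2

/-- Gains a factor `prob μ B` when the event is impossible off `B`. It supplies the factor `1/2` per
bit in the collision bound for the hash. -/
theorem prob_bind_le_mul (μ : PMF α) (ν : α → PMF β) (S : Set β) (B : Set α) {c : ℝ} (hc : 0 ≤ c)
    (h : ∀ a ∈ B, prob (ν a) S ≤ c) (h0 : ∀ a ∉ B, prob (ν a) S = 0) :
    prob (μ.bind ν) S ≤ prob μ B * c := by
  have key : (μ.bind ν).toOuterMeasure S ≤ μ.toOuterMeasure B * ENNReal.ofReal c := by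
    rw [toOuterMeasure_bind_ofReal, PMF.toOuterMeasure_apply, ← ENNReal.tsum_mul_right]
    refine ENNReal.tsum_le_tsum fun a => ?_
    by_cases ha : a ∈ B
    · simp only [Set.indicator_of_mem ha]
      gcongr
      exact h a ha
    · simp [h0 a ha]
  have h2 := ENNReal.toReal_mono (ENNReal.mul_ne_top (toOuterMeasure_ne_top _ _)
    ENNReal.ofReal_ne_top) key
  rwa [ENNReal.toReal_mul, ENNReal.toReal_ofReal hc] at h2

/-- The lower bound matching `prob_bind_le_mul`; it multiplies the mass of the bad examples by the
probability of correct readings. -/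
theorem le_prob_bind_mul (μ : PMF α) (ν : α → PMF β) (S : Set β) (B : Set α) {c : ℝ} (hc : 0 ≤ c)
    (h : ∀ a ∈ B, c ≤ prob (ν a) S) : prob μ B * c ≤ prob (μ.bind ν) S := by
  have key : μ.toOuterMeasure B * ENNReal.ofReal c ≤ (μ.bind ν).toOuterMeasure S := by
    rw [toOuterMeasure_bind_ofReal, PMF.toOuterMeasure_apply, ← ENNReal.tsum_mul_right]
    refine ENNReal.tsum_le_tsum fun a => ?_
    by_cases ha : a ∈ B
    · simp only [Set.indicator_of_mem ha]
      gcongr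
      exact h a ha
    · simp [ha]
  have h2 := ENNReal.toReal_mono (toOuterMeasure_ne_top _ _) key
  rwa [ENNReal.toReal_mul, ENNReal.toReal_ofReal hc] at h2

theorem prob_bind_le_of_forall (μ : PMF α) (ν : α → PMF β) (S : Set β) {c : ℝ} (hc : 0 ≤ c)
    (h : ∀ a, prob (ν a) S ≤ c) : prob (μ.bind ν) S ≤ c := by
  have := prob_bind_le μ ν S ∅ hc fun a _ => h a
  simpa [prob] using this

/-! ### Independent repetitions -/

/-- Draw `w (M-1), …, w 0` independently from `ρ`; the other values are those of `w`. -/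
def iid (ρ : PMF α) : ℕ → (ℕ → α) → PMF (ℕ → α)
  | 0, w => PMF.pure w
  | M + 1, w => ρ.bind fun a => iid ρ M (Function.update w M a)

theorem iid_support_ge (ρ : PMF α) (M : ℕ) : ∀ w, ∀ w' ∈ (iid ρ M w).support, ∀ j, M ≤ j →
    w' j = w j := by
  induction M with
  | zero =>
    intro w w' hw j _
    simp only [iid, PMF.support_pure, Set.mem_singleton_iff] at hw
    rw [hw]
  | succ M ih =>
    intro w w' hw j hj
    obtain ⟨a, -, hw⟩ := (PMF.mem_support_bind_iff _ _ _).1 hw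
    rw [ih _ w' hw j (by omega), Function.update_of_ne (by omega)]

theorem iid_support_lt (ρ : PMF α) (M : ℕ) : ∀ w, ∀ w' ∈ (iid ρ M w).support, ∀ j < M,
    w' j ∈ ρ.support := by
  induction M with
  | zero => intro w w' hw j hj; omega
  | succ M ih =>
    intro w w' hw j hj
    obtain ⟨a, ha, hw⟩ := (PMF.mem_support_bind_iff _ _ _).1 hw
    rcases Nat.lt_succ_iff_lt_or_eq.1 hj with h | h
    · exact ih _ w' hw j h
    · rw [iid_support_ge ρ M _ w' hw j (by omega), h, Function.update_self]; exact ha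

/-- The sets may depend on the index, so the same product formula serves for events on all draws, on
a single draw, and for a prescribed bit string. -/
theorem iid_outer (ρ : PMF α) (A : ℕ → Set α) (M : ℕ) : ∀ w,
    (iid ρ M w).toOuterMeasure {w' | ∀ t < M, w' t ∈ A t} =
      ∏ t ∈ Finset.range M, ρ.toOuterMeasure (A t) := by
  induction M with
  | zero => intro w; simp [iid]
  | succ M ih =>
    intro w
    rw [iid, PMF.toOuterMeasure_bind_apply, Finset.prod_range_succ, mul_comm,
      PMF.toOuterMeasure_apply, ← ENNReal.tsum_mul_right]
    refine tsum_congr fun a => ?_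
    by_cases ha : a ∈ A M
    · rw [Set.indicator_of_mem ha, ← ih (Function.update w M a)]
      congr 1
      refine PMF.toOuterMeasure_apply_eq_of_inter_support_eq _ ?_
      ext w'
      simp only [Set.mem_inter_iff, Set.mem_setOf_eq]
      refine ⟨fun ⟨h, hp⟩ => ⟨fun t ht => h t (by omega), hp⟩, fun ⟨h, hp⟩ => ⟨fun t ht => ?_, hp⟩⟩
      rcases Nat.lt_succ_iff_lt_or_eq.1 ht with h' | h'
      · exact h t h'
      · rw [h', iid_support_ge ρ M _ w' hp M le_rfl, Function.update_self]; exact ha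
    · rw [Set.indicator_of_notMem ha, zero_mul]
      refine mul_eq_zero_of_right _ ?_
      rw [PMF.toOuterMeasure_apply_eq_zero_iff, Set.disjoint_left]
      intro w' hw' h
      have := h M (by omega)
      rw [iid_support_ge ρ M _ w' hw' M le_rfl, Function.update_self] at this
      exact ha this

theorem prob_iid (ρ : PMF α) (A : Set α) (M : ℕ) (w : ℕ → α) :
    prob (iid ρ M w) {w' | ∀ t < M, w' t ∈ A} = prob ρ A ^ M := by
  unfold prob
  rw [iid_outer ρ (fun _ => A)]
  simp

/-- Two independent copies rarely agree. -/
theorem prob_iid_eq_le (ρ : PMF α) {c : ℝ} (hc : 0 ≤ c) (hρ : ∀ a, prob ρ {a} ≤ c) (M : ℕ) :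
    ∀ w, ∀ i j, i < j → j < M → prob (iid ρ M w) {w' | w' i = w' j} ≤ c := by
  induction M with
  | zero => intro w i j _ h; omega
  | succ M ih =>
    intro w i j hij hj
    refine prob_bind_le_of_forall _ _ _ hc fun a => ?_
    rcases Nat.lt_succ_iff_lt_or_eq.1 hj with h' | h'
    · exact ih _ i j hij h'
    · subst h'
      -- The later index is drawn first, with value `a`; the draw at `i` must then hit the fixed
      -- value `a`, all others being free.
      have key : prob (iid ρ j (Function.update w j a)) {w' | ∀ t < j, w' t ∈ if t = i then {a} else Set.univ} ≤ c := by
        unfold prob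
        rw [iid_outer ρ (fun t => if t = i then {a} else Set.univ),
          Finset.prod_eq_single_of_mem i (Finset.mem_range.2 hij)]
        · simpa [prob] using hρ a
        · intro t _ ht
          have := (ρ.toOuterMeasure_apply_eq_one_iff Set.univ).2 (Set.subset_univ _)
          simpa [ht] using this
      refine le_trans ?_ key
      unfold prob
      refine ENNReal.toReal_mono (toOuterMeasure_ne_top _ _) (PMF.toOuterMeasure_mono _ ?_)
      rintro w' ⟨hw1, hw2⟩ t ht
      by_cases hti : t = i
      · subst hti
        have : w' j = a := by rw [iid_support_ge ρ j _ w' hw2 j le_rfl, Function.update_self]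
        simpa [← this] using hw1
      · simp [hti]

/-! ### Uniform points -/

/-- A fair coin. -/
def coin : PMF Bool := PMF.uniformOfFintype Bool

/-- A uniform point, drawn bit by bit. -/
def drawPoint (n : ℕ) : PMF (Fin n → Bool) := (iid coin n fun _ => false).map fun w i => w i

/-- Each point prescribes `n` independent fair bits, hence has mass `2⁻ⁿ`. The machine draws bits,
whereas the counting arguments use the uniform distribution. -/
theorem drawPoint_eq (n : ℕ) : drawPoint n = PMF.uniformOfFintype (Fin n → Bool) := by
  ext p
  have h1 : drawPoint n p = (drawPoint n).toOuterMeasure {p} := by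
    rw [PMF.toOuterMeasure_apply_singleton]
  rw [h1, drawPoint, PMF.toOuterMeasure_map_apply]
  have h2 : (fun (w : ℕ → Bool) (i : Fin n) => w i) ⁻¹' {p} =
      {w | ∀ t < n, w t ∈ if h : t < n then {p ⟨t, h⟩} else Set.univ} := by
    ext w
    simp only [Set.mem_preimage, Set.mem_singleton_iff, Set.mem_setOf_eq, funext_iff]
    refine ⟨fun h t ht => by simpa [ht] using h ⟨t, ht⟩, fun h i => by simpa using h i i.2⟩
  rw [h2, iid_outer coin (fun t => if h : t < n then {p ⟨t, h⟩} else Set.univ),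
    Finset.prod_congr rfl (g := fun _ => (2 : ENNReal)⁻¹)]
  · simp [PMF.uniformOfFintype_apply, ENNReal.inv_pow]
  · intro t ht
    rw [Finset.mem_range] at ht
    simp only [ht, dif_pos, PMF.toOuterMeasure_apply_singleton]
    simp [coin, PMF.uniformOfFintype_apply]

end prob

/-! ### Testing dictators -/

section dictator

variable {n : ℕ}

/-- Pointwise sum of points. -/
def xorP (p q : Fin n → Bool) : Fin n → Bool := fun i => (p i ^^ q i)

/-- Pointwise product of points. -/
def andP (p q : Fin n → Bool) : Fin n → Bool := fun i => (p i && q i)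

/-- The difference of `g` at `y` in direction `p`. -/
def diff (g : BoolFun n) (y p : Fin n → Bool) : Bool := (g y ^^ g (xorP y p))

/-- The test that differences of `g` are additive and multiplicative. -/
def TestOK (g : BoolFun n) (y u v : Fin n → Bool) : Prop :=
  (diff g y u ^^ diff g y v) = diff g y (xorP u v) ∧
    diff g y (andP u v) = (diff g y u && diff g y v)

/-- A coordinate or the constant zero. -/
def coordOr (o : Option (Fin n)) (x : Fin n → Bool) : Bool := o.elim false x

theorem xorP_xorP_self (x d : Fin n → Bool) : xorP (xorP x d) d = x := by
  funext i; simp only [xorP]; cases x i <;> cases d i <;> rfl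

theorem xorP_comm (x y : Fin n → Bool) : xorP x y = xorP y x := by
  funext i; simp only [xorP]; cases x i <;> cases y i <;> rfl

theorem xorP_assoc (x y z : Fin n → Bool) : xorP (xorP x y) z = xorP x (xorP y z) := by
  funext i; simp only [xorP]; cases x i <;> cases y i <;> cases z i <;> rfl

/-- Translation. -/
def xorEquiv (d : Fin n → Bool) : (Fin n → Bool) ≃ (Fin n → Bool) where
  toFun x := xorP x d
  invFun x := xorP x d
  left_inv x := xorP_xorP_self x d
  right_inv x := xorP_xorP_self x d

-- Translation by `d` exchanges the two level sets of `h`.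
open Finset in
theorem card_additive {h : BoolFun n} (hadd : ∀ x y, h (xorP x y) = (h x ^^ h y))
    {d : Fin n → Bool} (hd : h d = true) :
    2 * #{x | h x = true} = Fintype.card (Fin n → Bool) := by
  have h1 : #{x | h x = true} = #{x | ¬ h x = true} := by
    refine Finset.card_equiv (xorEquiv d) fun x => ?_
    simp [xorEquiv, hadd, hd]
  have h2 := Finset.card_filter_add_card_filter_not (s := (univ : Finset (Fin n → Bool)))
    (fun x => h x = true)
  rw [Finset.card_univ] at h2
  omega

/-- If `G` is 1 at a unit vector `e_i`, then `G x = G x · G e_i = G (x · e_i)`, which is `x i`. If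
`G` vanishes at all unit vectors, additivity makes it zero. -/
theorem exists_coord {G : BoolFun n} (hadd : ∀ x y, G (xorP x y) = (G x ^^ G y))
    (hmul : ∀ x y, G (andP x y) = (G x && G y)) : ∃ o : Option (Fin n), ∀ x, G x = coordOr o x := by
  classical
  have h0 : G (fun _ => false) = false := by
    have := hadd (fun _ => false) (fun _ => false)
    rw [show xorP (fun _ : Fin n => false) (fun _ => false) = fun _ => false from rfl] at this
    rw [this]; simp
  by_cases h : ∃ i, G (fun j => decide (j = i)) = true
  · obtain ⟨i, hi⟩ := h
    refine ⟨some i, fun x => ?_⟩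
    have h1 := hmul x fun j => decide (j = i)
    rw [hi, Bool.and_true] at h1
    rw [← h1]
    by_cases hx : x i = true
    · rw [show andP x (fun j => decide (j = i)) = fun j => decide (j = i) from ?_, hi]
      · exact hx.symm
      · funext j
        by_cases hj : j = i
        · subst hj; simp [andP, hx]
        · simp [andP, hj]
    · rw [show andP x (fun j => decide (j = i)) = fun j => false from ?_, h0]
      · simpa [coordOr] using hx
      · funext j
        by_cases hj : j = i
        · subst hj; simp [andP, hx]
        · simp [andP, hj]
  · push Not at h
    refine ⟨none, fun x => ?_⟩
    have key : ∀ s : Finset (Fin n), G (fun j => decide (j ∈ s)) = false := by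
      intro s
      induction s using Finset.induction_on with
      | empty => simpa using h0
      | insert i s hi ih =>
        rw [show (fun j => decide (j ∈ insert i s)) =
          xorP (fun j => decide (j = i)) (fun j => decide (j ∈ s)) from ?_, hadd, ih]
        · simpa using h i
        · funext j
          by_cases hj : j = i
          · subst hj; simp [xorP, hi]
          · simp [xorP, hj]
    have := key (Finset.univ.filter fun j => x j = true)
    simpa [coordOr] using this

open Finset in
/-- If the test fails with small probability then all differences are given by one coordinate
(or vanish), up to a small error for each direction. -/
theorem exists_coord_of_test (g : BoolFun n) (θ : ℝ) (hθ : θ ≤ 1 / 32) [DecidablePred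
      fun t : (Fin n → Bool) × (Fin n → Bool) × (Fin n → Bool) => ¬ TestOK g t.1 t.2.1 t.2.2]
    (hfail : (#{t : (Fin n → Bool) × (Fin n → Bool) × (Fin n → Bool) |
        ¬ TestOK g t.1 t.2.1 t.2.2} : ℝ) ≤ θ * (Fintype.card (Fin n → Bool) : ℝ) ^ 3) :
    ∃ o : Option (Fin n), ∀ x : Fin n → Bool,
      (#{y | diff g y x ≠ coordOr o x} : ℝ) ≤ 2 * θ * Fintype.card (Fin n → Bool) := by
  classical
  set N : ℝ := (Fintype.card (Fin n → Bool) : ℝ) with hN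
  have hNpos : 0 < N := by rw [hN]; exact_mod_cast Fintype.card_pos
  set F : ℕ := #{t : (Fin n → Bool) × (Fin n → Bool) × (Fin n → Bool) |
        ¬ TestOK g t.1 t.2.1 t.2.2} with hF
  -- agreement of differences at different base points
  have step1 : ∀ x : Fin n → Bool,
      (#{t : (Fin n → Bool) × (Fin n → Bool) | diff g t.1 x ≠ diff g t.2 x} : ℝ) * N ≤ 2 * F := by
    intro x
    -- The directions are replaced by others depending injectively on the triple, so the failing
    -- triples are still at most `F` in number.
    have e1 : #{t : (Fin n → Bool) × (Fin n → Bool) × (Fin n → Bool) |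
        ¬ TestOK g t.1 (xorP t.1 t.2.1) t.2.2} ≤ F := by
      refine Finset.card_le_card_of_injOn (fun t => (t.1, xorP t.1 t.2.1, t.2.2)) ?_ ?_
      · intro t ht; simpa using ht
      · rintro ⟨a, b, c⟩ _ ⟨a', b', c'⟩ _ h
        simp only [Prod.mk.injEq] at h
        obtain ⟨rfl, h, rfl⟩ := h
        have := congrArg (xorP a) h
        rw [← xorP_assoc, ← xorP_assoc, xorP_comm (xorP a a), xorP_comm (xorP a a), ← xorP_assoc,
          ← xorP_assoc, xorP_xorP_self, xorP_xorP_self] at this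
        rw [this]
    have e2 : #{t : (Fin n → Bool) × (Fin n → Bool) × (Fin n → Bool) |
        ¬ TestOK g (xorP t.1 x) (xorP t.1 t.2.1) (xorP t.2.2 x)} ≤ F := by
      refine Finset.card_le_card_of_injOn
        (fun t => (xorP t.1 x, xorP t.1 t.2.1, xorP t.2.2 x)) ?_ ?_
      · intro t ht; simpa using ht
      · rintro ⟨a, b, c⟩ _ ⟨a', b', c'⟩ _ h
        simp only [Prod.mk.injEq] at h
        obtain ⟨h1, h, h3⟩ := h
        obtain rfl := (xorEquiv x).injective h1
        obtain rfl := (xorEquiv x).injective h3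
        have := congrArg (xorP a) h
        rw [← xorP_assoc, ← xorP_assoc, xorP_comm (xorP a a), xorP_comm (xorP a a), ← xorP_assoc,
          ← xorP_assoc, xorP_xorP_self, xorP_xorP_self] at this
        rw [this]
    -- Additivity at base `y` with directions `y + z, v`, and at base `y + x` with directions `y +
    -- z, v + x`: in the sum of the two identities `g (y + v)` and `g (z + v)` cancel, leaving
    -- equality of the differences at `y` and `z` in direction `x`. The auxiliary `v` is free, which
    -- gives the factor `N`.
    have e3 : #{t : (Fin n → Bool) × (Fin n → Bool) | diff g t.1 x ≠ diff g t.2 x} *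
        Fintype.card (Fin n → Bool) ≤
        #{t : (Fin n → Bool) × (Fin n → Bool) × (Fin n → Bool) |
          ¬ TestOK g t.1 (xorP t.1 t.2.1) t.2.2} +
        #{t : (Fin n → Bool) × (Fin n → Bool) × (Fin n → Bool) |
          ¬ TestOK g (xorP t.1 x) (xorP t.1 t.2.1) (xorP t.2.2 x)} := by
      rw [← Finset.card_univ, ← Finset.card_product]
      refine le_trans ?_ (Finset.card_union_le _ _)
      refine Finset.card_le_card_of_injOn (fun t => (t.1.1, t.1.2, t.2)) ?_ ?_
      · rintro ⟨⟨y, z⟩, v⟩ ht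
        simp only [coe_product, coe_univ, Set.mem_prod, Set.mem_univ, and_true, coe_filter,
          mem_univ, true_and, Set.mem_setOf_eq] at ht
        simp only [coe_union, coe_filter, mem_univ, true_and, Set.mem_union, Set.mem_setOf_eq]
        by_contra hcon
        push Not at hcon
        obtain ⟨⟨h1, -⟩, ⟨h2, -⟩⟩ := hcon
        apply ht
        simp only [diff] at h1 h2 ⊢
        have a1 : xorP y (xorP y z) = z := by
          funext i; simp only [xorP]; cases y i <;> cases z i <;> rfl
        have a2 : xorP y (xorP (xorP y z) v) = xorP z v := by
          funext i; simp only [xorP]; cases y i <;> cases z i <;> cases v i <;> rfl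
        have a3 : xorP (xorP y x) (xorP y z) = xorP z x := by
          funext i; simp only [xorP]; cases y i <;> cases z i <;> cases x i <;> rfl
        have a4 : xorP (xorP y x) (xorP v x) = xorP y v := by
          funext i; simp only [xorP]; cases y i <;> cases v i <;> cases x i <;> rfl
        have a5 : xorP (xorP y x) (xorP (xorP y z) (xorP v x)) = xorP z v := by
          funext i; simp only [xorP]
          cases y i <;> cases v i <;> cases x i <;> cases z i <;> rfl
        rw [a1, a2] at h1
        rw [a3, a4, a5] at h2
        revert h1 h2
        cases g y <;> cases g z <;> cases g (xorP y x) <;> cases g (xorP z x) <;>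
          cases g (xorP y v) <;> cases g (xorP z v) <;> simp
      · rintro ⟨⟨a, b⟩, c⟩ _ ⟨⟨a', b'⟩, c'⟩ _ h
        simpa [and_assoc] using h
    have e4 := e3.trans (Nat.add_le_add e1 e2)
    rw [hN]
    have : ((#{t : (Fin n → Bool) × (Fin n → Bool) | diff g t.1 x ≠ diff g t.2 x} *
        Fintype.card (Fin n → Bool) : ℕ) : ℝ) ≤ ((F + F : ℕ) : ℝ) := by exact_mod_cast e4
    push_cast at this
    linarith
  -- the majority value
  have step2 : ∀ x : Fin n → Bool, ∃ b : Bool, (#{y | diff g y x ≠ b} : ℝ) ≤ 2 * θ * N := by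
    intro x
    set a := #{y | diff g y x = true} with ha
    set b := #{y | ¬ diff g y x = true} with hb
    have hab : (a : ℝ) + b = N := by
      rw [hN, ← Finset.card_univ]
      exact_mod_cast Finset.card_filter_add_card_filter_not (s := univ) (fun y => diff g y x = true)
    have hdis : (a * b : ℝ) + a * b ≤
        #{t : (Fin n → Bool) × (Fin n → Bool) | diff g t.1 x ≠ diff g t.2 x} := by
      have : a * b + b * a ≤
          #{t : (Fin n → Bool) × (Fin n → Bool) | diff g t.1 x ≠ diff g t.2 x} := by
        rw [ha, hb, ← Finset.card_product, ← Finset.card_product, ← Finset.card_union_of_disjoint]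
        · refine Finset.card_le_card ?_
          rintro ⟨y, z⟩ h
          simp only [mem_union, mem_product, mem_filter, mem_univ, true_and] at h ⊢
          rcases h with ⟨h1, h2⟩ | ⟨h1, h2⟩
          · rw [h1]; exact fun h => h2 h.symm
          · rw [h2]; exact h1
        · rw [Finset.disjoint_left]
          rintro ⟨y, z⟩ h h'
          simp only [mem_product, mem_filter, mem_univ, true_and] at h h'
          exact h'.1 h.1
      have := (Nat.cast_le (α := ℝ)).2 this
      push_cast at this
      linarith
    -- The ordered disagreeing pairs number `2ab`. The larger class has at least `N/2` elements, so
    -- this bounds the smaller one by `2θN`.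
    have hprod : (a : ℝ) * b ≤ θ * N ^ 2 := by
      have h1 := step1 x
      have h2 : ((a * b : ℝ) + a * b) * N ≤ 2 * (θ * N ^ 3) := by
        calc ((a * b : ℝ) + a * b) * N ≤ _ := mul_le_mul_of_nonneg_right hdis hNpos.le
          _ ≤ 2 * F := h1
          _ ≤ _ := by linarith
      have h3 : ((a : ℝ) * b) * N ≤ (θ * N ^ 2) * N := by nlinarith
      exact le_of_mul_le_mul_right h3 hNpos
    have ha0 : (0 : ℝ) ≤ a := Nat.cast_nonneg _
    have hb0 : (0 : ℝ) ≤ b := Nat.cast_nonneg _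
    rcases le_total (a : ℝ) b with hle | hle
    · refine ⟨false, ?_⟩
      have : #{y | diff g y x ≠ false} = a := by rw [ha]; congr 1; ext y; simp
      rw [this]
      have : (a : ℝ) * (N / 2) ≤ (2 * θ * N) * (N / 2) := by nlinarith
      exact le_of_mul_le_mul_right this (by positivity)
    · refine ⟨true, ?_⟩
      have : #{y | diff g y x ≠ true} = b := rfl
      rw [this]
      have : (b : ℝ) * (N / 2) ≤ (2 * θ * N) * (N / 2) := by nlinarith
      exact le_of_mul_le_mul_right this (by positivity)
  choose G hG using step2
  have hshift : ∀ x d : Fin n → Bool, (#{y | diff g (xorP y d) x ≠ G x} : ℝ) ≤ 2 * θ * N := by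
    intro x d
    refine le_trans ?_ (hG x)
    refine Nat.cast_le.2 (Finset.card_le_card_of_injOn (xorEquiv d) ?_ ((xorEquiv d).injective.injOn))
    intro y hy
    simpa [xorEquiv] using hy
  -- Differences telescope: `x` from `y`, then `x'` from `y + x`. Each of three exceptional sets of
  -- `y` has density at most `2θ`, and `6θ < 1`, so some `y` avoids all of them.
  have hadd : ∀ x y, G (xorP x y) = (G x ^^ G y) := by
    intro x x'
    by_contra hne
    have hcov : (univ : Finset (Fin n → Bool)) ⊆ ({y | diff g y x ≠ G x} : Finset _) ∪
        (({y | diff g (xorP y x) x' ≠ G x'} : Finset _) ∪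
          ({y | diff g y (xorP x x') ≠ G (xorP x x')} : Finset _)) := by
      intro y _
      simp only [mem_union, mem_filter, mem_univ, true_and]
      by_contra hcon
      push Not at hcon
      obtain ⟨h1, h2, h3⟩ := hcon
      apply hne
      rw [← h1, ← h2, ← h3]
      simp only [diff, xorP_assoc]
      cases g y <;> cases g (xorP y x) <;> cases g (xorP y (xorP x x')) <;> rfl
    have h1 := (Finset.card_le_card hcov).trans ((Finset.card_union_le _ _).trans
      (Nat.add_le_add_left (Finset.card_union_le _ _) _))
    rw [Finset.card_univ] at h1
    have h2 := (Nat.cast_le (α := ℝ)).2 h1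
    push_cast at h2
    have := hG x
    have := hshift x' x
    have := hG (xorP x x')
    nlinarith
  -- Density `7θ`: one `θ` for the failing tests and `2θ` for each of the directions `u`, `v`, `uv`
  -- where the difference may differ from `G`.
  have hbad : (#{t : (Fin n → Bool) × (Fin n → Bool) | G (andP t.1 t.2) ≠ (G t.1 && G t.2)} : ℝ) ≤
      7 * θ * N ^ 2 := by
    set Bd := #{t : (Fin n → Bool) × (Fin n → Bool) | G (andP t.1 t.2) ≠ (G t.1 && G t.2)} with hBd
    set E : (Fin n → Bool) → ℕ := fun x => #{y | diff g y x ≠ G x} with hE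
    have hproj : ∀ φ : (Fin n → Bool) × (Fin n → Bool) → (Fin n → Bool),
        (#{t : (Fin n → Bool) × (Fin n → Bool) × (Fin n → Bool) |
          diff g t.1 (φ t.2) ≠ G (φ t.2)} : ℝ) ≤ 2 * θ * N ^ 3 := by
      intro φ
      have h1 : #{t : (Fin n → Bool) × (Fin n → Bool) × (Fin n → Bool) |
          diff g t.1 (φ t.2) ≠ G (φ t.2)} = ∑ p : (Fin n → Bool) × (Fin n → Bool), E (φ p) := by
        rw [Finset.card_filter, Fintype.sum_prod_type_right]
        refine Finset.sum_congr rfl fun p _ => ?_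
        rw [hE]
        simp only [Finset.card_filter]
      rw [h1]
      push_cast
      calc ∑ p : (Fin n → Bool) × (Fin n → Bool), (E (φ p) : ℝ)
          ≤ ∑ p : (Fin n → Bool) × (Fin n → Bool), 2 * θ * N :=
            Finset.sum_le_sum fun p _ => hG (φ p)
        _ = 2 * θ * N ^ 3 := by
            rw [Finset.sum_const, Finset.card_univ, Fintype.card_prod, nsmul_eq_mul]
            push_cast
            rw [← hN]; ring
    have hcov : (Fintype.card (Fin n → Bool)) * Bd ≤ F +
        (#{t : (Fin n → Bool) × (Fin n → Bool) × (Fin n → Bool) | diff g t.1 t.2.1 ≠ G t.2.1} +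
        (#{t : (Fin n → Bool) × (Fin n → Bool) × (Fin n → Bool) | diff g t.1 t.2.2 ≠ G t.2.2} +
        #{t : (Fin n → Bool) × (Fin n → Bool) × (Fin n → Bool) |
          diff g t.1 (andP t.2.1 t.2.2) ≠ G (andP t.2.1 t.2.2)})) := by
      rw [← Finset.card_univ, hBd, ← Finset.card_product, hF]
      refine le_trans ?_ ((Finset.card_union_le _ _).trans (Nat.add_le_add_left
        ((Finset.card_union_le _ _).trans (Nat.add_le_add_left (Finset.card_union_le _ _) _)) _))
      refine Finset.card_le_card ?_
      rintro ⟨y, u, v⟩ h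
      simp only [mem_product, mem_filter, mem_univ, true_and, mem_union] at h ⊢
      by_contra hcon
      push Not at hcon
      obtain ⟨⟨-, h1⟩, h2, h3, h4⟩ := hcon
      apply h
      rw [← h2, ← h3, ← h4, h1]
    have h2 := (Nat.cast_le (α := ℝ)).2 hcov
    push_cast at h2
    have h3 := hproj fun p => p.1
    have h4 := hproj fun p => p.2
    have h5 := hproj fun p => andP p.1 p.2
    have h6 : (Bd : ℝ) * N ≤ (7 * θ * N ^ 2) * N := by
      rw [← hN] at h2
      nlinarith
    exact le_of_mul_le_mul_right h6 hNpos
  -- The defect `φ` is bilinear over `F₂`. If it is nonzero somewhere, half of all `u` give a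
  -- nonzero functional, and each of these is 1 on half of all `v`. The resulting density `1/4`
  -- exceeds `7θ ≤ 7/32`, which is where the bound on `θ` is needed.
  have hmul : ∀ x y, G (andP x y) = (G x && G y) := by
    by_contra hne
    push Not at hne
    obtain ⟨u₀, v₀, h0⟩ := hne
    set φ : (Fin n → Bool) → (Fin n → Bool) → Bool := fun u v => (G (andP u v) ^^ (G u && G v)) with hφ
    have hφv : ∀ u v v', φ u (xorP v v') = (φ u v ^^ φ u v') := by
      intro u v v'
      simp only [hφ]
      rw [show andP u (xorP v v') = xorP (andP u v) (andP u v') from ?_, hadd, hadd]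
      · cases G u <;> cases G v <;> cases G v' <;> cases G (andP u v) <;> cases G (andP u v') <;> rfl
      · funext i; simp only [xorP, andP]; cases u i <;> cases v i <;> cases v' i <;> rfl
    have hφu : ∀ v u u', φ (xorP u u') v = (φ u v ^^ φ u' v) := by
      intro v u u'
      simp only [hφ]
      rw [show andP (xorP u u') v = xorP (andP u v) (andP u' v) from ?_, hadd, hadd]
      · cases G u <;> cases G v <;> cases G u' <;> cases G (andP u v) <;> cases G (andP u' v) <;> rfl
      · funext i; simp only [xorP, andP]; cases u i <;> cases v i <;> cases u' i <;> rfl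
    have h00 : φ u₀ v₀ = true := by
      simp only [hφ]; revert h0
      cases G (andP u₀ v₀) <;> cases G u₀ <;> cases G v₀ <;> simp
    have hc1 := card_additive (h := fun u => φ u v₀) (hφu v₀) h00
    have hc2 : #{u | φ u v₀ = true} * Fintype.card (Fin n → Bool) ≤
        2 * #{t : (Fin n → Bool) × (Fin n → Bool) | G (andP t.1 t.2) ≠ (G t.1 && G t.2)} := by
      have e1 : #{t : (Fin n → Bool) × (Fin n → Bool) | G (andP t.1 t.2) ≠ (G t.1 && G t.2)} =
          ∑ u, #{v | φ u v = true} := by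
        rw [Finset.card_filter, Fintype.sum_prod_type]
        refine Finset.sum_congr rfl fun u _ => ?_
        rw [Finset.card_filter]
        refine Finset.sum_congr rfl fun v _ => ?_
        simp only [hφ]
        cases G (andP u v) <;> cases G u <;> cases G v <;> rfl
      rw [e1, Finset.mul_sum, ← smul_eq_mul, ← Finset.sum_const]
      refine le_trans ?_ (Finset.sum_le_sum_of_subset (Finset.subset_univ {u | φ u v₀ = true}))
      refine Finset.sum_le_sum fun u hu => ?_
      simp only [mem_filter, mem_univ, true_and] at hu
      rw [card_additive (h := fun v => φ u v) (hφv u) hu]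
    have hc1' := (Nat.cast_inj (R := ℝ)).2 hc1
    have hc2' := (Nat.cast_le (α := ℝ)).2 hc2
    push_cast at hc1' hc2'
    rw [← hN] at hc1' hc2'
    nlinarith
  obtain ⟨o, ho⟩ := exists_coord hadd hmul
  refine ⟨o, fun x => ?_⟩
  simp only [← ho]
  exact hG x

end dictator

/-! ### Consistency with trees of small rank -/

/-- A table of labelled examples together with an enumeration of literals. -/
structure Tab : Type where
  /-- number of examples -/
  q : ℕ
  /-- number of literals -/
  W : ℕ
  /-- bit `v` of example `t` -/
  tb : ℕ → ℕ → Bool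
  /-- labels -/
  lb : ℕ → Bool
  /-- variables of literals -/
  lv : ℕ → ℕ
  /-- signs of literals -/
  lp : ℕ → Bool

namespace Tab

variable (E : Tab)

/-- Example `t` satisfies literal `i`. -/
def lit (i t : ℕ) : Bool := E.tb t (E.lv i) == E.lp i

/-- All examples in `S` have the same label. -/
def pureB (S : ℕ → Bool) : Bool :=
  !(decide (∃ t < E.q, S t = true ∧ E.lb t = true) &&
    decide (∃ t < E.q, S t = true ∧ E.lb t = false))

/-- Repeatedly remove the examples satisfying a literal under which `Rl` succeeds. -/
def elim (Rl : (ℕ → Bool) → Bool) (S : ℕ → Bool) : ℕ → ℕ → Bool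
  | 0 => S
  | i + 1 => if Rl (fun t => elim Rl S i t && E.lit i t) then
      fun t => elim Rl S i t && !E.lit i t else elim Rl S i

/-- The recursive consistency search. -/
def R : ℕ → (ℕ → Bool) → Bool
  | 0, S => E.pureB S
  | l + 1, S => E.pureB (E.elim (R l) S E.W)

/-- A tree is consistent with the examples in `S`. -/
def Cons {s : ℕ} (S : ℕ → Bool) (T : DTree s) : Prop :=
  ∀ t < E.q, S t = true → T.eval (fun v => E.tb t v) = E.lb t

theorem Cons.mono {E : Tab} {s : ℕ} {S S' : ℕ → Bool} {T : DTree s} (h : E.Cons S T)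
    (hS : ∀ t, S' t = true → S t = true) : E.Cons S' T := fun t ht hS' => h t ht (hS t hS')

theorem pureB_of_leaf {s : ℕ} {S : ℕ → Bool} {b : Bool} (h : E.Cons S (DTree.leaf b : DTree s)) :
    E.pureB S = true := by
  simp only [pureB, Bool.not_eq_true', Bool.and_eq_false_iff, decide_eq_false_iff_not]
  by_contra hcon
  push Not at hcon
  obtain ⟨⟨t, ht, hS, hl⟩, t', ht', hS', hl'⟩ := hcon
  have h1 := h t ht hS
  have h2 := h t' ht' hS'
  rw [hl] at h1
  rw [hl'] at h2
  simp only [DTree.eval] at h1 h2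
  rw [h1] at h2
  exact absurd h2 (by simp)

theorem elim_mono (Rl : (ℕ → Bool) → Bool) (S : ℕ → Bool) {i j : ℕ} (hij : i ≤ j) :
    ∀ t, E.elim Rl S j t = true → E.elim Rl S i t = true := by
  induction j, hij using Nat.le_induction with
  | base => exact fun t h => h
  | succ j hij ih =>
    intro t h
    apply ih
    simp only [elim] at h
    split at h
    · simp only [Bool.and_eq_true] at h; exact h.1
    · exact h

theorem size_pos {s : ℕ} (T : DTree s) : 1 ≤ T.size := by
  induction T with
  | leaf b => simp [DTree.size]
  | node i l r ihl ihr => simp only [DTree.size]; omega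

/-- The literals come in `P` passes of length `w`, each containing every literal. During a pass the
literal that leads from the root of the current tree to its smaller subtree is met. The search one
level down succeeds on the examples satisfying it, so they are removed and the rest is consistent
with the other subtree alone. After `P ≥ T.size` passes only a leaf can remain. -/
theorem R_of_cons {s P w : ℕ} (hW : E.W = P * w)
    (hlit : ∀ a < P, ∀ v < s, ∀ b, ∃ i, a * w ≤ i ∧ i < (a + 1) * w ∧ E.lv i = v ∧ E.lp i = b)
    (l : ℕ) : ∀ (S : ℕ → Bool) (T : DTree s), T.size < 2 ^ (l + 1) → T.size ≤ P → E.Cons S T →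
      E.R l S = true := by
  induction l with
  | zero =>
    intro S T h1 _ h3
    cases T with
    | leaf b => exact E.pureB_of_leaf h3
    | node i l r =>
      have := size_pos l
      have := size_pos r
      simp only [DTree.size] at h1
      omega
  | succ l ih =>
    intro S T h1 h2 h3
    have key : ∀ a ≤ P, ∃ T' : DTree s, E.Cons (E.elim (E.R l) S (a * w)) T' ∧
        T'.size ≤ T.size ∧ (T'.size = 1 ∨ T'.size + a ≤ T.size) := by
      intro a
      induction a with
      | zero => intro _; exact ⟨T, by simpa [elim] using h3, le_rfl, Or.inr le_rfl⟩
      | succ a iha =>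
        intro ha
        obtain ⟨T', c1, c2, c3⟩ := iha (by omega)
        have hmono := E.elim_mono (E.R l) S (Nat.mul_le_mul_right w (Nat.le_succ a))
        cases T' with
        | leaf b =>
          exact ⟨_, c1.mono hmono, c2, Or.inl rfl⟩
        | node v A B =>
          have hA := size_pos A
          have hB := size_pos B
          simp only [DTree.size] at c2 c3
          have c4 : A.size + B.size + a ≤ T.size := by omega
          -- The sizes add up to less than `2 ^ (l + 2)`, so one subtree is small enough for level
          -- `l`.
          have hsmall : A.size < 2 ^ (l + 1) ∨ B.size < 2 ^ (l + 1) := by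
            rw [pow_succ] at h1
            omega
          -- the literal leading to the small subtree is eliminated
          have main : ∀ b : Bool, ∀ C C' : DTree s, C.size < 2 ^ (l + 1) → C.size ≤ P →
              (∀ x : Fin s → Bool, x v = b → (DTree.node v A B).eval x = C.eval x) →
              (∀ x : Fin s → Bool, x v ≠ b → (DTree.node v A B).eval x = C'.eval x) →
              E.Cons (E.elim (E.R l) S ((a + 1) * w)) C' := by
            intro b C C' hC hCP h4 h5
            obtain ⟨i, i1, i2, i3, i4⟩ := hlit a (by omega) v v.2 b
            have hci := c1.mono (E.elim_mono (E.R l) S i1)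
            have hR : E.R l (fun t => E.elim (E.R l) S i t && E.lit i t) = true := by
              refine ih _ C hC hCP fun t ht hS => ?_
              simp only [Bool.and_eq_true, lit, beq_iff_eq, i3, i4] at hS
              rw [← hci t ht hS.1, h4 _ hS.2]
            have h6 : E.Cons (E.elim (E.R l) S (i + 1)) C' := by
              intro t ht hS
              rw [elim, if_pos hR] at hS
              simp only [Bool.and_eq_true, lit, Bool.not_eq_true', beq_eq_false_iff_ne,
                i3, i4] at hS
              rw [← hci t ht hS.1, h5 _ hS.2]
            exact h6.mono (E.elim_mono (E.R l) S (by omega))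
          rcases hsmall with h | h
          · refine ⟨B, main false A B h (by omega) ?_ ?_, by omega, Or.inr (by omega)⟩
            · intro x hx; simp [DTree.eval, hx]
            · intro x hx; simp [DTree.eval, hx]
          · refine ⟨A, main true B A h (by omega) ?_ ?_, by omega, Or.inr (by omega)⟩
            · intro x hx; simp [DTree.eval, hx]
            · intro x hx; simp [DTree.eval, hx]
    -- A tree that is not a leaf would have lost `P ≥ T.size` leaves.
    obtain ⟨T', c1, c2, c3⟩ := key P le_rfl
    have := size_pos T'
    rw [← hW] at c1
    cases T' with
    | leaf b => exact E.pureB_of_leaf c1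
    | node v A B =>
      have := size_pos A
      have := size_pos B
      simp only [DTree.size] at c3
      omega

end Tab

/-! ### Hypotheses found by the search -/

/-- A chain of optional hypotheses ending in a bit. -/
def Chain (α : Type) : ℕ → Type
  | 0 => Bool
  | j + 1 => Option α × Chain α j

/-- Hypotheses of a given rank. -/
def Hyp (W : ℕ) : ℕ → Type
  | 0 => Bool
  | l + 1 => Chain (Hyp W l) W

instance Chain.fintype (α : Type) [Fintype α] : (j : ℕ) → Fintype (Chain α j)
  | 0 => inferInstanceAs (Fintype Bool)
  | j + 1 => @instFintypeProd _ _ _ (Chain.fintype α j)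

instance Hyp.fintype (W : ℕ) : (l : ℕ) → Fintype (Hyp W l)
  | 0 => inferInstanceAs (Fintype Bool)
  | l + 1 => @Chain.fintype _ (Hyp.fintype W l) W

theorem Chain.card (α : Type) [Fintype α] (j : ℕ) :
    Fintype.card (Chain α j) = 2 * (Fintype.card α + 1) ^ j := by
  induction j with
  | zero => exact Fintype.card_bool
  | succ j ih =>
    have : Fintype.card (Chain α (j + 1)) = Fintype.card (Option α) * Fintype.card (Chain α j) :=
      Fintype.card_prod _ _
    rw [this, Fintype.card_option, ih, pow_succ]
    ring

/-- With `L = (2W+1)^l` one has `2 (2^L + 1)^W ≤ 2^(1 + (L+1) W)`, and the exponent is at most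
`(2W+1) L`. The same number bounds the steps of the iterative search. -/
theorem Hyp.card_le (W l : ℕ) : Fintype.card (Hyp W l) ≤ 2 ^ ((2 * W + 1) ^ l) := by
  induction l with
  | zero => exact Fintype.card_bool.le
  | succ l ih =>
    have h1 : Fintype.card (Hyp W (l + 1)) = 2 * (Fintype.card (Hyp W l) + 1) ^ W :=
      Chain.card (Hyp W l) W
    rw [h1]
    set L := (2 * W + 1) ^ l with hL
    have hL1 : 1 ≤ L := Nat.one_le_pow _ _ (by omega)
    calc 2 * (Fintype.card (Hyp W l) + 1) ^ W ≤ 2 * (2 ^ (L + 1)) ^ W := by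
          gcongr
          rw [pow_succ]
          have : 1 ≤ 2 ^ L := Nat.one_le_two_pow
          omega
      _ = 2 ^ (1 + (L + 1) * W) := by rw [← pow_mul, pow_add, pow_one]
      _ ≤ 2 ^ ((2 * W + 1) ^ (l + 1)) := by
          refine Nat.pow_le_pow_right (by norm_num) ?_
          rw [pow_succ, ← hL]
          nlinarith

/-- Evaluate a chain from literal `i` on. -/
def Chain.eval {α : Type} (ev : α → Bool) (lit : ℕ → Bool) : (j i : ℕ) → Chain α j → Bool
  | 0, _, b => b
  | j + 1, i, (some g, c) => if lit i then ev g else Chain.eval ev lit j (i + 1) c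
  | j + 1, i, (none, c) => Chain.eval ev lit j (i + 1) c

/-- Evaluate a hypothesis, given the values of the literals. -/
def Hyp.eval {W : ℕ} (lit : ℕ → Bool) : (l : ℕ) → Hyp W l → Bool
  | 0, b => b
  | l + 1, c => Chain.eval (Hyp.eval lit l) lit W 0 c

/-- The hypothesis is the transcript of the search: an entry `some` where a literal was eliminated,
holding the transcript of the subsearch, and the common label at the end. It reads an example only
through its literals and lives in a type independent of the examples, which permits a union bound.
-/
theorem Tab.exists_hyp (E : Tab) (l : ℕ) : ∀ S : ℕ → Bool, E.R l S = true →
    ∃ h : Hyp E.W l, ∀ t < E.q, S t = true → Hyp.eval (fun i => E.lit i t) l h = E.lb t := by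
  have hpure : ∀ S : ℕ → Bool, E.pureB S = true → ∃ b : Bool, ∀ t < E.q, S t = true → b = E.lb t := by
    intro S hS
    simp only [pureB, Bool.not_eq_true', Bool.and_eq_false_iff, decide_eq_false_iff_not] at hS
    rcases hS with h | h
    · refine ⟨false, fun t ht hSt => ?_⟩
      push Not at h
      have := h t ht hSt
      simpa using this.symm
    · refine ⟨true, fun t ht hSt => ?_⟩
      push Not at h
      have := h t ht hSt
      simpa using this.symm
  induction l with
  | zero => exact hpure
  | succ l ih =>
    intro S hS
    have key : ∀ j i, i + j = E.W → ∃ c : Chain (Hyp E.W l) j, ∀ t < E.q,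
        E.elim (E.R l) S i t = true →
          Chain.eval (Hyp.eval (fun i => E.lit i t) l) (fun i => E.lit i t) j i c = E.lb t := by
      intro j
      induction j with
      | zero =>
        intro i hi
        obtain rfl : i = E.W := by omega
        obtain ⟨b, hb⟩ := hpure _ hS
        exact ⟨b, hb⟩
      | succ j ihj =>
        intro i hi
        obtain ⟨c, hc⟩ := ihj (i + 1) (by omega)
        by_cases hR : E.R l (fun t => E.elim (E.R l) S i t && E.lit i t) = true
        · obtain ⟨g, hg⟩ := ih _ hR
          refine ⟨(some g, c), fun t ht hSt => ?_⟩
          simp only [Chain.eval]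
          by_cases hl : E.lit i t = true
          · rw [if_pos hl]
            exact hg t ht (by simp [hSt, hl])
          · rw [if_neg hl]
            exact hc t ht (by simp [elim, hR, hSt, hl])
        · refine ⟨(none, c), fun t ht hSt => ?_⟩
          simp only [Chain.eval]
          exact hc t ht (by simpa [elim, hR] using hSt)
    obtain ⟨c, hc⟩ := key E.W 0 (by omega)
    exact ⟨c, hc⟩

/-- A tree branching on the literal `coordOr o x = b`. -/
def condTree {n : ℕ} (o : Option (Fin n)) (b : Bool) (A B : DTree n) : DTree n :=
  match o with
  | none => if b then B else A
  | some i => if b then .node i B A else .node i A B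

theorem condTree_eval {n : ℕ} (o : Option (Fin n)) (b : Bool) (A B : DTree n) (x : Fin n → Bool) :
    (condTree o b A B).eval x = if coordOr o x == b then A.eval x else B.eval x := by
  cases o with
  | none => cases b <;> simp [condTree, coordOr]
  | some i => cases b <;> cases hx : x i <;> simp [condTree, coordOr, DTree.eval, hx]

theorem condTree_size {n : ℕ} (o : Option (Fin n)) (b : Bool) (A B : DTree n) :
    (condTree o b A B).size ≤ A.size + B.size := by
  cases o with
  | none => cases b <;> simp [condTree]
  | some i => cases b <;> simp [condTree, DTree.size, Nat.add_comm]

/-- A chain is a decision list over literals with trees at its exits: each entry contributes at most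
one branching and one tree of size at most `M`. -/
theorem Chain.exists_tree {α : Type} {n M : ℕ} (hM : 1 ≤ M) (o : ℕ → Option (Fin n)) (b : ℕ → Bool)
    (ev : (Fin n → Bool) → α → Bool)
    (hα : ∀ a, ∃ T : DTree n, T.size ≤ M ∧ ∀ x, T.eval x = ev x a) (j : ℕ) :
    ∀ i (c : Chain α j), ∃ T : DTree n, T.size ≤ j * M + 1 ∧
      ∀ x, T.eval x = Chain.eval (ev x) (fun i => coordOr (o i) x == b i) j i c := by
  induction j with
  | zero => intro i c; exact ⟨.leaf c, by simp [DTree.size], fun x => rfl⟩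
  | succ j ih =>
    rintro i ⟨g, c⟩
    obtain ⟨T, h1, h2⟩ := ih (i + 1) c
    cases g with
    | none =>
      refine ⟨T, by rw [Nat.succ_mul]; omega, fun x => ?_⟩
      rw [h2]; rfl
    | some g =>
      obtain ⟨T', h3, h4⟩ := hα g
      refine ⟨condTree (o i) (b i) T' T, (condTree_size _ _ _ _).trans ?_, fun x => ?_⟩
      · rw [Nat.succ_mul]; omega
      · rw [condTree_eval, h4, h2]; rfl

/-- One more level costs `W M + 1 ≤ (W + 1) M` leaves. The literals here are exact coordinates (or
constants), not the noisy table bits. -/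
theorem Hyp.exists_tree {W n : ℕ} (o : ℕ → Option (Fin n)) (b : ℕ → Bool) (l : ℕ) :
    ∀ h : Hyp W l, ∃ T : DTree n, T.size ≤ (W + 1) ^ l ∧
      ∀ x, T.eval x = Hyp.eval (fun i => coordOr (o i) x == b i) l h := by
  induction l with
  | zero => intro h; exact ⟨.leaf h, by simp [DTree.size], fun x => rfl⟩
  | succ l ih =>
    intro h
    obtain ⟨T, h1, h2⟩ := Chain.exists_tree (Nat.one_le_pow l (W + 1) (by omega)) o b
      (fun x => Hyp.eval (fun i => coordOr (o i) x == b i) l) ih W 0 h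
    refine ⟨T, h1.trans ?_, h2⟩
    have := Nat.one_le_pow l (W + 1) (by omega)
    rw [pow_succ]
    nlinarith

/-! ### The search as an iteration -/

/-- States of the iterative search: the level, the mode (`true` when returning), the result of the
last finished call, the literal index of each level and the set of each level. -/
structure ESt : Type where
  l : ℕ
  dir : Bool
  res : Bool
  dg : ℕ → ℕ
  S : ℕ → ℕ → Bool

namespace Tab

variable (E : Tab)

/-- The effect of a return to level `l + 1`: new set of that level. -/
def upSet (st : ESt) : ℕ → Bool :=
  if st.res then fun t => st.S (st.l + 1) t && !E.lit (st.dg (st.l + 1)) t else st.S (st.l + 1)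

/-- One step of the iterative search. -/
def step (r : ℕ) (st : ESt) : ESt :=
  if st.dir = false then
    if st.l = 0 then ⟨st.l, true, E.pureB (st.S 0), st.dg, st.S⟩
    else ⟨st.l - 1, false, st.res, Function.update st.dg st.l 0,
      Function.update st.S (st.l - 1) fun t => st.S st.l t && E.lit 0 t⟩
  -- After the top-level call has returned the state is fixed, so the program can run a prescribed
  -- number of steps.
  else if r ≤ st.l then st
  else if E.W ≤ st.dg (st.l + 1) + 1 then
    ⟨st.l + 1, true, E.pureB (E.upSet st),
      Function.update st.dg (st.l + 1) (st.dg (st.l + 1) + 1),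
      Function.update st.S (st.l + 1) (E.upSet st)⟩
  else ⟨st.l, false, st.res, Function.update st.dg (st.l + 1) (st.dg (st.l + 1) + 1),
      Function.update (Function.update st.S (st.l + 1) (E.upSet st)) st.l
        fun t => E.upSet st t && E.lit (st.dg (st.l + 1) + 1) t⟩

/-- A call at level `l + 1` spends one step on the call, and for each of `W` literals a subcall and
one return step; this fits into `(2W+1)^(l+1)`. Levels above the active one are untouched, so the
suspended callers find their sets and literal indices intact. -/
theorem step_iterate (hW : 1 ≤ E.W) (r l : ℕ) (hl : l ≤ r) : ∀ st : ESt, st.l = l → st.dir = false →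
    ∃ M ≤ (2 * E.W + 1) ^ l, ((E.step r)^[M] st).l = l ∧ ((E.step r)^[M] st).dir = true ∧
      ((E.step r)^[M] st).res = E.R l (st.S l) ∧
      ∀ m, l < m → ((E.step r)^[M] st).S m = st.S m ∧ ((E.step r)^[M] st).dg m = st.dg m := by
  induction l with
  | zero =>
    intro st h1 h2
    refine ⟨1, by simp, ?_⟩
    simp [step, h1, h2, R]
  | succ l ih =>
    intro st h1 h2
    -- The state just before the subcall for literal `i`: level `l + 1` holds the `i`-th stage of
    -- the elimination.
    have key : ∀ i < E.W, ∃ M ≤ 1 + i * ((2 * E.W + 1) ^ l + 1), 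
        ((E.step r)^[M] st).l = l ∧ ((E.step r)^[M] st).dir = false ∧
        ((E.step r)^[M] st).S (l + 1) = E.elim (E.R l) (st.S (l + 1)) i ∧
        (((E.step r)^[M] st).S l = fun t => E.elim (E.R l) (st.S (l + 1)) i t && E.lit i t) ∧
        ((E.step r)^[M] st).dg (l + 1) = i ∧
        ∀ m, l + 1 < m → ((E.step r)^[M] st).S m = st.S m ∧ ((E.step r)^[M] st).dg m = st.dg m := by
      intro i
      induction i with
      | zero =>
        intro _
        refine ⟨1, by omega, ?_⟩
        simp only [Function.iterate_one, step, h1, h2, if_true, Nat.succ_ne_zero, if_false,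
          Nat.add_sub_cancel, elim]
        refine ⟨trivial, trivial, by simp, by simp, by simp, fun m hm => ?_⟩
        rw [Function.update_of_ne (by omega), Function.update_of_ne (by omega)]
        exact ⟨rfl, rfl⟩
      | succ i ihi =>
        intro hi
        obtain ⟨M, m1, m2, m3, m4, m5, m6, m7⟩ := ihi (by omega)
        obtain ⟨M', n1, n2, n3, n4, n5⟩ := ih (by omega) _ m2 m3
        rw [← Function.iterate_add_apply] at n2 n3 n4 n5
        refine ⟨(M' + M) + 1, ?_, ?_⟩
        · rw [Nat.succ_mul]; omega
        · rw [Function.iterate_succ_apply']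
          have hS := (n5 (l + 1) (by omega)).1
          have hd := (n5 (l + 1) (by omega)).2
          rw [m4] at hS
          rw [m6] at hd
          rw [m5] at n4
          set st' := (E.step r)^[M' + M] st with hst'
          have hup : E.upSet st' = E.elim (E.R l) (st.S (l + 1)) (i + 1) := by
            simp only [upSet, n4, n2, hS, hd, elim]
          simp only [step, n3, n2, hd, Bool.true_eq_false, if_false, show ¬ r ≤ l by omega,
            show ¬ E.W ≤ i + 1 by omega, hup]
          refine ⟨trivial, trivial, by simp, by simp, by simp, fun m hm => ?_⟩
          rw [Function.update_of_ne (by omega), Function.update_of_ne (by omega),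
            Function.update_of_ne (by omega)]
          have a1 := n5 m (by omega)
          have a2 := m7 m hm
          exact ⟨a1.1.trans a2.1, a1.2.trans a2.2⟩
    obtain ⟨M, m1, m2, m3, m4, m5, m6, m7⟩ := key (E.W - 1) (by omega)
    obtain ⟨M', n1, n2, n3, n4, n5⟩ := ih (by omega) _ m2 m3
    rw [← Function.iterate_add_apply] at n2 n3 n4 n5
    refine ⟨(M' + M) + 1, ?_, ?_⟩
    · have hP := Nat.one_le_pow l (2 * E.W + 1) (by omega)
      obtain ⟨w, hw⟩ : ∃ w, E.W = w + 1 := ⟨E.W - 1, by omega⟩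
      rw [hw] at m1 n1 hP ⊢
      rw [Nat.add_sub_cancel] at m1
      rw [pow_succ]
      nlinarith
    · rw [Function.iterate_succ_apply']
      have hS := (n5 (l + 1) (by omega)).1
      have hd := (n5 (l + 1) (by omega)).2
      rw [m4] at hS
      rw [m6] at hd
      rw [m5] at n4
      set st' := (E.step r)^[M' + M] st with hst'
      have hup : E.upSet st' = E.elim (E.R l) (st.S (l + 1)) E.W := by
        obtain ⟨w, hw⟩ : ∃ w, E.W = w + 1 := ⟨E.W - 1, by omega⟩
        rw [hw] at n4 hS hd
        rw [Nat.add_sub_cancel] at n4 hS hd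
        simp only [upSet, n4, n2, hS, hd, hw, elim]
      simp only [step, n3, n2, hd, Bool.true_eq_false, if_false, show ¬ r ≤ l by omega,
        show E.W ≤ E.W - 1 + 1 by omega, if_true, hup]
      refine ⟨trivial, trivial, rfl, fun m hm => ?_⟩
      rw [Function.update_of_ne (by omega), Function.update_of_ne (by omega)]
      have a1 := n5 m (by omega)
      have a2 := m7 m hm
      exact ⟨a1.1.trans a2.1, a1.2.trans a2.2⟩

/-- The iterative search computes the recursive one. -/
theorem step_result (hW : 1 ≤ E.W) (r : ℕ) (st : ESt) (h1 : st.l = r) (h2 : st.dir = false) :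
    ((E.step r)^[(2 * E.W + 1) ^ r] st).res = E.R r (st.S r) := by
  obtain ⟨M, hM, m1, m2, m3, -⟩ := E.step_iterate hW r r le_rfl st h1 h2
  have hfix : ∀ j, (E.step r)^[j] ((E.step r)^[M] st) = (E.step r)^[M] st := by
    intro j
    refine Function.iterate_fixed ?_ j
    simp [step, m1, m2]
  obtain ⟨j, hj⟩ := Nat.exists_eq_add_of_le hM
  rw [hj, Nat.add_comm, Function.iterate_add_apply, hfix, m3]

end Tab

/-! ### The tester as a random process -/

/-- The randomness used by one row of the table: an example and three uniform points. -/
structure Row (n : ℕ) : Type where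
  x : Fin n → Bool
  y : Fin n → Bool
  u : Fin n → Bool
  v : Fin n → Bool

instance (n : ℕ) : Inhabited (Row n) :=
  ⟨⟨fun _ => false, fun _ => false, fun _ => false, fun _ => false⟩⟩

/-- The distribution of a row. -/
def rowDist {n : ℕ} (D : PMF (Fin n → Bool)) : PMF (Row n) :=
  D.bind fun x => (drawPoint n).bind fun y => (drawPoint n).bind fun u =>
    (drawPoint n).bind fun v => PMF.pure ⟨x, y, u, v⟩

/-- Append random bits to a binary number. -/
def hashFrom : ℕ → ℕ → PMF ℕ
  | 0, h => PMF.pure h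
  | j + 1, h => coin.bind fun b => hashFrom j (h + h + b.toNat)

/-- The relevant blocks found so far, with witnesses. -/
structure Fd (n : ℕ) : Type where
  k : ℕ
  blk : ℕ → ℕ
  wit : ℕ → Fin n → Bool
  mark : ℕ → Bool

/-- No block has been found. -/
def Fd.init (n : ℕ) : Fd n := ⟨0, fun _ => 0, fun _ _ => false, fun _ => false⟩

namespace Fd

variable {n : ℕ} (f : BoolFun n) (H : ℕ → ℕ) (F : Fd n)

/-- Keep a point on the found blocks and put zeros elsewhere. -/
def proj (x : Fin n → Bool) : Fin n → Bool := fun i => F.mark (H i) && x i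

/-- Keep a point on the found blocks and on the blocks up to `h`, and put zeros elsewhere. -/
def part (h : ℕ) (x : Fin n → Bool) : Fin n → Bool :=
  fun i => (F.mark (H i) || decide (H i ≤ h)) && x i

/-- The function seen on block `j` through its witness. -/
def g (j : ℕ) : BoolFun n := fun p => f fun i => if H i = F.blk j then p i else F.wit j i

/-- The first block at which the hybrids of `x` get the value of `x`. -/
def newBlock (x : Fin n → Bool) : ℕ := sInf {h | f (F.part H h x) = f x}

/-- Add the block discovered through `x`. -/
def discover (x : Fin n → Bool) : Fd n :=
  ⟨F.k + 1, Function.update F.blk F.k (F.newBlock f H x),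
    Function.update F.wit F.k (F.part H (F.newBlock f H x) x),
    Function.update F.mark (F.newBlock f H x) true⟩

/-- The found blocks do not explain the example. -/
def Disc (ρ : Row n) : Prop := f (F.proj H ρ.x) ≠ f ρ.x

open Classical in
/-- The blocks found after a round. -/
def next (q : ℕ) (w : ℕ → Row n) : Fd n :=
  if h : ∃ t, t < q ∧ F.Disc f H (w t) then F.discover f H (w (Nat.find h)).x else F

/-- The table of a round. -/
def tab (s W q : ℕ) (w : ℕ → Row n) : Tab where
  q := q
  W := W
  tb t j := diff (F.g f H j) (w t).y (w t).x
  lb t := f (w t).x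
  lv i := i / 2 % s
  lp i := decide (i % 2 = 1)

/-- A round passes. -/
def Pass (s W r q : ℕ) (w : ℕ → Row n) : Prop :=
  (∀ t < q, ¬ F.Disc f H (w t)) ∧
  (∀ t < q, ∀ j < s, TestOK (F.g f H j) (w t).y (w t).u (w t).v) ∧
  (F.tab f H s W q w).R r (fun _ => true) = true

end Fd

section process

variable {n : ℕ} (f : BoolFun n) (D : PMF (Fin n → Bool))

open Classical in
/-- The rounds of the tester. -/
def rounds (H : ℕ → ℕ) (s W r q : ℕ) : ℕ → Fd n × Bool → PMF (Fd n × Bool)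
  | 0, st => PMF.pure st
  | m + 1, st => (iid (rowDist D) q fun _ => default).bind fun w =>
      rounds H s W r q m (st.1.next f H q w, st.2 || decide (st.1.Pass f H s W r q w))

/-- The whole tester. -/
def tester (s W r q τ : ℕ) : PMF (Fd n × Bool) :=
  -- The leading 1 makes every hash value positive, so block 0 contains no variable and can mark an
  -- unused slot.
  (iid (hashFrom τ 1) n fun _ => 0).bind fun H => rounds f D H s W r q (s + 1) (Fd.init n, false)

end process

/-! ### The hash -/

/-- Appending `j` bits to `h` gives the dyadic interval of `h`. The interval yields positivity of
the hash, the bound on the scan of hybrids, and the collision bound. -/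
theorem hashFrom_support (j : ℕ) : ∀ h, ∀ a ∈ (hashFrom j h).support,
    h * 2 ^ j ≤ a ∧ a < (h + 1) * 2 ^ j := by
  induction j with
  | zero =>
    intro h a ha
    simp only [hashFrom, PMF.support_pure, Set.mem_singleton_iff] at ha
    subst ha; simp
  | succ j ih =>
    intro h a ha
    obtain ⟨b, -, ha⟩ := (PMF.mem_support_bind_iff _ _ _).1 ha
    obtain ⟨h1, h2⟩ := ih _ a ha
    rw [pow_succ]
    cases b
    · simp only [Bool.toNat_false] at h1 h2
      constructor <;> nlinarith [Nat.one_le_two_pow (n := j)]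
    · simp only [Bool.toNat_true] at h1 h2
      constructor <;> nlinarith [Nat.one_le_two_pow (n := j)]

theorem prob_coin_le (b : Bool) {S : Set Bool} (hS : S ⊆ {b}) : prob coin S ≤ 1 / 2 := by
  refine (prob_mono coin hS).trans ?_
  unfold prob
  rw [PMF.toOuterMeasure_apply_singleton]
  simp [coin, PMF.uniformOfFintype_apply]

/-- The two values of the next bit lead to disjoint intervals, so at most one of them can still
reach `a`. -/
theorem prob_hashFrom_le (j : ℕ) : ∀ h a, prob (hashFrom j h) {a} ≤ (1 / 2) ^ j := by
  induction j with
  | zero => intro h a; simpa using prob_le_one _ _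
  | succ j ih =>
    intro h a
    have h1 := prob_bind_le_mul coin (fun b => hashFrom j (h + h + b.toNat)) {a}
      {b | (h + h + b.toNat) * 2 ^ j ≤ a ∧ a < (h + h + b.toNat + 1) * 2 ^ j}
      (c := (1 / 2) ^ j) (by positivity) (fun b _ => ih _ a) (fun b hb => by
        refine prob_eq_zero _ fun a' ha' h' => hb ?_
        rw [Set.mem_singleton_iff] at h'
        subst h'
        exact hashFrom_support j _ _ ha')
    have h2 : prob coin {b | (h + h + b.toNat) * 2 ^ j ≤ a ∧ a < (h + h + b.toNat + 1) * 2 ^ j}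
        ≤ 1 / 2 := by
      have hpos := Nat.one_le_two_pow (n := j)
      by_cases hb : (h + h + 1) * 2 ^ j ≤ a
      · refine prob_coin_le true fun b hb' => ?_
        cases b
        · simp only [Set.mem_setOf_eq, Bool.toNat_false, Nat.add_zero] at hb'
          omega
        · rfl
      · refine prob_coin_le false fun b hb' => ?_
        cases b
        · rfl
        · simp only [Set.mem_setOf_eq, Bool.toNat_true] at hb'
          omega
    rw [hashFrom, pow_succ, mul_comm]
    exact h1.trans (mul_le_mul_of_nonneg_right h2 (by positivity))

/-- A union bound over pairs in `V`. Only collisions inside `V`, the variables of the tree, do harm,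
so the number of blocks depends on `s` and not on `n`. -/
theorem prob_not_injOn_le (τ n : ℕ) (V : Finset (Fin n)) :
    prob (iid (hashFrom τ 1) n fun _ => 0)
      {H | ¬ Set.InjOn (fun i : Fin n => H i) V} ≤ (V.card : ℝ) ^ 2 * (1 / 2) ^ τ := by
  have hsub : {H : ℕ → ℕ | ¬ Set.InjOn (fun i : Fin n => H i) V} ⊆
      ⋃ p ∈ (V ×ˢ V).filter (fun p => p.1 < p.2), {H : ℕ → ℕ | H p.1 = H p.2} := by
    intro H hH
    simp only [Set.mem_setOf_eq, Set.InjOn] at hH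
    push Not at hH
    obtain ⟨a, ha, b, hb, hab, hne⟩ := hH
    simp only [Set.mem_iUnion, Finset.mem_filter, Finset.mem_product, Set.mem_setOf_eq, exists_prop]
    rcases lt_or_gt_of_ne hne with h | h
    · exact ⟨(a, b), ⟨⟨ha, hb⟩, h⟩, hab⟩
    · exact ⟨(b, a), ⟨⟨hb, ha⟩, h⟩, hab.symm⟩
  refine (prob_mono _ hsub).trans ((prob_iUnion_le _ _ _).trans ?_)
  refine (Finset.sum_le_card_nsmul _ _ ((1 / 2 : ℝ) ^ τ) fun p hp => ?_).trans ?_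
  · simp only [Finset.mem_filter] at hp
    exact prob_iid_eq_le _ (by positivity) (prob_hashFrom_le τ 1) n _ _ _ hp.2 p.2.2
  · rw [nsmul_eq_mul]
    refine mul_le_mul_of_nonneg_right ?_ (by positivity)
    have := (Finset.card_filter_le (V ×ˢ V) (fun p => p.1 < p.2))
    rw [Finset.card_product] at this
    calc _ ≤ ((V.card * V.card : ℕ) : ℝ) := by exact_mod_cast this
      _ = _ := by push_cast; ring

/-! ### Soundness -/

theorem prob_uniform {α : Type} [Fintype α] [Nonempty α] (P : α → Prop) [DecidablePred P] :
    prob (PMF.uniformOfFintype α) {a | P a} =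
      ((Finset.univ.filter P).card : ℝ) / Fintype.card α := by
  classical
  unfold prob
  rw [PMF.toOuterMeasure_uniformOfFintype_apply]
  rw [ENNReal.toReal_div, ENNReal.toReal_natCast, ENNReal.toReal_natCast]
  congr 2
  rw [Fintype.card_subtype]
  rfl

theorem uniform_bind_uniform {α β γ : Type} [Fintype α] [Nonempty α] [Fintype β] [Nonempty β]
    (F : α → β → PMF γ) :
    ((PMF.uniformOfFintype α).bind fun a => (PMF.uniformOfFintype β).bind fun b => F a b) =
      (PMF.uniformOfFintype (α × β)).bind fun p => F p.1 p.2 := by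
  ext c
  simp only [PMF.bind_apply, PMF.uniformOfFintype_apply, tsum_fintype, Fintype.sum_prod_type,
    Fintype.card_prod, Nat.cast_mul, Finset.mul_sum]
  refine Finset.sum_congr rfl fun a _ => Finset.sum_congr rfl fun b _ => ?_
  rw [ENNReal.mul_inv (by simp) (by simp), mul_assoc]

theorem rowDist_eq {n : ℕ} (D : PMF (Fin n → Bool)) : rowDist D = D.bind fun x =>
    (PMF.uniformOfFintype ((Fin n → Bool) × (Fin n → Bool) × (Fin n → Bool))).map
      fun t => ⟨x, t.1, t.2.1, t.2.2⟩ := by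
  unfold rowDist
  congr 1
  funext x
  rw [drawPoint_eq]
  simp only [uniform_bind_uniform]
  rfl

section soundness

variable {n : ℕ} {f : BoolFun n} {D : PMF (Fin n → Bool)}

/-- With exact coordinates the hypothesis is a tree of size at most `S`, hence wrong on mass more
than `ε` of the examples. For each such `x` the fresh point `y` makes all `s` readings right with
probability at least `1/2`, by a union bound with error `1/(2s)` per slot, and then the hypothesis
errs on the row. -/
theorem prob_hyp_le {ε : ℝ} {S : ℕ} (hfar : IsFar D ε f (DT n S)) {s W r : ℕ} (hs : 1 ≤ s)
    (hS : (W + 1) ^ r ≤ S) (g : ℕ → BoolFun n) (o : ℕ → Option (Fin n))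
    (hg : ∀ j < s, ∀ x : Fin n → Bool, prob (PMF.uniformOfFintype (Fin n → Bool))
      {y | diff (g j) y x ≠ coordOr (o j) x} ≤ 1 / (2 * s)) (b : ℕ → Bool) (h : Hyp W r) :
    prob (rowDist D) {ρ | Hyp.eval (fun i => diff (g (i / 2 % s)) ρ.y ρ.x == b i) r h = f ρ.x} ≤
      1 - ε / 2 := by
  obtain ⟨T, hT, hT'⟩ := Hyp.exists_tree (fun i => o (i / 2 % s)) b r h
  have h1 := hfar T.eval ⟨T, hT.trans hS, rfl⟩
  have hcompl := prob_add_compl (rowDist D)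
    {ρ | Hyp.eval (fun i => diff (g (i / 2 % s)) ρ.y ρ.x == b i) r h = f ρ.x}
  have key : prob D {x | T.eval x ≠ f x} * (1 / 2) ≤ prob (rowDist D)
      {ρ | Hyp.eval (fun i => diff (g (i / 2 % s)) ρ.y ρ.x == b i) r h = f ρ.x}ᶜ := by
    refine le_prob_bind_mul D _ _ {x | T.eval x ≠ f x} (by norm_num) fun x hx => ?_
    -- all bits are right with probability at least one half
    have hall : prob (drawPoint n) (⋃ j ∈ Finset.range s, {y | diff (g j) y x ≠ coordOr (o j) x})
        ≤ 1 / 2 := by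
      refine (prob_iUnion_le _ _ _).trans ?_
      have : ∀ j ∈ Finset.range s, prob (drawPoint n) {y | diff (g j) y x ≠ coordOr (o j) x} ≤
          1 / (2 * s) := by
        intro j hj
        rw [drawPoint_eq]
        exact hg j (Finset.mem_range.1 hj) x
      refine (Finset.sum_le_card_nsmul _ _ _ this).trans ?_
      have : (0 : ℝ) < s := by exact_mod_cast hs
      simp
      field_simp
      norm_num
    have h2 := prob_add_compl (drawPoint n)
      (⋃ j ∈ Finset.range s, {y | diff (g j) y x ≠ coordOr (o j) x})
    have h3 : (1 : ℝ) / 2 ≤ prob (drawPoint n)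
      (⋃ j ∈ Finset.range s, {y | diff (g j) y x ≠ coordOr (o j) x})ᶜ := by linarith
    rw [← mul_one (1 / 2 : ℝ)]
    refine (mul_le_mul_of_nonneg_right h3 zero_le_one).trans ?_
    refine le_prob_bind_mul _ _ _ _ zero_le_one fun y hy => ?_
    rw [← prob_univ ((drawPoint n).bind fun u => (drawPoint n).bind fun v =>
      PMF.pure (⟨x, y, u, v⟩ : Row n))]
    unfold prob
    refine ENNReal.toReal_mono (toOuterMeasure_ne_top _ _) (PMF.toOuterMeasure_mono _ ?_)
    rintro ρ ⟨-, hρ⟩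
    obtain ⟨u, -, hρ⟩ := (PMF.mem_support_bind_iff _ _ _).1 hρ
    obtain ⟨v, -, hρ⟩ := (PMF.mem_support_bind_iff _ _ _).1 hρ
    simp only [PMF.support_pure, Set.mem_singleton_iff] at hρ
    subst hρ
    simp only [Set.mem_compl_iff, Set.mem_setOf_eq]
    simp only [Set.mem_compl_iff, Set.mem_iUnion, Finset.mem_range, Set.mem_setOf_eq, exists_prop,
      not_exists, not_and, not_not] at hy
    have : (fun i => diff (g (i / 2 % s)) y x == b i) = fun i => coordOr (o (i / 2 % s)) x == b i := by
      funext i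
      rw [hy _ (Nat.mod_lt _ (by omega))]
    rw [this, ← hT']
    exact hx
  linarith

open Classical in
theorem prob_testOK_le (g : BoolFun n) : prob (rowDist D) {ρ | TestOK g ρ.y ρ.u ρ.v} ≤
    1 - ((Finset.univ.filter fun t : (Fin n → Bool) × (Fin n → Bool) × (Fin n → Bool) =>
      ¬ TestOK g t.1 t.2.1 t.2.2).card : ℝ) / (Fintype.card (Fin n → Bool) : ℝ) ^ 3 := by
  rw [rowDist_eq]
  have hcard : (Fintype.card ((Fin n → Bool) × (Fin n → Bool) × (Fin n → Bool)) : ℝ) =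
      (Fintype.card (Fin n → Bool) : ℝ) ^ 3 := by
    rw [Fintype.card_prod, Fintype.card_prod]; push_cast; ring
  have h1 := prob_uniform (fun t : (Fin n → Bool) × (Fin n → Bool) × (Fin n → Bool) =>
      ¬ TestOK g t.1 t.2.1 t.2.2)
  have h2 := prob_add_compl (PMF.uniformOfFintype _)
    {t : (Fin n → Bool) × (Fin n → Bool) × (Fin n → Bool) | ¬ TestOK g t.1 t.2.1 t.2.2}
  rw [h1, hcard] at h2
  have h3 : {t : (Fin n → Bool) × (Fin n → Bool) × (Fin n → Bool) |
      ¬ TestOK g t.1 t.2.1 t.2.2}ᶜ = {t | TestOK g t.1 t.2.1 t.2.2} := by ext t; simp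
  rw [h3] at h2
  have h4 := prob_nonneg (PMF.uniformOfFintype ((Fin n → Bool) × (Fin n → Bool) × (Fin n → Bool)))
    {t | TestOK g t.1 t.2.1 t.2.2}
  refine prob_bind_le_of_forall _ _ _ (by linarith) fun x => ?_
  rw [prob_map]
  refine le_of_eq (Eq.trans ?_ (eq_sub_of_add_eq' h2))
  rfl

open Classical in
/-- A round passes with small probability if `f` is far from small trees. -/
theorem prob_pass_le {ε δ' : ℝ} {S : ℕ} (hε : ε ≤ 1) (hfar : IsFar D ε f (DT n S))
    {s W r q : ℕ} (hs : 1 ≤ s) (hS : (W + 1) ^ r ≤ S)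
    (h1 : (1 - 1 / (32 * s : ℝ)) ^ q ≤ δ')
    (h2 : (2 : ℝ) ^ ((2 * W + 1) ^ r) * (1 - ε / 2) ^ q ≤ δ')
    (H : ℕ → ℕ) (F : Fd n) :
    prob (iid (rowDist D) q fun _ => default) {w | F.Pass f H s W r q w} ≤ δ' := by
  have hs' : (1 : ℝ) ≤ s := by exact_mod_cast hs
  set fails : ℕ → ℝ := fun j =>
    ((Finset.univ.filter fun t : (Fin n → Bool) × (Fin n → Bool) × (Fin n → Bool) =>
      ¬ TestOK (F.g f H j) t.1 t.2.1 t.2.2).card : ℝ) with hfails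
  have hN : (0 : ℝ) < (Fintype.card (Fin n → Bool) : ℝ) ^ 3 := by
    have : 0 < Fintype.card (Fin n → Bool) := Fintype.card_pos
    positivity
  -- Either some slot violates the test at rate at least `1/(32s)`, and `q` rows catch it, or every
  -- slot reads a coordinate with error at most `2/(32s) ≤ 1/(2s)`.
  by_cases hA : ∃ j < s, 1 / (32 * s : ℝ) ≤ fails j / (Fintype.card (Fin n → Bool) : ℝ) ^ 3
  · obtain ⟨j, hj, hA⟩ := hA
    have hsub : {w : ℕ → Row n | F.Pass f H s W r q w} ⊆
        {w | ∀ t < q, w t ∈ {ρ : Row n | TestOK (F.g f H j) ρ.y ρ.u ρ.v}} :=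
      fun w hw t ht => hw.2.1 t ht j hj
    refine (prob_mono _ hsub).trans ?_
    rw [prob_iid]
    refine (pow_le_pow_left₀ (prob_nonneg _ _) ?_ q).trans h1
    refine (prob_testOK_le _).trans ?_
    linarith
  · push Not at hA
    have ho : ∀ j, ∃ o : Option (Fin n), j < s → ∀ x : Fin n → Bool,
        prob (PMF.uniformOfFintype (Fin n → Bool)) {y | diff (F.g f H j) y x ≠ coordOr o x} ≤
          1 / (2 * s) := by
      intro j
      by_cases hj : j < s
      · have hlt := hA j hj
        obtain ⟨o, ho⟩ := exists_coord_of_test (F.g f H j) (1 / (32 * s)) (by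
            rw [div_le_div_iff₀ (by positivity) (by norm_num)]; linarith) (by
            rw [div_lt_iff₀ hN] at hlt
            convert hlt.le using 2)
        refine ⟨o, fun _ x => ?_⟩
        rw [prob_uniform]
        have hc : (0 : ℝ) < Fintype.card (Fin n → Bool) := by exact_mod_cast Fintype.card_pos
        rw [div_le_iff₀ hc]
        refine (le_of_eq_of_le ?_ (ho x)).trans ?_
        · congr!
        · refine mul_le_mul_of_nonneg_right ?_ hc.le
          rw [mul_one_div, div_le_div_iff₀ (by positivity) (by positivity)]
          linarith
      · exact ⟨none, fun h => absurd h hj⟩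
    choose o ho using ho
    -- Every successful search is covered by some hypothesis that explains all rows; for a fixed
    -- hypothesis the rows are independent.
    have hsub : {w : ℕ → Row n | F.Pass f H s W r q w} ⊆
        ⋃ h ∈ (Finset.univ : Finset (Hyp W r)), {w | ∀ t < q, w t ∈ {ρ : Row n |
          Hyp.eval (fun i => diff (F.g f H (i / 2 % s)) ρ.y ρ.x == decide (i % 2 = 1)) r h
            = f ρ.x}} := by
      intro w hw
      obtain ⟨h, hh⟩ := (F.tab f H s W q w).exists_hyp r _ hw.2.2
      simp only [Set.mem_iUnion]
      exact ⟨h, Finset.mem_univ _, fun t ht => hh t ht rfl⟩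
    refine (prob_mono _ hsub).trans ((prob_iUnion_le _ _ _).trans ?_)
    refine (Finset.sum_le_card_nsmul _ _ ((1 - ε / 2) ^ q) fun h _ => ?_).trans ?_
    · rw [prob_iid]
      exact pow_le_pow_left₀ (prob_nonneg _ _)
        (prob_hyp_le hfar hs hS (fun j => F.g f H j) o (fun j hj => ho j hj) _ h) q
    · rw [nsmul_eq_mul]
      refine le_trans (mul_le_mul_of_nonneg_right ?_ (pow_nonneg (by linarith) _)) h2
      rw [Finset.card_univ]
      exact_mod_cast Hyp.card_le W r

/-- Each round uses fresh rows and the bound `δ'` is uniform in the collection `F`, so the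
dependence of `F` on earlier rounds is harmless. -/
theorem prob_rounds_le {δ' : ℝ} (hδ : 0 ≤ δ') {s W r q : ℕ} (H : ℕ → ℕ)
    (h : ∀ F : Fd n, prob (iid (rowDist D) q fun _ => default) {w | F.Pass f H s W r q w} ≤ δ')
    (m : ℕ) : ∀ F : Fd n,
      prob (rounds f D H s W r q m (F, false)) {st | st.2 = true} ≤ m * δ' := by
  classical
  induction m with
  | zero =>
    intro F
    rw [rounds, prob_pure]
    simp
  | succ m ih =>
    intro F
    have := prob_bind_le (iid (rowDist D) q fun _ => default)
      (fun w => rounds f D H s W r q m (F.next f H q w, false || decide (F.Pass f H s W r q w)))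
      {st | st.2 = true} {w | F.Pass f H s W r q w} (c := m * δ') (by positivity) (fun w hw => by
        simp only [Set.mem_setOf_eq] at hw
        simp only [hw, decide_false, Bool.or_false]
        exact ih _)
    rw [rounds]
    push_cast
    linarith [h F]

/-- The tester rarely accepts functions that are far from small trees. -/
theorem tester_sound {ε δ' : ℝ} {S : ℕ} (hε : ε ≤ 1) (hfar : IsFar D ε f (DT n S))
    {s W r q τ : ℕ} (hs : 1 ≤ s) (hS : (W + 1) ^ r ≤ S)
    (h1 : (1 - 1 / (32 * s : ℝ)) ^ q ≤ δ')
    (h2 : (2 : ℝ) ^ ((2 * W + 1) ^ r) * (1 - ε / 2) ^ q ≤ δ') :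
    prob (tester f D s W r q τ) {st | st.2 = true} ≤ (s + 1) * δ' := by
  have hδ : 0 ≤ δ' := (prob_nonneg _ _).trans (prob_pass_le hε hfar hs hS h1 h2 (fun _ => 0) (Fd.init n))
  refine prob_bind_le_of_forall _ _ _ (by positivity) fun H => ?_
  have := prob_rounds_le hδ H (prob_pass_le hε hfar hs hS h1 h2 H) (s + 1) (Fd.init n)
  push_cast at this
  exact this

end soundness

/-! ### Completeness -/

/-- The variables of a tree. -/
def treeVars {n : ℕ} : DTree n → Finset (Fin n)
  | .leaf _ => ∅
  | .node i l r => insert i (treeVars l ∪ treeVars r)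

theorem treeVars_card {n : ℕ} (T : DTree n) : (treeVars T).card + 1 ≤ T.size := by
  induction T with
  | leaf b => simp [treeVars, DTree.size]
  | node i l r ihl ihr =>
    simp only [treeVars, DTree.size]
    have h1 := Finset.card_insert_le i (treeVars l ∪ treeVars r)
    have h2 := Finset.card_union_le (treeVars l) (treeVars r)
    omega

theorem DTree_eval_congr {n : ℕ} (T : DTree n) {x y : Fin n → Bool}
    (h : ∀ i ∈ treeVars T, x i = y i) : T.eval x = T.eval y := by
  induction T with
  | leaf b => rfl
  | node i l r ihl ihr =>
    simp only [treeVars, Finset.mem_insert, Finset.mem_union] at h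
    simp only [DTree.eval, h i (Or.inl rfl), ihl fun j hj => h j (Or.inr (Or.inl hj)),
      ihr fun j hj => h j (Or.inr (Or.inr hj))]

/-- Variables without a slot are read as zero: the node collapses to its left subtree, so the size
does not grow. -/
theorem exists_subst {n s : ℕ} (σ : Fin n → Option (Fin s)) (T : DTree n) :
    ∃ T' : DTree s, T'.size ≤ T.size ∧ ∀ (z : Fin n → Bool) (b : Fin s → Bool),
      (∀ i ∈ treeVars T, z i = coordOr (σ i) b) → T'.eval b = T.eval z := by
  induction T with
  | leaf b => exact ⟨.leaf b, le_rfl, fun _ _ _ => rfl⟩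
  | node i l r ihl ihr =>
    obtain ⟨l', hl, hl'⟩ := ihl
    obtain ⟨r', hr, hr'⟩ := ihr
    refine ⟨condTree (σ i) true r' l', (condTree_size _ _ _ _).trans ?_, fun z b h => ?_⟩
    · simp only [DTree.size]; omega
    · simp only [treeVars, Finset.mem_insert, Finset.mem_union] at h
      rw [condTree_eval, hl' z b fun j hj => h j (Or.inr (Or.inl hj)),
        hr' z b fun j hj => h j (Or.inr (Or.inr hj)), ← h i (Or.inl rfl)]
      simp [DTree.eval]

section completeness

variable {n : ℕ} {T : DTree n} {H : ℕ → ℕ}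

/-- The found blocks are relevant and their witnesses read off the relevant variables. -/
structure Fd.Good (T : DTree n) (H : ℕ → ℕ) (F : Fd n) : Prop where
  lit : ∀ j < F.k, ∃ i ∈ treeVars T, H i = F.blk j ∧ ∃ c, ∀ p, F.g T.eval H j p = (p i ^^ c)
  rest : ∀ j, F.k ≤ j → F.blk j = 0
  mark : ∀ h, F.mark h = true ↔ ∃ j < F.k, F.blk j = h
  inj : ∀ j < F.k, ∀ j' < F.k, F.blk j = F.blk j' → j = j'

theorem Fd.good_init : (Fd.init n).Good T H where
  lit := fun j hj => absurd hj (by simp [Fd.init])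
  rest := fun j _ => rfl
  mark := fun h => by simp [Fd.init]
  inj := fun j hj => absurd hj (by simp [Fd.init])

/-- Distinct blocks contain distinct variables of the tree. This limits the number of discoveries
and shows that `s` slots are enough. -/
theorem Fd.Good.k_le {F : Fd n} (hF : F.Good T H) : F.k ≤ (treeVars T).card := by
  have key : ∀ j, ∃ i : Option (Fin n), j < F.k → ∃ i' ∈ treeVars T, i = some i' ∧ H i' = F.blk j := by
    intro j
    by_cases hj : j < F.k
    · obtain ⟨i, hi, h, -⟩ := hF.lit j hj
      exact ⟨some i, fun _ => ⟨i, hi, rfl, h⟩⟩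
    · exact ⟨none, fun h => absurd h hj⟩
  choose φ hφ using key
  have := Finset.card_le_card_of_injOn (s := Finset.range F.k)
    (t := (treeVars T).map ⟨some, Option.some_injective _⟩) φ
    (by
      intro j hj
      obtain ⟨i, hi, h, -⟩ := hφ j (by simpa using hj)
      rw [h]
      simpa using hi)
    (by
      intro j hj j' hj' h
      obtain ⟨i, hi, h1, h2⟩ := hφ j (by simpa using hj)
      obtain ⟨i', hi', h1', h2'⟩ := hφ j' (by simpa using hj')
      rw [h1, h1', Option.some.injEq] at h
      subst h
      exact hF.inj j (by simpa using hj) j' (by simpa using hj') (h2.symm.trans h2'))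
  simpa using this

/-- The unknown sign `c` cancels in a difference. -/
theorem Fd.Good.diff_of_lt {F : Fd n} {f : BoolFun n} {j : ℕ} {i : Fin n} {c : Bool}
    (h : ∀ p, F.g f H j p = (p i ^^ c)) (y p : Fin n → Bool) : diff (F.g f H j) y p = p i := by
  simp only [diff, h, xorP]
  cases y i <;> cases p i <;> cases c <;> rfl

/-- No variable has hash 0, so in an unused slot the function does not depend on its argument. -/
theorem Fd.diff_of_blk {F : Fd n} {f : BoolFun n} (hH : ∀ i : Fin n, 1 ≤ H i) {j : ℕ}
    (hj : F.blk j = 0) (y p : Fin n → Bool) : diff (F.g f H j) y p = false := by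
  have : ∀ z, F.g f H j z = f (F.wit j) := by
    intro z
    simp only [Fd.g]
    congr 1
    funext i
    have := hH i
    rw [if_neg (by omega)]
  simp [diff, this]

theorem testOK_of_coord {g : BoolFun n} {o : Option (Fin n)} (h : ∀ y p, diff g y p = coordOr o p)
    (y u v : Fin n → Bool) : TestOK g y u v := by
  simp only [TestOK, h]
  cases o <;> simp [coordOr, xorP, andP]

/-- The first hybrid at which the value is that of `x`. -/
theorem Fd.newBlock_spec (f : BoolFun n) (F : Fd n) {B : ℕ} (hB : ∀ i : Fin n, H i < B)
    (hB1 : 1 ≤ B) (x : Fin n → Bool) :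
    f (F.part H (F.newBlock f H x) x) = f x ∧ F.newBlock f H x < B ∧
      ∀ h < F.newBlock f H x, f (F.part H h x) ≠ f x := by
  have hmem : B - 1 ∈ {h | f (F.part H h x) = f x} := by
    simp only [Set.mem_setOf_eq]
    congr 1
    funext i
    have := hB i
    simp [Fd.part, show H i ≤ B - 1 by omega]
  refine ⟨Nat.sInf_mem ⟨_, hmem⟩, ?_, fun h hh => Nat.notMem_of_lt_sInf hh⟩
  have := Nat.sInf_le hmem
  simp only [Fd.newBlock]
  omega

/-- The hybrid at the new block and its predecessor have different values and differ only on that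
block, so a variable of the tree lies there; injectivity of the hash makes it the only one. Outside
the block the witness is fixed, so the new slot depends on this variable alone and is not constant.
-/
theorem Fd.Good.discover {F : Fd n} (hF : F.Good T H) (hH : ∀ i : Fin n, 1 ≤ H i)
    (hinj : Set.InjOn (fun i : Fin n => H i) (treeVars T)) {x : Fin n → Bool}
    (hx : T.eval (F.proj H x) ≠ T.eval x) : (F.discover T.eval H x).Good T H := by
  -- Any strict bound on the hash values serves: it only ensures that the last hybrid is `x` itself.
  obtain ⟨h1, -, h3⟩ := F.newBlock_spec (H := H) T.eval (B := (∑ i : Fin n, H i) + 1)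
    (fun i => Nat.lt_succ_of_le (Finset.single_le_sum (f := fun i : Fin n => H i)
      (fun _ _ => Nat.zero_le _) (Finset.mem_univ i))) (by omega) x
  set h₀ := F.newBlock T.eval H x with hh₀
  -- The hybrid at 0 is the projection, since no variable has hash 0; the discrepancy excludes it,
  -- and a preceding hybrid exists.
  have hpos : h₀ ≠ 0 := by
    intro h0
    rw [h0] at h1
    apply hx
    rw [← h1]
    congr 1
    funext i
    have := hH i
    simp [Fd.proj, Fd.part, show ¬ H i = 0 by omega]
  have h2 := h3 (h₀ - 1) (by omega)
  set a := F.part H h₀ x with ha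
  set b := F.part H (h₀ - 1) x with hb
  have hab : ∀ i : Fin n, H i ≠ h₀ → a i = b i := by
    intro i hi
    simp only [ha, hb, Fd.part]
    congr 2
    rw [decide_eq_decide]
    omega
  have hne : ∃ i ∈ treeVars T, a i ≠ b i := by
    by_contra hcon
    push Not at hcon
    exact h2 (by rw [← h1]; exact (DTree_eval_congr T hcon).symm)
  obtain ⟨i, hi, hiab⟩ := hne
  have hHi : H i = h₀ := by
    by_contra h
    exact hiab (hab i h)
  -- On a marked block both hybrids would carry the bits of `x`.
  have hmark : F.mark h₀ = false := by
    by_contra h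
    rw [Bool.not_eq_false] at h
    apply hiab
    simp [ha, hb, Fd.part, hHi, h]
  have hnew : ∀ j < F.k, F.blk j ≠ h₀ := by
    intro j hj h
    have := (hF.mark h₀).2 ⟨j, hj, h⟩
    rw [hmark] at this
    exact absurd this (by simp)
  have hblk : ∀ j < F.k, (F.discover T.eval H x).blk j = F.blk j := by
    intro j hj
    simp [Fd.discover, Function.update_of_ne (Nat.ne_of_lt hj)]
  have hg : ∀ j < F.k, (F.discover T.eval H x).g T.eval H j = F.g T.eval H j := by
    intro j hj
    funext p
    simp [Fd.g, Fd.discover, Function.update_of_ne (Nat.ne_of_lt hj)]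
  have hk : (F.discover T.eval H x).blk F.k = h₀ := by simp [Fd.discover, hh₀]
  constructor
  · intro j hj
    rcases Nat.lt_succ_iff_lt_or_eq.1 hj with hj | rfl
    · rw [hblk j hj, hg j hj]
      exact hF.lit j hj
    · refine ⟨i, hi, by rw [hHi, hk], ?_⟩
      set G := (F.discover T.eval H x).g T.eval H F.k with hG
      have hGdef : ∀ p, G p = T.eval fun i => if H i = h₀ then p i else a i := by
        intro p
        simp [hG, Fd.g, Fd.discover, ← hh₀, ← ha]
      have hdep : ∀ p p' : Fin n → Bool, p i = p' i → G p = G p' := by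
        intro p p' hpp
        rw [hGdef, hGdef]
        refine DTree_eval_congr T fun i' hi' => ?_
        by_cases hb : H i' = h₀
        · obtain rfl : i' = i := hinj hi' hi (hb.trans hHi.symm)
          simp [hb, hpp]
        · simp [hb]
      have e1 : G a = T.eval a := by rw [hGdef]; congr 1; funext i'; simp
      have e2 : G b = T.eval b := by
        rw [hGdef]; congr 1; funext i'
        by_cases hb : H i' = h₀
        · simp [hb]
        · simp [hb, hab i' hb]
      have hval : G a ≠ G b := by rw [e1, e2, h1]; exact fun h => h2 h.symm
      -- The sign is read off at the predecessor hybrid; any other value of bit `i` is the one at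
      -- `a`.
      refine ⟨G b ^^ b i, fun p => ?_⟩
      by_cases hp : p i = b i
      · rw [hdep p b hp, hp]; cases G b <;> cases b i <;> rfl
      · have hp' : p i = a i := by
          revert hp hiab; cases p i <;> cases b i <;> cases a i <;> simp
        rw [hdep p a hp', hp']
        revert hval hiab
        cases G a <;> cases G b <;> cases a i <;> cases b i <;> simp
  · intro j hj
    have hj' : F.k + 1 ≤ j := hj
    have h1 : j ≠ F.k := by omega
    simpa [Fd.discover, Function.update_of_ne h1] using hF.rest j (by omega)
  · intro h
    by_cases hh : h = h₀
    · subst hh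
      simp only [Fd.discover, ← hh₀, Function.update_self, true_iff]
      exact ⟨F.k, Nat.lt_succ_self _, by simp⟩
    · simp only [Fd.discover, ← hh₀, Function.update_of_ne hh, hF.mark h]
      constructor
      · rintro ⟨j, hj, hj'⟩
        exact ⟨j, by omega, by rw [Function.update_of_ne (Nat.ne_of_lt hj)]; exact hj'⟩
      · rintro ⟨j, hj, hj'⟩
        rcases Nat.lt_succ_iff_lt_or_eq.1 hj with hj | rfl
        · rw [Function.update_of_ne (Nat.ne_of_lt hj)] at hj'
          exact ⟨j, hj, hj'⟩
        · rw [Function.update_self] at hj'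
          exact absurd hj'.symm hh
  · intro j hj j' hj' h
    rcases Nat.lt_succ_iff_lt_or_eq.1 hj with hj | rfl <;>
      rcases Nat.lt_succ_iff_lt_or_eq.1 hj' with hj' | rfl
    · rw [hblk j hj, hblk j' hj'] at h
      exact hF.inj j hj j' hj' h
    · rw [hblk j hj, hk] at h
      exact absurd h (hnew j hj)
    · rw [hblk j' hj', hk] at h
      exact absurd h.symm (hnew j' hj')
    · rfl

/-- The literals of a table form passes through all literals. -/
theorem lit_passes {s : ℕ} (a : ℕ) (v : ℕ) (hv : v < s) (b : Bool) :
    ∃ i, a * (2 * s) ≤ i ∧ i < (a + 1) * (2 * s) ∧ i / 2 % s = v ∧ decide (i % 2 = 1) = b := by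
  refine ⟨a * (2 * s) + 2 * v + b.toNat, by omega, ?_, ?_, ?_⟩
  · have h1 : (a + 1) * (2 * s) = a * (2 * s) + 2 * s := by ring
    have : b.toNat ≤ 1 := Bool.toNat_le b
    omega
  · have : (a * (2 * s) + 2 * v + b.toNat) / 2 = v + s * a := by
      have h1 : b.toNat ≤ 1 := Bool.toNat_le b
      have h2 : a * (2 * s) = 2 * (s * a) := by ring
      omega
    rw [this, Nat.add_mul_mod_self_left, Nat.mod_eq_of_lt hv]
  · have h2 : a * (2 * s) = 2 * (s * a) := by ring
    cases b
    · simp; omega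
    · simp; omega

/-- Without a discrepancy the label of `x` is the value of the tree at the projection of `x`. There
each variable of the tree is the bit of its slot or zero, so substitution turns the tree into one
over the slots that explains the table. -/
theorem Fd.Good.pass {F : Fd n} (hF : F.Good T H) (hH : ∀ i : Fin n, 1 ≤ H i)
    (hinj : Set.InjOn (fun i : Fin n => H i) (treeVars T)) {s r q : ℕ} (hT : T.size ≤ s)
    (hr : s < 2 ^ (r + 1)) {w : ℕ → Row n} (hw : ∀ t < q, ¬ F.Disc T.eval H (w t)) :
    F.Pass T.eval H s (2 * s * s) r q w := by
  classical
  have hcard := treeVars_card T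
  have hk := hF.k_le
  refine ⟨hw, fun t _ j _ => ?_, ?_⟩
  · by_cases hj : j < F.k
    · obtain ⟨i, hi, -, c, hc⟩ := hF.lit j hj
      exact testOK_of_coord (o := some i) (fun y p => Fd.Good.diff_of_lt hc y p) _ _ _
    · exact testOK_of_coord (o := none)
        (fun y p => Fd.diff_of_blk hH (hF.rest j (not_lt.1 hj)) y p) _ _ _
  · -- rename the variables of the tree to the slots
    have hσ : ∀ i : Fin n, ∃ o : Option (Fin s), i ∈ treeVars T → ∀ x y : Fin n → Bool,
        F.proj H x i = coordOr o fun v => diff (F.g T.eval H v) y x := by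
      intro i
      by_cases hm : F.mark (H i) = true
      · obtain ⟨j, hj, hji⟩ := (hF.mark _).1 hm
        refine ⟨some ⟨j, by omega⟩, fun hi x y => ?_⟩
        obtain ⟨i', hi', h1, c, hc⟩ := hF.lit j hj
        obtain rfl : i' = i := hinj hi' hi (h1.trans hji)
        simp [coordOr, Fd.proj, hm, Fd.Good.diff_of_lt hc]
      · refine ⟨none, fun hi x y => ?_⟩
        simp [coordOr, Fd.proj, hm]
    choose σ hσ using hσ
    obtain ⟨T', h1, h2⟩ := exists_subst σ T
    refine Tab.R_of_cons _ (s := s) (P := s) (w := 2 * s) (by simp [Fd.tab]; ring)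
      (fun a _ v hv b => lit_passes a v hv b) r _ T' (by omega) (by omega) fun t ht _ => ?_
    have := hw t ht
    simp only [Fd.Disc, not_not] at this
    simp only [Fd.tab]
    rw [← this]
    exact h2 _ _ fun i hi => hσ i hi _ _

/-- With `m` rounds to go, either a round has passed or the variables of the tree number less than
the found blocks plus `m`. A round with a discrepancy adds a block, any other round passes, and at
`m = 0` the second case contradicts `Fd.Good.k_le`. -/
theorem rounds_complete {D : PMF (Fin n → Bool)} (hH : ∀ i : Fin n, 1 ≤ H i)
    (hinj : Set.InjOn (fun i : Fin n => H i) (treeVars T)) {s r q : ℕ} (hT : T.size ≤ s)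
    (hr : s < 2 ^ (r + 1)) (m : ℕ) : ∀ st : Fd n × Bool, 
    (st.2 = true ∨ (st.1.Good T H ∧ (treeVars T).card < st.1.k + m)) →
      ∀ st' ∈ (rounds T.eval D H s (2 * s * s) r q m st).support, st'.2 = true := by
  classical
  induction m with
  | zero =>
    rintro st hst st' hst'
    simp only [rounds, PMF.support_pure, Set.mem_singleton_iff] at hst'
    subst hst'
    rcases hst with h | ⟨h, h'⟩
    · exact h
    · have := h.k_le
      omega
  | succ m ih =>
    intro st hst st' hst'
    obtain ⟨w, -, hst'⟩ := (PMF.mem_support_bind_iff _ _ _).1 hst'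
    refine ih _ ?_ st' hst'
    rcases hst with h | ⟨h, h'⟩
    · left; simp [h]
    · by_cases hd : ∃ t, t < q ∧ st.1.Disc T.eval H (w t)
      · right
        have hnext : st.1.next T.eval H q w = st.1.discover T.eval H (w (Nat.find hd)).x := by
          simp only [Fd.next]
          rw [dif_pos hd]
        simp only [hnext]
        refine ⟨h.discover hH hinj (Nat.find_spec hd).2, ?_⟩
        simp only [Fd.discover]
        omega
      · left
        push Not at hd
        have := h.pass hH hinj hT hr hd
        simp [this]

/-- The tester accepts small trees unless the hash has a collision. -/
theorem tester_complete {D : PMF (Fin n → Bool)} {s r q τ : ℕ} (hT : T.size ≤ s)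
    (hr : s < 2 ^ (r + 1)) :
    1 - (s : ℝ) ^ 2 * (1 / 2) ^ τ ≤ prob (tester T.eval D s (2 * s * s) r q τ) {st | st.2 = true} := by
  have hcard := treeVars_card T
  have h1 : prob (tester T.eval D s (2 * s * s) r q τ) {st | st.2 = true}ᶜ ≤
      prob (iid (hashFrom τ 1) n fun _ => 0)
        {H | ¬ Set.InjOn (fun i : Fin n => H i) (treeVars T)} + 0 := by
    have h2 := prob_bind_le (iid (hashFrom τ 1) n fun _ => 0)
      (fun H => rounds T.eval D H s (2 * s * s) r q (s + 1) (Fd.init n, false)) {st | st.2 = true}ᶜ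
      -- Positivity of the hash values is only known on the support; the complement is added as a
      -- null event.
      ({H | ¬ Set.InjOn (fun i : Fin n => H i) (treeVars T)} ∪
        (iid (hashFrom τ 1) n fun _ => 0).supportᶜ) (c := 0) le_rfl (fun H hH => by
        simp only [Set.mem_union, Set.mem_setOf_eq, not_or, not_not, Set.mem_compl_iff] at hH
        refine le_of_eq (prob_eq_zero _ fun st' hst' h => h ?_)
        refine rounds_complete (fun i => ?_) hH.1 hT hr (s + 1) _ (Or.inr ⟨Fd.good_init, ?_⟩) st' hst'
        · have := hashFrom_support τ 1 _ (iid_support_lt _ _ _ _ hH.2 i i.2)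
          have h3 := Nat.one_le_two_pow (n := τ)
          omega
        · simp only [Fd.init]; omega)
    refine h2.trans (add_le_add_left ((prob_union_le _ _ _).trans ?_) 0)
    rw [prob_eq_zero _ (S := (iid (hashFrom τ 1) n fun _ => 0).supportᶜ) (fun a ha h => h ha),
      add_zero]
  have h3 := prob_not_injOn_le τ n (treeVars T)
  have h4 := prob_add_compl (tester T.eval D s (2 * s * s) r q τ) {st | st.2 = true}
  have h5 : ((treeVars T).card : ℝ) ^ 2 * (1 / 2) ^ τ ≤ (s : ℝ) ^ 2 * (1 / 2) ^ τ := by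
    refine mul_le_mul_of_nonneg_right (pow_le_pow_left₀ (Nat.cast_nonneg _) ?_ 2) (by positivity)
    exact_mod_cast (by omega : (treeVars T).card ≤ s)
  linarith

end completeness

/-! ### The program -/

namespace Cmd

/-- `x := y xor z` for bits `y` and `z`. -/
def xorC (x y z t : Var) : Cmd := .sub x y z ;; .sub t z y ;; .add x x t

/-- No operation. -/
def skip : Cmd := .set .d 0

/-- Constants, `r = log₂ s`, `W` and `W2`. -/
def param1 (C : ℕ) : Cmd :=
  .set .one 1 ;; .set .two 2 ;; .set .p 1 ;; .set .cst C ;;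
  -- `p` is doubled and `r` incremented as long as `2p ≤ s`; `s` iterations are more than enough.
  .rep .k1 .s (.add .t .p .p ;; .sub .d .t .s ;;
    .ite .d skip (.add .p .t .zero ;; .add .r .r .one)) ;;
  .rep .k1 .s (.add .W .W .s ;; .add .W .W .s) ;;
  .add .W2 .W .W ;; .add .W2 .W2 .one

/-- `L = W2 ^ r`. -/
def param2 : Cmd :=
  .set .L 1 ;; .rep .k1 .r (.set .t 0 ;; .rep .k2 .W2 (.add .t .t .L) ;; .add .L .t .zero)

/-- The number `q` of rows and the number `tau` of hash bits. -/
def param3 (Ct : ℕ) : Cmd :=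
  -- `q = N · C · s · L`, and `2 + 2r` of the hash bits outweigh the factor `s²` of the pairs,
  -- leaving the collision probability `2^(-Ct)`.
  .rep .k1 .s (.add .e .e .L) ;; .rep .k1 .cst (.add .c .c .e) ;; .rep .k1 .N (.add .q .q .c) ;;
  .set .tau Ct ;; .add .tau .tau .two ;; .add .tau .tau .r ;; .add .tau .tau .r

/-- The number of blocks, offsets, and the list of literals. -/
def param4 : Cmd :=
  .set .m2 2 ;; .rep .k1 .tau (.add .m2 .m2 .m2) ;;
  .rep .k1 .s (.add .qs .qs .q) ;; .rep .k1 .s (.add .sn .sn .n) ;; .rep .k1 .r (.add .rq .rq .q) ;;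
  .add .s1 .s .one ;; .set .c 0 ;;
  -- There are `s` passes over the `s` slots, each slot with sign 0 and then 1. Sign 0 is not
  -- written: the memory starts at zero.
  .rep .k1 .s (.set .t 0 ;; .rep .k2 .s (.st .LV .c .t ;; .add .c .c .one ;; .st .LV .c .t ;;
    .st .LP .c .one ;; .add .c .c .one ;; .add .t .t .one))

/-- The random hash of the variables. -/
def hashC : Cmd :=
  .rep .ki .n (.set .h 1 ;; .rep .k1 .tau (.flip .b ;; .add .h .h .h ;; .add .h .h .b) ;;
    .st .H .ki .h)

/-- A uniform point. -/
def drawPt (a : Arr) : Cmd := .rep .ki .n (.flip .b ;; .st a .ki .b)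

/-- A random example. -/
def drawEx : Cmd := .smp .lx ;; .rep .ki .n (.ldB .xx .ki ;; .st .X .ki .xx)

/-- The randomness of a row. -/
def drawRow : Cmd := drawEx ;; drawPt .Y ;; drawPt .U ;; drawPt .V

/-- Project the example to the found blocks. -/
def fillProj : Cmd :=
  .rep .ki .n (.ld .h .H .ki ;; .ld .b .MK .h ;; .ite .b (.ld .xx .X .ki) (.set .xx 0) ;;
    .stB .ki .xx)

/-- The hybrid up to block `hh`. -/
def fillPart : Cmd :=
  .rep .ki .n (.ld .h .H .ki ;; .ld .b .MK .h ;; .sub .d .h .hh ;; .ite .d skip (.set .b 1) ;;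
    .ite .b (.ld .xx .PD .ki) (.set .xx 0) ;; .stB .ki .xx)

/-- Put a point into the block of the current slot. -/
def fillBlock (a : Arr) : Cmd :=
  .rep .ki .n (.ld .h .H .ki ;; xorC .d .h .bj .d2 ;;
    .ite .d (.add .wi .wp .ki ;; .ld .xx .WT .wi) (.ld .xx a .ki) ;; .stB .ki .xx)

/-- The points at which the slots are evaluated. -/
def points : Cmd :=
  .rep .ki .n (.ld .xx .X .ki ;; .ld .yy .Y .ki ;; .ld .uu .U .ki ;; .ld .c .V .ki ;;
    xorC .d .yy .uu .t ;; .st .P1 .ki .d ;; xorC .d2 .yy .c .t ;; .st .P2 .ki .d2 ;;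
    -- The product of two bits is the truncated difference `u + v - 1`.
    xorC .h .d .c .t ;; .st .P3 .ki .h ;; .add .b .uu .c ;; .sub .b .b .one ;;
    xorC .h .yy .b .t ;; .st .P4 .ki .h ;; xorC .h .yy .xx .t ;; .st .P5 .ki .h)

/-- Tests of a slot. -/
def slotTests : Cmd :=
  xorC .b .w0 .w1 .t ;; xorC .c .w0 .w2 .t ;; xorC .d .w0 .w3 .t ;; xorC .g .w0 .w4 .t ;;
  xorC .h .b .c .t ;; xorC .o .h .d .t ;; .add .bad .bad .o ;;
  .add .o .b .c ;; .sub .o .o .one ;; xorC .h .o .g .t ;; .add .bad .bad .h ;;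
  xorC .h .w0 .w5 .t ;; .st .TB .tp .h

/-- Evaluation of a slot at the six points. -/
def slotEval : Cmd :=
  fillBlock .Y ;; .qry .w0 ;; fillBlock .P1 ;; .qry .w1 ;; fillBlock .P2 ;; .qry .w2 ;;
  fillBlock .P3 ;; .qry .w3 ;; fillBlock .P4 ;; .qry .w4 ;; fillBlock .P5 ;; .qry .w5

/-- One slot. -/
def slot : Cmd :=
  -- The loop counts down, so the pointers to the witness and to the table entry start past the end
  -- and are decremented first.
  .sub .wp .wp .n ;; .sub .tp .tp .one ;; .ld .bj .BLK .kj ;; slotEval ;; slotTests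

/-- Compare the example with its projection. -/
def checkDisc : Cmd :=
  fillProj ;; .qry .e ;; xorC .d .e .lx .d2 ;;
  .ite .d (.set .flag 1 ;; .add .lp .lx .zero ;; .rep .ki .n (.ld .xx .X .ki ;; .st .PD .ki .xx)) skip

/-- The deterministic part of a row. -/
def rowDet : Cmd :=
  checkDisc ;; points ;; .add .wp .sn .zero ;; .rep .kj .s slot ;; .st .LB .kt .lx

/-- The search for a new block. -/
def search : Cmd :=
  .set .hh 0 ;; .set .fnd 0 ;;
  .rep .k1 .m2 (.ite .fnd skip (fillPart ;; .qry .e ;; xorC .d .e .lp .d2 ;;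
    .ite .d (.add .hh .hh .one) (.set .fnd 1)))

/-- Find and record a new block. -/
def discover : Cmd :=
  search ;; .st .BLK .k .hh ;; .st .MK .hh .one ;;
  .rep .ki .n (.ldB .xx .ki ;; .add .wi .kn .ki ;; .st .WT .wi .xx) ;;
  .add .kn .kn .n ;; .add .k .k .one

/-- Restrict the current set by literal `g`, one level down. -/
def downC : Cmd :=
  -- The set of level `l` occupies the `q` cells from `l · q` on; `o` and `o2` are the offsets of
  -- the current and the next lower level, and `c` walks up the rows of the table in the column of
  -- the literal.
  .ld .uu .LV .g ;; .ld .yy .LP .g ;; .sub .o2 .o .q ;; .add .c .uu .qs ;;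
  .rep .kt .q (.sub .c .c .s ;; .ld .b .TB .c ;; xorC .d .b .yy .t ;; .add .p .o .kt ;;
    .ld .h .S .p ;; .ite .d (.set .h 0) skip ;; .add .p .o2 .kt ;; .st .S .p .h) ;;
  .sub .l .l .one ;; .add .o .o2 .zero

/-- Remove the examples satisfying literal `g`. -/
def upC : Cmd :=
  .ld .uu .LV .g ;; .ld .yy .LP .g ;; .add .c .uu .qs ;;
  .rep .kt .q (.sub .c .c .s ;; .ld .b .TB .c ;; xorC .d .b .yy .t ;; .add .p .o .kt ;;
    .ite .d skip (.st .S .p .zero))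

/-- Test whether the current set has a single label. -/
def pureC : Cmd :=
  .set .xx 0 ;; .set .e 0 ;;
  .rep .kt .q (.add .p .o .kt ;; .ld .h .S .p ;;
    .ite .h (.ld .b .LB .kt ;; .ite .b (.set .xx 1) (.set .e 1)) skip) ;;
  -- The result is 0 exactly when both labels have been seen.
  .add .d .xx .e ;; .sub .d .d .one ;; .sub .res .one .d

/-- A step in calling mode. -/
def callC : Cmd :=
  .ite .l (.st .DG .l .zero ;; .set .g 0 ;; downC) (pureC ;; .set .dir 1)

/-- A step in returning mode. -/
def retC : Cmd :=
  .sub .d .r .l ;;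
  .ite .d (.add .l .l .one ;; .add .o .o .q ;; .ld .g .DG .l ;; .ite .res upC skip ;;
    .add .g .g .one ;; .st .DG .l .g ;; .sub .d .W .g ;; .ite .d (downC ;; .set .dir 0) pureC) skip

/-- A step of the consistency search. -/
def stepC : Cmd := .ite .dir retC callC

/-- The consistency search. -/
def searchInit : Cmd :=
  .add .o .rq .zero ;; .rep .kt .q (.add .c .o .kt ;; .st .S .c .one) ;;
  .add .l .r .zero ;; .set .dir 0 ;; .set .res 0

/-- The end of a round without discrepancy. -/
def finish : Cmd :=
  searchInit ;; .rep .k1 .L stepC ;; .ite .bad skip (.ite .res (.set .acc 1) skip)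

/-- A round. -/
def round : Cmd :=
  .set .flag 0 ;; .set .bad 0 ;; .add .tp .qs .zero ;;
  .rep .kt .q (drawRow ;; rowDet) ;; .ite .flag discover finish

/-- The main part, after the computation of the parameters. -/
def mainC : Cmd := hashC ;; .rep .kd .s1 round

/-- The whole program, up to the initialization of the address cell. -/
def prog (C Ct : ℕ) : Cmd :=
  -- The register `n` is cell 0, where acceptance is read; it is overwritten by the verdict at the
  -- very end.
  param1 C ;; param2 ;; param3 Ct ;; param4 ;; mainC ;; .add .n .acc .zero

theorem prog_wf (C Ct : ℕ) : (prog C Ct).wf = true := by rfl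

end Cmd

/-! ### Deterministic loops -/

section loops

variable {n : ℕ} {f : BoolFun n}

/-- Everything not written by `c` is the same in both states. -/
def Frame (c : Cmd) (σ σ' : HS) : Prop :=
  (∀ x, c.writes x = false → σ'.v x = σ.v x) ∧ ∀ a, c.writesA a = false → σ'.A a = σ.A a

theorem frame_run (c : Cmd) (hd : c.det = true) (σ : HS) : Frame c σ (c.run f σ) :=
  ⟨fun _ hx => c.run_v hd hx σ, fun _ ha => c.run_A hd ha σ⟩

/-- The invariant rule for loops, where `I j` is asserted with `j` iterations left. The step may
also use that everything not written by the loop has its initial value. -/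
theorem rep_inv {C : Cmd} {k r : Var} {c : Cmd} (hC : C = .rep k r c) (hd : C.det = true) (σ : HS)
    (I : ℕ → HS → Prop) (h0 : I (σ.v r) (σ.setV k (σ.v r) 2))
    (hstep : ∀ j < σ.v r, ∀ σ', Frame C σ σ' → I (j + 1) σ' → I j (c.run f (σ'.setV k j 3))) :
    ∃ σ', Frame C σ σ' ∧ I 0 σ' ∧ C.run f σ = σ'.tick 1 := by
  subst hC
  have key : ∀ j ≤ σ.v r, ∀ σ', Frame (.rep k r c) σ σ' → I j σ' →
      ∃ σ'', Frame (.rep k r c) σ σ'' ∧ I 0 σ'' ∧ iterRun (c.run f) k j σ' = σ''.tick 1 := by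
    intro j
    induction j with
    | zero => intro _ σ' hF hI; exact ⟨σ', hF, hI, rfl⟩
    | succ j ih =>
      intro hj σ' hF hI
      refine ih (by omega) _ ⟨fun x hx => ?_, fun a ha => ?_⟩ (hstep j (by omega) σ' hF hI)
      · simp only [Cmd.writes, Bool.or_eq_false_iff, decide_eq_false_iff_not] at hx
        rw [c.run_v hd hx.2, ← hF.1 x (by simp [Cmd.writes, hx.1, hx.2])]
        simp [HS.setV, Ne.symm hx.1]
      · rw [c.run_A hd ha, ← hF.2 a ha]; rfl
  refine key _ le_rfl _ ⟨fun x hx => ?_, fun a ha => rfl⟩ h0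
  simp only [Cmd.writes, Bool.or_eq_false_iff, decide_eq_false_iff_not] at hx
  simp [HS.setV, Ne.symm hx.1]

/-- A loop that increments a register. -/
theorem rep_add {k r x y : Var} (hkx : k ≠ x) (hky : k ≠ y) (hxy : x ≠ y) (σ : HS) :
    ((Cmd.rep k r (.add x x y)).run f σ).v x = σ.v x + σ.v r * σ.v y := by
  obtain ⟨σ', hF, hI, he⟩ := rep_inv (f := f) (k := k) (r := r) (c := .add x x y) rfl rfl σ
    (fun j τ => τ.v x + j * σ.v y = σ.v x + σ.v r * σ.v y)
    (by simp [HS.setV, Function.update_of_ne hkx.symm])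
    (by
      intro j _ τ hF hI
      have := hF.1 y (by simp [Cmd.writes, hkx, hky, hxy])
      simp only [Cmd.run, HS.setV, Function.update_self, Function.update_of_ne hkx.symm,
        Function.update_of_ne hky.symm, this]
      rw [← hI]; ring)
  rw [he]
  rw [Nat.zero_mul, Nat.add_zero] at hI
  exact hI

theorem toNat_xor (a b : Bool) : a.toNat - b.toNat + (b.toNat - a.toNat) = (a ^^ b).toNat := by
  cases a <;> cases b <;> rfl

theorem toNat_and (a b : Bool) : a.toNat + b.toNat - 1 = (a && b).toNat := by
  cases a <;> cases b <;> rfl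

/-- Loops that fill the buffer. -/
theorem fill_buffer_val {C c : Cmd} (hC : C = .rep .ki .n c) (hd : C.det = true) (σ : HS) (hn : σ.v .n = n) (p : Fin n → Bool)
    (h : ∀ i : Fin n, ∀ τ, Frame C σ τ →
      ((c.run f (τ.setV .ki i 3)).B = Function.update τ.B i (p i).toNat)) :
    ∀ i : Fin n, (C.run f σ).B i = (p i).toNat := by
  obtain ⟨σ', hF, hI, he⟩ := rep_inv (f := f) hC hd σ
    (fun j τ => ∀ i : Fin n, j ≤ i → τ.B i = (p i).toNat)
    (by intro i hi; have := i.2; omega)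
    (by
      intro j hj τ hF hI i hi
      rw [hn] at hj
      rw [h ⟨j, hj⟩ τ hF]
      by_cases hij : (i : ℕ) = j
      · have : i = ⟨j, hj⟩ := Fin.ext hij
        subst this
        simp
      · rw [Function.update_of_ne hij]
        exact hI i (by omega))
  rw [he]
  exact fun i => hI i (Nat.zero_le _)

theorem bufPoint_of_val {B : ℕ → ℕ} {p : Fin n → Bool} (h : ∀ i : Fin n, B i = (p i).toNat) :
    bufPoint n B = p := by
  funext i
  simp only [bufPoint, h]
  cases p i <;> rfl

theorem fill_buffer {C c : Cmd} (hC : C = .rep .ki .n c) (hd : C.det = true) (σ : HS)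
    (hn : σ.v .n = n) (p : Fin n → Bool)
    (h : ∀ i : Fin n, ∀ τ, Frame C σ τ →
      ((c.run f (τ.setV .ki i 3)).B = Function.update τ.B i (p i).toNat)) :
    bufPoint n (C.run f σ).B = p :=
  bufPoint_of_val (fill_buffer_val hC hd σ hn p h)

/-- The array `a` starts with the point `p`. -/
def PtArr (σ : HS) (a : Arr) (p : Fin n → Bool) : Prop := ∀ i : Fin n, σ.A a i = (p i).toNat

end loops

/-! ### Verification of the program -/

/-- Parameters of a run. -/
structure Prm : Type where
  s : ℕ
  W : ℕ
  r : ℕ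
  q : ℕ
  m2 : ℕ

/-- The parameters, the hash and the literals are stored in the registers and arrays. -/
structure Env (n : ℕ) (P : Prm) (H : ℕ → ℕ) (σ : HS) : Prop where
  vn : σ.v .n = n
  one : σ.v .one = 1
  zero : σ.v .zero = 0
  s : σ.v .s = P.s
  W : σ.v .W = P.W
  r : σ.v .r = P.r
  q : σ.v .q = P.q
  L : σ.v .L = (2 * P.W + 1) ^ P.r
  m2 : σ.v .m2 = P.m2
  qs : σ.v .qs = P.q * P.s
  sn : σ.v .sn = P.s * n
  rq : σ.v .rq = P.r * P.q
  hash : ∀ i : Fin n, σ.A .H i = H i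
  LV : ∀ i < P.W, σ.A .LV i = i / 2 % P.s
  LP : ∀ i < P.W, σ.A .LP i = i % 2

/-- The command does not write the environment. -/
def Cmd.keepsEnv (c : Cmd) : Bool :=
  [Var.n, .one, .zero, .s, .W, .r, .q, .L, .m2, .qs, .sn, .rq].all (fun x => !c.writes x) &&
    [Arr.H, .LV, .LP].all fun a => !c.writesA a

/-- The side condition is a syntactic check that evaluates to `true` on each concrete command, so
the environment is carried across by `rfl`. -/
theorem Env.frame {n : ℕ} {P : Prm} {H : ℕ → ℕ} {c : Cmd} {σ σ' : HS} (hE : Env n P H σ)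
    (hF : Frame c σ σ') (hc : c.keepsEnv = true) : Env n P H σ' := by
  simp only [Cmd.keepsEnv, List.all_cons, List.all_nil, Bool.and_true, Bool.and_eq_true,
    Bool.not_eq_true'] at hc
  obtain ⟨⟨h1, h2, h3, h4, h5, h6, h7, h8, h9, h10, h11, h12⟩, a1, a2, a3⟩ := hc
  constructor
  · rw [hF.1 _ h1, hE.vn]
  · rw [hF.1 _ h2, hE.one]
  · rw [hF.1 _ h3, hE.zero]
  · rw [hF.1 _ h4, hE.s]
  · rw [hF.1 _ h5, hE.W]
  · rw [hF.1 _ h6, hE.r]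
  · rw [hF.1 _ h7, hE.q]
  · rw [hF.1 _ h8, hE.L]
  · rw [hF.1 _ h9, hE.m2]
  · rw [hF.1 _ h10, hE.qs]
  · rw [hF.1 _ h11, hE.sn]
  · rw [hF.1 _ h12, hE.rq]
  · rw [hF.2 _ a1]; exact hE.hash
  · rw [hF.2 _ a2]; exact hE.LV
  · rw [hF.2 _ a3]; exact hE.LP

/-- The found blocks are stored in the arrays. -/
structure FdRel {n : ℕ} (F : Fd n) (σ : HS) : Prop where
  k : σ.v .k = F.k
  kn : σ.v .kn = F.k * n
  blk : ∀ j, σ.A .BLK j = F.blk j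
  wit : ∀ j, ∀ i : Fin n, σ.A .WT (j * n + i) = (F.wit j i).toNat
  mark : ∀ h, σ.A .MK h = (F.mark h).toNat

/-- The command does not write the found blocks. -/
def Cmd.keepsFd (c : Cmd) : Bool :=
  [Var.k, .kn].all (fun x => !c.writes x) && [Arr.BLK, .WT, .MK].all fun a => !c.writesA a

theorem FdRel.frame {n : ℕ} {F : Fd n} {c : Cmd} {σ σ' : HS} (hE : FdRel F σ)
    (hF : Frame c σ σ') (hc : c.keepsFd = true) : FdRel F σ' := by
  simp only [Cmd.keepsFd, List.all_cons, List.all_nil, Bool.and_true, Bool.and_eq_true,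
    Bool.not_eq_true'] at hc
  obtain ⟨⟨h1, h2⟩, a1, a2, a3⟩ := hc
  constructor
  · rw [hF.1 _ h1, hE.k]
  · rw [hF.1 _ h2, hE.kn]
  · rw [hF.2 _ a1]; exact hE.blk
  · rw [hF.2 _ a2]; exact hE.wit
  · rw [hF.2 _ a3]; exact hE.mark

theorem PtArr.frame {n : ℕ} {a : Arr} {p : Fin n → Bool} {c : Cmd} {σ σ' : HS} (h : PtArr σ a p)
    (hF : Frame c σ σ') (hc : c.writesA a = false) : PtArr σ' a p := by
  unfold PtArr; rw [hF.2 _ hc]; exact h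

/-! ### Points in the buffer: projections, hybrids and block substitutions -/

section fill

variable {n : ℕ} {f : BoolFun n} {P : Prm} {H : ℕ → ℕ} {F : Fd n}

theorem fillProj_spec {σ : HS} (hE : Env n P H σ) (hF : FdRel F σ) {x : Fin n → Bool}
    (hx : PtArr σ .X x) : bufPoint n (Cmd.fillProj.run f σ).B = F.proj H x := by
  refine fill_buffer rfl rfl σ hE.vn _ fun i τ hτ => ?_
  have h1 := (hE.frame hτ rfl).hash i
  have h2 := (hF.frame hτ rfl).mark (H i)
  have h3 := hx.frame hτ rfl i
  cases hm : F.mark (H i) <;>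
  simp [Cmd.run, HS.setV, HS.setA, HS.setB, HS.tick, h1, h2, h3, hm, Fd.proj]

theorem fillPart_val {σ : HS} (hE : Env n P H σ) (hF : FdRel F σ) {x : Fin n → Bool}
    (hx : PtArr σ .PD x) :
    ∀ i : Fin n, (Cmd.fillPart.run f σ).B i = (F.part H (σ.v .hh) x i).toNat := by
  refine fill_buffer_val rfl rfl σ hE.vn _ fun i τ hτ => ?_
  have h1 := (hE.frame hτ rfl).hash i
  have h2 := (hF.frame hτ rfl).mark (H i)
  have h3 := hx.frame hτ rfl i
  have h4 := hτ.1 .hh rfl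
  by_cases hle : H i ≤ σ.v .hh
  · simp [Cmd.run, Cmd.skip, HS.setV, HS.setA, HS.setB, HS.tick, h1, h2, h3, h4, Fd.part, hle]
  · have : ¬ (H i - σ.v .hh = 0) := by omega
    cases hm : F.mark (H i) <;>
    simp [Cmd.run, Cmd.skip, HS.setV, HS.setA, HS.setB, HS.tick, h1, h2, h3, h4, hm, Fd.part, hle,
      this]

theorem sub_add_sub_eq_zero (a b : ℕ) : a - b + (b - a) = 0 ↔ a = b := by omega

theorem fillBlock_spec {σ : HS} (hE : Env n P H σ) (a : Arr) {p wit : Fin n → Bool} {b off : ℕ}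
    (hb : σ.v .bj = b) (hoff : σ.v .wp = off) (hp : PtArr σ a p)
    (hw : ∀ i : Fin n, σ.A .WT (off + i) = (wit i).toNat) :
    bufPoint n ((Cmd.fillBlock a).run f σ).B = fun i : Fin n => if H i = b then p i else wit i := by
  refine fill_buffer rfl rfl σ hE.vn _ fun i τ hτ => ?_
  have h1 := (hE.frame hτ rfl).hash i
  have h2 := hτ.1 .bj rfl
  have h3 := hp.frame hτ rfl i
  have h4 := hτ.1 .wp rfl
  have h5 := hw i
  rw [← hτ.2 .WT rfl] at h5
  by_cases hib : H i = b
  · simp [Cmd.run, Cmd.xorC, HS.setV, HS.setA, HS.setB, HS.tick, h1, h2, h3, h4, h5, hb, hoff, hib]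
  · have := (sub_add_sub_eq_zero (H i) b).not.2 hib
    simp only [Cmd.run, Cmd.xorC, HS.setV, HS.setA, HS.setB, HS.tick, Function.update_self,
      Function.update_of_ne, ne_eq, reduceCtorEq, not_false_eq_true, h1, h2, h3, h4, h5, hb, hoff,
      this, if_true, hib, if_false, i.2]

theorem points_spec {σ : HS} (hE : Env n P H σ) {ρ : Row n} (hX : PtArr σ .X ρ.x)
    (hY : PtArr σ .Y ρ.y) (hU : PtArr σ .U ρ.u) (hV : PtArr σ .V ρ.v) :
    PtArr (Cmd.points.run f σ) .P1 (xorP ρ.y ρ.u) ∧ PtArr (Cmd.points.run f σ) .P2 (xorP ρ.y ρ.v) ∧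
    PtArr (Cmd.points.run f σ) .P3 (xorP ρ.y (xorP ρ.u ρ.v)) ∧
    PtArr (Cmd.points.run f σ) .P4 (xorP ρ.y (andP ρ.u ρ.v)) ∧
    PtArr (Cmd.points.run f σ) .P5 (xorP ρ.y ρ.x) := by
  obtain ⟨σ', hF, hI, he⟩ := rep_inv (f := f) (C := Cmd.points) rfl rfl σ
    (fun j τ => ∀ i : Fin n, j ≤ i →
      τ.A .P1 i = (xorP ρ.y ρ.u i).toNat ∧ τ.A .P2 i = (xorP ρ.y ρ.v i).toNat ∧
      τ.A .P3 i = (xorP ρ.y (xorP ρ.u ρ.v) i).toNat ∧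
      τ.A .P4 i = (xorP ρ.y (andP ρ.u ρ.v) i).toNat ∧ τ.A .P5 i = (xorP ρ.y ρ.x i).toNat)
    (by intro i hi; have := i.2; rw [hE.vn] at hi; omega)
    (by
      intro j hj τ hτ hI i hi
      rw [hE.vn] at hj
      have e1 := (hE.frame hτ rfl).one
      have hX := hX.frame hτ rfl ⟨j, hj⟩
      have hY := hY.frame hτ rfl ⟨j, hj⟩
      have hU := hU.frame hτ rfl ⟨j, hj⟩
      have hV := hV.frame hτ rfl ⟨j, hj⟩
      simp only at hX hY hU hV
      simp only [Cmd.run, Cmd.xorC, HS.setV, HS.setA, HS.setB, HS.tick, Function.update_self,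
        Function.update_of_ne, ne_eq, reduceCtorEq, not_false_eq_true, e1, hX, hY, hU, hV,
        toNat_xor, toNat_and]
      by_cases hij : (i : ℕ) = j
      · have : i = ⟨j, hj⟩ := Fin.ext hij
        subst this
        simp [xorP, andP]
      · simp only [Function.update_of_ne hij]
        exact hI i (by omega))
  rw [he]
  exact ⟨fun i => (hI i (Nat.zero_le _)).1, fun i => (hI i (Nat.zero_le _)).2.1,
    fun i => (hI i (Nat.zero_le _)).2.2.1, fun i => (hI i (Nat.zero_le _)).2.2.2.1,
    fun i => (hI i (Nat.zero_le _)).2.2.2.2⟩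

theorem fillQry_spec {σ : HS} (hE : Env n P H σ) (hFd : FdRel F σ) (a : Arr) {p : Fin n → Bool} {j : ℕ}
    (hb : σ.v .bj = F.blk j) (hoff : σ.v .wp = j * n) (hp : PtArr σ a p) (x : Var) :
    ((Cmd.qry x).run f ((Cmd.fillBlock a).run f σ)).v x = (F.g f H j p).toNat := by
  have h : ∀ τ, ((Cmd.qry x).run f τ).v x = (f (bufPoint n τ.B)).toNat := by
    intro τ; simp [Cmd.run, HS.setV]
  rw [h, fillBlock_spec hE a hb hoff hp (hFd.wit j)]
  rfl

end fill

/-! ### The slots of one row: evaluations and coordinate tests -/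

section row

variable {n : ℕ} {f : BoolFun n} {P : Prm} {H : ℕ → ℕ} {F : Fd n}

/-- The points of a row are stored. -/
structure Pts (ρ : Row n) (σ : HS) : Prop where
  Y : PtArr σ .Y ρ.y
  P1 : PtArr σ .P1 (xorP ρ.y ρ.u)
  P2 : PtArr σ .P2 (xorP ρ.y ρ.v)
  P3 : PtArr σ .P3 (xorP ρ.y (xorP ρ.u ρ.v))
  P4 : PtArr σ .P4 (xorP ρ.y (andP ρ.u ρ.v))
  P5 : PtArr σ .P5 (xorP ρ.y ρ.x)

/-- The command does not write the points of a row. -/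
def Cmd.keepsPts (c : Cmd) : Bool :=
  [Arr.Y, .P1, .P2, .P3, .P4, .P5].all fun a => !c.writesA a

theorem Pts.frame {ρ : Row n} {c : Cmd} {σ σ' : HS} (h : Pts ρ σ) (hF : Frame c σ σ')
    (hc : c.keepsPts = true) : Pts ρ σ' := by
  simp only [Cmd.keepsPts, List.all_cons, List.all_nil, Bool.and_true, Bool.and_eq_true,
    Bool.not_eq_true'] at hc
  obtain ⟨a1, a2, a3, a4, a5, a6⟩ := hc
  exact ⟨h.Y.frame hF a1, h.P1.frame hF a2, h.P2.frame hF a3, h.P3.frame hF a4, h.P4.frame hF a5,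
    h.P5.frame hF a6⟩

theorem evalAt_spec {σ : HS} (hE : Env n P H σ) (hFd : FdRel F σ) {j : ℕ} (a : Arr)
    {p : Fin n → Bool} (hb : σ.v .bj = F.blk j) (hoff : σ.v .wp = j * n) (hp : PtArr σ a p)
    (x : Var) : ((Cmd.fillBlock a ;; Cmd.qry x).run f σ).v x = (F.g f H j p).toNat :=
  fillQry_spec hE hFd a hb hoff hp x

theorem slotEval_spec {σ : HS} (hE : Env n P H σ) (hFd : FdRel F σ) {j : ℕ} {ρ : Row n}
    (hb : σ.v .bj = F.blk j) (hoff : σ.v .wp = j * n) (hp : Pts ρ σ) :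
    (Cmd.slotEval.run f σ).v .w0 = (F.g f H j ρ.y).toNat ∧
    (Cmd.slotEval.run f σ).v .w1 = (F.g f H j (xorP ρ.y ρ.u)).toNat ∧
    (Cmd.slotEval.run f σ).v .w2 = (F.g f H j (xorP ρ.y ρ.v)).toNat ∧
    (Cmd.slotEval.run f σ).v .w3 = (F.g f H j (xorP ρ.y (xorP ρ.u ρ.v))).toNat ∧
    (Cmd.slotEval.run f σ).v .w4 = (F.g f H j (xorP ρ.y (andP ρ.u ρ.v))).toNat ∧
    (Cmd.slotEval.run f σ).v .w5 = (F.g f H j (xorP ρ.y ρ.x)).toNat := by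
  -- Six evaluations in sequence; each later state is known only through what the preceding command
  -- leaves unchanged and the one value it computes.
  obtain ⟨σ1, e1⟩ : ∃ τ, τ = (Cmd.fillBlock .Y ;; Cmd.qry .w0).run f σ := ⟨_, rfl⟩
  obtain ⟨σ2, e2⟩ : ∃ τ, τ = (Cmd.fillBlock .P1 ;; Cmd.qry .w1).run f σ1 := ⟨_, rfl⟩
  obtain ⟨σ3, e3⟩ : ∃ τ, τ = (Cmd.fillBlock .P2 ;; Cmd.qry .w2).run f σ2 := ⟨_, rfl⟩
  obtain ⟨σ4, e4⟩ : ∃ τ, τ = (Cmd.fillBlock .P3 ;; Cmd.qry .w3).run f σ3 := ⟨_, rfl⟩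
  obtain ⟨σ5, e5⟩ : ∃ τ, τ = (Cmd.fillBlock .P4 ;; Cmd.qry .w4).run f σ4 := ⟨_, rfl⟩
  obtain ⟨σ6, e6⟩ : ∃ τ, τ = (Cmd.fillBlock .P5 ;; Cmd.qry .w5).run f σ5 := ⟨_, rfl⟩
  have hfin : Cmd.slotEval.run f σ = σ6 := by rw [e6, e5, e4, e3, e2, e1]; rfl
  have f1 : Frame _ σ σ1 := e1 ▸ frame_run _ rfl σ
  have f2 : Frame _ σ1 σ2 := e2 ▸ frame_run _ rfl σ1
  have f3 : Frame _ σ2 σ3 := e3 ▸ frame_run _ rfl σ2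
  have f4 : Frame _ σ3 σ4 := e4 ▸ frame_run _ rfl σ3
  have f5 : Frame _ σ4 σ5 := e5 ▸ frame_run _ rfl σ4
  have f6 : Frame _ σ5 σ6 := e6 ▸ frame_run _ rfl σ5
  have E1 := hE.frame f1 rfl
  have E2 := E1.frame f2 rfl
  have E3 := E2.frame f3 rfl
  have E4 := E3.frame f4 rfl
  have E5 := E4.frame f5 rfl
  have G1 := hFd.frame f1 rfl
  have G2 := G1.frame f2 rfl
  have G3 := G2.frame f3 rfl
  have G4 := G3.frame f4 rfl
  have G5 := G4.frame f5 rfl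
  have b1 := (f1.1 .bj rfl).trans hb
  have b2 := (f2.1 .bj rfl).trans b1
  have b3 := (f3.1 .bj rfl).trans b2
  have b4 := (f4.1 .bj rfl).trans b3
  have b5 := (f5.1 .bj rfl).trans b4
  have o1 := (f1.1 .wp rfl).trans hoff
  have o2 := (f2.1 .wp rfl).trans o1
  have o3 := (f3.1 .wp rfl).trans o2
  have o4 := (f4.1 .wp rfl).trans o3
  have o5 := (f5.1 .wp rfl).trans o4
  have p1 := hp.frame f1 rfl
  have p2 := p1.frame f2 rfl
  have p3 := p2.frame f3 rfl
  have p4 := p3.frame f4 rfl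
  have p5 := p4.frame f5 rfl
  have r1 := evalAt_spec (f := f) hE hFd .Y hb hoff hp.Y .w0
  have r2 := evalAt_spec (f := f) E1 G1 .P1 b1 o1 p1.P1 .w1
  have r3 := evalAt_spec (f := f) E2 G2 .P2 b2 o2 p2.P2 .w2
  have r4 := evalAt_spec (f := f) E3 G3 .P3 b3 o3 p3.P3 .w3
  have r5 := evalAt_spec (f := f) E4 G4 .P4 b4 o4 p4.P4 .w4
  have r6 := evalAt_spec (f := f) E5 G5 .P5 b5 o5 p5.P5 .w5
  rw [← e1] at r1
  rw [← e2] at r2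
  rw [← e3] at r3
  rw [← e4] at r4
  rw [← e5] at r5
  rw [← e6] at r6
  rw [hfin]
  refine ⟨?_, ?_, ?_, ?_, ?_, r6⟩
  · rw [f6.1 .w0 rfl, f5.1 .w0 rfl, f4.1 .w0 rfl, f3.1 .w0 rfl, f2.1 .w0 rfl, r1]
  · rw [f6.1 .w1 rfl, f5.1 .w1 rfl, f4.1 .w1 rfl, f3.1 .w1 rfl, r2]
  · rw [f6.1 .w2 rfl, f5.1 .w2 rfl, f4.1 .w2 rfl, r3]
  · rw [f6.1 .w3 rfl, f5.1 .w3 rfl, r4]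
  · rw [f6.1 .w4 rfl, r5]

theorem slotTests_spec {σ : HS} (hone : σ.v .one = 1) {w0 w1 w2 w3 w4 w5 : Bool}
    (h0 : σ.v .w0 = w0.toNat) (h1 : σ.v .w1 = w1.toNat) (h2 : σ.v .w2 = w2.toNat)
    (h3 : σ.v .w3 = w3.toNat) (h4 : σ.v .w4 = w4.toNat) (h5 : σ.v .w5 = w5.toNat) :
    (Cmd.slotTests.run f σ).v .bad = σ.v .bad + (((w0 ^^ w1) ^^ (w0 ^^ w2)) ^^ (w0 ^^ w3)).toNat +
      (((w0 ^^ w1) && (w0 ^^ w2)) ^^ (w0 ^^ w4)).toNat ∧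
    (Cmd.slotTests.run f σ).A .TB = Function.update (σ.A .TB) (σ.v .tp) (w0 ^^ w5).toNat := by
  constructor <;>
  simp only [Cmd.slotTests, Cmd.run, Cmd.xorC, HS.setV, HS.setA, HS.setB, HS.tick,
    Function.update_self, Function.update_of_ne, ne_eq, reduceCtorEq, not_false_eq_true, hone, h0,
    h1, h2, h3, h4, h5, toNat_xor, toNat_and]

/-- The register `bad` adds up the violations of both identities, so it stays zero exactly as long
as all tests hold. -/
theorem testOK_iff (g : BoolFun n) (y u v : Fin n → Bool) (b : ℕ) :
    b + (((g y ^^ g (xorP y u)) ^^ (g y ^^ g (xorP y v))) ^^ (g y ^^ g (xorP y (xorP u v)))).toNat +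
      (((g y ^^ g (xorP y u)) && (g y ^^ g (xorP y v))) ^^ (g y ^^ g (xorP y (andP u v)))).toNat = 0
      ↔ b = 0 ∧ TestOK g y u v := by
  unfold TestOK diff
  generalize g y = a0
  generalize g (xorP y u) = a1
  generalize g (xorP y v) = a2
  generalize g (xorP y (xorP u v)) = a3
  generalize g (xorP y (andP u v)) = a4
  cases a0 <;> cases a1 <;> cases a2 <;> cases a3 <;> cases a4 <;> simp

theorem slot_spec {σ : HS} (hE : Env n P H σ) (hFd : FdRel F σ) {j T : ℕ} {ρ : Row n}
    (hj : σ.v .kj = j) (hoff : σ.v .wp = (j + 1) * n) (htp : σ.v .tp = T + 1) (hp : Pts ρ σ) :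
    (Cmd.slot.run f σ).v .wp = j * n ∧ (Cmd.slot.run f σ).v .tp = T ∧
    ((Cmd.slot.run f σ).v .bad = 0 ↔ σ.v .bad = 0 ∧ TestOK (F.g f H j) ρ.y ρ.u ρ.v) ∧
    (Cmd.slot.run f σ).A .TB = Function.update (σ.A .TB) T (diff (F.g f H j) ρ.y ρ.x).toNat := by
  obtain ⟨σ1, e1⟩ : ∃ τ, τ = (Cmd.sub .wp .wp .n ;; Cmd.sub .tp .tp .one ;; Cmd.ld .bj .BLK .kj).run f σ :=
    ⟨_, rfl⟩
  obtain ⟨σ2, e2⟩ : ∃ τ, τ = Cmd.slotEval.run f σ1 := ⟨_, rfl⟩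
  obtain ⟨σ3, e3⟩ : ∃ τ, τ = Cmd.slotTests.run f σ2 := ⟨_, rfl⟩
  have hfin : Cmd.slot.run f σ = σ3 := by rw [e3, e2, e1]; rfl
  have f1 : Frame _ σ σ1 := e1 ▸ frame_run _ rfl σ
  have f2 : Frame _ σ1 σ2 := e2 ▸ frame_run _ rfl σ1
  have f3 : Frame _ σ2 σ3 := e3 ▸ frame_run _ rfl σ2
  have E1 := hE.frame f1 rfl
  have G1 := hFd.frame f1 rfl
  have p1 := hp.frame f1 rfl
  have b1 : σ1.v .bj = F.blk j := by
    rw [e1]; simp [Cmd.run, HS.setV, hj, hFd.blk]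
  have o1 : σ1.v .wp = j * n := by
    rw [e1]; simp [Cmd.run, HS.setV, hoff, hE.vn, Nat.add_mul]
  have t1 : σ1.v .tp = T := by
    rw [e1]; simp [Cmd.run, HS.setV, htp, hE.one]
  obtain ⟨r0, r1, r2, r3, r4, r5⟩ := slotEval_spec (f := f) E1 G1 b1 o1 p1
  rw [← e2] at r0 r1 r2 r3 r4 r5
  obtain ⟨s1, s2⟩ := slotTests_spec (f := f) (E1.frame f2 rfl).one r0 r1 r2 r3 r4 r5
  rw [← e3] at s1 s2
  rw [hfin]
  refine ⟨?_, ?_, ?_, ?_⟩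
  · rw [f3.1 .wp rfl, f2.1 .wp rfl, o1]
  · rw [f3.1 .tp rfl, f2.1 .tp rfl, t1]
  · rw [s1, f2.1 .bad rfl, f1.1 .bad rfl, testOK_iff]
  · rw [s2, f2.2 .TB rfl, f1.2 .TB rfl, f2.1 .tp rfl, t1]; rfl

theorem slots_spec {σ : HS} (hE : Env n P H σ) (hFd : FdRel F σ) {T : ℕ} {ρ : Row n}
    (hoff : σ.v .wp = P.s * n) (htp : σ.v .tp = T + P.s) (hp : Pts ρ σ) :
    ((Cmd.rep .kj .s Cmd.slot).run f σ).v .tp = T ∧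
    (((Cmd.rep .kj .s Cmd.slot).run f σ).v .bad = 0 ↔
      σ.v .bad = 0 ∧ ∀ j < P.s, TestOK (F.g f H j) ρ.y ρ.u ρ.v) ∧
    (∀ j < P.s, ((Cmd.rep .kj .s Cmd.slot).run f σ).A .TB (T + j) =
      (diff (F.g f H j) ρ.y ρ.x).toNat) ∧
    ∀ i, T + P.s ≤ i → ((Cmd.rep .kj .s Cmd.slot).run f σ).A .TB i = σ.A .TB i := by
  obtain ⟨σ', hF, hI, he⟩ := rep_inv (f := f) (C := Cmd.rep .kj .s Cmd.slot) rfl rfl σ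
    (fun k τ => τ.v .wp = k * n ∧ τ.v .tp = T + k ∧
      (τ.v .bad = 0 ↔ σ.v .bad = 0 ∧ ∀ j < P.s, k ≤ j → TestOK (F.g f H j) ρ.y ρ.u ρ.v) ∧
      (∀ j < P.s, k ≤ j → τ.A .TB (T + j) = (diff (F.g f H j) ρ.y ρ.x).toNat) ∧
      ∀ i, T + P.s ≤ i → τ.A .TB i = σ.A .TB i)
    (by
      rw [hE.s]
      refine ⟨by simp [HS.setV, hoff], by simp [HS.setV, htp], ?_, ?_, fun _ _ => rfl⟩
      · simp only [HS.setV, Function.update_of_ne, ne_eq, reduceCtorEq, not_false_eq_true]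
        exact ⟨fun h => ⟨h, fun j h1 h2 => by omega⟩, fun h => h.1⟩
      · intro j h1 h2; omega)
    (by
      intro k hk τ hτ ⟨i1, i2, i3, i4, i5⟩
      rw [hE.s] at hk
      have hs : Frame (Cmd.rep .kj .s Cmd.slot) τ (τ.setV .kj k 3) :=
        ⟨fun x hx => by
          have : x ≠ .kj := by rintro rfl; exact absurd hx (by decide)
          simp [HS.setV, this], fun _ _ => rfl⟩
      obtain ⟨g1, g2, g3, g4⟩ := slot_spec (f := f) (σ := τ.setV .kj k 3) (j := k) (T := T + k)
        ((hE.frame hτ rfl).frame hs rfl) ((hFd.frame hτ rfl).frame hs rfl) (by simp [HS.setV])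
        (by simpa [HS.setV] using i1) (by simpa [HS.setV, Nat.add_assoc] using i2)
        ((hp.frame hτ rfl).frame hs rfl)
      refine ⟨g1, g2, ?_, ?_, ?_⟩
      · rw [g3]
        simp only [HS.setV, Function.update_of_ne, ne_eq, reduceCtorEq, not_false_eq_true]
        rw [i3]
        constructor
        · rintro ⟨⟨h1, h2⟩, h3⟩
          refine ⟨h1, fun j hj hkj => ?_⟩
          rcases Nat.eq_or_lt_of_le hkj with h | h
          · exact h ▸ h3
          · exact h2 j hj h
        · rintro ⟨h1, h2⟩
          exact ⟨⟨h1, fun j hj hkj => h2 j hj (by omega)⟩, h2 k hk le_rfl⟩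
      · intro j hj hkj
        rw [g4]
        rcases Nat.eq_or_lt_of_le hkj with h | h
        · subst h; simp
        · rw [Function.update_of_ne (by omega)]; exact i4 j hj h
      · intro i hi
        rw [g4, Function.update_of_ne (by omega)]; exact i5 i hi)
  rw [he]
  obtain ⟨i1, i2, i3, i4, i5⟩ := hI
  refine ⟨by simpa [HS.tick] using i2, ?_, fun j hj => i4 j hj (Nat.zero_le _), i5⟩
  simp only [HS.tick]
  rw [i3]
  simp

end row

/-! ### Processing all rows of a round -/

section row

variable {n : ℕ} {f : BoolFun n} {P : Prm} {H : ℕ → ℕ} {F : Fd n}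

theorem copyPD_spec {σ : HS} (hn : σ.v .n = n) {x : Fin n → Bool} (hx : PtArr σ .X x) :
    PtArr ((Cmd.rep .ki .n (.ld .xx .X .ki ;; .st .PD .ki .xx)).run f σ) .PD x := by
  obtain ⟨σ', hF, hI, he⟩ := rep_inv (f := f) (k := .ki) (r := .n)
    (c := .ld .xx .X .ki ;; .st .PD .ki .xx) rfl rfl σ
    (fun j τ => ∀ i : Fin n, j ≤ i → τ.A .PD i = (x i).toNat)
    (by intro i hi; have := i.2; omega)
    (by
      intro j hj τ hτ hI i hi
      rw [hn] at hj
      have h1 := hx.frame hτ rfl ⟨j, hj⟩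
      simp only at h1
      simp only [Cmd.run, HS.setV, HS.setA, Function.update_self, Function.update_of_ne, ne_eq,
        reduceCtorEq, not_false_eq_true, h1]
      by_cases hij : (i : ℕ) = j
      · have : i = ⟨j, hj⟩ := Fin.ext hij
        subst this
        simp
      · rw [Function.update_of_ne hij]
        exact hI i (by omega))
  rw [he]
  exact fun i => hI i (Nat.zero_le _)

theorem checkDisc_spec {σ : HS} (hE : Env n P H σ) (hFd : FdRel F σ) {ρ : Row n}
    (hx : PtArr σ .X ρ.x) (hl : σ.v .lx = (f ρ.x).toNat) :
    (F.Disc f H ρ → (Cmd.checkDisc.run f σ).v .flag = 1 ∧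
      (Cmd.checkDisc.run f σ).v .lp = (f ρ.x).toNat ∧ PtArr (Cmd.checkDisc.run f σ) .PD ρ.x) ∧
    (¬ F.Disc f H ρ → (Cmd.checkDisc.run f σ).v .flag = σ.v .flag ∧
      (Cmd.checkDisc.run f σ).v .lp = σ.v .lp ∧
      (Cmd.checkDisc.run f σ).A .PD = σ.A .PD) := by
  obtain ⟨σ1, e1⟩ : ∃ τ, τ = Cmd.fillProj.run f σ := ⟨_, rfl⟩
  have f1 : Frame _ σ σ1 := e1 ▸ frame_run _ rfl σ
  have hp := fillProj_spec (f := f) hE hFd hx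
  rw [← e1] at hp
  obtain ⟨σ2, e2⟩ : ∃ τ, τ = (Cmd.qry .e ;; Cmd.xorC .d .e .lx .d2).run f σ1 := ⟨_, rfl⟩
  have f2 : Frame _ σ1 σ2 := e2 ▸ frame_run _ rfl σ1
  have hd : σ2.v .d = (f (F.proj H ρ.x) ^^ f ρ.x).toNat := by
    rw [e2]
    have := f1.1 .lx rfl
    rw [hl] at this
    simp only [Cmd.run, Cmd.xorC, HS.setV, Function.update_self, Function.update_of_ne, ne_eq,
      reduceCtorEq, not_false_eq_true, this, hp, toNat_xor]
  have hfin : Cmd.checkDisc.run f σ = (Cmd.ite .d (.set .flag 1 ;; .add .lp .lx .zero ;;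
      .rep .ki .n (.ld .xx .X .ki ;; .st .PD .ki .xx)) Cmd.skip).run f σ2 := by
    rw [e2, e1]; rfl
  have E2 := (hE.frame f1 rfl).frame f2 rfl
  constructor
  · intro hD
    have hd1 : σ2.v .d ≠ 0 := by
      rw [hd]; unfold Fd.Disc at hD; revert hD; cases f (F.proj H ρ.x) <;> cases f ρ.x <;> simp
    obtain ⟨σ3, e3⟩ : ∃ τ, τ = (Cmd.set .flag 1 ;; Cmd.add .lp .lx .zero).run f (σ2.tick 1) := ⟨_, rfl⟩
    have f3 : Frame _ (σ2.tick 1) σ3 := e3 ▸ frame_run _ rfl _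
    have h4 : Cmd.checkDisc.run f σ = (Cmd.rep .ki .n (.ld .xx .X .ki ;; .st .PD .ki .xx)).run f σ3 := by
      rw [hfin, e3]; simp only [Cmd.run, hd1, ne_eq, not_false_eq_true, if_true]
    rw [h4]
    have f4 : Frame _ σ3 _ := frame_run (f := f) (Cmd.rep .ki .n (.ld .xx .X .ki ;; .st .PD .ki .xx)) rfl σ3
    refine ⟨?_, ?_, copyPD_spec ?_ ?_⟩
    · rw [f4.1 .flag rfl, e3]; simp [Cmd.run, HS.setV]
    · rw [f4.1 .lp rfl, e3]
      have h5 : σ2.v .lx = (f ρ.x).toNat := by rw [f2.1 .lx rfl, f1.1 .lx rfl, hl]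
      simp [Cmd.run, HS.setV, HS.tick, h5, E2.zero]
    · rw [f3.1 .n rfl]; exact E2.vn
    · intro i; rw [f3.2 .X rfl]
      exact ((hx.frame f1 rfl).frame f2 rfl) i
  · intro hD
    have hd1 : σ2.v .d = 0 := by
      rw [hd]; unfold Fd.Disc at hD; revert hD; cases f (F.proj H ρ.x) <;> cases f ρ.x <;> simp
    have h4 : Cmd.checkDisc.run f σ = (σ2.tick 1).setV .d 0 1 := by
      rw [hfin]; simp only [Cmd.run, Cmd.skip, hd1, ne_eq, not_true_eq_false, if_false]
    rw [h4]
    refine ⟨?_, ?_, ?_⟩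
    · simp [HS.setV, HS.tick]; rw [f2.1 .flag rfl, f1.1 .flag rfl]
    · simp [HS.setV, HS.tick]; rw [f2.1 .lp rfl, f1.1 .lp rfl]
    · simp [HS.setV, HS.tick]; rw [f2.2 .PD rfl, f1.2 .PD rfl]

theorem rowDet_spec {σ : HS} (hE : Env n P H σ) (hFd : FdRel F σ) {ρ : Row n} {t : ℕ}
    (hX : PtArr σ .X ρ.x) (hY : PtArr σ .Y ρ.y) (hU : PtArr σ .U ρ.u) (hV : PtArr σ .V ρ.v)
    (hl : σ.v .lx = (f ρ.x).toNat) (ht : σ.v .kt = t) (htp : σ.v .tp = (t + 1) * P.s) :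
    (F.Disc f H ρ → (Cmd.rowDet.run f σ).v .flag = 1 ∧
      (Cmd.rowDet.run f σ).v .lp = (f ρ.x).toNat ∧ PtArr (Cmd.rowDet.run f σ) .PD ρ.x) ∧
    (¬ F.Disc f H ρ → (Cmd.rowDet.run f σ).v .flag = σ.v .flag ∧
      (Cmd.rowDet.run f σ).v .lp = σ.v .lp ∧ (Cmd.rowDet.run f σ).A .PD = σ.A .PD) ∧
    (Cmd.rowDet.run f σ).v .tp = t * P.s ∧
    ((Cmd.rowDet.run f σ).v .bad = 0 ↔
      σ.v .bad = 0 ∧ ∀ j < P.s, TestOK (F.g f H j) ρ.y ρ.u ρ.v) ∧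
    (∀ j < P.s, (Cmd.rowDet.run f σ).A .TB (t * P.s + j) = (diff (F.g f H j) ρ.y ρ.x).toNat) ∧
    (∀ i, (t + 1) * P.s ≤ i → (Cmd.rowDet.run f σ).A .TB i = σ.A .TB i) ∧
    (Cmd.rowDet.run f σ).A .LB = Function.update (σ.A .LB) t (f ρ.x).toNat := by
  obtain ⟨σ1, e1⟩ : ∃ τ, τ = Cmd.checkDisc.run f σ := ⟨_, rfl⟩
  obtain ⟨σ2, e2⟩ : ∃ τ, τ = Cmd.points.run f σ1 := ⟨_, rfl⟩
  obtain ⟨σ3, e3⟩ : ∃ τ, τ = (Cmd.add .wp .sn .zero).run f σ2 := ⟨_, rfl⟩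
  obtain ⟨σ4, e4⟩ : ∃ τ, τ = (Cmd.rep .kj .s Cmd.slot).run f σ3 := ⟨_, rfl⟩
  obtain ⟨σ5, e5⟩ : ∃ τ, τ = (Cmd.st .LB .kt .lx).run f σ4 := ⟨_, rfl⟩
  have hfin : Cmd.rowDet.run f σ = σ5 := by rw [e5, e4, e3, e2, e1]; rfl
  have f1 : Frame _ σ σ1 := e1 ▸ frame_run _ rfl σ
  have f2 : Frame _ σ1 σ2 := e2 ▸ frame_run _ rfl σ1
  have f3 : Frame _ σ2 σ3 := e3 ▸ frame_run _ rfl σ2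
  have f4 : Frame _ σ3 σ4 := e4 ▸ frame_run _ rfl σ3
  have f5 : Frame _ σ4 σ5 := e5 ▸ frame_run _ rfl σ4
  have E1 := hE.frame f1 rfl
  have E2 := E1.frame f2 rfl
  have E3 := E2.frame f3 rfl
  have G3 := ((hFd.frame f1 rfl).frame f2 rfl).frame f3 rfl
  obtain ⟨p1, p2, p3, p4, p5⟩ := points_spec (f := f) E1 (hX.frame f1 rfl) (hY.frame f1 rfl)
    (hU.frame f1 rfl) (hV.frame f1 rfl)
  rw [← e2] at p1 p2 p3 p4 p5
  have hp : Pts ρ σ2 := ⟨(hY.frame f1 rfl).frame f2 rfl, p1, p2, p3, p4, p5⟩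
  obtain ⟨c1, c2⟩ := checkDisc_spec (f := f) hE hFd hX hl
  rw [← e1] at c1 c2
  have t3 : σ3.v .tp = t * P.s + P.s := by
    rw [f3.1 .tp rfl, f2.1 .tp rfl, f1.1 .tp rfl, htp]; ring
  have w3 : σ3.v .wp = P.s * n := by
    rw [e3]; simp [Cmd.run, HS.setV, E2.sn, E2.zero]
  obtain ⟨s1, s2, s3, s4⟩ := slots_spec (f := f) E3 G3 w3 t3 (hp.frame f3 rfl)
  rw [← e4] at s1 s2 s3 s4
  rw [hfin]
  refine ⟨fun h => ?_, fun h => ?_, ?_, ?_, ?_, ?_, ?_⟩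
  · obtain ⟨d1, d2, d3⟩ := c1 h
    refine ⟨?_, ?_, (((d3.frame f2 rfl).frame f3 rfl).frame f4 rfl).frame f5 rfl⟩
    · rw [f5.1 .flag rfl, f4.1 .flag rfl, f3.1 .flag rfl, f2.1 .flag rfl, d1]
    · rw [f5.1 .lp rfl, f4.1 .lp rfl, f3.1 .lp rfl, f2.1 .lp rfl, d2]
  · obtain ⟨d1, d2, d3⟩ := c2 h
    refine ⟨?_, ?_, ?_⟩
    · rw [f5.1 .flag rfl, f4.1 .flag rfl, f3.1 .flag rfl, f2.1 .flag rfl, d1]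
    · rw [f5.1 .lp rfl, f4.1 .lp rfl, f3.1 .lp rfl, f2.1 .lp rfl, d2]
    · rw [f5.2 .PD rfl, f4.2 .PD rfl, f3.2 .PD rfl, f2.2 .PD rfl, d3]
  · rw [f5.1 .tp rfl, s1]
  · rw [f5.1 .bad rfl, s2, f3.1 .bad rfl, f2.1 .bad rfl, f1.1 .bad rfl]
  · intro j hj
    rw [f5.2 .TB rfl, s3 j hj]
  · intro i hi
    rw [f5.2 .TB rfl, s4 i (by linarith), f3.2 .TB rfl, f2.2 .TB rfl, f1.2 .TB rfl]
  · have h1 : σ4.v .kt = t := by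
      rw [f4.1 .kt rfl, f3.1 .kt rfl, f2.1 .kt rfl, f1.1 .kt rfl, ht]
    have h2 : σ4.v .lx = (f ρ.x).toNat := by
      rw [f4.1 .lx rfl, f3.1 .lx rfl, f2.1 .lx rfl, f1.1 .lx rfl, hl]
    rw [e5]
    simp [Cmd.run, HS.setA, h1, h2]
    rw [f4.2 .LB rfl, f3.2 .LB rfl, f2.2 .LB rfl, f1.2 .LB rfl]

/-- The rows from `j` on have been processed. -/
structure RowRel (f : BoolFun n) (P : Prm) (H : ℕ → ℕ) (F : Fd n) (j : ℕ) (w : ℕ → Row n)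
    (σ : HS) : Prop where
  env : Env n P H σ
  fd : FdRel F σ
  tp : σ.v .tp = j * P.s
  none : (∀ t, j ≤ t → t < P.q → ¬ F.Disc f H (w t)) → σ.v .flag = 0
  -- Rows are processed downwards and a discrepancy overwrites the stored example, so the survivor
  -- is the one of least index, as in `Fd.next`.
  some : ∀ t, j ≤ t → t < P.q → F.Disc f H (w t) →
    (∀ t', j ≤ t' → t' < t → ¬ F.Disc f H (w t')) →
    σ.v .flag ≠ 0 ∧ σ.v .lp = (f (w t).x).toNat ∧ PtArr σ .PD (w t).x
  bad : σ.v .bad = 0 ↔ ∀ t, j ≤ t → t < P.q → ∀ v < P.s,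
    TestOK (F.g f H v) (w t).y (w t).u (w t).v
  TB : ∀ t, j ≤ t → t < P.q → ∀ v < P.s,
    σ.A .TB (t * P.s + v) = (diff (F.g f H v) (w t).y (w t).x).toNat
  LB : ∀ t, j ≤ t → t < P.q → σ.A .LB t = (f (w t).x).toNat

/-- Row `j` is new and later rows keep their entries. The update of `w` at `j` mirrors the order in
which `iid` draws. -/
theorem RowRel.step {j : ℕ} (hj : j < P.q) {w : ℕ → Row n} {ρ : Row n} {σ τ : HS}
    (hR : RowRel f P H F (j + 1) w σ) {c : Cmd} (hF : Frame c σ τ) (hc1 : c.keepsEnv = true)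
    (hc2 : c.keepsFd = true) (hc3 : [Arr.TB, .LB, .PD].all (fun a => !c.writesA a) = true)
    (hc4 : [Var.tp, .flag, .lp, .bad].all (fun a => !c.writes a) = true)
    (hX : PtArr τ .X ρ.x) (hY : PtArr τ .Y ρ.y) (hU : PtArr τ .U ρ.u) (hV : PtArr τ .V ρ.v)
    (hl : τ.v .lx = (f ρ.x).toNat) (ht : τ.v .kt = j) :
    RowRel f P H F j (Function.update w j ρ) (Cmd.rowDet.run f τ) := by
  simp only [List.all_cons, List.all_nil, Bool.and_true, Bool.and_eq_true,
    Bool.not_eq_true'] at hc3 hc4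
  obtain ⟨a1, a2, a3⟩ := hc3
  obtain ⟨v1, v2, v3, v4⟩ := hc4
  have E := hR.env.frame hF hc1
  have G := hR.fd.frame hF hc2
  obtain ⟨d1, d2, d3, d4, d5, d6, d7⟩ := rowDet_spec (f := f) E G hX hY hU hV hl ht
    ((hF.1 _ v1).trans hR.tp)
  have f1 : Frame _ τ _ := frame_run (f := f) Cmd.rowDet rfl τ
  have hne : ∀ t, j + 1 ≤ t → t ≠ j := by intros; omega
  constructor
  · exact E.frame f1 rfl
  · exact G.frame f1 rfl
  · exact d3
  · intro h
    have h0 := h j le_rfl hj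
    rw [Function.update_self] at h0
    rw [(d2 h0).1, hF.1 _ v2]
    refine hR.none fun t h1 h2 => ?_
    have := h t (by omega) h2
    rwa [Function.update_of_ne (hne t h1)] at this
  · intro t h1 h2 h3 h4
    rcases Nat.eq_or_lt_of_le h1 with h | h
    · subst h
      rw [Function.update_self] at h3 ⊢
      obtain ⟨g1, g2, g3⟩ := d1 h3
      exact ⟨by rw [g1]; exact one_ne_zero, g2, g3⟩
    · have h0 := h4 j le_rfl h
      rw [Function.update_self] at h0
      rw [Function.update_of_ne (hne t h)] at h3 ⊢
      obtain ⟨g1, g2, g3⟩ := d2 h0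
      unfold PtArr
      rw [g1, g2, g3, hF.1 _ v2, hF.1 _ v3, hF.2 _ a3]
      refine hR.some t h h2 h3 fun t' h5 h6 => ?_
      have := h4 t' (by omega) h6
      rwa [Function.update_of_ne (hne t' h5)] at this
  · rw [d4, hF.1 _ v4, hR.bad]
    constructor
    · rintro ⟨h1, h2⟩ t h3 h4
      rcases Nat.eq_or_lt_of_le h3 with h | h
      · subst h; rw [Function.update_self]; exact h2
      · rw [Function.update_of_ne (hne t h)]; exact h1 t h h4
    · intro h
      refine ⟨fun t h3 h4 => ?_, ?_⟩
      · have := h t (by omega) h4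
        rwa [Function.update_of_ne (hne t h3)] at this
      · have := h j le_rfl hj
        rwa [Function.update_self] at this
  · intro t h1 h2 v hv
    rcases Nat.eq_or_lt_of_le h1 with h | h
    · subst h; rw [Function.update_self]; exact d5 v hv
    · rw [Function.update_of_ne (hne t h), d6 _ (by
        have := Nat.mul_le_mul_right P.s (show j + 1 ≤ t from h); omega), hF.2 _ a1]
      exact hR.TB t h h2 v hv
  · intro t h1 h2
    rw [d7]
    rcases Nat.eq_or_lt_of_le h1 with h | h
    · subst h; simp
    · rw [Function.update_of_ne (hne t h), Function.update_of_ne (hne t h), hF.2 _ a2]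
      exact hR.LB t h h2

end row

/-! ### Discovery of a new block -/

section discover

variable {n : ℕ} {f : BoolFun n} {P : Prm} {H : ℕ → ℕ} {F : Fd n}

theorem Frame.trans {c : Cmd} {σ τ ρ : HS} (h : Frame c σ τ) (h' : Frame c τ ρ) : Frame c σ ρ :=
  ⟨fun x hx => (h'.1 x hx).trans (h.1 x hx), fun a ha => (h'.2 a ha).trans (h.2 a ha)⟩

theorem frame_setV {k r : Var} {c : Cmd} (τ : HS) (j t : ℕ) :
    Frame (Cmd.rep k r c) τ (τ.setV k j t) := by
  refine ⟨fun x hx => ?_, fun _ _ => rfl⟩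
  have : x ≠ k := by
    rintro rfl; simp [Cmd.writes] at hx
  simp [HS.setV, this]

theorem frame_tick {c : Cmd} (τ : HS) (t : ℕ) : Frame c τ (τ.tick t) :=
  ⟨fun _ _ => rfl, fun _ _ => rfl⟩

/-- All hash values are below `m2`, so the scan over `m2` hybrids meets a success. From then on the
body does nothing, and the buffer still holds the successful hybrid when the loop ends. -/
theorem search_spec {σ : HS} (hE : Env n P H σ) (hFd : FdRel F σ) (hB : ∀ i : Fin n, H i < P.m2)
    (hB1 : 1 ≤ P.m2) {x : Fin n → Bool} (hx : PtArr σ .PD x) (hl : σ.v .lp = (f x).toNat) :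
    (Cmd.search.run f σ).v .hh = F.newBlock f H x ∧
    ∀ i : Fin n, (Cmd.search.run f σ).B i = (F.part H (F.newBlock f H x) x i).toNat := by
  obtain ⟨n1, n2, n3⟩ := Fd.newBlock_spec f F hB hB1 x
  obtain ⟨σ1, e1⟩ : ∃ τ, τ = (Cmd.set .hh 0 ;; Cmd.set .fnd 0).run f σ := ⟨_, rfl⟩
  have f1 : Frame _ σ σ1 := e1 ▸ frame_run _ rfl σ
  have E1 := hE.frame f1 rfl
  have G1 := hFd.frame f1 rfl
  have x1 := hx.frame f1 rfl
  have l1 := (f1.1 .lp rfl).trans hl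
  obtain ⟨σ', hF, hI, he⟩ := rep_inv (f := f) (k := .k1) (r := .m2) (c := .ite .fnd Cmd.skip
      (Cmd.fillPart ;; .qry .e ;; Cmd.xorC .d .e .lp .d2 ;;
        .ite .d (.add .hh .hh .one) (.set .fnd 1))) rfl rfl σ1
    -- Before success, `hh` counts the failed hybrids; after it, `hh` is the first success and the
    -- buffer holds its point.
    (fun j τ => (τ.v .fnd = 0 ∧ τ.v .hh + j = P.m2 ∧ ∀ h < τ.v .hh, f (F.part H h x) ≠ f x) ∨
      (τ.v .fnd ≠ 0 ∧ f (F.part H (τ.v .hh) x) = f x ∧ (∀ h < τ.v .hh, f (F.part H h x) ≠ f x) ∧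
        ∀ i : Fin n, τ.B i = (F.part H (τ.v .hh) x i).toNat))
    (by
      left
      rw [E1.m2]
      have h1 : σ1.v .fnd = 0 := by rw [e1]; simp [Cmd.run, HS.setV]
      have h2 : σ1.v .hh = 0 := by rw [e1]; simp [Cmd.run, HS.setV]
      simp [HS.setV, h1, h2])
    (by
      intro j hj τ hτ hI
      obtain ⟨τ1, t1⟩ : ∃ τ1, τ1 = (τ.setV .k1 j 3).tick 1 := ⟨_, rfl⟩
      have g1 := (frame_setV (k := .k1) (r := .m2) (c := .ite .fnd Cmd.skip
        (Cmd.fillPart ;; .qry .e ;; Cmd.xorC .d .e .lp .d2 ;;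
        .ite .d (.add .hh .hh .one) (.set .fnd 1))) τ j 3).trans
        (frame_tick (τ.setV .k1 j 3) 1)
      rw [← t1] at g1
      have g2 := hτ.trans g1
      have hv : ∀ y, y ≠ .k1 → τ1.v y = τ.v y := by
        intro y hy; rw [t1]; simp [HS.setV, HS.tick, hy]
      have hBB : τ1.B = τ.B := by rw [t1]; rfl
      simp only [Cmd.run]
      rw [show (τ.setV .k1 j 3).v .fnd = τ.v .fnd from by simp [HS.setV], ← t1]
      rcases hI with ⟨i1, i2, i3⟩ | ⟨i1, i2, i3, i4⟩
      · rw [if_neg (by simp [i1])]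
        obtain ⟨τ2, t2⟩ : ∃ τ2, τ2 = Cmd.fillPart.run f τ1 := ⟨_, rfl⟩
        have g3 : Frame _ τ1 τ2 := t2 ▸ frame_run _ rfl τ1
        have hval := fillPart_val (f := f) (E1.frame g2 rfl) (G1.frame g2 rfl) (x1.frame g2 rfl)
        have hpt := bufPoint_of_val hval
        rw [← t2] at hval hpt ⊢
        have h1 : τ1.v .hh = τ.v .hh := hv _ (by decide)
        rw [h1] at hval hpt
        have h2 : τ2.v .lp = (f x).toNat := by rw [g3.1 .lp rfl, g2.1 .lp rfl, l1]
        have h3 : τ2.v .hh = τ.v .hh := by rw [g3.1 .hh rfl, h1]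
        have h4 : τ2.v .one = 1 := ((E1.frame g2 rfl).frame g3 rfl).one
        have h5 : τ2.v .fnd = 0 := by rw [g3.1 .fnd rfl, hv _ (by decide), i1]
        by_cases hq : f (F.part H (τ.v .hh) x) = f x
        · right
          simp only [Cmd.run, Cmd.xorC, HS.setV, HS.tick, Function.update_self,
            Function.update_of_ne, ne_eq, reduceCtorEq, not_false_eq_true, hpt, h2, h3, h4, h5,
            toNat_xor, hq, Bool.xor_self, Bool.toNat_false, not_true_eq_false, if_false]
          exact ⟨trivial, trivial, i3, hval⟩
        · left
          have hq' : (f (F.part H (τ.v .hh) x) ^^ f x).toNat = 1 := by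
            revert hq; cases f (F.part H (τ.v .hh) x) <;> cases f x <;> simp
          simp only [Cmd.run, Cmd.xorC, HS.setV, HS.tick, Function.update_self,
            Function.update_of_ne, ne_eq, reduceCtorEq, not_false_eq_true, hpt, h2, h3, h4, h5,
            toNat_xor, hq', one_ne_zero, if_true]
          refine ⟨trivial, by omega, fun h hh => ?_⟩
          rcases Nat.lt_succ_iff_lt_or_eq.1 hh with h' | h'
          · exact i3 h h'
          · rw [h']; exact hq
      · right
        rw [if_pos i1]
        simp only [Cmd.skip, Cmd.run, HS.setV, Function.update_of_ne, ne_eq, reduceCtorEq,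
          not_false_eq_true, hv, hBB]
        exact ⟨i1, i2, i3, i4⟩)
  have hfin : Cmd.search.run f σ = σ'.tick 1 := by rw [← he, e1]; rfl
  rw [hfin]
  simp only [HS.tick]
  rcases hI with ⟨i1, i2, i3⟩ | ⟨i1, i2, i3, i4⟩
  · exact absurd n1 (i3 _ (by omega))
  · have : σ'.v .hh = F.newBlock f H x := by
      rcases lt_trichotomy (σ'.v .hh) (F.newBlock f H x) with h | h | h
      · exact absurd i2 (n3 _ h)
      · exact h
      · exact absurd n1 (i3 _ h)
    rw [← this]
    exact ⟨rfl, i4⟩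

/-- The witness is copied from the buffer as the search left it, so the hybrid need not be rebuilt.
-/
theorem discover_spec {σ : HS} (hE : Env n P H σ) (hFd : FdRel F σ) (hB : ∀ i : Fin n, H i < P.m2)
    (hB1 : 1 ≤ P.m2) {x : Fin n → Bool} (hx : PtArr σ .PD x) (hl : σ.v .lp = (f x).toNat) :
    FdRel (F.discover f H x) (Cmd.discover.run f σ) := by
  obtain ⟨s1, s2⟩ := search_spec (f := f) hE hFd hB hB1 hx hl
  obtain ⟨σ1, e1⟩ : ∃ τ, τ = Cmd.search.run f σ := ⟨_, rfl⟩
  rw [← e1] at s1 s2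
  have f1 : Frame _ σ σ1 := e1 ▸ frame_run _ rfl σ
  have E1 := hE.frame f1 rfl
  have G1 := hFd.frame f1 rfl
  obtain ⟨σ2, e2⟩ : ∃ τ, τ = (Cmd.st .BLK .k .hh ;; Cmd.st .MK .hh .one).run f σ1 := ⟨_, rfl⟩
  have f2 : Frame _ σ1 σ2 := e2 ▸ frame_run _ rfl σ1
  have E2 := E1.frame f2 rfl
  have hB2 : σ2.B = σ1.B := by rw [e2]; rfl
  have hkn2 : σ2.v .kn = F.k * n := (f2.1 .kn rfl).trans G1.kn
  have hWT2 : σ2.A .WT = σ1.A .WT := f2.2 .WT rfl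
  obtain ⟨σ3, hF3, hI3, he3⟩ := rep_inv (f := f) (k := .ki) (r := .n)
    (c := .ldB .xx .ki ;; .add .wi .kn .ki ;; .st .WT .wi .xx) rfl rfl σ2
    (fun j τ => τ.B = σ1.B ∧ ∀ m, τ.A .WT m = if F.k * n + j ≤ m ∧ m < F.k * n + n then σ1.B (m - F.k * n)
      else σ1.A .WT m)
    (by
      rw [E2.vn]
      refine ⟨hB2, fun m => ?_⟩
      rw [if_neg (by omega)]
      exact congrFun hWT2 m)
    (by
      intro j hj τ hτ ⟨i1, i2⟩
      rw [E2.vn] at hj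
      have hkn := (hτ.1 .kn rfl).trans hkn2
      simp only [Cmd.run, HS.setV, HS.setA, Function.update_self, Function.update_of_ne, ne_eq,
        reduceCtorEq, not_false_eq_true, hj, if_true, i1, hkn]
      refine ⟨trivial, fun m => ?_⟩
      by_cases hm : m = F.k * n + j
      · subst hm
        rw [Function.update_self, if_pos (by omega)]
        congr 1; omega
      · rw [Function.update_of_ne hm, i2]
        by_cases hc : F.k * n + (j + 1) ≤ m ∧ m < F.k * n + n
        · rw [if_pos hc, if_pos (by omega)]
        · rw [if_neg hc, if_neg (by omega)])
  obtain ⟨σ4, e4⟩ : ∃ τ, τ = (Cmd.add .kn .kn .n ;; Cmd.add .k .k .one).run f (σ3.tick 1) :=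
    ⟨_, rfl⟩
  have f4 : Frame _ (σ3.tick 1) σ4 := e4 ▸ frame_run _ rfl _
  have hfin : Cmd.discover.run f σ = σ4 := by rw [e4, ← he3, e2, e1]; rfl
  rw [hfin]
  have E3 := E2.frame hF3 rfl
  have hk3 : σ3.v .k = F.k := by rw [hF3.1 .k rfl, f2.1 .k rfl, G1.k]
  have hkn3 : σ3.v .kn = F.k * n := by rw [hF3.1 .kn rfl, hkn2]
  constructor
  · rw [e4]; simp [Cmd.run, HS.setV, HS.tick, hk3, E3.one, Fd.discover]
  · rw [e4]; simp [Cmd.run, HS.setV, HS.tick, hkn3, E3.vn, Fd.discover, Nat.add_mul]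
  · intro j
    rw [f4.2 .BLK rfl]
    simp only [HS.tick]
    rw [hF3.2 .BLK rfl, e2]
    simp only [Cmd.run, HS.setA, Function.update_self, Function.update_of_ne, ne_eq, reduceCtorEq,
      not_false_eq_true, G1.k, s1, Fd.discover]
    by_cases hj : j = F.k
    · subst hj; simp
    · rw [Function.update_of_ne hj, Function.update_of_ne hj, G1.blk]
  · intro j i
    rw [f4.2 .WT rfl]
    simp only [HS.tick]
    rw [hI3.2]
    by_cases hj : j = F.k
    · subst hj
      rw [if_pos (by have := i.2; omega), show F.k * n + i - F.k * n = (i : ℕ) by omega, s2]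
      simp [Fd.discover]
    · rw [if_neg, G1.wit]
      · simp [Fd.discover, hj]
      · have hi := i.2
        rcases Nat.lt_or_gt_of_ne hj with h | h
        · have := Nat.mul_le_mul_right n (show j + 1 ≤ F.k from h)
          rw [Nat.add_mul] at this
          omega
        · have := Nat.mul_le_mul_right n (show F.k + 1 ≤ j from h)
          rw [Nat.add_mul] at this
          omega
  · intro h
    rw [f4.2 .MK rfl]
    simp only [HS.tick]
    rw [hF3.2 .MK rfl, e2]
    simp only [Cmd.run, HS.setA, Function.update_self, Function.update_of_ne, ne_eq, reduceCtorEq,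
      not_false_eq_true, s1, E1.one, Fd.discover]
    by_cases hj : h = F.newBlock f H x
    · subst hj; simp
    · rw [Function.update_of_ne hj, Function.update_of_ne hj, G1.mark]

end discover

/-! ### Set operations of the consistency search -/

section search

variable {n : ℕ} {f : BoolFun n} {P : Prm} {H : ℕ → ℕ} {E : Tab}

/-- The table is stored in the arrays. -/
structure TabRel (E : Tab) (P : Prm) (σ : HS) : Prop where
  q : E.q = P.q
  W : E.W = P.W
  lv : ∀ i < P.W, E.lv i < P.s
  TB : ∀ t < P.q, ∀ v < P.s, σ.A .TB (t * P.s + v) = (E.tb t v).toNat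
  LB : ∀ t < P.q, σ.A .LB t = (E.lb t).toNat
  LV : ∀ i < P.W, σ.A .LV i = E.lv i
  LP : ∀ i < P.W, σ.A .LP i = (E.lp i).toNat

/-- The command does not write the table. -/
def Cmd.keepsTab (c : Cmd) : Bool := [Arr.TB, .LB, .LV, .LP].all fun a => !c.writesA a

theorem TabRel.frame {c : Cmd} {σ σ' : HS} (h : TabRel E P σ) (hF : Frame c σ σ')
    (hc : c.keepsTab = true) : TabRel E P σ' := by
  simp only [Cmd.keepsTab, List.all_cons, List.all_nil, Bool.and_true, Bool.and_eq_true,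
    Bool.not_eq_true'] at hc
  obtain ⟨a1, a2, a3, a4⟩ := hc
  refine ⟨h.q, h.W, h.lv, ?_, ?_, ?_, ?_⟩
  · rw [hF.2 _ a1]; exact h.TB
  · rw [hF.2 _ a2]; exact h.LB
  · rw [hF.2 _ a3]; exact h.LV
  · rw [hF.2 _ a4]; exact h.LP

theorem downC_spec {σ : HS} (hE : Env n P H σ) (hT : TabRel E P σ) {i m : ℕ} (hi : i < P.W)
    (hg : σ.v .g = i) (hl : σ.v .l = m + 1) (ho : σ.v .o = (m + 1) * P.q) :
    (Cmd.downC.run f σ).v .l = m ∧ (Cmd.downC.run f σ).v .o = m * P.q ∧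
    (∀ t < P.q, ((Cmd.downC.run f σ).A .S (m * P.q + t) ≠ 0 ↔
      σ.A .S ((m + 1) * P.q + t) ≠ 0 ∧ E.lit i t = true)) ∧
    ∀ a, (a < m * P.q ∨ m * P.q + P.q ≤ a) → (Cmd.downC.run f σ).A .S a = σ.A .S a := by
  have hlv := hT.lv i hi
  have hq1 : (m + 1) * P.q = m * P.q + P.q := by ring
  obtain ⟨σ1, e1⟩ : ∃ τ, τ = (Cmd.ld .uu .LV .g ;; Cmd.ld .yy .LP .g ;; Cmd.sub .o2 .o .q ;;
      Cmd.add .c .uu .qs).run f σ := ⟨_, rfl⟩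
  have f1 : Frame _ σ σ1 := e1 ▸ frame_run _ rfl σ
  have E1 := hE.frame f1 rfl
  have T1 := hT.frame f1 rfl
  have y1 : σ1.v .yy = (E.lp i).toNat := by
    rw [e1]; simp [Cmd.run, HS.setV, hg, hT.LP i hi]
  have o1 : σ1.v .o = m * P.q + P.q := by rw [f1.1 .o rfl, ho, hq1]
  have p1 : σ1.v .o2 = m * P.q := by
    rw [e1]; simp [Cmd.run, HS.setV, ho, hE.q, hq1]
  have c1 : σ1.v .c = E.lv i + P.q * P.s := by
    rw [e1]; simp [Cmd.run, HS.setV, hg, hT.LV i hi, hE.qs]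
  obtain ⟨σ', hF, hI, he⟩ := rep_inv (f := f) (k := .kt) (r := .q) (c := Cmd.sub .c .c .s ;;
      .ld .b .TB .c ;; Cmd.xorC .d .b .yy .t ;; .add .p .o .kt ;;
    .ld .h .S .p ;; .ite .d (.set .h 0) Cmd.skip ;; .add .p .o2 .kt ;; .st .S .p .h) rfl rfl σ1
    (fun j τ => τ.v .c = E.lv i + j * P.s ∧
      (∀ t < P.q, j ≤ t → (τ.A .S (m * P.q + t) ≠ 0 ↔
        σ1.A .S ((m + 1) * P.q + t) ≠ 0 ∧ E.lit i t = true)) ∧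
      ∀ a, (a < m * P.q + j ∨ m * P.q + P.q ≤ a) → τ.A .S a = σ1.A .S a)
    (by
      rw [E1.q]
      exact ⟨by simp [HS.setV, c1], fun t h1 h2 => by omega, fun _ _ => rfl⟩)
    (by
      intro j hj τ hτ ⟨i1, i2, i3⟩
      rw [E1.q] at hj
      have a1 := (E1.frame hτ rfl).s
      have a2 := (T1.frame hτ rfl).TB j hj _ hlv
      have a3 := (hτ.1 .yy rfl).trans y1
      have a4 := (hτ.1 .o rfl).trans o1
      have a5 := (hτ.1 .o2 rfl).trans p1
      -- The source cell belongs to level `m + 1` and is outside the block being written.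
      have a6 := i3 (m * P.q + P.q + j) (by omega)
      have a7 : E.lv i + (j + 1) * P.s - P.s = j * P.s + E.lv i := by
        rw [Nat.add_mul]; omega
      have key : ∀ w : ℕ, (w ≠ 0 ↔ σ1.A .S ((m + 1) * P.q + j) ≠ 0 ∧ E.lit i j = true) →
          (j * P.s + E.lv i = E.lv i + j * P.s ∧
          (∀ t < P.q, j ≤ t → (Function.update (τ.A .S) (m * P.q + j) w (m * P.q + t) ≠ 0 ↔
            σ1.A .S ((m + 1) * P.q + t) ≠ 0 ∧ E.lit i t = true)) ∧
          ∀ a, (a < m * P.q + j ∨ m * P.q + P.q ≤ a) →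
            Function.update (τ.A .S) (m * P.q + j) w a = σ1.A .S a) := by
        intro w hw
        refine ⟨Nat.add_comm _ _, fun t h1 h2 => ?_, fun a ha => ?_⟩
        · rcases Nat.eq_or_lt_of_le h2 with h | h
          · subst h; rw [Function.update_self]; exact hw
          · rw [Function.update_of_ne (by omega)]; exact i2 t h1 h
        · rw [Function.update_of_ne (by omega)]; exact i3 a (by omega)
      by_cases hlit : E.lit i j = true
      · have hd : (E.tb j (E.lv i) ^^ E.lp i).toNat = 0 := by
          unfold Tab.lit at hlit; revert hlit; cases E.tb j (E.lv i) <;> cases E.lp i <;> simp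
        simp only [Cmd.run, Cmd.xorC, Cmd.skip, HS.setV, HS.setA, HS.tick, Function.update_self,
          Function.update_of_ne, ne_eq, reduceCtorEq, not_false_eq_true, a1, i1, a2, a3, a4, a5, a6,
          a7, toNat_xor, hd, not_true_eq_false, if_false]
        exact key _ (by simp [hlit, hq1])
      · have hd : (E.tb j (E.lv i) ^^ E.lp i).toNat = 1 := by
          unfold Tab.lit at hlit; revert hlit; cases E.tb j (E.lv i) <;> cases E.lp i <;> simp
        simp only [Cmd.run, Cmd.xorC, Cmd.skip, HS.setV, HS.setA, HS.tick, Function.update_self,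
          Function.update_of_ne, ne_eq, reduceCtorEq, not_false_eq_true, a1, i1, a2, a3, a4, a5, a6,
          a7, toNat_xor, hd, one_ne_zero, if_true]
        exact key _ (by simp [hlit]))
  obtain ⟨σ2, e2⟩ : ∃ τ, τ = (Cmd.sub .l .l .one ;; Cmd.add .o .o2 .zero).run f (σ'.tick 1) :=
    ⟨_, rfl⟩
  have f2 : Frame _ (σ'.tick 1) σ2 := e2 ▸ frame_run _ rfl _
  have hfin : Cmd.downC.run f σ = σ2 := by rw [e2, ← he, e1]; rfl
  obtain ⟨i1, i2, i3⟩ := hI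
  have E2 := E1.frame hF rfl
  have l2 : σ'.v .l = m + 1 := by rw [hF.1 .l rfl, f1.1 .l rfl, hl]
  have o2 : σ'.v .o2 = m * P.q := (hF.1 .o2 rfl).trans p1
  rw [hfin, f2.2 .S rfl]
  refine ⟨?_, ?_, fun t ht => ?_, fun a ha => ?_⟩
  · rw [e2]; simp [Cmd.run, HS.setV, HS.tick, l2, E2.one]
  · rw [e2]; simp [Cmd.run, HS.setV, HS.tick, o2, E2.zero]
  · have := i2 t ht (Nat.zero_le _)
    rwa [f1.2 .S rfl] at this
  · exact (i3 a (by omega)).trans (congrFun (f1.2 .S rfl) a)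

theorem upC_spec {σ : HS} (hE : Env n P H σ) (hT : TabRel E P σ) {i o : ℕ} (hi : i < P.W)
    (hg : σ.v .g = i) (ho : σ.v .o = o) :
    (∀ t < P.q, ((Cmd.upC.run f σ).A .S (o + t) ≠ 0 ↔
      σ.A .S (o + t) ≠ 0 ∧ E.lit i t = false)) ∧
    ∀ a, (a < o ∨ o + P.q ≤ a) → (Cmd.upC.run f σ).A .S a = σ.A .S a := by
  have hlv := hT.lv i hi
  obtain ⟨σ1, e1⟩ : ∃ τ, τ = (Cmd.ld .uu .LV .g ;; Cmd.ld .yy .LP .g ;;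
      Cmd.add .c .uu .qs).run f σ := ⟨_, rfl⟩
  have f1 : Frame _ σ σ1 := e1 ▸ frame_run _ rfl σ
  have E1 := hE.frame f1 rfl
  have T1 := hT.frame f1 rfl
  have y1 : σ1.v .yy = (E.lp i).toNat := by
    rw [e1]; simp [Cmd.run, HS.setV, hg, hT.LP i hi]
  have o1 : σ1.v .o = o := by rw [f1.1 .o rfl, ho]
  have c1 : σ1.v .c = E.lv i + P.q * P.s := by
    rw [e1]; simp [Cmd.run, HS.setV, hg, hT.LV i hi, hE.qs]
  obtain ⟨σ', hF, hI, he⟩ := rep_inv (f := f) (k := .kt) (r := .q) (c := Cmd.sub .c .c .s ;;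
      .ld .b .TB .c ;; Cmd.xorC .d .b .yy .t ;; .add .p .o .kt ;;
      .ite .d Cmd.skip (.st .S .p .zero)) rfl rfl σ1
    (fun j τ => τ.v .c = E.lv i + j * P.s ∧
      (∀ t < P.q, j ≤ t → (τ.A .S (o + t) ≠ 0 ↔
        σ1.A .S (o + t) ≠ 0 ∧ E.lit i t = false)) ∧
      ∀ a, (a < o + j ∨ o + P.q ≤ a) → τ.A .S a = σ1.A .S a)
    (by
      rw [E1.q]
      exact ⟨by simp [HS.setV, c1], fun t h1 h2 => by omega, fun _ _ => rfl⟩)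
    (by
      intro j hj τ hτ ⟨i1, i2, i3⟩
      rw [E1.q] at hj
      have a1 := (E1.frame hτ rfl).s
      have a2 := (T1.frame hτ rfl).TB j hj _ hlv
      have a3 := (hτ.1 .yy rfl).trans y1
      have a4 := (hτ.1 .o rfl).trans o1
      have a6 := (E1.frame hτ rfl).zero
      have a7 : E.lv i + (j + 1) * P.s - P.s = j * P.s + E.lv i := by
        rw [Nat.add_mul]; omega
      by_cases hlit : E.lit i j = true
      · have hd : (E.tb j (E.lv i) ^^ E.lp i).toNat = 0 := by
          unfold Tab.lit at hlit; revert hlit; cases E.tb j (E.lv i) <;> cases E.lp i <;> simp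
        simp only [Cmd.run, Cmd.xorC, Cmd.skip, HS.setV, HS.setA, HS.tick, Function.update_self,
          Function.update_of_ne, ne_eq, reduceCtorEq, not_false_eq_true, a1, i1, a2, a3, a4, a6,
          a7, toNat_xor, hd, not_true_eq_false, if_false]
        refine ⟨Nat.add_comm _ _, fun t h1 h2 => ?_, fun a ha => ?_⟩
        · rcases Nat.eq_or_lt_of_le h2 with h | h
          · subst h; rw [Function.update_self]; simp [hlit]
          · rw [Function.update_of_ne (by omega)]; exact i2 t h1 h
        · rw [Function.update_of_ne (by omega)]; exact i3 a (by omega)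
      · have hd : (E.tb j (E.lv i) ^^ E.lp i).toNat = 1 := by
          unfold Tab.lit at hlit; revert hlit; cases E.tb j (E.lv i) <;> cases E.lp i <;> simp
        simp only [Cmd.run, Cmd.xorC, Cmd.skip, HS.setV, HS.setA, HS.tick, Function.update_self,
          Function.update_of_ne, ne_eq, reduceCtorEq, not_false_eq_true, a1, i1, a2, a3, a4, a6,
          a7, toNat_xor, hd, one_ne_zero, if_true]
        refine ⟨Nat.add_comm _ _, fun t h1 h2 => ?_, fun a ha => i3 a (by omega)⟩
        rcases Nat.eq_or_lt_of_le h2 with h | h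
        · subst h; have h5 := i3 (o + j) (by omega); rw [h5]; simp [hlit]
        · exact i2 t h1 h)
  have hfin : Cmd.upC.run f σ = σ'.tick 1 := by rw [← he, e1]; rfl
  obtain ⟨i1, i2, i3⟩ := hI
  rw [hfin]
  simp only [HS.tick]
  refine ⟨fun t ht => ?_, fun a ha => ?_⟩
  · have := i2 t ht (Nat.zero_le _)
    rwa [f1.2 .S rfl] at this
  · exact (i3 a (by omega)).trans (congrFun (f1.2 .S rfl) a)

theorem pureC_spec {σ : HS} (hE : Env n P H σ) (hT : TabRel E P σ) {o : ℕ} (ho : σ.v .o = o)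
    {S : ℕ → Bool} (hS : ∀ t < P.q, (σ.A .S (o + t) ≠ 0 ↔ S t = true)) :
    (Cmd.pureC.run f σ).v .res = (E.pureB S).toNat := by
  obtain ⟨σ1, e1⟩ : ∃ τ, τ = (Cmd.set .xx 0 ;; Cmd.set .e 0).run f σ := ⟨_, rfl⟩
  have f1 : Frame _ σ σ1 := e1 ▸ frame_run _ rfl σ
  have E1 := hE.frame f1 rfl
  have T1 := hT.frame f1 rfl
  have x1 : σ1.v .xx = 0 := by rw [e1]; simp [Cmd.run, HS.setV]
  have y1 : σ1.v .e = 0 := by rw [e1]; simp [Cmd.run, HS.setV]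
  have o1 : σ1.v .o = o := by rw [f1.1 .o rfl, ho]
  obtain ⟨σ', hF, hI, he⟩ := rep_inv (f := f) (k := .kt) (r := .q) (c := Cmd.add .p .o .kt ;;
      .ld .h .S .p ;;
      .ite .h (.ld .b .LB .kt ;; .ite .b (.set .xx 1) (.set .e 1)) Cmd.skip) rfl rfl σ1
    (fun j τ => (τ.v .xx = 0 ∨ τ.v .xx = 1) ∧ (τ.v .e = 0 ∨ τ.v .e = 1) ∧
      (τ.v .xx = 1 ↔ ∃ t < P.q, j ≤ t ∧ S t = true ∧ E.lb t = true) ∧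
      (τ.v .e = 1 ↔ ∃ t < P.q, j ≤ t ∧ S t = true ∧ E.lb t = false))
    (by
      rw [E1.q]
      simp only [HS.setV, Function.update_of_ne, ne_eq, reduceCtorEq, not_false_eq_true, x1, y1]
      refine ⟨Or.inl trivial, Or.inl trivial, ⟨by simp, ?_⟩, ⟨by simp, ?_⟩⟩ <;>
      · rintro ⟨t, h1, h2, -⟩; omega)
    (by
      intro j hj τ hτ ⟨i1, i2, i3, i4⟩
      rw [E1.q] at hj
      have a2 := (T1.frame hτ rfl).LB j hj
      have a4 := (hτ.1 .o rfl).trans o1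
      have a5 : τ.A .S = σ.A .S := (hτ.2 .S rfl).trans (f1.2 .S rfl)
      have a6 := hS j hj
      have split : ∀ Q : ℕ → Prop, (∃ t < P.q, j ≤ t ∧ Q t) ↔ Q j ∨ ∃ t < P.q, j + 1 ≤ t ∧ Q t := by
        intro Q
        constructor
        · rintro ⟨t, h1, h2, h3⟩
          rcases Nat.eq_or_lt_of_le h2 with h | h
          · exact Or.inl (h ▸ h3)
          · exact Or.inr ⟨t, h1, h, h3⟩
        · rintro (h | ⟨t, h1, h2, h3⟩)
          · exact ⟨j, hj, le_rfl, h⟩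
          · exact ⟨t, h1, by omega, h3⟩
      rw [split fun t => S t = true ∧ E.lb t = true, split fun t => S t = true ∧ E.lb t = false,
        ← i3, ← i4]
      by_cases hs : σ.A .S (o + j) = 0
      · have : S j = false := by
          rw [← Bool.not_eq_true, ← a6]; simp [hs]
        simp only [Cmd.run, Cmd.skip, HS.setV, HS.tick, Function.update_self,
          Function.update_of_ne, ne_eq, reduceCtorEq, not_false_eq_true, a2, a4, a5, hs,
          not_true_eq_false, if_false, this]
        simp [i1, i2]
      · have h1 : S j = true := a6.1 hs
        cases hlb : E.lb j
        · rw [hlb] at a2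
          simp only [Cmd.run, Cmd.skip, HS.setV, HS.tick, Function.update_self,
            Function.update_of_ne, ne_eq, reduceCtorEq, not_false_eq_true, a2, a4, a5, hs,
            not_true_eq_false, if_false, if_true, h1, hlb, Bool.toNat_false]
          simp [i1]
        · rw [hlb] at a2
          simp only [Cmd.run, Cmd.skip, HS.setV, HS.tick, Function.update_self,
            Function.update_of_ne, ne_eq, reduceCtorEq, not_false_eq_true, a2, a4, a5, hs,
            one_ne_zero, if_true, h1, hlb, Bool.toNat_true]
          simp [i2])
  have E2 := E1.frame hF rfl
  have hfin : Cmd.pureC.run f σ = (Cmd.add .d .xx .e ;; Cmd.sub .d .d .one ;;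
      Cmd.sub .res .one .d).run f (σ'.tick 1) := by rw [← he, e1]; rfl
  rw [hfin]
  simp only [Cmd.run, HS.setV, HS.tick, Function.update_self, Function.update_of_ne, ne_eq,
    reduceCtorEq, not_false_eq_true, E2.one]
  obtain ⟨i1, i2, i3, i4⟩ := hI
  simp only [Nat.zero_le, true_and] at i3 i4
  unfold Tab.pureB
  rw [hT.q]
  by_cases b1 : ∃ t < P.q, S t = true ∧ E.lb t = true <;>
  by_cases b2 : ∃ t < P.q, S t = true ∧ E.lb t = false
  · rw [i3.2 b1, i4.2 b2, decide_eq_true b1, decide_eq_true b2]; rfl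
  · rw [i3.2 b1, i2.resolve_right (fun h => b2 (i4.1 h)), decide_eq_true b1, decide_eq_false b2]; rfl
  · rw [i1.resolve_right (fun h => b1 (i3.1 h)), i4.2 b2, decide_eq_false b1, decide_eq_true b2]; rfl
  · rw [i1.resolve_right (fun h => b1 (i3.1 h)), i2.resolve_right (fun h => b2 (i4.1 h)),
      decide_eq_false b1, decide_eq_false b2]; rfl

end search

/-! ### The iterative search on the machine -/

section search

variable {n : ℕ} {f : BoolFun n} {P : Prm} {H : ℕ → ℕ} {E : Tab}

/-- The state of the iterative search is stored. -/
structure ERel (P : Prm) (st : ESt) (σ : HS) : Prop where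
  l : σ.v .l = st.l
  dir : σ.v .dir = st.dir.toNat
  res : σ.v .res = st.res.toNat
  o : σ.v .o = st.l * P.q
  dg : ∀ m, σ.A .DG m = st.dg m
  S : ∀ m, ∀ t < P.q, (σ.A .S (m * P.q + t) ≠ 0 ↔ st.S m t = true)
  le : st.l ≤ P.r
  -- The levels above the current one are suspended calls; their indices must point to stored
  -- literals. Nothing is required of the other levels.
  lt : ∀ m, st.l < m → m ≤ P.r → st.dg m < P.W

theorem run_ite_ne {x : Var} {a b : Cmd} {σ : HS} (h : σ.v x ≠ 0) :
    (Cmd.ite x a b).run f σ = a.run f (σ.tick 1) := by rw [Cmd.run, if_pos h]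

theorem run_ite_eq {x : Var} {a b : Cmd} {σ : HS} (h : σ.v x = 0) :
    (Cmd.ite x a b).run f σ = b.run f (σ.tick 1) := by rw [Cmd.run, if_neg (not_not.2 h)]

/-- The sets of different levels occupy disjoint blocks of `q` cells. -/
theorem mul_add_disjoint {m m' q t : ℕ} (h : m ≠ m') (ht : t < q) :
    m * q + t < m' * q ∨ m' * q + q ≤ m * q + t := by
  rcases Nat.lt_or_gt_of_ne h with h | h
  · have := Nat.mul_le_mul_right q (show m + 1 ≤ m' from h)
    rw [Nat.add_mul] at this; omega
  · have := Nat.mul_le_mul_right q (show m' + 1 ≤ m from h)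
    rw [Nat.add_mul] at this; omega

theorem callC_spec {σ : HS} {st : ESt} (hE : Env n P H σ) (hT : TabRel E P σ) (hW : 1 ≤ P.W)
    (hR : ERel P st σ) (hd : st.dir = false) : ERel P (E.step P.r st) (Cmd.callC.run f σ) := by
  unfold Tab.step
  rw [if_pos hd]
  have f0 : Frame (Cmd.ite .l (.st .DG .l .zero ;; .set .g 0 ;; Cmd.downC)
    (Cmd.pureC ;; .set .dir 1)) σ (σ.tick 1) := frame_tick _ _
  have E0 := hE.frame f0 rfl
  have T0 := hT.frame f0 rfl
  by_cases hl : st.l = 0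
  · rw [if_pos hl]
    have h1 : Cmd.callC.run f σ = (Cmd.set .dir 1).run f (Cmd.pureC.run f (σ.tick 1)) := by
      simp only [Cmd.callC, Cmd.run]
      rw [if_neg (by rw [hR.l, hl]; simp)]
    have f1 : Frame _ (σ.tick 1) _ := frame_run (f := f) Cmd.pureC rfl (σ.tick 1)
    have f2 : Frame _ _ _ := frame_run (f := f) (Cmd.set .dir 1) rfl (Cmd.pureC.run f (σ.tick 1))
    have hp := pureC_spec (f := f) E0 T0 (o := 0) (S := st.S 0)
      (show σ.v .o = 0 by rw [hR.o, hl, Nat.zero_mul])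
      (fun t ht => by have := hR.S 0 t ht; rw [Nat.zero_mul] at this; exact this)
    rw [h1]
    constructor
    · rw [f2.1 .l rfl, f1.1 .l rfl]; exact hR.l
    · simp [Cmd.run, HS.setV]
    · rw [f2.1 .res rfl, hp]
    · rw [f2.1 .o rfl, f1.1 .o rfl]; exact hR.o
    · rw [f2.2 .DG rfl, f1.2 .DG rfl]; exact hR.dg
    · rw [f2.2 .S rfl, f1.2 .S rfl]; exact hR.S
    · exact hR.le
    · exact hR.lt
  · rw [if_neg hl]
    obtain ⟨m, hm⟩ : ∃ m, st.l = m + 1 := ⟨st.l - 1, by omega⟩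
    obtain ⟨σ1, e1⟩ : ∃ τ, τ = (Cmd.st .DG .l .zero ;; Cmd.set .g 0).run f (σ.tick 1) := ⟨_, rfl⟩
    have f1 : Frame _ (σ.tick 1) σ1 := e1 ▸ frame_run _ rfl _
    have h1 : Cmd.callC.run f σ = Cmd.downC.run f σ1 := by
      rw [e1]
      simp only [Cmd.callC, Cmd.run]
      rw [if_pos (by rw [hR.l]; exact hl)]
    have f2 : Frame _ σ1 _ := frame_run (f := f) Cmd.downC rfl σ1
    obtain ⟨d1, d2, d3, d4⟩ := downC_spec (f := f) (E0.frame f1 rfl) (T0.frame f1 rfl) (i := 0)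
      (m := m) hW (by rw [e1]; simp [Cmd.run, HS.setV])
      (by rw [f1.1 .l rfl]; exact hR.l.trans hm)
      (by rw [f1.1 .o rfl]; exact hR.o.trans (by rw [hm]))
    have hSS : σ1.A .S = σ.A .S := f1.2 .S rfl
    rw [hSS] at d3 d4
    rw [h1, hm, Nat.add_sub_cancel]
    have hdg : ∀ j, σ1.A .DG j = Function.update st.dg (m + 1) 0 j := by
      intro j
      rw [e1]
      have z := E0.zero
      simp only [Cmd.run, HS.setV, HS.setA, HS.tick, Function.update_self, hR.l, hm] at z ⊢
      rw [z]
      by_cases hj : j = m + 1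
      · subst hj; simp
      · rw [Function.update_of_ne hj, Function.update_of_ne hj]; exact hR.dg j
    constructor
    · exact d1
    · rw [f2.1 .dir rfl, f1.1 .dir rfl]; exact hR.dir.trans (by rw [hd])
    · rw [f2.1 .res rfl, f1.1 .res rfl]; exact hR.res
    · exact d2
    · rw [f2.2 .DG rfl]; exact hdg
    · intro j t ht
      by_cases hj : j = m
      · subst hj
        rw [d3 t ht, hR.S _ t ht]
        simp
      · rw [d4 _ (mul_add_disjoint hj ht), hR.S j t ht]
        simp [hj]
    · have := hR.le; simp only; omega
    · intro j h1 h2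
      by_cases hj : j = m + 1
      · subst hj; simp only [Function.update_self]; omega
      · simp only [Function.update_of_ne hj]; exact hR.lt j (by simp only at h1; omega) h2

theorem retC_spec {σ : HS} {st : ESt} (hE : Env n P H σ) (hT : TabRel E P σ)
    (hR : ERel P st σ) (hd : st.dir = true) : ERel P (E.step P.r st) (Cmd.retC.run f σ) := by
  unfold Tab.step
  rw [if_neg (by rw [hd]; simp)]
  obtain ⟨σ1, e1⟩ : ∃ τ, τ = ((Cmd.sub .d .r .l).run f σ).tick 1 := ⟨_, rfl⟩
  have f1 : Frame (Cmd.sub .d .r .l) σ σ1 := e1 ▸ (frame_run _ rfl σ).trans (frame_tick _ _)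
  have hd1 : σ1.v .d = P.r - st.l := by
    rw [e1]; simp [Cmd.run, HS.setV, HS.tick, hE.r, hR.l]
  have E1 := hE.frame f1 rfl
  have T1 := hT.frame f1 rfl
  by_cases hl : P.r ≤ st.l
  · rw [if_pos hl]
    have h1 : Cmd.retC.run f σ = Cmd.skip.run f σ1 := by
      have h2 : ((Cmd.sub .d .r .l).run f σ).v .d = 0 := by
        have : σ1.v .d = 0 := by rw [hd1]; omega
        rwa [e1] at this
      rw [e1]
      exact run_ite_eq h2
    have f2 : Frame _ σ1 _ := frame_run (f := f) Cmd.skip rfl σ1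
    rw [h1]
    constructor
    · rw [f2.1 .l rfl, f1.1 .l rfl]; exact hR.l
    · rw [f2.1 .dir rfl, f1.1 .dir rfl]; exact hR.dir
    · rw [f2.1 .res rfl, f1.1 .res rfl]; exact hR.res
    · rw [f2.1 .o rfl, f1.1 .o rfl]; exact hR.o
    · rw [f2.2 .DG rfl, f1.2 .DG rfl]; exact hR.dg
    · rw [f2.2 .S rfl, f1.2 .S rfl]; exact hR.S
    · exact hR.le
    · exact hR.lt
  · rw [if_neg hl]
    obtain ⟨σ2, e2⟩ : ∃ τ, τ = (Cmd.add .l .l .one ;; Cmd.add .o .o .q ;; Cmd.ld .g .DG .l).run f σ1 :=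
      ⟨_, rfl⟩
    obtain ⟨σ3, e3⟩ : ∃ τ, τ = (Cmd.ite .res Cmd.upC Cmd.skip).run f σ2 := ⟨_, rfl⟩
    obtain ⟨σ4, e4⟩ : ∃ τ, τ = ((Cmd.add .g .g .one ;; Cmd.st .DG .l .g ;;
        Cmd.sub .d .W .g).run f σ3).tick 1 := ⟨_, rfl⟩
    have hfin : Cmd.retC.run f σ = if σ4.v .d ≠ 0 then (Cmd.downC ;; .set .dir 0).run f σ4
        else Cmd.pureC.run f σ4 := by
      have h2 : ((Cmd.sub .d .r .l).run f σ).v .d ≠ 0 := by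
        have : σ1.v .d ≠ 0 := by rw [hd1]; omega
        rwa [e1] at this
      have h3 : Cmd.retC.run f σ = (Cmd.ite .d (Cmd.downC ;; .set .dir 0) Cmd.pureC).run f
          ((Cmd.add .g .g .one ;; Cmd.st .DG .l .g ;; Cmd.sub .d .W .g).run f σ3) := by
        rw [e3, e2, e1]
        exact run_ite_ne h2
      rw [h3]
      split_ifs with h4
      · rw [e4] at h4 ⊢; exact run_ite_ne h4
      · rw [e4] at h4 ⊢; exact run_ite_eq (not_not.1 h4)
    have f2 : Frame _ σ1 σ2 := e2 ▸ frame_run _ rfl σ1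
    have f3 : Frame _ σ2 σ3 := e3 ▸ frame_run _ rfl σ2
    have f4 : Frame (Cmd.add .g .g .one ;; Cmd.st .DG .l .g ;; Cmd.sub .d .W .g) σ3 σ4 :=
      e4 ▸ (frame_run _ rfl σ3).trans (frame_tick _ _)
    have E2 := E1.frame f2 rfl
    have E3 := E2.frame f3 rfl
    have E4 := E3.frame f4 rfl
    have T2 := T1.frame f2 rfl
    have T3 := T2.frame f3 rfl
    have T4 := T3.frame f4 rfl
    have hgW := hR.lt (st.l + 1) (by omega) (by omega)
    have l2 : σ2.v .l = st.l + 1 := by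
      have := f1.1 .l rfl
      rw [e2]; simp [Cmd.run, HS.setV, this, hR.l, E1.one]
    have o2 : σ2.v .o = (st.l + 1) * P.q := by
      have := f1.1 .o rfl
      rw [e2]; simp [Cmd.run, HS.setV, this, hR.o, E1.q, Nat.add_mul]
    have g2 : σ2.v .g = st.dg (st.l + 1) := by
      have h5 := f1.1 .l rfl
      have h6 := f1.2 .DG rfl
      rw [e2]; simp [Cmd.run, HS.setV, h5, hR.l, E1.one, h6, hR.dg]
    have r2 : σ2.v .res = st.res.toNat := by rw [f2.1 .res rfl, f1.1 .res rfl, hR.res]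
    have S2 : σ2.A .S = σ.A .S := (f2.2 .S rfl).trans (f1.2 .S rfl)
    have S3 : ∀ m, ∀ t < P.q, (σ3.A .S (m * P.q + t) ≠ 0 ↔
        Function.update st.S (st.l + 1) (E.upSet st) m t = true) := by
      intro m t ht
      cases hres : st.res
      · have : σ3 = Cmd.skip.run f (σ2.tick 1) := by
          rw [e3]; simp only [Cmd.run]; rw [if_neg (by rw [r2, hres]; simp)]
        have h7 : σ3.A .S = σ.A .S := by
          rw [this, ← S2]; rfl
        rw [h7, hR.S m t ht]
        simp only [Tab.upSet, hres]
        by_cases hm : m = st.l + 1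
        · subst hm; simp
        · rw [Function.update_of_ne hm]
      · have : σ3 = Cmd.upC.run f (σ2.tick 1) := by
          rw [e3]; simp only [Cmd.run]; rw [if_pos (by rw [r2, hres]; simp)]
        obtain ⟨u1, u2⟩ := upC_spec (f := f) (E2.frame (frame_tick (c := Cmd.skip) σ2 1) rfl)
          (T2.frame (frame_tick (c := Cmd.skip) σ2 1) rfl) hgW g2 o2
        rw [← this] at u1 u2
        simp only [HS.tick, S2] at u1 u2
        by_cases hm : m = st.l + 1
        · subst hm
          rw [u1 t ht, Function.update_self, hR.S _ t ht]
          simp [Tab.upSet, hres]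
        · rw [u2 _ (mul_add_disjoint hm ht), hR.S m t ht, Function.update_of_ne hm]
    have S4 : σ4.A .S = σ3.A .S := f4.2 .S rfl
    have l4 : σ4.v .l = st.l + 1 := by rw [f4.1 .l rfl, f3.1 .l rfl, l2]
    have o4 : σ4.v .o = (st.l + 1) * P.q := by rw [f4.1 .o rfl, f3.1 .o rfl, o2]
    have g3 : σ3.v .g = st.dg (st.l + 1) := by rw [f3.1 .g rfl, g2]
    have l3 : σ3.v .l = st.l + 1 := by rw [f3.1 .l rfl, l2]
    have g4 : σ4.v .g = st.dg (st.l + 1) + 1 := by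
      rw [e4]; simp [Cmd.run, HS.setV, HS.setA, HS.tick, g3, E3.one]
    have d4 : σ4.v .d = P.W - (st.dg (st.l + 1) + 1) := by
      rw [e4]; simp [Cmd.run, HS.setV, HS.setA, HS.tick, g3, E3.one, E3.W]
    have dg3 : σ3.A .DG = σ.A .DG := by rw [f3.2 .DG rfl, f2.2 .DG rfl, f1.2 .DG rfl]
    have dg4 : ∀ m, σ4.A .DG m = Function.update st.dg (st.l + 1) (st.dg (st.l + 1) + 1) m := by
      intro m
      rw [e4]
      simp only [Cmd.run, HS.setV, HS.setA, HS.tick, Function.update_self, Function.update_of_ne,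
        ne_eq, reduceCtorEq, not_false_eq_true, g3, l3, E3.one, dg3]
      by_cases hm : m = st.l + 1
      · subst hm; simp
      · rw [Function.update_of_ne hm, Function.update_of_ne hm, hR.dg]
    have dir4 : σ4.v .dir = 1 := by
      rw [f4.1 .dir rfl, f3.1 .dir rfl, f2.1 .dir rfl, f1.1 .dir rfl, hR.dir, hd]; rfl
    have res4 : σ4.v .res = st.res.toNat := by rw [f4.1 .res rfl, f3.1 .res rfl, r2]
    rw [hfin]
    by_cases hW : E.W ≤ st.dg (st.l + 1) + 1
    · rw [if_pos hW, if_neg (by rw [d4, ← hT.W]; omega)]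
      have f5 : Frame _ σ4 _ := frame_run (f := f) Cmd.pureC rfl σ4
      have hp := pureC_spec (f := f) E4 T4 (S := E.upSet st) o4 (fun t ht => by
        rw [S4, S3 _ t ht, Function.update_self])
      constructor
      · rw [f5.1 .l rfl]; exact l4
      · rw [f5.1 .dir rfl]; exact dir4
      · exact hp
      · rw [f5.1 .o rfl]; exact o4
      · rw [f5.2 .DG rfl]; exact dg4
      · rw [f5.2 .S rfl, S4]; exact S3
      · simp only; omega
      · intro m h1 h2
        simp only at h1 ⊢
        rw [Function.update_of_ne (by omega)]
        exact hR.lt m (by omega) h2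
    · rw [if_neg hW, if_pos (by rw [d4, ← hT.W]; omega)]
      rw [hT.W] at hW
      obtain ⟨c1, c2, c3, c4⟩ := downC_spec (f := f) E4 T4 (by omega) g4 l4 o4
      obtain ⟨σ5, e5⟩ : ∃ τ, τ = Cmd.downC.run f σ4 := ⟨_, rfl⟩
      have f5 : Frame _ σ4 σ5 := e5 ▸ frame_run _ rfl σ4
      have f6 : Frame _ σ5 _ := frame_run (f := f) (Cmd.set .dir 0) rfl σ5
      have h1 : (Cmd.downC ;; .set .dir 0).run f σ4 = (Cmd.set .dir 0).run f σ5 := by rw [e5]; rfl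
      rw [← e5] at c1 c2 c3 c4
      rw [h1]
      constructor
      · rw [f6.1 .l rfl]; exact c1
      · simp [Cmd.run, HS.setV]
      · rw [f6.1 .res rfl, f5.1 .res rfl]; exact res4
      · rw [f6.1 .o rfl]; exact c2
      · rw [f6.2 .DG rfl, f5.2 .DG rfl]; exact dg4
      · rw [f6.2 .S rfl]
        intro m t ht
        by_cases hm : m = st.l
        · subst hm
          rw [c3 t ht, S4, S3 _ t ht, Function.update_self]
          simp
        · rw [c4 _ (mul_add_disjoint hm ht), S4, S3 m t ht]
          simp [hm]
      · exact hR.le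
      · intro m h1 h2
        simp only at h1 ⊢
        by_cases hm : m = st.l + 1
        · subst hm; rw [Function.update_self]; omega
        · rw [Function.update_of_ne hm]; exact hR.lt m h1 h2

theorem stepC_spec {σ : HS} {st : ESt} (hE : Env n P H σ) (hT : TabRel E P σ) (hW : 1 ≤ P.W)
    (hR : ERel P st σ) : ERel P (E.step P.r st) (Cmd.stepC.run f σ) := by
  have f0 : Frame Cmd.skip σ (σ.tick 1) := frame_tick _ _
  have hR' : ERel P st (σ.tick 1) := ⟨hR.l, hR.dir, hR.res, hR.o, hR.dg, hR.S, hR.le, hR.lt⟩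
  simp only [Cmd.stepC, Cmd.run]
  cases hd : st.dir
  · rw [if_neg (by rw [hR.dir, hd]; simp)]
    exact callC_spec (hE.frame f0 rfl) (hT.frame f0 rfl) hW hR' hd
  · rw [if_pos (by rw [hR.dir, hd]; simp)]
    exact retC_spec (hE.frame f0 rfl) (hT.frame f0 rfl) hR' hd

/-- The lower levels hold leftovers of earlier rounds, so the abstract state takes whatever the
memory contains there. Only the set of the top level matters for the result. -/
theorem searchInit_spec {σ : HS} (hE : Env n P H σ) :
    ∃ st : ESt, ERel P st (Cmd.searchInit.run f σ) ∧ st.l = P.r ∧ st.dir = false ∧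
      ∀ t < P.q, st.S P.r t = true := by
  obtain ⟨σ1, e1⟩ : ∃ τ, τ = (Cmd.add .o .rq .zero).run f σ := ⟨_, rfl⟩
  have f1 : Frame _ σ σ1 := e1 ▸ frame_run _ rfl σ
  have E1 := hE.frame f1 rfl
  have o1 : σ1.v .o = P.r * P.q := by rw [e1]; simp [Cmd.run, HS.setV, hE.rq, hE.zero]
  obtain ⟨σ', hF, hI, he⟩ := rep_inv (f := f) (k := .kt) (r := .q)
    (c := Cmd.add .c .o .kt ;; .st .S .c .one) rfl rfl σ1
    (fun j τ => ∀ t < P.q, j ≤ t → τ.A .S (P.r * P.q + t) ≠ 0)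
    (by rw [E1.q]; intro t h1 h2; omega)
    (by
      intro j hj τ hτ hI
      have a1 := (hτ.1 .o rfl).trans o1
      have a2 := (E1.frame hτ rfl).one
      simp only [Cmd.run, HS.setV, HS.setA, HS.tick, Function.update_self, Function.update_of_ne,
        ne_eq, reduceCtorEq, not_false_eq_true, a1, a2]
      intro t h1 h2
      rcases Nat.eq_or_lt_of_le h2 with h | h
      · subst h; simp
      · rw [Function.update_of_ne (by omega)]; exact hI t h1 h)
  obtain ⟨σ2, e2⟩ : ∃ τ, τ = (Cmd.add .l .r .zero ;; Cmd.set .dir 0 ;; Cmd.set .res 0).run f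
    (σ'.tick 1) := ⟨_, rfl⟩
  have f2 : Frame _ (σ'.tick 1) σ2 := e2 ▸ frame_run _ rfl _
  have hfin : Cmd.searchInit.run f σ = σ2 := by rw [e2, ← he, e1]; rfl
  have E2 := E1.frame hF rfl
  rw [hfin]
  refine ⟨⟨P.r, false, false, σ2.A .DG, fun m t => decide (σ2.A .S (m * P.q + t) ≠ 0)⟩,
    ⟨?_, ?_, ?_, ?_, fun m => rfl, fun m t ht => by simp, le_rfl, fun m h1 h2 => by
      simp only at h1; omega⟩, rfl, rfl, fun t ht => ?_⟩
  · rw [e2]; simp [Cmd.run, HS.setV, HS.tick, E2.r, E2.zero]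
  · rw [e2]; simp [Cmd.run, HS.setV, HS.tick]
  · rw [e2]; simp [Cmd.run, HS.setV, HS.tick]
  · rw [f2.1 .o rfl]; exact (hF.1 .o rfl).trans o1
  · simp only [decide_eq_true_eq]
    rw [f2.2 .S rfl]; exact hI t ht (Nat.zero_le _)

theorem pureB_congr {S S' : ℕ → Bool} (h : ∀ t < E.q, S t = S' t) : E.pureB S = E.pureB S' := by
  have key : ∀ b, (∃ t < E.q, S t = true ∧ E.lb t = b) ↔ ∃ t < E.q, S' t = true ∧ E.lb t = b := by
    intro b
    constructor
    · rintro ⟨t, h1, h2⟩; exact ⟨t, h1, h t h1 ▸ h2⟩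
    · rintro ⟨t, h1, h2⟩; exact ⟨t, h1, (h t h1).symm ▸ h2⟩
  unfold Tab.pureB
  simp only [key]

theorem elim_congr {Rl : (ℕ → Bool) → Bool}
    (hRl : ∀ S S' : ℕ → Bool, (∀ t < E.q, S t = S' t) → Rl S = Rl S') {S S' : ℕ → Bool}
    (h : ∀ t < E.q, S t = S' t) (i : ℕ) : ∀ t < E.q, E.elim Rl S i t = E.elim Rl S' i t := by
  induction i with
  | zero => exact h
  | succ i ih =>
    intro t ht
    have : Rl (fun t => E.elim Rl S i t && E.lit i t) = Rl (fun t => E.elim Rl S' i t && E.lit i t) :=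
      hRl _ _ fun t ht => by rw [ih t ht]
    simp only [Tab.elim, this]
    split
    · simp only [ih t ht]
    · exact ih t ht

/-- The memory determines a set only on the `q` row indices, and the search looks no further. -/
theorem R_congr (l : ℕ) : ∀ {S S' : ℕ → Bool}, (∀ t < E.q, S t = S' t) → E.R l S = E.R l S' := by
  induction l with
  | zero => intro S S' h; exact pureB_congr h
  | succ l ih => intro S S' h; exact pureB_congr (elim_congr (fun S S' h => ih h) h _)

theorem finish_spec {σ : HS} (hE : Env n P H σ) (hT : TabRel E P σ) (hW : 1 ≤ P.W) :
    ((Cmd.finish.run f σ).v .acc ≠ 0 ↔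
      σ.v .acc ≠ 0 ∨ (σ.v .bad = 0 ∧ E.R P.r (fun _ => true) = true)) := by
  obtain ⟨st, s1, s2, s3, s4⟩ := searchInit_spec (f := f) hE
  obtain ⟨σ1, e1⟩ : ∃ τ, τ = Cmd.searchInit.run f σ := ⟨_, rfl⟩
  have f1 : Frame _ σ σ1 := e1 ▸ frame_run _ rfl σ
  rw [← e1] at s1
  have E1 := hE.frame f1 rfl
  have T1 := hT.frame f1 rfl
  obtain ⟨σ', hF, hI, he⟩ := rep_inv (f := f) (k := .k1) (r := .L) (c := Cmd.stepC) rfl rfl σ1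
    (fun j τ => ∃ M, M + j = (2 * P.W + 1) ^ P.r ∧ ERel P ((E.step P.r)^[M] st) τ)
    (by
      rw [E1.L]
      refine ⟨0, Nat.zero_add _, ?_⟩
      simp only [Function.iterate_zero, id]
      exact ⟨s1.l, s1.dir, s1.res, s1.o, s1.dg, s1.S, s1.le, s1.lt⟩)
    (by
      rintro j hj τ hτ ⟨M, hM, hR⟩
      refine ⟨M + 1, by omega, ?_⟩
      rw [Function.iterate_succ_apply']
      have g := hτ.trans (frame_setV τ j 3)
      exact stepC_spec (E1.frame g rfl) (T1.frame g rfl) hW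
        ⟨hR.l, hR.dir, hR.res, hR.o, hR.dg, hR.S, hR.le, hR.lt⟩)
  obtain ⟨M, hM, hR⟩ := hI
  rw [Nat.add_zero] at hM
  subst hM
  have hres := hR.res
  rw [← hT.W] at hres
  rw [E.step_result (hT.W ▸ hW) P.r st s2 s3] at hres
  rw [R_congr (E := E) P.r (S' := fun _ => true) (fun t ht => s4 t (hT.q ▸ ht))] at hres
  have hfin : Cmd.finish.run f σ = (Cmd.ite .bad Cmd.skip (.ite .res (.set .acc 1)
      Cmd.skip)).run f (σ'.tick 1) := by rw [← he, e1]; rfl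
  have b' : σ'.v .bad = σ.v .bad := (hF.1 .bad rfl).trans (f1.1 .bad rfl)
  have a' : σ'.v .acc = σ.v .acc := (hF.1 .acc rfl).trans (f1.1 .acc rfl)
  rw [hfin]
  by_cases hb : σ.v .bad = 0 <;> cases hr : E.R P.r (fun _ => true)
  all_goals
    rw [hr] at hres
    simp [Cmd.run, Cmd.skip, HS.setV, HS.tick, b', a', hb, hres]

end search

/-! ### Couplings of the program with the tester -/

section coupling

variable {α β γ : Type}

theorem Sim.mono_support_right {μ : PMF α} {ν : PMF β} {R R' : α → β → Prop} (h : Sim μ ν R)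
    (hR : ∀ b ∈ ν.support, ∀ a, R a b → R' a b) : Sim μ ν R' := by
  obtain ⟨κ, h1, h2, h3⟩ := h
  refine ⟨κ, h1, h2, fun p hp => hR _ ?_ _ (h3 p hp)⟩
  rw [← h2, PMF.support_map]
  exact ⟨p, hp, rfl⟩

theorem Sim.map_right {μ : PMF α} {ν : PMF β} {R : α → β → Prop} (h : Sim μ ν R) (g : β → γ)
    {R' : α → γ → Prop} (hR : ∀ a b, R a b → R' a (g b)) : Sim μ (ν.map g) R' := by
  rw [← PMF.bind_pure_comp, ← PMF.bind_pure μ]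
  exact h.bind fun a b hab => Sim.pure (hR a b hab)

theorem Sim.bind_left {μ : PMF α} {ν : PMF β} {R : α → β → Prop} (h : Sim μ ν R)
    {F : α → PMF γ} {R' : γ → β → Prop} (hF : ∀ a b, R a b → Sim (F a) (PMF.pure b) R') :
    Sim (μ.bind F) ν R' := by
  rw [← PMF.bind_pure ν]
  exact h.bind hF

end coupling

/-! ### Coupling of the random commands with the idealized process -/

section programs

variable {n : ℕ} {f : BoolFun n} {D : PMF (Fin n → Bool)} {β : Type}

theorem frame_den (c : Cmd) (σ : HS) : ∀ τ ∈ (c.den f D σ).support, Frame c σ τ :=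
  fun τ hτ => ⟨fun _ hx => c.den_v hx σ τ hτ, fun _ ha => c.den_A ha σ τ hτ⟩

theorem Sim.frame {c : Cmd} {σ : HS} {ν : PMF β} {R : HS → β → Prop}
    (h : Sim (c.den f D σ) ν R) : Sim (c.den f D σ) ν fun τ b => Frame c σ τ ∧ R τ b :=
  h.mono_support fun τ hτ b hR => ⟨frame_den c σ τ hτ, hR⟩

theorem frame_rep {k r : Var} {c : Cmd} {σ τ : HS} (h : Frame c σ τ) : Frame (.rep k r c) σ τ := by
  refine ⟨fun x hx => h.1 x ?_, h.2⟩
  simp only [Cmd.writes, Bool.or_eq_false_iff] at hx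
  exact hx.2

/-- The loop rule for couplings: the process `G` satisfies the recursion of the loop with `step` in
place of the body, and `R j` relates the two sides when `j` iterations are left. -/
theorem rep_sim {C c : Cmd} {k r : Var} (hC : C = .rep k r c) (σ : HS) (G step : ℕ → β → PMF β)
    (hG0 : ∀ b, G 0 b = PMF.pure b) (hG : ∀ j b, G (j + 1) b = (step j b).bind (G j)) (b : β)
    (R : ℕ → HS → β → Prop) {R' : HS → β → Prop} (h0 : R (σ.v r) (σ.setV k (σ.v r) 2) b)
    (hstep : ∀ j < σ.v r, ∀ σ' b, Frame C σ σ' → R (j + 1) σ' b →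
      Sim (c.den f D (σ'.setV k j 3)) (step j b) (R j))
    (hfin : ∀ τ b, Frame C σ τ → R 0 τ b → R' (τ.tick 1) b) :
    Sim (C.den f D σ) (G (σ.v r) b) R' := by
  subst hC
  have key : ∀ j ≤ σ.v r, ∀ σ' b, Frame (.rep k r c) σ σ' → R j σ' b →
      Sim (iterDen (c.den f D) k j σ') (G j b) R' := by
    intro j
    induction j with
    | zero =>
      intro _ σ' b hF hR
      rw [hG0]
      exact Sim.pure (hfin _ _ hF hR)
    | succ j ih =>
      intro hj σ' b hF hR
      rw [hG, iterDen]
      refine (hstep j hj σ' b hF hR).frame.bind fun τ b' hτ => ?_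
      exact ih (by omega) τ b' ((hF.trans (frame_setV σ' j 3)).trans (frame_rep hτ.1)) hτ.2
  exact key _ le_rfl _ _ (frame_setV σ _ 2) h0

theorem den_seq_det {a b : Cmd} (ha : a.det = true) (σ : HS) :
    (a ;; b).den f D σ = b.den f D (a.run f σ) := by
  rw [Cmd.den, a.den_of_det ha, PMF.pure_bind]

theorem seq_det_sim {a b : Cmd} {σ : HS} {ν : PMF β} {R R' : HS → β → Prop}
    (h : Sim (a.den f D σ) ν R) (hb : b.det = true) (hR : ∀ τ x, R τ x → R' (b.run f τ) x) :
    Sim ((a ;; b).den f D σ) ν R' := by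
  rw [Cmd.den]
  refine h.bind_left fun τ x hτ => ?_
  rw [b.den_of_det hb]
  exact Sim.pure (hR τ x hτ)

theorem flip_sim (x : Var) (σ : HS) :
    Sim ((Cmd.flip x).den f D σ) coin fun τ b => τ = σ.setV x b.toNat 1 := by
  have := Sim.map coin (fun b : Bool => σ.setV x b.toNat 1) (fun b => b)
    (R := fun τ b => τ = σ.setV x b.toNat 1) fun _ => rfl
  rwa [show (fun b : Bool => b) = id from rfl, PMF.map_id] at this

theorem drawPt_sim (a : Arr) (σ : HS) (hn : σ.v .n = n) :
    Sim ((Cmd.drawPt a).den f D σ) (drawPoint n) fun τ p => PtArr τ a p := by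
  have h := rep_sim (f := f) (D := D) (C := Cmd.drawPt a) rfl σ (fun M w => iid coin M w)
    (fun j w => coin.map (Function.update w j)) (fun _ => rfl)
    (fun j w => by simp only [iid, PMF.bind_map]; rfl) (fun _ => false)
    (fun j τ w => ∀ i : Fin n, j ≤ i → τ.A a i = (w i).toNat)
    (R' := fun τ w => PtArr τ a fun i => w i)
    (by intro i hi; have := i.2; omega)
    (by
      intro j hj σ' w hF hR
      refine (seq_det_sim (flip_sim .b _) rfl (R' := fun τ b =>
        ∀ i : Fin n, j ≤ i → τ.A a i = (Function.update w j b i).toNat) ?_).map_right _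
          fun τ b h => h
      rintro τ b rfl i hi
      simp only [Cmd.run, HS.setV, HS.setA, Function.update_self, Function.update_of_ne, ne_eq,
        reduceCtorEq, not_false_eq_true]
      rcases Nat.eq_or_lt_of_le hi with h | h
      · rw [← h, Function.update_self, Function.update_self]
      · rw [Function.update_of_ne (by omega), Function.update_of_ne (by omega)]
        exact hR i h)
    (fun τ w _ h i => h i (Nat.zero_le _))
  rw [hn] at h
  exact h.map_right _ fun τ w h => h

theorem drawEx_sim (σ : HS) (hn : σ.v .n = n) :
    Sim (Cmd.drawEx.den f D σ) D fun τ x => PtArr τ .X x ∧ τ.v .lx = (f x).toNat := by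
  have h : Sim ((Cmd.smp .lx).den f D σ) D
      fun τ x => τ = (σ.setB (pointBuf x) 0).setV .lx (f x).toNat (n + 2) := by
    have := Sim.map D (fun x => (σ.setB (pointBuf x) 0).setV .lx (f x).toNat (n + 2)) (fun b => b)
      (R := fun τ x => τ = (σ.setB (pointBuf x) 0).setV .lx (f x).toNat (n + 2)) fun _ => rfl
    rwa [show (fun b : Fin n → Bool => b) = id from rfl, PMF.map_id] at this
  refine seq_det_sim h rfl ?_
  rintro τ x rfl
  obtain ⟨σ', hF, hI, he⟩ := rep_inv (f := f) (k := .ki) (r := .n)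
    (c := .ldB .xx .ki ;; .st .X .ki .xx) rfl rfl
    ((σ.setB (pointBuf x) 0).setV .lx (f x).toNat (n + 2))
    (fun j τ => τ.B = pointBuf x ∧ ∀ i : Fin n, j ≤ i → τ.A .X i = (x i).toNat)
    (by
      refine ⟨rfl, fun i hi => ?_⟩
      have := i.2
      simp only [HS.setV, HS.setB, Function.update_of_ne, ne_eq, reduceCtorEq, not_false_eq_true,
        hn] at hi
      omega)
    (by
      intro j hj τ hτ ⟨i1, i2⟩
      simp only [HS.setV, HS.setB, Function.update_of_ne, ne_eq, reduceCtorEq, not_false_eq_true,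
        hn] at hj
      simp only [Cmd.run, HS.setV, HS.setA, Function.update_self, Function.update_of_ne, ne_eq,
        reduceCtorEq, not_false_eq_true, hj, if_true, i1]
      refine ⟨trivial, fun i hi => ?_⟩
      by_cases hij : (i : ℕ) = j
      · have : i = ⟨j, hj⟩ := Fin.ext hij
        subst this
        simp only [Function.update_self, pointBuf, dif_pos hj]
      · rw [Function.update_of_ne hij]
        exact i2 i (by omega))
  rw [he]
  refine ⟨fun i => hI.2 i (Nat.zero_le _), ?_⟩
  simp only [HS.tick]
  rw [hF.1 .lx rfl]
  simp [HS.setV]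

theorem drawRow_sim (σ : HS) (hn : σ.v .n = n) :
    Sim (Cmd.drawRow.den f D σ) (rowDist D) fun τ ρ => PtArr τ .X ρ.x ∧ PtArr τ .Y ρ.y ∧
      PtArr τ .U ρ.u ∧ PtArr τ .V ρ.v ∧ τ.v .lx = (f ρ.x).toNat := by
  unfold Cmd.drawRow rowDist
  simp only [Cmd.den]
  refine (drawEx_sim σ hn).frame.bind fun σ1 x h1 => ?_
  have n1 := (h1.1.1 .n rfl).trans hn
  refine (drawPt_sim .Y σ1 n1).frame.bind fun σ2 y h2 => ?_
  have n2 := (h2.1.1 .n rfl).trans n1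
  refine (drawPt_sim .U σ2 n2).frame.bind fun σ3 u h3 => ?_
  have n3 := (h3.1.1 .n rfl).trans n2
  refine ((drawPt_sim .V σ3 n3).frame.map_right (fun v => (⟨x, y, u, v⟩ : Row n))
    fun σ4 v h4 => ?_)
  refine ⟨((h1.2.1.frame h2.1 rfl).frame h3.1 rfl).frame h4.1 rfl,
    (h2.2.frame h3.1 rfl).frame h4.1 rfl, h3.2.frame h4.1 rfl, h4.2, ?_⟩
  rw [h4.1.1 .lx rfl, h3.1.1 .lx rfl, h2.1.1 .lx rfl]
  exact h1.2.2

variable {P : Prm} {H : ℕ → ℕ} {F : Fd n}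

/-- State at the beginning of a round. -/
structure RoundRel (P : Prm) (H : ℕ → ℕ) (σ : HS) (st : Fd n × Bool) : Prop where
  env : Env n P H σ
  fd : FdRel st.1 σ
  acc : σ.v .acc ≠ 0 ↔ st.2 = true

theorem rows_sim (σ : HS) (hE : Env n P H σ) (hFd : FdRel F σ) (hflag : σ.v .flag = 0)
    (hbad : σ.v .bad = 0) (htp : σ.v .tp = P.q * P.s) :
    Sim ((Cmd.rep .kt .q (Cmd.drawRow ;; Cmd.rowDet)).den f D σ)
      (iid (rowDist D) P.q fun _ => default) fun τ w => RowRel f P H F 0 w τ := by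
  have h := rep_sim (f := f) (D := D) (C := Cmd.rep .kt .q (Cmd.drawRow ;; Cmd.rowDet)) rfl σ
    (fun M w => iid (rowDist D) M w)
    (fun j w => (rowDist D).map (Function.update w j)) (fun _ => rfl)
    (fun j w => by simp only [iid, PMF.bind_map]; rfl) (fun _ => default)
    (fun j τ w => RowRel f P H F j w τ) (R' := fun τ w => RowRel f P H F 0 w τ)
    (by
      have hF : Frame (Cmd.rep .kt .q Cmd.skip) σ (σ.setV .kt (σ.v .q) 2) := frame_setV _ _ _
      rw [hE.q] at hF ⊢
      constructor
      · exact hE.frame hF rfl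
      · exact hFd.frame hF rfl
      · rw [hF.1 .tp rfl, htp]
      · intro _; rw [hF.1 .flag rfl, hflag]
      · intro t h1 h2; omega
      · rw [hF.1 .bad rfl, hbad]
        exact ⟨fun _ t h1 h2 => by omega, fun _ => rfl⟩
      · intro t h1 h2; omega
      · intro t h1 h2; omega)
    (by
      intro j hj σ' w hF hR
      rw [hE.q] at hj
      have h1 : Frame (Cmd.rep .kt .q Cmd.drawRow) σ' (σ'.setV .kt j 3) := frame_setV _ _ _
      have hn : (σ'.setV .kt j 3).v .n = n := (h1.1 .n rfl).trans hR.env.vn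
      refine (seq_det_sim (drawRow_sim _ hn).frame rfl (R' := fun τ ρ =>
        RowRel f P H F j (Function.update w j ρ) τ) ?_).map_right _ fun τ b h => h
      rintro τ ρ ⟨h2, h3, h4, h5, h6, h7⟩
      refine hR.step hj (h1.trans (frame_rep h2)) rfl rfl rfl rfl h3 h4 h5 h6 h7 ?_
      rw [h2.1 .kt rfl]
      simp [HS.setV])
    (fun τ w _ h => by
      have hF : Frame Cmd.skip τ (τ.tick 1) := frame_tick _ _
      exact ⟨h.env.frame hF rfl, h.fd.frame hF rfl, h.tp, h.none, h.some, h.bad, h.TB, h.LB⟩)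
  rwa [hE.q] at h

theorem RowRel.tabRel {w : ℕ → Row n} {σ : HS} (hs : 1 ≤ P.s) (h : RowRel f P H F 0 w σ) :
    TabRel (F.tab f H P.s P.W P.q w) P σ := by
  constructor
  · rfl
  · rfl
  · intro i _; exact Nat.mod_lt _ hs
  · intro t ht v hv; exact h.TB t (Nat.zero_le _) ht v hv
  · intro t ht; exact h.LB t (Nat.zero_le _) ht
  · exact h.env.LV
  · intro i hi
    rw [h.env.LP i hi]
    simp only [Fd.tab]
    rcases Nat.mod_two_eq_zero_or_one i with h0 | h0 <;> rw [h0] <;> rfl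

-- After the rows have been drawn the rest of a round is deterministic, so the coupling of the rows
-- determines the coupling of the round.
open Classical in
theorem round_sim (hs : 1 ≤ P.s) (hW : 1 ≤ P.W) (hB : ∀ i : Fin n, H i < P.m2) (hB1 : 1 ≤ P.m2)
    {σ : HS} {st : Fd n × Bool} (hR : RoundRel P H σ st) :
    Sim (Cmd.round.den f D σ) ((iid (rowDist D) P.q fun _ => default).map fun w =>
      (st.1.next f H P.q w, st.2 || decide (st.1.Pass f H P.s P.W P.r P.q w))) (RoundRel P H) := by
  obtain ⟨σ1, e1⟩ : ∃ τ, τ = (Cmd.set .flag 0 ;; Cmd.set .bad 0 ;; Cmd.add .tp .qs .zero).run f σ :=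
    ⟨_, rfl⟩
  have f1 : Frame _ σ σ1 := e1 ▸ frame_run _ rfl σ
  have h0 : Cmd.round.den f D σ = (Cmd.rep .kt .q (Cmd.drawRow ;; Cmd.rowDet) ;;
      Cmd.ite .flag Cmd.discover Cmd.finish).den f D σ1 := by
    rw [e1, Cmd.round, den_seq_det rfl, den_seq_det rfl, den_seq_det rfl]
    rfl
  have E1 := hR.env.frame f1 rfl
  have G1 := hR.fd.frame f1 rfl
  rw [h0]
  refine (seq_det_sim (rows_sim σ1 E1 G1 (by rw [e1]; simp [Cmd.run, HS.setV])
    (by rw [e1]; simp [Cmd.run, HS.setV])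
    (by rw [e1]; simp [Cmd.run, HS.setV, hR.env.qs, hR.env.zero])).frame rfl
    (R' := fun τ w => RoundRel P H τ (st.1.next f H P.q w,
      st.2 || decide (st.1.Pass f H P.s P.W P.r P.q w))) ?_).map_right _ fun τ b h => h
  rintro τ w ⟨f2, hw⟩
  have hacc : τ.v .acc = σ.v .acc := (f2.1 .acc rfl).trans (f1.1 .acc rfl)
  have f3 : Frame Cmd.skip τ (τ.tick 1) := frame_tick _ _
  by_cases hex : ∃ t, t < P.q ∧ st.1.Disc f H (w t)
  · have hmin := fun t' (h : t' < Nat.find hex) => Nat.find_min hex h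
    obtain ⟨g1, g2, g3⟩ := hw.some (Nat.find hex) (Nat.zero_le _) (Nat.find_spec hex).1
      (Nat.find_spec hex).2 fun t' _ h hD =>
        hmin t' h ⟨h.trans (Nat.find_spec hex).1, hD⟩
    rw [run_ite_ne g1]
    have f4 : Frame _ (τ.tick 1) _ := frame_run (f := f) Cmd.discover rfl (τ.tick 1)
    have hd := discover_spec (f := f) (hw.env.frame f3 rfl) (hw.fd.frame f3 rfl) hB hB1
      (x := (w (Nat.find hex)).x) g3 g2
    constructor
    · exact (hw.env.frame f3 rfl).frame f4 rfl
    · simp only [Fd.next, dif_pos hex]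
      exact hd
    · rw [f4.1 .acc rfl]
      have hp : ¬ st.1.Pass f H P.s P.W P.r P.q w := fun h =>
        h.1 _ (Nat.find_spec hex).1 (Nat.find_spec hex).2
      simp only [HS.tick, hacc, hR.acc, decide_eq_false hp, Bool.or_false]
  · have hno : ∀ t < P.q, ¬ st.1.Disc f H (w t) := fun t h1 h2 => hex ⟨t, h1, h2⟩
    rw [run_ite_eq (hw.none fun t _ h => hno t h)]
    have f4 : Frame _ (τ.tick 1) _ := frame_run (f := f) Cmd.finish rfl (τ.tick 1)
    have hfin := finish_spec (f := f) (hw.env.frame f3 rfl) ((hw.tabRel hs).frame f3 rfl) hW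
    constructor
    · exact (hw.env.frame f3 rfl).frame f4 rfl
    · simp only [Fd.next, dif_neg hex]
      exact (hw.fd.frame f3 rfl).frame f4 rfl
    · rw [hfin]
      simp only [HS.tick, hacc, hR.acc, hw.bad, Bool.or_eq_true, decide_eq_true_eq]
      refine or_congr Iff.rfl ⟨fun h => ⟨hno, fun t ht v hv => h.1 t (Nat.zero_le _) ht v hv, h.2⟩,
        fun h => ⟨fun t _ ht v hv => h.2.1 t ht v hv, h.2.2⟩⟩

theorem rounds_sim (hs : 1 ≤ P.s) (hW : 1 ≤ P.W) (hB : ∀ i : Fin n, H i < P.m2) (hB1 : 1 ≤ P.m2)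
    {σ : HS} {st : Fd n × Bool} (hR : RoundRel P H σ st) (hs1 : σ.v .s1 = P.s + 1) :
    Sim ((Cmd.rep .kd .s1 Cmd.round).den f D σ) (rounds f D H P.s P.W P.r P.q (P.s + 1) st)
      (RoundRel P H) := by
  classical
  have h := rep_sim (f := f) (D := D) (C := Cmd.rep .kd .s1 Cmd.round) rfl σ
    (fun M st => rounds f D H P.s P.W P.r P.q M st)
    (fun _ st => (iid (rowDist D) P.q fun _ => default).map fun w =>
      (st.1.next f H P.q w, st.2 || decide (st.1.Pass f H P.s P.W P.r P.q w)))
    (fun _ => rfl)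
    (fun j w => by
      simp only [rounds, PMF.bind_map]
      congr 1) st
    (fun _ τ st => RoundRel P H τ st) (R' := RoundRel P H)
    (by
      have hF : Frame (Cmd.rep .kd .s1 Cmd.skip) σ (σ.setV .kd (σ.v .s1) 2) := frame_setV _ _ _
      exact ⟨hR.env.frame hF rfl, hR.fd.frame hF rfl, by rw [hF.1 .acc rfl]; exact hR.acc⟩)
    (by
      intro j _ σ' st' _ hR'
      have hF : Frame (Cmd.rep .kd .s1 Cmd.skip) σ' (σ'.setV .kd j 3) := frame_setV _ _ _
      exact round_sim hs hW hB hB1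
        ⟨hR'.env.frame hF rfl, hR'.fd.frame hF rfl, by rw [hF.1 .acc rfl]; exact hR'.acc⟩)
    (fun τ st' _ h => by
      have hF : Frame Cmd.skip τ (τ.tick 1) := frame_tick _ _
      exact ⟨h.env.frame hF rfl, h.fd.frame hF rfl, h.acc⟩)
  rwa [hs1] at h

/-- `hashC` overwrites the hash array, so the general frame rule does not apply; the new values are
supplied instead. -/
theorem Env.hash_frame {σ σ' : HS} (hE : Env n P H σ) (hF : Frame Cmd.hashC σ σ') {H' : ℕ → ℕ}
    (hH : ∀ i : Fin n, σ'.A .H i = H' i) : Env n P H' σ' := by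
  constructor
  · rw [hF.1 .n rfl, hE.vn]
  · rw [hF.1 .one rfl, hE.one]
  · rw [hF.1 .zero rfl, hE.zero]
  · rw [hF.1 .s rfl, hE.s]
  · rw [hF.1 .W rfl, hE.W]
  · rw [hF.1 .r rfl, hE.r]
  · rw [hF.1 .q rfl, hE.q]
  · rw [hF.1 .L rfl, hE.L]
  · rw [hF.1 .m2 rfl, hE.m2]
  · rw [hF.1 .qs rfl, hE.qs]
  · rw [hF.1 .sn rfl, hE.sn]
  · rw [hF.1 .rq rfl, hE.rq]
  · exact hH
  · rw [hF.2 .LV rfl]; exact hE.LV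
  · rw [hF.2 .LP rfl]; exact hE.LP

theorem bits_sim (σ : HS) (h : ℕ) (hh : σ.v .h = h) :
    Sim ((Cmd.rep .k1 .tau (.flip .b ;; .add .h .h .h ;; .add .h .h .b)).den f D σ)
      (hashFrom (σ.v .tau) h) fun τ a => τ.v .h = a := by
  refine rep_sim (f := f) (D := D) rfl σ hashFrom (fun _ h => coin.map fun b => h + h + b.toNat)
    (fun _ => rfl) (fun j w => by simp only [hashFrom, PMF.bind_map]; rfl) h
    (fun _ τ a => τ.v .h = a) (by simp [HS.setV, hh]) ?_ (fun _ _ _ h => h)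
  rintro j _ σ' a _ ha
  refine (seq_det_sim (flip_sim .b _) rfl (R' := fun τ b => τ.v .h = a + a + b.toNat) ?_).map_right
    _ fun τ b h => h
  rintro τ b rfl
  simp only [Cmd.run, HS.setV, Function.update_self, Function.update_of_ne, ne_eq, reduceCtorEq,
    not_false_eq_true, ha]

theorem hashC_sim (σ : HS) (hn : σ.v .n = n) :
    Sim (Cmd.hashC.den f D σ) (iid (hashFrom (σ.v .tau) 1) n fun _ => 0)
      fun τ H => ∀ i : Fin n, τ.A .H i = H i ∧ H i < 2 ^ (σ.v .tau + 1) := by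
  have h := rep_sim (f := f) (D := D) (C := Cmd.hashC) rfl σ
    (fun M w => iid (hashFrom (σ.v .tau) 1) M w)
    (fun j w => (hashFrom (σ.v .tau) 1).map (Function.update w j)) (fun _ => rfl)
    (fun j w => by simp only [iid, PMF.bind_map]; rfl) (fun _ => 0)
    (fun j τ w => ∀ i : Fin n, j ≤ i → τ.A .H i = w i)
    (R' := fun τ w => ∀ i : Fin n, τ.A .H i = w i)
    (by intro i hi; have := i.2; omega)
    (by
      intro j hj σ' w hF hR
      rw [den_seq_det rfl]
      obtain ⟨σ1, e1⟩ : ∃ τ, τ = (Cmd.set .h 1).run f (σ'.setV .ki j 3) := ⟨_, rfl⟩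
      have hb := bits_sim (f := f) (D := D) σ1 1 (by rw [e1]; simp [Cmd.run, HS.setV])
      have htau : σ1.v .tau = σ.v .tau := by
        rw [← hF.1 .tau rfl, e1]; simp [Cmd.run, HS.setV]
      rw [htau] at hb
      rw [← e1]
      refine (seq_det_sim hb.frame rfl (R' := fun τ a =>
        ∀ i : Fin n, j ≤ i → τ.A .H i = Function.update w j a i) ?_).map_right _ fun τ b h => h
      rintro τ a ⟨h1, rfl⟩ i hi
      have h2 : τ.v .ki = j := by rw [h1.1 .ki rfl, e1]; simp [Cmd.run, HS.setV]
      have h3 : τ.A .H = σ'.A .H := by rw [h1.2 .H rfl, e1]; rfl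
      simp only [Cmd.run, HS.setA, Function.update_self, h2, h3]
      rcases Nat.eq_or_lt_of_le hi with h | h
      · rw [← h, Function.update_self, Function.update_self]
      · rw [Function.update_of_ne (by omega), Function.update_of_ne (by omega)]
        exact hR i h)
    (fun τ w _ h i => h i (Nat.zero_le _))
  rw [hn] at h
  refine h.mono_support_right fun H hH τ hτ i => ⟨hτ i, ?_⟩
  have := (hashFrom_support _ _ _ (iid_support_lt _ _ _ _ hH i i.2)).2
  rwa [pow_succ, mul_comm]

theorem mainC_sim (hs : 1 ≤ P.s) (hW : 1 ≤ P.W) {σ : HS} {H₀ : ℕ → ℕ} (hE : Env n P H₀ σ)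
    (hFd : FdRel (Fd.init n) σ) (hacc : σ.v .acc = 0) (hs1 : σ.v .s1 = P.s + 1)
    (hm2 : P.m2 = 2 ^ (σ.v .tau + 1)) :
    Sim (Cmd.mainC.den f D σ) (tester f D P.s P.W P.r P.q (σ.v .tau))
      fun τ st => τ.v .acc ≠ 0 ↔ st.2 = true := by
  unfold Cmd.mainC tester
  rw [Cmd.den]
  refine (hashC_sim σ hE.vn).frame.bind fun σ1 H h1 => ?_
  refine (rounds_sim (P := P) hs hW (fun i => hm2 ▸ (h1.2 i).2) (hm2 ▸ Nat.one_le_two_pow)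
    ⟨hE.hash_frame h1.1 fun i => (h1.2 i).1, hFd.frame h1.1 rfl, ?_⟩
    ((h1.1.1 .s1 rfl).trans hs1)).mono fun τ st h => h.acc
  rw [h1.1.1 .acc rfl, hacc]; simp

end programs

/-! ### The computation of the parameters -/

section params

variable {n : ℕ} {f : BoolFun n}

/-- Throughout `p = 2 ^ r ≤ s`, and either doubling has stopped or `r` equals the number of
iterations made. The latter cannot hold after `s` iterations, as `s < 2 ^ s`. -/
theorem log_loop_spec {σ : HS} {s : ℕ} (hs : 1 ≤ s) (h1 : σ.v .s = s) (hone : σ.v .one = 1)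
    (hzero : σ.v .zero = 0) (hp : σ.v .p = 1) (hr : σ.v .r = 0) {σ' : HS}
    (hσ' : σ' = (Cmd.rep .k1 .s (.add .t .p .p ;; .sub .d .t .s ;;
      .ite .d Cmd.skip (.add .p .t .zero ;; .add .r .r .one))).run f σ) :
    2 ^ σ'.v .r ≤ s ∧ s < 2 ^ (σ'.v .r + 1) := by
  subst hσ'
  obtain ⟨σ', hF, ⟨i1, i2, i3⟩, he⟩ := rep_inv (f := f) (k := .k1) (r := .s)
    (c := .add .t .p .p ;; .sub .d .t .s ;;
      .ite .d Cmd.skip (.add .p .t .zero ;; .add .r .r .one)) rfl rfl σ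
    (fun j τ => τ.v .p = 2 ^ τ.v .r ∧ τ.v .p ≤ s ∧ (s < 2 * τ.v .p ∨ τ.v .r + j = s))
    (by
      rw [h1]
      simp [HS.setV, hp, hr, hs])
    (by
      rintro j hj τ hτ ⟨i1, i2, i3⟩
      have a1 := (hτ.1 .s rfl).trans h1
      have a2 := (hτ.1 .one rfl).trans hone
      have a3 := (hτ.1 .zero rfl).trans hzero
      by_cases hlt : s < 2 * τ.v .p
      · have hd : τ.v .p + τ.v .p - s ≠ 0 := by omega
        simp only [Cmd.run, Cmd.skip, HS.setV, HS.tick, Function.update_self,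
          Function.update_of_ne, ne_eq, reduceCtorEq, not_false_eq_true, a1, hd, if_true]
        exact ⟨i1, i2, Or.inl hlt⟩
      · have hd : τ.v .p + τ.v .p - s = 0 := by omega
        simp only [Cmd.run, Cmd.skip, HS.setV, HS.tick, Function.update_self,
          Function.update_of_ne, ne_eq, reduceCtorEq, not_false_eq_true, a1, a2, a3, hd,
          not_true_eq_false, if_false, Nat.add_zero]
        refine ⟨by rw [i1, pow_succ]; ring, by omega, Or.inr ?_⟩
        have := i3.resolve_left hlt
        omega)
  rw [he]
  simp only [HS.tick]
  rw [i1] at i2 i3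
  refine ⟨i2, ?_⟩
  rcases i3 with h | h
  · rw [pow_succ]; omega
  · rw [Nat.add_zero] at h
    rw [h] at i2
    exact absurd i2 (not_le.2 Nat.lt_two_pow_self)

theorem param1_spec {C s : ℕ} {σ : HS} (hs : 1 ≤ s) (h1 : σ.v .s = s) (hzero : σ.v .zero = 0)
    (hr : σ.v .r = 0) (hW : σ.v .W = 0) {σ' : HS} (hσ' : σ' = (Cmd.param1 C).run f σ) :
    σ'.v .one = 1 ∧ σ'.v .two = 2 ∧ σ'.v .cst = C ∧ σ'.v .W = 2 * s * s ∧
      σ'.v .W2 = 2 * (2 * s * s) + 1 ∧ 2 ^ σ'.v .r ≤ s ∧ s < 2 ^ (σ'.v .r + 1) := by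
  obtain ⟨σ1, e1⟩ : ∃ τ, τ = (Cmd.set .one 1 ;; Cmd.set .two 2 ;; Cmd.set .p 1 ;;
    Cmd.set .cst C).run f σ := ⟨_, rfl⟩
  obtain ⟨σ2, e2⟩ : ∃ τ, τ = (Cmd.rep .k1 .s (.add .t .p .p ;; .sub .d .t .s ;;
      .ite .d Cmd.skip (.add .p .t .zero ;; .add .r .r .one))).run f σ1 := ⟨_, rfl⟩
  have f1 : Frame _ σ σ1 := e1 ▸ frame_run _ rfl σ
  have f2 : Frame _ σ1 σ2 := e2 ▸ frame_run _ rfl σ1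
  have b1 : σ1.v .one = 1 := by rw [e1]; simp [Cmd.run, HS.setV]
  have b2 : σ1.v .two = 2 := by rw [e1]; simp [Cmd.run, HS.setV]
  have b3 : σ1.v .p = 1 := by rw [e1]; simp [Cmd.run, HS.setV]
  have b4 : σ1.v .cst = C := by rw [e1]; simp [Cmd.run, HS.setV]
  have hlog := log_loop_spec hs ((f1.1 .s rfl).trans h1) b1 ((f1.1 .zero rfl).trans hzero) b3
    ((f1.1 .r rfl).trans hr) e2
  have s2 : σ2.v .s = s := (f2.1 .s rfl).trans ((f1.1 .s rfl).trans h1)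
  obtain ⟨σ3, hF, hI, he⟩ := rep_inv (f := f) (k := .k1) (r := .s)
    (c := .add .W .W .s ;; .add .W .W .s) rfl rfl σ2
    (fun j τ => τ.v .W + 2 * j * s = 2 * s * s)
    (by
      have : σ2.v .W = 0 := (f2.1 .W rfl).trans ((f1.1 .W rfl).trans hW)
      simp [HS.setV, this, s2])
    (by
      intro j hj τ hτ hI
      have a1 := (hτ.1 .s rfl).trans s2
      simp only [Cmd.run, HS.setV, Function.update_self, Function.update_of_ne, ne_eq, reduceCtorEq,
        not_false_eq_true, a1]
      rw [← hI]; ring)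
  obtain ⟨σ4, e4⟩ : ∃ τ, τ = (Cmd.add .W2 .W .W ;; Cmd.add .W2 .W2 .one).run f (σ3.tick 1) :=
    ⟨_, rfl⟩
  have f4 : Frame _ (σ3.tick 1) σ4 := e4 ▸ frame_run _ rfl _
  have hfin : σ' = σ4 := by rw [hσ', e4, ← he, e2, e1]; rfl
  rw [hfin]
  have w3 : σ3.v .W = 2 * s * s := by rw [← hI]; ring
  have o3 : σ3.v .one = 1 := (hF.1 .one rfl).trans ((f2.1 .one rfl).trans b1)
  have hr4 : σ4.v .r = σ2.v .r := (f4.1 .r rfl).trans (hF.1 .r rfl)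
  rw [hr4]
  refine ⟨(f4.1 .one rfl).trans o3, ?_, ?_, (f4.1 .W rfl).trans w3, ?_, hlog⟩
  · exact (f4.1 .two rfl).trans ((hF.1 .two rfl).trans ((f2.1 .two rfl).trans b2))
  · exact (f4.1 .cst rfl).trans ((hF.1 .cst rfl).trans ((f2.1 .cst rfl).trans b4))
  · rw [e4]
    simp [Cmd.run, HS.setV, HS.tick, w3, o3]
    ring

theorem param2_spec {σ : HS} (hzero : σ.v .zero = 0) {σ' : HS} (hσ' : σ' = Cmd.param2.run f σ) :
    σ'.v .L = σ.v .W2 ^ σ.v .r := by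
  obtain ⟨σ1, e1⟩ : ∃ τ, τ = (Cmd.set .L 1).run f σ := ⟨_, rfl⟩
  have f1 : Frame _ σ σ1 := e1 ▸ frame_run _ rfl σ
  have r1 : σ1.v .r = σ.v .r := f1.1 .r rfl
  obtain ⟨σ2, hF, hI, he⟩ := rep_inv (f := f) (k := .k1) (r := .r)
    (c := .set .t 0 ;; .rep .k2 .W2 (.add .t .t .L) ;; .add .L .t .zero) rfl rfl σ1
    (fun j τ => τ.v .L * σ.v .W2 ^ j = σ.v .W2 ^ σ.v .r)
    (by
      have : σ1.v .L = 1 := by rw [e1]; simp [Cmd.run, HS.setV]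
      simp [HS.setV, this, r1])
    (by
      intro j hj τ hτ hI
      have a1 : τ.v .W2 = σ.v .W2 := (hτ.1 .W2 rfl).trans (f1.1 .W2 rfl)
      have a2 : τ.v .zero = 0 := (hτ.1 .zero rfl).trans ((f1.1 .zero rfl).trans hzero)
      obtain ⟨τ1, t1⟩ : ∃ τ1, τ1 = (Cmd.set .t 0).run f (τ.setV .k1 j 3) := ⟨_, rfl⟩
      have g := rep_add (f := f) (k := .k2) (r := .W2) (x := .t) (y := .L) (by decide) (by decide)
        (by decide) τ1
      have g1 : Frame _ τ1 _ := frame_run (f := f) (Cmd.rep .k2 .W2 (.add .t .t .L)) rfl τ1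
      have h3 : (Cmd.set .t 0 ;; .rep .k2 .W2 (.add .t .t .L) ;; .add .L .t .zero).run f
          (τ.setV .k1 j 3) = (Cmd.add .L .t .zero).run f
            ((Cmd.rep .k2 .W2 (.add .t .t .L)).run f τ1) := by rw [t1]; rfl
      have c1 : τ1.v .t = 0 := by rw [t1]; simp [Cmd.run, HS.setV]
      have c2 : τ1.v .L = τ.v .L := by rw [t1]; simp [Cmd.run, HS.setV]
      have c3 : τ1.v .W2 = σ.v .W2 := by rw [t1]; simp [Cmd.run, HS.setV, a1]
      have c4 : τ1.v .zero = 0 := by rw [t1]; simp [Cmd.run, HS.setV, a2]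
      rw [h3]
      have c5 := g1.1 .zero rfl
      rw [c4] at c5
      rw [c1, c2, c3, Nat.zero_add] at g
      have h4 : ((Cmd.add .L .t .zero).run f
          ((Cmd.rep .k2 .W2 (.add .t .t .L)).run f τ1)).v .L = σ.v .W2 * τ.v .L := by
        rw [Cmd.run, HS.setV, g, c5]
        simp
      rw [h4, ← hI, pow_succ]
      ring)
  have hfin : σ' = σ2.tick 1 := by rw [hσ', ← he, e1]; rfl
  rw [hfin]
  simpa [HS.tick] using hI

theorem param3_spec {Ct : ℕ} {σ : HS} (he : σ.v .e = 0) (hc : σ.v .c = 0) (hq : σ.v .q = 0)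
    (htwo : σ.v .two = 2) {σ' : HS} (hσ' : σ' = (Cmd.param3 Ct).run f σ) :
    σ'.v .q = σ.v .N * (σ.v .cst * (σ.v .s * σ.v .L)) ∧
      σ'.v .tau = Ct + 2 + σ.v .r + σ.v .r := by
  obtain ⟨σ1, e1⟩ : ∃ τ, τ = (Cmd.rep .k1 .s (.add .e .e .L)).run f σ := ⟨_, rfl⟩
  obtain ⟨σ2, e2⟩ : ∃ τ, τ = (Cmd.rep .k1 .cst (.add .c .c .e)).run f σ1 := ⟨_, rfl⟩
  obtain ⟨σ3, e3⟩ : ∃ τ, τ = (Cmd.rep .k1 .N (.add .q .q .c)).run f σ2 := ⟨_, rfl⟩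
  obtain ⟨σ4, e4⟩ : ∃ τ, τ = (Cmd.set .tau Ct ;; Cmd.add .tau .tau .two ;; Cmd.add .tau .tau .r ;;
    Cmd.add .tau .tau .r).run f σ3 := ⟨_, rfl⟩
  have hfin : σ' = σ4 := by rw [hσ', e4, e3, e2, e1]; rfl
  have f1 : Frame _ σ σ1 := e1 ▸ frame_run _ rfl σ
  have f2 : Frame _ σ1 σ2 := e2 ▸ frame_run _ rfl σ1
  have f3 : Frame _ σ2 σ3 := e3 ▸ frame_run _ rfl σ2
  have f4 : Frame _ σ3 σ4 := e4 ▸ frame_run _ rfl σ3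
  have g1 := rep_add (f := f) (k := .k1) (r := .s) (x := .e) (y := .L) (by decide) (by decide)
    (by decide) σ
  have g2 := rep_add (f := f) (k := .k1) (r := .cst) (x := .c) (y := .e) (by decide) (by decide)
    (by decide) σ1
  have g3 := rep_add (f := f) (k := .k1) (r := .N) (x := .q) (y := .c) (by decide) (by decide)
    (by decide) σ2
  rw [← e1, he, Nat.zero_add] at g1
  rw [← e2, g1, f1.1 .c rfl, hc, f1.1 .cst rfl, Nat.zero_add] at g2
  rw [← e3, g2, f2.1 .q rfl, f1.1 .q rfl, hq, f2.1 .N rfl, f1.1 .N rfl, Nat.zero_add] at g3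
  rw [hfin]
  refine ⟨by rw [f4.1 .q rfl, g3], ?_⟩
  have h1 : σ3.v .two = 2 := by rw [f3.1 .two rfl, f2.1 .two rfl, f1.1 .two rfl, htwo]
  have h2 : σ3.v .r = σ.v .r := by rw [f3.1 .r rfl, f2.1 .r rfl, f1.1 .r rfl]
  rw [e4]
  simp [Cmd.run, HS.setV, h1, h2]

/-- The first `c` literals are stored. -/
def LitsTo (s c : ℕ) (σ : HS) : Prop :=
  -- The second clause is needed because the sign of an even literal is never written.
  (∀ i < c, σ.A .LV i = i / 2 % s ∧ σ.A .LP i = i % 2) ∧ ∀ i, c ≤ i → σ.A .LP i = 0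

theorem lits_spec {s : ℕ} {σ : HS} (hs : σ.v .s = s) (hone : σ.v .one = 1) (hc : σ.v .c = 0)
    (hLP : ∀ i, σ.A .LP i = 0) :
    LitsTo s (2 * (s * s)) ((Cmd.rep .k1 .s (.set .t 0 ;; .rep .k2 .s (.st .LV .c .t ;;
      .add .c .c .one ;; .st .LV .c .t ;; .st .LP .c .one ;; .add .c .c .one ;;
      .add .t .t .one))).run f σ) := by
  obtain ⟨σ1, hF, ⟨a, i1, i2, i3⟩, he⟩ := rep_inv (f := f) (k := .k1) (r := .s)
    (c := .set .t 0 ;; .rep .k2 .s (.st .LV .c .t ;;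
      .add .c .c .one ;; .st .LV .c .t ;; .st .LP .c .one ;; .add .c .c .one ;;
      .add .t .t .one)) rfl rfl σ
    (fun j τ => ∃ a, a + j = s ∧ τ.v .c = 2 * (s * a) ∧ LitsTo s (2 * (s * a)) τ)
    (by
      rw [hs]
      exact ⟨0, Nat.zero_add _, by simp [HS.setV, hc],
        fun i hi => by simp at hi, fun i _ => hLP i⟩)
    (by
      rintro j hj τ hτ ⟨a, i1, i2, i3⟩
      obtain ⟨τ1, t1⟩ : ∃ τ1, τ1 = (Cmd.set .t 0).run f (τ.setV .k1 j 3) := ⟨_, rfl⟩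
      have c1 : τ1.v .t = 0 := by rw [t1]; simp [Cmd.run, HS.setV]
      have c2 : τ1.v .c = 2 * (s * a) := by rw [t1]; simp [Cmd.run, HS.setV, i2]
      have c3 : τ1.v .s = s := by rw [← hs, ← hτ.1 .s rfl, t1]; simp [Cmd.run, HS.setV]
      have c4 : τ1.v .one = 1 := by rw [← hone, ← hτ.1 .one rfl, t1]; simp [Cmd.run, HS.setV]
      have c5 : LitsTo s (2 * (s * a)) τ1 := by rw [t1]; exact i3
      obtain ⟨τ2, gF, ⟨g1, g2, g3⟩, ge⟩ := rep_inv (f := f) (k := .k2) (r := .s)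
        (c := .st .LV .c .t ;; .add .c .c .one ;; .st .LV .c .t ;; .st .LP .c .one ;;
          .add .c .c .one ;; .add .t .t .one) rfl rfl τ1
        (fun l ρ => ρ.v .t + l = s ∧ ρ.v .c = 2 * (s * a + ρ.v .t) ∧
          LitsTo s (2 * (s * a + ρ.v .t)) ρ)
        (by
          rw [c3]
          simp only [HS.setV, Function.update_of_ne, ne_eq, reduceCtorEq, not_false_eq_true, c1, c2,
            Nat.zero_add, Nat.add_zero]
          exact ⟨trivial, trivial, c5⟩)
        (by
          rintro l hl ρ hρ ⟨h1, h2, h3, h4⟩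
          have d1 := (hρ.1 .one rfl).trans c4
          have hdiv : (s * a + ρ.v .t) % s = ρ.v .t := by
            rw [Nat.mul_add_mod, Nat.mod_eq_of_lt (by omega)]
          unfold LitsTo
          simp only [Cmd.run, HS.setV, HS.setA, Function.update_self, Function.update_of_ne, ne_eq,
            reduceCtorEq, not_false_eq_true, d1, h2]
          refine ⟨by omega, by ring, fun i hi => ?_, fun i hi => ?_⟩
          · rcases lt_trichotomy i (2 * (s * a + ρ.v .t)) with h | h | h
            · rw [Function.update_of_ne (by omega), Function.update_of_ne (by omega),
                Function.update_of_ne (by omega)]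
              exact h3 i h
            · rw [Function.update_of_ne (by omega), h, Function.update_self,
                Function.update_of_ne (by omega), h4 _ le_rfl]
              exact ⟨by rw [Nat.mul_div_cancel_left _ two_pos, hdiv], by omega⟩
            · have h5 : i = 2 * (s * a + ρ.v .t) + 1 := by omega
              rw [h5, Function.update_self, Function.update_self]
              refine ⟨?_, by omega⟩
              rw [show (2 * (s * a + ρ.v .t) + 1) / 2 = s * a + ρ.v .t by omega, hdiv]
          · rw [Function.update_of_ne (by omega)]
            exact h4 i (by omega))
      have hfin : (Cmd.set .t 0 ;; .rep .k2 .s (.st .LV .c .t ;; .add .c .c .one ;;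
          .st .LV .c .t ;; .st .LP .c .one ;; .add .c .c .one ;;
          .add .t .t .one)).run f (τ.setV .k1 j 3) = τ2.tick 1 := by rw [← ge, t1]; rfl
      rw [hfin]
      rw [Nat.add_zero] at g1
      rw [g1] at g2 g3
      exact ⟨a + 1, by omega, by simp only [HS.tick]; rw [g2]; ring,
        by rw [show s * (a + 1) = s * a + s by ring]; exact g3⟩)
  rw [he]
  rw [Nat.add_zero] at i1
  subst i1
  exact i3

theorem double_spec {σ : HS} {σ' : HS} (hσ' : σ' = (Cmd.rep .k1 .tau (.add .m2 .m2 .m2)).run f σ) :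
    σ'.v .m2 = σ.v .m2 * 2 ^ σ.v .tau := by
  obtain ⟨σ1, hF, hI, he⟩ := rep_inv (f := f) (k := .k1) (r := .tau)
    (c := .add .m2 .m2 .m2) rfl rfl σ
    (fun j τ => τ.v .m2 * 2 ^ j = σ.v .m2 * 2 ^ σ.v .tau)
    (by simp [HS.setV])
    (by
      intro j hj τ hτ hI
      rw [← hI]
      simp only [Cmd.run, HS.setV, Function.update_self, Function.update_of_ne, ne_eq, reduceCtorEq,
        not_false_eq_true]
      rw [pow_succ]; ring)
  rw [hσ', he]
  simpa [HS.tick] using hI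

theorem param4_spec {σ : HS} (hqs : σ.v .qs = 0) (hsn : σ.v .sn = 0) (hrq : σ.v .rq = 0)
    (hone : σ.v .one = 1) (hLP : ∀ i, σ.A .LP i = 0) {σ' : HS} (hσ' : σ' = Cmd.param4.run f σ) :
    σ'.v .m2 = 2 ^ (σ.v .tau + 1) ∧ σ'.v .qs = σ.v .s * σ.v .q ∧ σ'.v .sn = σ.v .s * σ.v .n ∧
      σ'.v .rq = σ.v .r * σ.v .q ∧ σ'.v .s1 = σ.v .s + 1 ∧
      LitsTo (σ.v .s) (2 * (σ.v .s * σ.v .s)) σ' := by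
  obtain ⟨σ0, e0⟩ : ∃ τ, τ = (Cmd.set .m2 2).run f σ := ⟨_, rfl⟩
  obtain ⟨σ1, e1⟩ : ∃ τ, τ = (Cmd.rep .k1 .tau (.add .m2 .m2 .m2)).run f σ0 := ⟨_, rfl⟩
  obtain ⟨σ2, e2⟩ : ∃ τ, τ = (Cmd.rep .k1 .s (.add .qs .qs .q)).run f σ1 := ⟨_, rfl⟩
  obtain ⟨σ3, e3⟩ : ∃ τ, τ = (Cmd.rep .k1 .s (.add .sn .sn .n)).run f σ2 := ⟨_, rfl⟩
  obtain ⟨σ4, e4⟩ : ∃ τ, τ = (Cmd.rep .k1 .r (.add .rq .rq .q)).run f σ3 := ⟨_, rfl⟩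
  obtain ⟨σ5, e5⟩ : ∃ τ, τ = (Cmd.add .s1 .s .one ;; Cmd.set .c 0).run f σ4 := ⟨_, rfl⟩
  obtain ⟨σ6, e6⟩ : ∃ τ, τ = (Cmd.rep .k1 .s (.set .t 0 ;; .rep .k2 .s (.st .LV .c .t ;;
      .add .c .c .one ;; .st .LV .c .t ;; .st .LP .c .one ;; .add .c .c .one ;;
      .add .t .t .one))).run f σ5 := ⟨_, rfl⟩
  have hfin : σ' = σ6 := by rw [hσ', e6, e5, e4, e3, e2, e1, e0]; rfl
  have f0 : Frame _ σ σ0 := e0 ▸ frame_run _ rfl σ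
  have f1 : Frame _ σ0 σ1 := e1 ▸ frame_run _ rfl σ0
  have f2 : Frame _ σ1 σ2 := e2 ▸ frame_run _ rfl σ1
  have f3 : Frame _ σ2 σ3 := e3 ▸ frame_run _ rfl σ2
  have f4 : Frame _ σ3 σ4 := e4 ▸ frame_run _ rfl σ3
  have f5 : Frame _ σ4 σ5 := e5 ▸ frame_run _ rfl σ4
  have f6 : Frame _ σ5 σ6 := e6 ▸ frame_run _ rfl σ5
  have g1 := double_spec (f := f) e1
  have g2 := rep_add (f := f) (k := .k1) (r := .s) (x := .qs) (y := .q) (by decide) (by decide)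
    (by decide) σ1
  have g3 := rep_add (f := f) (k := .k1) (r := .s) (x := .sn) (y := .n) (by decide) (by decide)
    (by decide) σ2
  have g4 := rep_add (f := f) (k := .k1) (r := .r) (x := .rq) (y := .q) (by decide) (by decide)
    (by decide) σ3
  have m0 : σ0.v .m2 = 2 := by rw [e0]; simp [Cmd.run, HS.setV]
  rw [m0, f0.1 .tau rfl] at g1
  have s1 : σ1.v .s = σ.v .s := (f1.1 .s rfl).trans (f0.1 .s rfl)
  have q1 : σ1.v .q = σ.v .q := (f1.1 .q rfl).trans (f0.1 .q rfl)
  have qs1 : σ1.v .qs = 0 := (f1.1 .qs rfl).trans ((f0.1 .qs rfl).trans hqs)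
  rw [← e2, qs1, s1, q1, Nat.zero_add] at g2
  have s2 : σ2.v .s = σ.v .s := (f2.1 .s rfl).trans s1
  have sn2 : σ2.v .sn = 0 :=
    (f2.1 .sn rfl).trans ((f1.1 .sn rfl).trans ((f0.1 .sn rfl).trans hsn))
  have n2 : σ2.v .n = σ.v .n := (f2.1 .n rfl).trans ((f1.1 .n rfl).trans (f0.1 .n rfl))
  rw [← e3, sn2, s2, n2, Nat.zero_add] at g3
  have r3 : σ3.v .r = σ.v .r :=
    (f3.1 .r rfl).trans ((f2.1 .r rfl).trans ((f1.1 .r rfl).trans (f0.1 .r rfl)))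
  have q3 : σ3.v .q = σ.v .q := (f3.1 .q rfl).trans ((f2.1 .q rfl).trans q1)
  have rq3 : σ3.v .rq = 0 := (f3.1 .rq rfl).trans ((f2.1 .rq rfl).trans
    ((f1.1 .rq rfl).trans ((f0.1 .rq rfl).trans hrq)))
  rw [← e4, rq3, r3, q3, Nat.zero_add] at g4
  have s4 : σ4.v .s = σ.v .s := (f4.1 .s rfl).trans ((f3.1 .s rfl).trans s2)
  have o4 : σ4.v .one = 1 := (f4.1 .one rfl).trans ((f3.1 .one rfl).trans ((f2.1 .one rfl).trans
    ((f1.1 .one rfl).trans ((f0.1 .one rfl).trans hone))))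
  have s15 : σ5.v .s1 = σ.v .s + 1 := by rw [e5]; simp [Cmd.run, HS.setV, s4, o4]
  have c5 : σ5.v .c = 0 := by rw [e5]; simp [Cmd.run, HS.setV]
  have LP5 : σ5.A .LP = σ.A .LP := by
    rw [f5.2 .LP rfl, f4.2 .LP rfl, f3.2 .LP rfl, f2.2 .LP rfl, f1.2 .LP rfl, f0.2 .LP rfl]
  have hl := lits_spec (f := f) ((f5.1 .s rfl).trans s4) ((f5.1 .one rfl).trans o4) c5
    (by rw [LP5]; exact hLP)
  rw [← e6] at hl
  rw [hfin]
  refine ⟨?_, ?_, ?_, ?_, (f6.1 .s1 rfl).trans s15, hl⟩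
  · rw [f6.1 .m2 rfl, f5.1 .m2 rfl, f4.1 .m2 rfl, f3.1 .m2 rfl, f2.1 .m2 rfl, g1, pow_succ,
      mul_comm]
  · rw [f6.1 .qs rfl, f5.1 .qs rfl, f4.1 .qs rfl, f3.1 .qs rfl, g2]
  · rw [f6.1 .sn rfl, f5.1 .sn rfl, f4.1 .sn rfl, g3]
  · rw [f6.1 .rq rfl, f5.1 .rq rfl, g4]

end params

/-! ### The running time -/

/-- The cost of the command is at most a constant times `X`. -/
def Cmd.fits (n : ℕ) (v : Var → ℕ) : Cmd → ℕ → Prop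
  | .qry _, X => 1 ≤ X ∧ n ≤ X
  | .smp _, X => 1 ≤ X ∧ n ≤ X
  | .seq a b, X => a.fits n v X ∧ b.fits n v X
  | .ite _ a b, X => a.fits n v X ∧ b.fits n v X
  | .rep _ r c, X => 1 ≤ X ∧ ∃ Y, 1 ≤ Y ∧ c.fits n v Y ∧ v r * Y ≤ X
  | _, X => 1 ≤ X

/-- The constant factor of the cost. -/
def Cmd.factor : Cmd → ℕ
  | .seq a b => a.factor + b.factor
  | .ite _ a b => 1 + (a.factor + b.factor)
  | .rep _ _ c => 6 + c.factor
  | _ => 9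

theorem Cmd.fits.pos {n : ℕ} {v : Var → ℕ} (c : Cmd) : ∀ {X : ℕ}, c.fits n v X → 1 ≤ X := by
  induction c with
  | seq a b iha ihb => exact fun h => iha h.1
  | ite y a b iha ihb => exact fun h => iha h.1
  | rep k r c ih => exact fun h => h.1
  | qry x => exact fun h => h.1
  | smp x => exact fun h => h.1
  | _ => exact fun h => h

/-- This separates a constant read off the program text from the size `X` depending on the input:
for nested loops only the products of the loop bounds have to be compared with `X`. -/
theorem Cmd.cost_le_of_fits {n : ℕ} {v : Var → ℕ} (c : Cmd) :
    ∀ {X : ℕ}, c.fits n v X → c.cost n v ≤ c.factor * X := by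
  induction c with
  | seq a b iha ihb =>
    intro X h
    have := iha h.1
    have := ihb h.2
    simp only [Cmd.cost, Cmd.factor, Nat.add_mul]
    omega
  | ite y a b iha ihb =>
    intro X h
    have := iha h.1
    have := ihb h.2
    have := Cmd.fits.pos a h.1
    simp only [Cmd.cost, Cmd.factor, Nat.add_mul]
    omega
  | rep k r c ih =>
    rintro X ⟨h1, Y, h2, h3, h4⟩
    have h5 := ih h3
    simp only [Cmd.cost, Cmd.factor]
    have h6 : v r ≤ v r * Y := Nat.le_mul_of_pos_right _ h2
    have h7 := Nat.mul_le_mul_left (v r) h5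
    have h8 := Nat.mul_le_mul_left c.factor h4
    rw [show v r * (c.factor * Y) = c.factor * (v r * Y) by ring] at h7
    rw [Nat.mul_add, Nat.add_mul]
    omega
  | qry x => intro X h; simp only [Cmd.cost, Cmd.factor, Cmd.fits] at h ⊢; omega
  | smp x => intro X h; simp only [Cmd.cost, Cmd.factor, Cmd.fits] at h ⊢; omega
  | _ => intro X h; simp only [Cmd.cost, Cmd.factor, Cmd.fits] at h ⊢; omega

/-! ### Sizes of the loop bounds in the pieces of the program -/

section fits

variable {n X : ℕ} {v : Var → ℕ}

theorem fits_rep {k r : Var} {c : Cmd} (Y : ℕ) (hX : 1 ≤ X) (hY : 1 ≤ Y) (hc : c.fits n v Y)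
    (h : v r * Y ≤ X) : (Cmd.rep k r c).fits n v X := ⟨hX, Y, hY, hc, h⟩

theorem fits_rep_one {k r : Var} {c : Cmd} (hX : 1 ≤ X) (hc : c.fits n v 1)
    (h : v r ≤ X) : (Cmd.rep k r c).fits n v X := fits_rep 1 hX le_rfl hc (by rwa [Nat.mul_one])

theorem fits_param1 {C : ℕ} (h1 : 1 ≤ X) (hs : v .s ≤ X) : (Cmd.param1 C).fits n v X := by
  have h2 : (Cmd.add .t .p .p ;; .sub .d .t .s ;;
    .ite .d Cmd.skip (.add .p .t .zero ;; .add .r .r .one)).fits n v 1 := by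
    simp [Cmd.fits, Cmd.skip]
  have h3 : (Cmd.add .W .W .s ;; .add .W .W .s).fits n v 1 := by simp [Cmd.fits]
  exact ⟨h1, h1, h1, h1, fits_rep_one h1 h2 hs, fits_rep_one h1 h3 hs, h1, h1⟩

theorem fits_param2 (h1 : 1 ≤ X) (hs : v .r * (v .W2 + 1) ≤ X) : Cmd.param2.fits n v X := by
  have h2 : (Cmd.add .t .t .L).fits n v 1 := by simp [Cmd.fits]
  -- The extra unit pays for the instructions around the inner loop, even if that loop is empty.
  have h3 : 1 ≤ v .W2 + 1 := by omega
  exact ⟨h1, fits_rep (v .W2 + 1) h1 h3 ⟨h3, fits_rep_one h3 h2 (Nat.le_succ _), h3⟩ hs⟩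

theorem fits_param3 {Ct : ℕ} (h1 : 1 ≤ X) (hs : v .s ≤ X) (hc : v .cst ≤ X) (hN : v .N ≤ X) :
    (Cmd.param3 Ct).fits n v X := by
  have h2 : ∀ x y z, (Cmd.add x y z).fits n v 1 := by simp [Cmd.fits]
  exact ⟨fits_rep_one h1 (h2 _ _ _) hs, fits_rep_one h1 (h2 _ _ _) hc, fits_rep_one h1 (h2 _ _ _) hN,
    h1, h1, h1, h1⟩

theorem fits_param4 (h1 : 1 ≤ X) (ht : v .tau ≤ X) (hs : v .s * (v .s + 1) ≤ X) (hr : v .r ≤ X) :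
    Cmd.param4.fits n v X := by
  have h2 : ∀ x y z, (Cmd.add x y z).fits n v 1 := by simp [Cmd.fits]
  have h3 : 1 ≤ v .s + 1 := by omega
  have hs' : v .s ≤ X := le_trans (Nat.le_mul_of_pos_right _ h3) hs
  have h4 : (Cmd.st .LV .c .t ;; .add .c .c .one ;; .st .LV .c .t ;; .st .LP .c .one ;;
    .add .c .c .one ;; .add .t .t .one).fits n v 1 := by simp [Cmd.fits]
  exact ⟨h1, fits_rep_one h1 (h2 _ _ _) ht, fits_rep_one h1 (h2 _ _ _) hs',
    fits_rep_one h1 (h2 _ _ _) hs', fits_rep_one h1 (h2 _ _ _) hr, h1, h1,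
    fits_rep (v .s + 1) h1 h3 ⟨h3, fits_rep_one h3 h4 (Nat.le_succ _)⟩ hs⟩

theorem fits_hashC (h1 : 1 ≤ X) (h : v .n * (v .tau + 1) ≤ X) : Cmd.hashC.fits n v X := by
  have h3 : 1 ≤ v .tau + 1 := by omega
  have h4 : (Cmd.flip .b ;; .add .h .h .h ;; .add .h .h .b).fits n v 1 := by simp [Cmd.fits]
  exact fits_rep (v .tau + 1) h1 h3 ⟨h3, fits_rep_one h3 h4 (Nat.le_succ _), h3⟩ h

theorem fits_slot (hv : v .n = n) (h1 : 1 ≤ X) (hn : n ≤ X) : Cmd.slot.fits n v X := by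
  have hb : ∀ a, (Cmd.fillBlock a).fits n v X := fun a =>
    fits_rep_one h1 (by simp [Cmd.fits, Cmd.xorC]) (hv.le.trans hn)
  have hq : ∀ x, (Cmd.qry x).fits n v X := fun x => ⟨h1, hn⟩
  have ht : Cmd.slotTests.fits n v X := by simp [Cmd.slotTests, Cmd.xorC, Cmd.fits, h1]
  exact ⟨h1, h1, h1, ⟨hb _, hq _, hb _, hq _, hb _, hq _, hb _, hq _, hb _, hq _, hb _, hq _⟩, ht⟩

theorem fits_row (hv : v .n = n) (h1 : 1 ≤ X) (hn : n ≤ X) (hs : v .s * n ≤ X) (hn1 : 1 ≤ n) :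
    (Cmd.drawRow ;; Cmd.rowDet).fits n v X := by
  have hd : ∀ a, (Cmd.drawPt a).fits n v X := fun a =>
    fits_rep_one h1 (by simp [Cmd.fits]) (hv.le.trans hn)
  have hx : Cmd.drawEx.fits n v X :=
    ⟨⟨h1, hn⟩, fits_rep_one h1 (by simp [Cmd.fits]) (hv.le.trans hn)⟩
  have hp : Cmd.fillProj.fits n v X :=
    fits_rep_one h1 (by simp [Cmd.fits]) (hv.le.trans hn)
  have hc : Cmd.checkDisc.fits n v X := by
    refine ⟨hp, ⟨h1, hn⟩, by simp [Cmd.xorC, Cmd.fits, h1], ⟨h1, h1, ?_⟩, h1⟩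
    exact fits_rep_one h1 (by simp [Cmd.fits]) (hv.le.trans hn)
  have hpt : Cmd.points.fits n v X :=
    fits_rep_one h1 (by simp [Cmd.fits, Cmd.xorC]) (hv.le.trans hn)
  exact ⟨⟨hx, hd _, hd _, hd _⟩, hc, hpt, h1, fits_rep n h1 hn1 (fits_slot hv hn1 le_rfl) hs, h1⟩

theorem fits_discover (hv : v .n = n) (h1 : 1 ≤ X) (hn : n ≤ X) (hm : v .m2 * n ≤ X) (hn1 : 1 ≤ n) :
    Cmd.discover.fits n v X := by
  have hp : Cmd.fillPart.fits n v n :=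
    fits_rep_one hn1 (by simp [Cmd.fits, Cmd.skip]) hv.le
  have hs : Cmd.search.fits n v X := by
    refine ⟨h1, h1, fits_rep n h1 hn1 ⟨hn1, hp, ⟨hn1, le_rfl⟩, ?_, hn1, hn1⟩ hm⟩
    simp [Cmd.xorC, Cmd.fits, hn1]
  exact ⟨hs, h1, h1, fits_rep_one h1 (by simp [Cmd.fits]) (hv.le.trans hn), h1, h1⟩

theorem fits_stepC (h1 : 1 ≤ X) (hq : v .q ≤ X) : Cmd.stepC.fits n v X := by
  have hd : Cmd.downC.fits n v X :=
    ⟨h1, h1, h1, h1, fits_rep_one h1 (by simp [Cmd.fits, Cmd.xorC, Cmd.skip]) hq, h1, h1⟩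
  have hu : Cmd.upC.fits n v X :=
    ⟨h1, h1, h1, fits_rep_one h1 (by simp [Cmd.fits, Cmd.xorC, Cmd.skip]) hq⟩
  have hp : Cmd.pureC.fits n v X :=
    ⟨h1, h1, fits_rep_one h1 (by simp [Cmd.fits, Cmd.skip]) hq, h1, h1, h1⟩
  exact ⟨⟨h1, ⟨h1, h1, h1, ⟨hu, h1⟩, h1, h1, h1, ⟨hd, h1⟩, hp⟩, h1⟩, ⟨h1, h1, hd⟩, hp, h1⟩

theorem fits_round (hv : v .n = n) (hn1 : 1 ≤ n) (hs1 : 1 ≤ v .s) (hq1 : 1 ≤ v .q)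
    (h1 : v .q * (v .s * n) ≤ X) (h2 : v .m2 * n ≤ X) (h3 : v .L * v .q ≤ X) :
    Cmd.round.fits n v X := by
  have hsn : 1 ≤ v .s * n := Nat.mul_pos hs1 hn1
  have hX : v .s * n ≤ X := le_trans (Nat.le_mul_of_pos_left _ hq1) h1
  have hX1 : 1 ≤ X := hsn.trans hX
  have hqX : v .q ≤ X := le_trans (Nat.le_mul_of_pos_right _ hsn) h1
  have hnX : n ≤ X := le_trans (Nat.le_mul_of_pos_left _ hs1) hX
  have hinit : Cmd.searchInit.fits n v X :=
    ⟨hX1, fits_rep_one hX1 (by simp [Cmd.fits]) hqX, hX1, hX1, hX1⟩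
  exact ⟨hX1, hX1, hX1, fits_rep (v .s * n) hX1 hsn
    (fits_row hv hsn (Nat.le_mul_of_pos_left _ hs1) le_rfl hn1) h1,
    fits_discover hv hX1 hnX h2 hn1, hinit,
    fits_rep (v .q) hX1 hq1 (fits_stepC hq1 le_rfl) h3, hX1, hX1, hX1⟩

theorem fits_mainC {Y : ℕ} (hv : v .n = n) (hn1 : 1 ≤ n) (hs1 : 1 ≤ v .s) (hq1 : 1 ≤ v .q)
    (h1 : v .q * (v .s * n) ≤ Y) (h2 : v .m2 * n ≤ Y) (h3 : v .L * v .q ≤ Y) (hX : 1 ≤ X)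
    (h4 : v .n * (v .tau + 1) ≤ X) (h5 : v .s1 * Y ≤ X) : Cmd.mainC.fits n v X := by
  have hY := fits_round hv hn1 hs1 hq1 h1 h2 h3
  exact ⟨fits_hashC hX h4, fits_rep Y hX (Cmd.fits.pos _ hY) hY h5⟩

end fits

/-! ### The whole program: behaviour and time -/

section whole

variable {n : ℕ} {f : BoolFun n} {D : PMF (Fin n → Bool)}

/-- `Y` dominates one round, that is, the rows (`q s n`), the scan of hybrids (`m2 · n`) and the
search (`L q`); `A` dominates `s + 1` rounds, the hashing and the computation of the parameters. All
estimates rest on `r < 2 ^ r ≤ s`. -/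
theorem time_bounds {n s N C Ct L r : ℕ} (hn : 1 ≤ n) (hs : 1 ≤ s) (hN : 1 ≤ N) (hC : 1 ≤ C)
    (hL1 : 1 ≤ L) (hr : 2 ^ r ≤ s) :
    let A := 2 ^ (Ct + 3) * (2 * C) * N * n * (s ^ 5 * (L * L))
    let Y := 2 ^ (Ct + 3) * C * N * n * (s ^ 4 * (L * L))
    1 ≤ A ∧ s ≤ A ∧ r * (2 * (2 * s * s) + 1 + 1) ≤ A ∧ C ≤ A ∧ N ≤ A ∧ Ct + 2 + r + r ≤ A ∧
      s * (s + 1) ≤ A ∧ r ≤ A ∧ n * (Ct + 2 + r + r + 1) ≤ A ∧ (s + 1) * Y ≤ A ∧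
      N * (C * (s * L)) * (s * n) ≤ Y ∧ 2 ^ (Ct + 2 + r + r + 1) * n ≤ Y ∧
      L * (N * (C * (s * L))) ≤ Y := by
  intro A Y
  have hM : 1 ≤ 2 ^ (Ct + 3) := Nat.one_le_two_pow
  have hs5 : 1 ≤ s ^ 5 := Nat.one_le_pow _ _ hs
  have hLL : 1 ≤ L * L := Nat.mul_pos hL1 hL1
  have hrs : r < s := lt_of_lt_of_le Nat.lt_two_pow_self hr
  have hm2 : 2 ^ (Ct + 2 + r + r + 1) ≤ 2 ^ (Ct + 3) * (s * s) := by
    rw [show Ct + 2 + r + r + 1 = (Ct + 3) + (r + r) by ring, pow_add, pow_add 2 r r]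
    exact Nat.mul_le_mul_left _ (Nat.mul_le_mul hr hr)
  have htau : Ct + 2 + r + r + 1 ≤ 2 ^ (Ct + 3) * (s * s) :=
    (Nat.lt_two_pow_self).le.trans hm2
  have hMs : 2 ^ (Ct + 3) * (s * s) ≤ 2 ^ (Ct + 3) * s ^ 5 := by
    rw [← pow_two]
    exact Nat.mul_le_mul_left _ (Nat.pow_le_pow_right hs (by norm_num))
  have hAle : ∀ b, b ≤ 2 ^ (Ct + 3) * s ^ 5 * n → b ≤ A := by
    intro b hb
    rw [show A = 2 ^ (Ct + 3) * s ^ 5 * n * ((2 * C) * N * (L * L)) by ring]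
    exact hb.trans (Nat.le_mul_of_pos_right _ (by positivity))
  have hAle' : ∀ b, b ≤ 2 ^ (Ct + 3) * s ^ 5 → b ≤ A := fun b hb =>
    hAle b (hb.trans (Nat.le_mul_of_pos_right _ hn))
  have hs3' : 8 * s ^ 3 ≤ 2 ^ (Ct + 3) * s ^ 5 := by
    refine Nat.mul_le_mul ?_ (Nat.pow_le_pow_right hs (by norm_num))
    rw [pow_add]; exact Nat.le_mul_of_pos_left _ Nat.one_le_two_pow
  have hss : s ^ 1 ≤ s ^ 3 := Nat.pow_le_pow_right hs (by norm_num)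
  have hss2 : s ^ 2 ≤ s ^ 3 := Nat.pow_le_pow_right hs (by norm_num)
  rw [pow_one] at hss
  refine ⟨hAle' _ (Nat.mul_pos hM hs5), hAle' _ (by omega), hAle' _ (le_trans ?_ hs3'), ?_, ?_,
    hAle' _ (le_trans (by omega) hMs), hAle' _ (le_trans ?_ hs3'), hAle' _ (by omega), hAle _ ?_, ?_,
    ?_, ?_, ?_⟩
  · have h7 : 2 * (2 * s * s) + 1 + 1 ≤ 6 * (s * s) := by nlinarith
    calc r * (2 * (2 * s * s) + 1 + 1) ≤ s * (6 * (s * s)) := Nat.mul_le_mul hrs.le h7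
      _ = 6 * s ^ 3 := by ring
      _ ≤ 8 * s ^ 3 := by omega
  · rw [show A = C * (2 ^ (Ct + 3) * 2 * N * n * (s ^ 5 * (L * L))) by ring]
    exact Nat.le_mul_of_pos_right _ (by positivity)
  · rw [show A = N * (2 ^ (Ct + 3) * (2 * C) * n * (s ^ 5 * (L * L))) by ring]
    exact Nat.le_mul_of_pos_right _ (by positivity)
  · rw [Nat.mul_add, ← pow_two]; omega
  · rw [Nat.mul_comm]
    exact Nat.mul_le_mul_right _ (htau.trans hMs)
  · rw [show A = (2 * s) * Y by ring]
    exact Nat.mul_le_mul_right _ (by omega)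
  · rw [show Y = N * (C * (s * L)) * (s * n) * (2 ^ (Ct + 3) * s ^ 2 * L) by ring]
    exact Nat.le_mul_of_pos_right _ (by positivity)
  · rw [show Y = 2 ^ (Ct + 3) * (s * s) * n * (C * N * s ^ 2 * (L * L)) by ring]
    exact (Nat.mul_le_mul_right _ hm2).trans (Nat.le_mul_of_pos_right _ (by positivity))
  · rw [show Y = L * (N * (C * (s * L))) * (2 ^ (Ct + 3) * s ^ 3 * n) by ring]
    exact Nat.le_mul_of_pos_right _ (by positivity)

/-- A state at the beginning of a run. -/
structure Init (n s N : ℕ) (σ : HS) : Prop where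
  n : σ.v .n = n
  s : σ.v .s = s
  N : σ.v .N = N
  v : ∀ x, x ≠ .n → x ≠ .s → x ≠ .N → σ.v x = 0
  A : ∀ a i, σ.A a i = 0

theorem time_run (c : Cmd) (l : List Var) (hd : c.det = true)
    (hc : c.boundsAll (fun x => decide (x ∈ l)) = true)
    (hw : l.all (fun x => !c.writes x) = true) {σ σ' : HS} (hσ' : σ' = c.run f σ) {X : ℕ}
    (hX : c.fits n σ.v X) : σ'.T ≤ σ.T + c.factor * X := by
  have h := c.den_time (f := f) (D := PMF.pure fun _ => false) _ hc (fun r hr => by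
    have := List.all_eq_true.1 hw r (of_decide_eq_true hr)
    simpa using this) σ σ' (by rw [c.den_of_det hd, hσ']; simp)
  exact h.trans (Nat.add_le_add_left (Cmd.cost_le_of_fits c hX) _)

/-- The constant of the running time. -/
def timeFactor (C Ct : ℕ) : ℕ :=
  (Cmd.param1 C).factor + Cmd.param2.factor + (Cmd.param3 Ct).factor + Cmd.param4.factor +
    Cmd.mainC.factor + 1

set_option maxHeartbeats 400000 in
theorem prog_spec {C Ct s N : ℕ} (hn : 1 ≤ n) (hs : 1 ≤ s) (hN : 1 ≤ N) (hC : 1 ≤ C) {σ : HS}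
    (hσ : Init n s N σ) :
    ∃ r, 2 ^ r ≤ s ∧ s < 2 ^ (r + 1) ∧
      Sim ((Cmd.prog C Ct).den f D σ)
        (tester f D s (2 * s * s) r (N * (C * (s * (2 * (2 * s * s) + 1) ^ r))) (Ct + 2 + r + r))
        (fun τ st => τ.v .n ≠ 0 ↔ st.2 = true) ∧
      ∀ τ ∈ ((Cmd.prog C Ct).den f D σ).support, τ.T ≤ σ.T + timeFactor C Ct *
        (2 ^ (Ct + 3) * (2 * C) * N * n * (s ^ 5 *
          ((2 * (2 * s * s) + 1) ^ r * (2 * (2 * s * s) + 1) ^ r))) := by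
  obtain ⟨σ1, e1⟩ : ∃ τ, τ = (Cmd.param1 C).run f σ := ⟨_, rfl⟩
  obtain ⟨σ2, e2⟩ : ∃ τ, τ = Cmd.param2.run f σ1 := ⟨_, rfl⟩
  obtain ⟨σ3, e3⟩ : ∃ τ, τ = (Cmd.param3 Ct).run f σ2 := ⟨_, rfl⟩
  obtain ⟨σ4, e4⟩ : ∃ τ, τ = Cmd.param4.run f σ3 := ⟨_, rfl⟩
  have f1 : Frame _ σ σ1 := e1 ▸ frame_run _ rfl σ
  have f2 : Frame _ σ1 σ2 := e2 ▸ frame_run _ rfl σ1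
  have f3 : Frame _ σ2 σ3 := e3 ▸ frame_run _ rfl σ2
  have f4 : Frame _ σ3 σ4 := e4 ▸ frame_run _ rfl σ3
  have hden : (Cmd.prog C Ct).den f D σ = (Cmd.mainC ;; Cmd.add .n .acc .zero).den f D σ4 := by
    rw [Cmd.prog, den_seq_det rfl, den_seq_det rfl, den_seq_det rfl, den_seq_det rfl, e4, e3, e2, e1]
  have v0 : ∀ x, x ≠ .n → x ≠ .s → x ≠ .N → σ.v x = 0 := hσ.v
  obtain ⟨a1, a2, a3, a4, a5, a6, a7⟩ := param1_spec hs hσ.s (v0 _ (by decide) (by decide) (by decide))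
    (v0 _ (by decide) (by decide) (by decide)) (v0 _ (by decide) (by decide) (by decide)) e1
  obtain ⟨r, hr⟩ : ∃ r, r = σ1.v .r := ⟨_, rfl⟩
  rw [← hr] at a6 a7
  have z1 : σ1.v .zero = 0 := (f1.1 .zero rfl).trans (v0 _ (by decide) (by decide) (by decide))
  have b1 := param2_spec z1 e2
  rw [a5, ← hr] at b1
  have z2 : σ2.v .zero = 0 := (f2.1 .zero rfl).trans z1
  have s2 : σ2.v .s = s := (f2.1 .s rfl).trans ((f1.1 .s rfl).trans hσ.s)
  have N2 : σ2.v .N = N := (f2.1 .N rfl).trans ((f1.1 .N rfl).trans hσ.N)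
  have c2 : σ2.v .cst = C := (f2.1 .cst rfl).trans a3
  have r2 : σ2.v .r = r := (f2.1 .r rfl).trans hr.symm
  obtain ⟨c3, d3⟩ := param3_spec (f := f) (σ := σ2) (Ct := Ct)
    ((f2.1 .e rfl).trans ((f1.1 .e rfl).trans (v0 _ (by decide) (by decide) (by decide))))
    ((f2.1 .c rfl).trans ((f1.1 .c rfl).trans (v0 _ (by decide) (by decide) (by decide))))
    ((f2.1 .q rfl).trans ((f1.1 .q rfl).trans (v0 _ (by decide) (by decide) (by decide))))
    ((f2.1 .two rfl).trans a2) e3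
  rw [N2, c2, s2, b1] at c3
  rw [r2] at d3
  obtain ⟨L, hL⟩ : ∃ L, L = (2 * (2 * s * s) + 1) ^ r := ⟨_, rfl⟩
  have hL1 : 1 ≤ L := by rw [hL]; exact Nat.one_le_pow _ _ (by omega)
  rw [← hL] at b1 c3
  have keep0 : ∀ x, (Cmd.param1 C).writes x = false → Cmd.param2.writes x = false →
      (Cmd.param3 Ct).writes x = false → σ3.v x = σ.v x := fun x h1 h2 h3 =>
    (f3.1 x h3).trans ((f2.1 x h2).trans (f1.1 x h1))
  have keepA : ∀ a i, a ≠ .LV → a ≠ .LP → σ4.A a i = 0 := by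
    intro a i h1 h2
    have : σ4.A a = σ.A a := by
      rw [f4.2 a (by cases a <;> first | rfl | exact absurd rfl h1 | exact absurd rfl h2),
        f3.2 a (by cases a <;> rfl), f2.2 a (by cases a <;> rfl), f1.2 a (by cases a <;> rfl)]
    rw [this, hσ.A]
  have s3 : σ3.v .s = s := (f3.1 .s rfl).trans s2
  have r3 : σ3.v .r = r := (f3.1 .r rfl).trans r2
  have n3 : σ3.v .n = n := (keep0 .n rfl rfl rfl).trans hσ.n
  have o3 : σ3.v .one = 1 := (f3.1 .one rfl).trans ((f2.1 .one rfl).trans a1)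
  obtain ⟨g1, g2, g3, g4, g5, g6⟩ := param4_spec (f := f) (σ := σ3)
    ((keep0 .qs rfl rfl rfl).trans (v0 _ (by decide) (by decide) (by decide)))
    ((keep0 .sn rfl rfl rfl).trans (v0 _ (by decide) (by decide) (by decide)))
    ((keep0 .rq rfl rfl rfl).trans (v0 _ (by decide) (by decide) (by decide))) o3
    (fun i => by rw [f3.2 .LP rfl, f2.2 .LP rfl, f1.2 .LP rfl, hσ.A]) e4
  rw [d3] at g1
  rw [s3, c3] at g2
  rw [s3, n3] at g3
  rw [r3, c3] at g4
  rw [s3] at g5 g6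
  have tau4 : σ4.v .tau = Ct + 2 + r + r := (f4.1 .tau rfl).trans d3
  have q4 : σ4.v .q = N * (C * (s * L)) := (f4.1 .q rfl).trans c3
  have L4 : σ4.v .L = L := (f4.1 .L rfl).trans ((f3.1 .L rfl).trans b1)
  have s4 : σ4.v .s = s := (f4.1 .s rfl).trans s3
  have n4 : σ4.v .n = n := (f4.1 .n rfl).trans n3
  have z4 : σ4.v .zero = 0 := (f4.1 .zero rfl).trans ((f3.1 .zero rfl).trans z2)
  have hE : Env n ⟨s, 2 * s * s, r, N * (C * (s * L)), 2 ^ (Ct + 2 + r + r + 1)⟩ (σ4.A .H) σ4 := by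
    constructor
    · exact n4
    · exact (f4.1 .one rfl).trans o3
    · exact z4
    · exact s4
    · exact (f4.1 .W rfl).trans ((f3.1 .W rfl).trans ((f2.1 .W rfl).trans a4))
    · exact (f4.1 .r rfl).trans r3
    · exact q4
    · exact L4.trans hL
    · exact g1
    · rw [g2, Nat.mul_comm]
    · exact g3
    · exact g4
    · intro i; rfl
    · intro i hi; exact (g6.1 i (by simpa [Nat.mul_assoc] using hi)).1
    · intro i hi; exact (g6.1 i (by simpa [Nat.mul_assoc] using hi)).2
  have hFd : FdRel (Fd.init n) σ4 := by
    constructor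
    · exact (f4.1 .k rfl).trans ((keep0 .k rfl rfl rfl).trans
        (v0 _ (by decide) (by decide) (by decide)))
    · rw [(f4.1 .kn rfl).trans ((keep0 .kn rfl rfl rfl).trans
        (v0 _ (by decide) (by decide) (by decide)))]
      simp [Fd.init]
    · intro j; exact keepA _ _ (by decide) (by decide)
    · intro j i; exact keepA _ _ (by decide) (by decide)
    · intro h; exact keepA _ _ (by decide) (by decide)
  have hacc : σ4.v .acc = 0 := (f4.1 .acc rfl).trans ((keep0 .acc rfl rfl rfl).trans
        (v0 _ (by decide) (by decide) (by decide)))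
  refine ⟨r, a6, a7, ?_, ?_⟩
  · rw [hden, ← hL]
    have hmain := mainC_sim (f := f) (D := D)
      (P := ⟨s, 2 * s * s, r, N * (C * (s * L)), 2 ^ (Ct + 2 + r + r + 1)⟩) hs
      (Nat.mul_pos (Nat.mul_pos two_pos hs) hs) hE hFd hacc g5 (by rw [tau4])
    rw [tau4] at hmain
    refine seq_det_sim hmain.frame rfl ?_
    rintro τ x ⟨h1, h2⟩
    have : τ.v .zero = 0 := (h1.1 .zero rfl).trans z4
    simpa [Cmd.run, HS.setV, this] using h2
  · intro τ hτ
    rw [← hL]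
    rw [hden] at hτ
    obtain ⟨σ5, h5, hτ⟩ := (PMF.mem_support_bind_iff _ _ _).1 hτ
    have h6 : τ.T = σ5.T + 1 := by
      rw [Cmd.den_of_det _ rfl] at hτ
      simp only [PMF.support_pure, Set.mem_singleton_iff] at hτ
      rw [hτ]; rfl
    obtain ⟨A, hA⟩ : ∃ A, A = 2 ^ (Ct + 3) * (2 * C) * N * n * (s ^ 5 * (L * L)) := ⟨_, rfl⟩
    rw [← hA]
    obtain ⟨m1, m2, m3, m4, m5, m6, m7, m8, m9, m10, m11, m12, m13⟩ :=
      time_bounds (Ct := Ct) hn hs hN hC hL1 a6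
    rw [← hA] at m1 m2 m3 m4 m5 m6 m7 m8 m9 m10
    have t1 := time_run (Cmd.param1 C) [.s] rfl rfl rfl e1 (X := A) (fits_param1 m1 (by
      rw [hσ.s]; exact m2))
    have t2 := time_run Cmd.param2 [.r, .W2] rfl rfl rfl e2 (X := A) (fits_param2 m1 (by
      rw [← hr, a5]; exact m3))
    have t3 := time_run (Cmd.param3 Ct) [.s, .cst, .N] rfl rfl rfl e3 (X := A) (fits_param3 m1
      (by rw [s2]; exact m2) (by rw [c2]; exact m4) (by rw [N2]; exact m5))
    have t4 := time_run Cmd.param4 [.tau, .s, .r] rfl rfl rfl e4 (X := A) (fits_param4 m1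
      (by rw [d3]; exact m6) (by rw [s3]; exact m7) (by rw [r3]; exact m8))
    have hfm : Cmd.mainC.fits n σ4.v A :=
      fits_mainC (Y := 2 ^ (Ct + 3) * C * N * n * (s ^ 4 * (L * L))) n4 hn (by rw [s4]; exact hs)
        (by rw [q4]; exact Nat.mul_pos hN (Nat.mul_pos hC (Nat.mul_pos hs hL1)))
        (by rw [q4, s4]; exact m11) (by rw [g1]; exact m12) (by rw [q4, L4]; exact m13) m1
        (by rw [n4, tau4]; exact m9) (by rw [g5]; exact m10)
    have t5 := (Cmd.mainC.den_time (f := f) (D := D)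
      (fun x => decide (x ∈ [Var.n, .s1, .q, .s, .m2, .L, .tau])) rfl (fun x hx => by
        have h8 := List.all_eq_true.1 (show [Var.n, .s1, .q, .s, .m2, .L, .tau].all
          (fun x => !Cmd.mainC.writes x) = true from rfl) x (of_decide_eq_true hx)
        simpa using h8) σ4 σ5 h5).trans
      (Nat.add_le_add_left (Cmd.cost_le_of_fits _ hfm) _)
    unfold timeFactor
    generalize (Cmd.param1 C).factor = k1 at t1 ⊢
    generalize Cmd.param2.factor = k2 at t2 ⊢
    generalize (Cmd.param3 Ct).factor = k3 at t3 ⊢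
    generalize Cmd.param4.factor = k4 at t4 ⊢
    generalize Cmd.mainC.factor = k5 at t5 ⊢
    rw [h6, Nat.add_mul, Nat.add_mul, Nat.add_mul, Nat.add_mul, Nat.add_mul]
    clear * - t1 t2 t3 t4 t5 m1
    omega

end whole

/-! ### Numerical estimates -/

section numerics

/-- For `s ≥ 2` one has `4s² + 1 ≤ s^5`, so the left side is at most `s^(5 + 10 r) ≤ s^(15 r)`. As
`r ≤ log s / log 2` and `15 / log 2 < 30`, the constant 30 suffices. For `s = 1` both sides are 1.
-/
theorem le_quasi {s r : ℕ} (hs : 1 ≤ s) (h1 : 2 ^ r ≤ s) (h2 : s < 2 ^ (r + 1)) :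
    ((s ^ 5 * ((2 * (2 * s * s) + 1) ^ r * (2 * (2 * s * s) + 1) ^ r) : ℕ) : ℝ) ≤ quasi 30 s := by
  rcases Nat.eq_or_lt_of_le hs with h | h
  · subst h
    have : r = 0 := by
      by_contra hr
      have := Nat.one_lt_two_pow hr
      omega
    subst this
    simp [quasi]
  · have hr : 1 ≤ r := by
      by_contra hr
      have : r = 0 := by omega
      subst this
      simp at h2; omega
    have h3 : 2 * (2 * s * s) + 1 ≤ s ^ 5 := by
      have h4 : 2 ^ 3 ≤ s ^ 3 := Nat.pow_le_pow_left h 3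
      calc 2 * (2 * s * s) + 1 ≤ 2 ^ 3 * s ^ 2 := by nlinarith
        _ ≤ s ^ 3 * s ^ 2 := Nat.mul_le_mul_right _ h4
        _ = s ^ 5 := by ring
    have h4 : s ^ 5 * ((2 * (2 * s * s) + 1) ^ r * (2 * (2 * s * s) + 1) ^ r) ≤ s ^ (15 * r) := by
      calc s ^ 5 * ((2 * (2 * s * s) + 1) ^ r * (2 * (2 * s * s) + 1) ^ r)
          ≤ s ^ 5 * ((s ^ 5) ^ r * (s ^ 5) ^ r) := by gcongr
        _ = s ^ (5 + (5 * r + 5 * r)) := by rw [← pow_mul, ← pow_add, ← pow_add]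
        _ ≤ s ^ (15 * r) := Nat.pow_le_pow_right hs (by omega)
    refine (Nat.cast_le.2 h4).trans ?_
    have hs1 : (1 : ℝ) ≤ s := by exact_mod_cast hs
    rw [Nat.cast_pow, ← Real.rpow_natCast]
    refine Real.rpow_le_rpow_of_exponent_le hs1 ?_
    have h5 : (r : ℝ) * Real.log 2 ≤ Real.log s := by
      rw [← Real.log_pow]
      exact Real.log_le_log (by positivity) (by exact_mod_cast h1)
    have h6 := Real.log_two_gt_d9
    have h7 : (0 : ℝ) ≤ r := Nat.cast_nonneg r
    push_cast
    nlinarith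

theorem le_pow_of_lt_two_pow {s r : ℕ} (hs : 1 ≤ s) (h2 : s < 2 ^ (r + 1)) :
    s ≤ (2 * (2 * s * s) + 1) ^ r := by
  rcases Nat.eq_zero_or_pos r with h | h
  · subst h; simp at h2 ⊢; omega
  · calc s ≤ 2 * (2 * s * s) + 1 := by nlinarith
      _ = (2 * (2 * s * s) + 1) ^ 1 := (pow_one _).symm
      _ ≤ _ := Nat.pow_le_pow_right (by omega) h

theorem one_sub_pow_le {x : ℝ} (hx : x ≤ 1) (q : ℕ) : (1 - x) ^ q ≤ Real.exp (-(q * x)) := by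
  calc (1 - x) ^ q ≤ (Real.exp (-x)) ^ q :=
        pow_le_pow_left₀ (by linarith) (Real.one_sub_le_exp_neg x) q
    _ = _ := by rw [← Real.exp_nat_mul]; ring_nf

/-- From `1 - x ≤ exp (-x)` with `q = 64 (m + 3) N s L`. A rate of `1/(32s)` gives the exponent `2
(m + 3) L N`; the rate `ε/2` gives at least `32 (m + 3) L`, since `N ε ≥ 1`, and this absorbs the `2
^ L ≤ exp L` hypotheses. -/
theorem row_estimates {s N L m : ℕ} {ε : ℝ} (hs : 1 ≤ s) (hL : 1 ≤ L) (hε : 0 < ε) (hε1 : ε ≤ 1)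
    (hN : 1 ≤ N) (hNε : 1 ≤ N * ε) :
    (1 - 1 / (32 * s : ℝ)) ^ (N * (64 * (m + 3) * (s * L))) ≤ Real.exp (-((m + 2) * L)) ∧
    (2 : ℝ) ^ L * (1 - ε / 2) ^ (N * (64 * (m + 3) * (s * L))) ≤ Real.exp (-((m + 2) * L)) := by
  have hs1 : (1 : ℝ) ≤ s := by exact_mod_cast hs
  have hL1 : (1 : ℝ) ≤ L := by exact_mod_cast hL
  have hN1 : (1 : ℝ) ≤ N := by exact_mod_cast hN
  have hm : (0 : ℝ) ≤ m := Nat.cast_nonneg m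
  have hmL : 0 ≤ (m : ℝ) * L := by positivity
  constructor
  · refine (one_sub_pow_le ?_ _).trans (Real.exp_le_exp.2 ?_)
    · rw [div_le_one (by positivity)]; linarith
    · push_cast
      rw [show (N : ℝ) * (64 * (m + 3) * (s * L)) * (1 / (32 * s)) = N * (2 * (m + 3) * L) by
        field_simp; ring]
      nlinarith [mul_le_mul_of_nonneg_right hN1 (show (0 : ℝ) ≤ 2 * (m + 3) * L by positivity)]
  · have h1 : (2 : ℝ) ^ L ≤ Real.exp L := by
      have : (2 : ℝ) ≤ Real.exp 1 := by linarith [Real.add_one_le_exp (1 : ℝ)]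
      calc (2 : ℝ) ^ L ≤ (Real.exp 1) ^ L := pow_le_pow_left₀ (by norm_num) this L
        _ = Real.exp L := by rw [← Real.exp_nat_mul, mul_one]
    calc (2 : ℝ) ^ L * (1 - ε / 2) ^ (N * (64 * (m + 3) * (s * L)))
        ≤ Real.exp L * Real.exp (-((N * (64 * (m + 3) * (s * L)) : ℕ) * (ε / 2))) :=
          mul_le_mul h1 (one_sub_pow_le (by linarith) _)
            (pow_nonneg (by linarith) _) (Real.exp_pos _).le
      _ ≤ _ := by
          rw [← Real.exp_add]
          refine Real.exp_le_exp.2 ?_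
          push_cast
          have h2 : (N : ℝ) * (64 * (m + 3) * (s * L)) * (ε / 2) =
            (N * ε) * s * (32 * (m + 3) * L) := by ring
          rw [h2]
          have h3 : 1 ≤ (N : ℝ) * ε * s := by nlinarith
          have h4 := mul_le_mul_of_nonneg_right h3 (show (0 : ℝ) ≤ 32 * (m + 3) * L by positivity)
          nlinarith

/-- The spare `2L` in the exponent pays for the union over `s + 1` rounds, as `s + 1 ≤ 2L + 1 ≤ exp
(2L)`. -/
theorem succ_mul_exp_le {s L m : ℕ} (h : s ≤ L) (hL : 1 ≤ L) :
    (s + 1 : ℝ) * Real.exp (-((m + 2) * L)) ≤ Real.exp (-m) := by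
  have hsL : (s : ℝ) ≤ L := by exact_mod_cast h
  have hL1 : (1 : ℝ) ≤ L := by exact_mod_cast hL
  have hm : (0 : ℝ) ≤ m := Nat.cast_nonneg m
  have h1 : (s + 1 : ℝ) ≤ Real.exp (2 * L) := by linarith [Real.add_one_le_exp (2 * L : ℝ)]
  calc (s + 1 : ℝ) * Real.exp (-((m + 2) * L))
      ≤ Real.exp (2 * L) * Real.exp (-((m + 2) * L)) :=
        mul_le_mul_of_nonneg_right h1 (Real.exp_pos _).le
    _ = Real.exp (-(m * L)) := by rw [← Real.exp_add]; ring_nf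
    _ ≤ Real.exp (-m) := Real.exp_le_exp.2 (by nlinarith)

theorem sq_mul_half_pow_le {s r Ct : ℕ} (h : s < 2 ^ (r + 1)) :
    (s : ℝ) ^ 2 * (1 / 2) ^ (Ct + 2 + r + r) ≤ (1 / 2) ^ Ct := by
  have h1 : (s : ℝ) ≤ 2 ^ (r + 1) := by exact_mod_cast h.le
  have h2 : (s : ℝ) ^ 2 ≤ (2 ^ (r + 1)) ^ 2 := pow_le_pow_left₀ (Nat.cast_nonneg s) h1 2
  have h3 : ((2 : ℝ) ^ (r + 1)) ^ 2 * (1 / 2) ^ (2 + r + r) = 1 := by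
    rw [← pow_mul, show (r + 1) * 2 = 2 + r + r by ring, ← mul_pow]
    norm_num
  calc (s : ℝ) ^ 2 * (1 / 2) ^ (Ct + 2 + r + r)
      ≤ (2 ^ (r + 1)) ^ 2 * (1 / 2) ^ (Ct + 2 + r + r) :=
        mul_le_mul_of_nonneg_right h2 (by positivity)
    _ = (1 / 2) ^ Ct * ((2 ^ (r + 1)) ^ 2 * (1 / 2) ^ (2 + r + r)) := by
        rw [show Ct + 2 + r + r = Ct + (2 + r + r) by ring, pow_add (1 / 2 : ℝ) Ct]; ring
    _ = (1 / 2) ^ Ct := by rw [h3, mul_one]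

end numerics

/-! ### The machine -/

section machine

variable {n : ℕ} {f : BoolFun n} {D : PMF (Fin n → Bool)}

/-- The program, with the initialization of the address cell. -/
def machine (C Ct : ℕ) : Prog :=
  .seq (.op (.const 63 64)) (.seq (.op (.add 63 63 0)) (Cmd.prog C Ct).compile)

theorem machine_spec {C Ct s N : ℕ} (hn : 1 ≤ n) (hs : 1 ≤ s) (hN : 1 ≤ N) (hC : 1 ≤ C) :
    ∃ r, 2 ^ r ≤ s ∧ s < 2 ^ (r + 1) ∧ ∃ μ, Runs f D (machine C Ct) (initState n s N) μ ∧
      prob μ accepting = prob (tester f D s (2 * s * s) r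
        (N * (C * (s * (2 * (2 * s * s) + 1) ^ r))) (Ct + 2 + r + r)) {st | st.2 = true} ∧
      ∀ τ ∈ μ.support, τ.time ≤ 2 + timeFactor C Ct *
        (2 ^ (Ct + 3) * (2 * C) * N * n * (s ^ 5 *
          ((2 * (2 * s * s) + 1) ^ r * (2 * (2 * s * s) + 1) ^ r))) := by
  obtain ⟨σ, hσ⟩ : ∃ σ : State, σ = (((initState n s N).upd
    (Function.update (initState n s N).mem 63 64) 1 0).upd
      (Function.update (Function.update (initState n s N).mem 63 64) 63 (64 + n)) 1 0) := ⟨_, rfl⟩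
  have hmem : ∀ a, σ.mem a = if a = 63 then 64 + n else if a = 0 then n else if a = 1 then s else
      if a = 2 then N else 0 := by
    intro a
    rw [hσ]
    simp only [State.upd, Function.update_idem, Function.update_apply, initState]
  have hT : σ.time = 2 := by rw [hσ]; rfl
  have h63 : σ.mem 63 = 64 + n := by rw [hmem]; rfl
  have hvar : ∀ x : Var, x.addr ≠ 63 := fun x => by have := x.addr_lt; omega
  have hI : Init n s N (absS n σ) := by
    constructor
    · simp only [absS, vOf, hmem]; rfl
    · simp only [absS, vOf, hmem]; rfl
    · simp only [absS, vOf, hmem]; rfl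
    · intro x h0 h1 h2
      simp only [absS, vOf, hmem]
      have e0 : x.addr ≠ 0 := fun h => h0 ((Var.addr_inj (y := .n)).1 h)
      have e1 : x.addr ≠ 1 := fun h => h1 ((Var.addr_inj (y := .s)).1 h)
      have e2 : x.addr ≠ 2 := fun h => h2 ((Var.addr_inj (y := .N)).1 h)
      rw [if_neg (hvar x), if_neg e0, if_neg e1, if_neg e2]
    · intro a i
      simp only [absS, aOf, hmem]
      rw [if_neg (by omega), if_neg (by omega), if_neg (by omega), if_neg (by omega)]
  obtain ⟨r, r1, r2, hsim, htime⟩ := prog_spec (f := f) (D := D) (C := C) (Ct := Ct) hn hs hN hC hI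
  obtain ⟨μ, hμ, -, hmap⟩ := Cmd.simulates (f := f) (D := D) (Cmd.prog C Ct) (Cmd.prog_wf C Ct) σ h63
  refine ⟨r, r1, r2, μ, ?_, ?_, ?_⟩
  · have hstep : (Instr.add 63 63 0).exec f D ((initState n s N).upd
        (Function.update (initState n s N).mem 63 64) 1 0) = PMF.pure σ := by
      rw [hσ]
      simp [Instr.exec, State.upd, initState]
    refine Runs.seqPure (.op _ _) (Runs.seqPure ?_ hμ)
    rw [← hstep]
    exact .op _ _
  · rw [← hsim.prob_eq (S := {h | h.v .n ≠ 0}) (S' := {st | st.2 = true}) fun a b h => h, ← hmap,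
      prob_map]
    rfl
  · intro τ hτ
    have : absS n τ ∈ ((Cmd.prog C Ct).den f D (absS n σ)).support := by
      rw [← hmap, PMF.support_map]
      exact ⟨τ, hτ, rfl⟩
    have := htime _ this
    simp only [absS, hT] at this
    exact this

end machine

end

end DTTester

open DTTester in
theorem mainTheorem12 :
    ∃ (c : ℝ) (L : ℕ), 0 < c ∧
      ∀ δ : ℝ, 0 < δ →
        ∃ (P : DTTest.Prog) (K : ℝ),
          ∀ n s : ℕ, 1 ≤ n → 1 ≤ s → ∀ ε : ℝ, 0 < ε → ε ≤ 1 →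
            ∀ (f : DTTest.BoolFun n) (D : PMF (Fin n → Bool)),
              ∃ μ : PMF DTTest.State,
                DTTest.Runs f D P (DTTest.initState n s ⌈1 / ε⌉₊) μ ∧
                (∀ σ ∈ μ.support,
                  (σ.time : ℝ) ≤ K * (DTTest.quasi c s * n / ε) ∧
                  (σ.queries : ℝ) ≤ K * ((DTTest.quasi c s / ε) *
                    (1 + Real.log (DTTest.quasi c s / ε)) ^ L)) ∧
                (f ∈ DTTest.DT n s → 1 - δ ≤ DTTest.prob μ DTTest.accepting) ∧
                (DTTest.IsFar D ε f (DTTest.DT n ⌊DTTest.quasi c s⌋₊) →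
                  1 - δ ≤ DTTest.prob μ DTTest.rejecting) := by
  -- The exponent 30 comes from `le_quasi`. The logarithmic exponent is 0: the time bound alone
  -- already limits the queries.
  refine ⟨30, 0, by norm_num, fun δ hδ => ?_⟩
  obtain ⟨m, hm⟩ : ∃ m : ℕ, Real.exp (-m) ≤ δ := by
    obtain ⟨m, hm⟩ := exists_nat_ge (-Real.log δ)
    refine ⟨m, ?_⟩
    rw [← Real.le_log_iff_exp_le hδ]
    linarith
  obtain ⟨Ct, hCt⟩ : ∃ Ct : ℕ, (1 / 2 : ℝ) ^ Ct < δ := exists_pow_lt_of_lt_one hδ (by norm_num)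
  obtain ⟨C, hC⟩ : ∃ C : ℕ, C = 64 * (m + 3) := ⟨_, rfl⟩
  -- The summand 2 covers the two instructions that initialize the address cell; the later factor 2
  -- comes from `⌈1/ε⌉ ≤ 2/ε`.
  obtain ⟨F, hF⟩ : ∃ F : ℕ, F = (2 + timeFactor C Ct) * (2 ^ (Ct + 3) * (2 * C)) := ⟨_, rfl⟩
  refine ⟨machine C Ct, F * 2, fun n s hn hs ε hε hε1 f D => ?_⟩
  have hNpos : 1 ≤ ⌈1 / ε⌉₊ := Nat.ceil_pos.2 (by positivity)
  have hN1 : 1 ≤ (⌈1 / ε⌉₊ : ℝ) * ε := by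
    have := Nat.le_ceil (1 / ε)
    rwa [div_le_iff₀ hε] at this
  have hN2 : (⌈1 / ε⌉₊ : ℝ) ≤ 2 / ε := by
    have h1 := (Nat.ceil_lt_add_one (show 0 ≤ 1 / ε by positivity)).le
    have h2 : 1 ≤ 1 / ε := by rw [le_div_iff₀ hε]; linarith
    calc (⌈1 / ε⌉₊ : ℝ) ≤ 1 / ε + 1 / ε := by linarith
      _ = 2 / ε := by ring
  generalize ⌈1 / ε⌉₊ = N at hNpos hN1 hN2 ⊢
  have hnR : (0 : ℝ) < n := by exact_mod_cast hn
  obtain ⟨r, r1, r2, μ, hμ, hacc, htime⟩ := machine_spec (f := f) (D := D) (C := C) (Ct := Ct)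
    (N := N) hn hs hNpos (by omega)
  have hq := le_quasi hs r1 r2
  obtain ⟨Q, hQ⟩ : ∃ Q, Q = DTTest.quasi 30 s := ⟨_, rfl⟩
  rw [← hQ] at hq ⊢
  have hsL := le_pow_of_lt_two_pow hs r2
  have hWL : (2 * s * s + 1) ^ r ≤ (2 * (2 * s * s) + 1) ^ r :=
    Nat.pow_le_pow_left (by omega) r
  generalize hLdef : (2 * (2 * s * s) + 1) ^ r = L at *
  have hL : 1 ≤ L := hs.trans hsL
  have hbound : ∀ σ ∈ μ.support, (σ.time : ℝ) ≤ F * 2 * (Q * n / ε) := by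
    intro σ hσ
    have h1 : σ.time ≤ F * (N * n * (s ^ 5 * (L * L))) := by
      refine (htime σ hσ).trans ?_
      have h2 : 1 ≤ 2 ^ (Ct + 3) * (2 * C) * N * n * (s ^ 5 * (L * L)) := by
        have : 1 ≤ C := by omega
        exact Nat.mul_pos (Nat.mul_pos (Nat.mul_pos (by positivity) hNpos) hn) (by positivity)
      rw [hF, show (2 + timeFactor C Ct) * (2 ^ (Ct + 3) * (2 * C)) * (N * n * (s ^ 5 * (L * L))) =
        2 * (2 ^ (Ct + 3) * (2 * C) * N * n * (s ^ 5 * (L * L))) + timeFactor C Ct *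
          (2 ^ (Ct + 3) * (2 * C) * N * n * (s ^ 5 * (L * L))) by ring]
      exact Nat.add_le_add_right (Nat.le_mul_of_pos_right _ h2) _
    calc (σ.time : ℝ) ≤ ((F * (N * n * (s ^ 5 * (L * L))) : ℕ) : ℝ) := Nat.cast_le.2 h1
      _ = F * (N * n * ((s ^ 5 * (L * L) : ℕ) : ℝ)) := by push_cast; ring
      _ ≤ F * ((2 / ε) * n * Q) := by gcongr
      _ = _ := by ring
  refine ⟨μ, hμ, fun σ hσ => ⟨hbound σ hσ, ?_⟩, fun hf => ?_, fun hfar => ?_⟩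
  -- Each query takes at least `n` units of time, so the bound on the time is divided by `n`.
  · have h1 := runs_queries hμ σ hσ
    simp only [DTTest.initState, Nat.zero_mul, Nat.zero_add, Nat.add_zero] at h1
    have h2 : (σ.queries : ℝ) * n ≤ F * 2 * (Q * n / ε) := by
      refine le_trans ?_ (hbound σ hσ)
      have : σ.queries * n ≤ σ.time := le_trans (Nat.mul_le_mul_left _ (Nat.le_succ n)) h1
      exact_mod_cast this
    rw [pow_zero, mul_one]
    refine le_of_mul_le_mul_right (h2.trans_eq ?_) hnR
    ring
  · obtain ⟨T, hT, rfl⟩ := hf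
    rw [hacc]
    refine le_trans ?_ (tester_complete hT r2)
    have := sq_mul_half_pow_le (Ct := Ct) r2
    linarith
  · have h1 : DTTest.prob μ DTTest.accepting ≤ δ := by
      rw [hacc]
      -- The trees behind the hypotheses have size at most `(W + 1)^r ≤ L`, which is far below the
      -- bound `s^5 L²` of `le_quasi`.
      have hS : (2 * s * s + 1) ^ r ≤ ⌊Q⌋₊ := by
        refine Nat.le_floor (le_trans ?_ hq)
        refine Nat.cast_le.2 (hWL.trans ?_)
        have : 1 ≤ s ^ 5 * L := Nat.mul_pos (Nat.one_le_pow _ _ hs) hL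
        calc L ≤ L * (s ^ 5 * L) := Nat.le_mul_of_pos_right _ this
          _ = s ^ 5 * (L * L) := by ring
      obtain ⟨e1, e2⟩ := row_estimates (m := m) hs hL hε hε1 hNpos hN1
      rw [← hC] at e1 e2
      refine (tester_sound (W := 2 * s * s) hε1 hfar hs hS e1 (by rw [hLdef]; exact e2)).trans ?_
      exact (succ_mul_exp_le hsL hL).trans hm
    have h2 := prob_add_compl μ DTTest.accepting
    have h3 : DTTest.acceptingᶜ = DTTest.rejecting := by
      ext σ; simp [DTTest.accepting, DTTest.rejecting]
    rw [h3] at h2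
    linarith
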